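/- An instance consists of a nonempty finite totally ordered set $Q$ of queries, a weight $w(q)\ge 0$ for each $q\in Q$, a finite collection $\mathcal C\subseteq 2^Q$ of classes (each with a unique identifier) such that every query belongs to at least one class, and a set $K\subseteq Q$ of keys. Let $n=|Q|$ and $m=\sum_{c\in\mathcal C}|c|$. A two-way-comparison decision tree (2WCDT) for the instance is a rooted binary tree in which each non-leaf node is a test $\cdot<k$ with $k\in K$ and $\min Q<k\le\max Q$, or a test $\cdot=k$ with $k\in K$, and has a yes-subtree and a no-subtree; each leaf is labeled with the identifier of one class, which must contain every query whose search ends at that leaf. The search for $q$ starts at the root and goes to the yes-subtree if $q$ satisfies the test and to the no-subtree otherwise; the depth of $q$ is the number of tests made by its search, and the cost of a tree is $\sum_{q\in Q} w(q)\,\mathrm{depth}(q)$. Theorem. There is an algorithm that, given any such instance, computes a minimum-cost 2WCDT together with its cost if the instance has a 2WCDT, and reports that there is none otherwise, in $O(n^3m)$ time. That is, there are a single deterministic program for a random-access machine and constants $C,d$ such that on every instance the program halts with the correct output after at most $C\,n^3m$ steps, where all words (integers) that it uses are smaller than $(n+m+2)^d$, every elementary operation on words (addition, truncated subtraction, multiplication,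 comparison, array access) takes one step, and queries and weights are real numbers, which the machine can only copy, add and compare, each in one step. The queries may be given in any order, a class is given by listing its members (as pairs of a class identifier and a query, in any order), and the tree is output in preorder. -/

import Mathlib

namespace TwoWay

/-! ### Two-way-comparison decision trees -/

/-- A problem instance `(Q, w, 𝒞, K)`.  The queries are `n ≥ 1` distinct real numbers, listed in an
arbitrary (not necessarily sorted) order and referred to by their positions `q : Fin n`; the classes
are `p` pairwise distinct sets of queries, referred to by their identifiers `j : Fin p`. -/
structure Instance where
  n : ℕ
  n_pos : 0 < n
  query : Fin n → ℝ
  query_injective : Function.Injective query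
  weight : Fin n → ℝ
  weight_nonneg : ∀ q, 0 ≤ weight q
  p : ℕ
  cls : Fin p → Finset (Fin n)
  cls_injective : Function.Injective cls
  cls_cover : ∀ q, ∃ j, q ∈ cls j
  keys : Finset (Fin n)

/-- The sum of the class sizes. -/
def Instance.m (I : Instance) : ℕ := ∑ j, (I.cls j).card

/-- The tests `· < k` and `· = k`, where `k` is a query (referred to by its position). -/
inductive Test (n : ℕ) : Type
  | lt (k : Fin n)
  | eq (k : Fin n)

/-- Decision trees.  The first subtree of a test node is its yes-subtree, the second its
no-subtree; leaves carry class identifiers. -/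
inductive Tree (n p : ℕ) : Type
  | leaf (j : Fin p)
  | node (u : Test n) (yes no : Tree n p)

/-- The query `q` satisfies the test. -/
def Test.Sat (I : Instance) (q : Fin I.n) : Test I.n → Prop
  | .lt k => I.query q < I.query k
  | .eq k => I.query q = I.query k

/-- The tests that a tree may use: `· = k` for a key `k`, and `· < k` for a key `k` with
`min Q < k ≤ max Q`. -/
def Test.Allowed (I : Instance) : Test I.n → Prop
  | .lt k => k ∈ I.keys ∧ (∃ q, I.query q < I.query k) ∧ (∃ q, I.query k ≤ I.query q)
  | .eq k => k ∈ I.keys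

/-- All tests in the tree are allowed. -/
def Tree.TestsAllowed (I : Instance) : Tree I.n I.p → Prop
  | .leaf _ => True
  | .node u yes no => u.Allowed I ∧ yes.TestsAllowed I ∧ no.TestsAllowed I

open Classical in
/-- The label of the leaf at which the search for `q` ends. -/
noncomputable def Tree.answer (I : Instance) (q : Fin I.n) : Tree I.n I.p → Fin I.p
  | .leaf j => j
  | .node u yes no => if u.Sat I q then yes.answer I q else no.answer I q

open Classical in
/-- The number of tests made by the search for `q`. -/
noncomputable def Tree.depth (I : Instance) (q : Fin I.n) : Tree I.n I.p → ℕ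
  | .leaf _ => 0
  | .node u yes no => (if u.Sat I q then yes.depth I q else no.depth I q) + 1

/-- `T` is a two-way-comparison decision tree for `I`: its tests are allowed, and each leaf's class
contains every query whose search ends at that leaf. -/
def Instance.IsDecisionTree (I : Instance) (T : Tree I.n I.p) : Prop :=
  T.TestsAllowed I ∧ ∀ q, q ∈ I.cls (T.answer I q)

/-- The weighted sum of the depths of the queries. -/
noncomputable def Instance.cost (I : Instance) (T : Tree I.n I.p) : ℝ :=
  ∑ q, I.weight q * (T.depth I q : ℝ)

/-- `T` is a minimum-cost two-way-comparison decision tree for `I`. -/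
def Instance.IsMinCost (I : Instance) (T : Tree I.n I.p) : Prop :=
  I.IsDecisionTree T ∧ ∀ T', I.IsDecisionTree T' → I.cost T ≤ I.cost T'

/-! ### A random-access machine

Programs of a word RAM with real registers.  A program uses finitely many registers and arrays,
each of which holds either words (natural numbers below a word bound) or real numbers.  Reals can be
copied, added and compared, and nothing else. -/

/-- The memory contents: word and real registers `wreg x`, `rreg x`, and cells `warr a i`,
`rarr a i` of word and real arrays. -/
structure State where
  wreg : ℕ → ℕ
  rreg : ℕ → ℝ
  warr : ℕ → ℕ → ℕ
  rarr : ℕ → ℕ → ℝ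

/-- Word expressions.  `get a i` reads cell `i` of word array `a`; `sub` is truncated. -/
inductive WExp : Type
  | const (c : ℕ)
  | reg (x : ℕ)
  | get (a : ℕ) (i : WExp)
  | add (e f : WExp)
  | sub (e f : WExp)
  | mul (e f : WExp)

/-- Real expressions. -/
inductive RExp : Type
  | zero
  | reg (x : ℕ)
  | get (a : ℕ) (i : WExp)
  | add (e f : RExp)

/-- Conditions: comparisons of words and of reals, and their Boolean combinations. -/
inductive BExp : Type
  | wlt (e f : WExp)
  | weq (e f : WExp)
  | rlt (e f : RExp)
  | not (b : BExp)
  | and (b c : BExp)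
  | or (b c : BExp)

/-- Programs. -/
inductive Prog : Type
  | skip
  | setW (x : ℕ) (e : WExp)
  | setR (x : ℕ) (e : RExp)
  | putW (a : ℕ) (i e : WExp)
  | putR (a : ℕ) (i : WExp) (e : RExp)
  | seq (P R : Prog)
  | cond (b : BExp) (P R : Prog)
  | loop (b : BExp) (P : Prog)

/-- The value of a word expression. -/
def WExp.val (s : State) : WExp → ℕ
  | .const c => c
  | .reg x => s.wreg x
  | .get a i => s.warr a (i.val s)
  | .add e f => e.val s + f.val s
  | .sub e f => e.val s - f.val s
  | .mul e f => e.val s * f.val s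

/-- All values that occur in the evaluation of the expression, addresses included, are words: they
are below the word bound `B`. -/
def WExp.Fits (B : ℕ) (s : State) : WExp → Prop
  | .const c => c < B
  | .reg x => s.wreg x < B
  | .get a i => i.Fits B s ∧ s.warr a (i.val s) < B
  | .add e f => e.Fits B s ∧ f.Fits B s ∧ e.val s + f.val s < B
  | .sub e f => e.Fits B s ∧ f.Fits B s
  | .mul e f => e.Fits B s ∧ f.Fits B s ∧ e.val s * f.val s < B

/-- The number of operations in the evaluation of a word expression. -/
def WExp.time : WExp → ℕ
  | .const _ => 1
  | .reg _ => 1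
  | .get _ i => i.time + 1
  | .add e f => e.time + f.time + 1
  | .sub e f => e.time + f.time + 1
  | .mul e f => e.time + f.time + 1

/-- The value of a real expression. -/
noncomputable def RExp.val (s : State) : RExp → ℝ
  | .zero => 0
  | .reg x => s.rreg x
  | .get a i => s.rarr a (i.val s)
  | .add e f => e.val s + f.val s

/-- All addresses in the expression are words. -/
def RExp.Fits (B : ℕ) (s : State) : RExp → Prop
  | .zero => True
  | .reg _ => True
  | .get _ i => i.Fits B s
  | .add e f => e.Fits B s ∧ f.Fits B s

/-- The number of operations in the evaluation of a real expression. -/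
def RExp.time : RExp → ℕ
  | .zero => 1
  | .reg _ => 1
  | .get _ i => i.time + 1
  | .add e f => e.time + f.time + 1

/-- The condition is true. -/
def BExp.Holds (s : State) : BExp → Prop
  | .wlt e f => e.val s < f.val s
  | .weq e f => e.val s = f.val s
  | .rlt e f => e.val s < f.val s
  | .not b => ¬ b.Holds s
  | .and b c => b.Holds s ∧ c.Holds s
  | .or b c => b.Holds s ∨ c.Holds s

/-- All words that occur in the evaluation of the condition are below `B`.  (Both sides of `and`
and `or` are always evaluated.) -/
def BExp.Fits (B : ℕ) (s : State) : BExp → Prop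
  | .wlt e f => e.Fits B s ∧ f.Fits B s
  | .weq e f => e.Fits B s ∧ f.Fits B s
  | .rlt e f => e.Fits B s ∧ f.Fits B s
  | .not b => b.Fits B s
  | .and b c => b.Fits B s ∧ c.Fits B s
  | .or b c => b.Fits B s ∧ c.Fits B s

/-- The number of operations in the evaluation of a condition. -/
def BExp.time : BExp → ℕ
  | .wlt e f => e.time + f.time + 1
  | .weq e f => e.time + f.time + 1
  | .rlt e f => e.time + f.time + 1
  | .not b => b.time + 1
  | .and b c => b.time + c.time + 1
  | .or b c => b.time + c.time + 1

/-- Write `v` to word register `x`. -/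
def State.setW (s : State) (x v : ℕ) : State :=
  { s with wreg := Function.update s.wreg x v }

/-- Write `v` to real register `x`. -/
def State.setR (s : State) (x : ℕ) (v : ℝ) : State :=
  { s with rreg := Function.update s.rreg x v }

/-- Write `v` to cell `i` of word array `a`. -/
def State.putW (s : State) (a i v : ℕ) : State :=
  { s with warr := Function.update s.warr a (Function.update (s.warr a) i v) }

/-- Write `v` to cell `i` of real array `a`. -/
def State.putR (s : State) (a i : ℕ) (v : ℝ) : State :=
  { s with rarr := Function.update s.rarr a (Function.update (s.rarr a) i v) }

/-- `Exec B P s t s'`: with word bound `B`, the program `P` started in state `s` halts after exactly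
`t` steps in state `s'`.  A program whose evaluation meets a number that is not a word has no
further execution.  Programs are deterministic: at most one rule applies to given `P` and `s`. -/
inductive Exec (B : ℕ) : Prog → State → ℕ → State → Prop
  | skip (s : State) : Exec B .skip s 1 s
  | setW (s : State) (x : ℕ) (e : WExp) (h : e.Fits B s) :
      Exec B (.setW x e) s (e.time + 1) (s.setW x (e.val s))
  | setR (s : State) (x : ℕ) (e : RExp) (h : e.Fits B s) :
      Exec B (.setR x e) s (e.time + 1) (s.setR x (e.val s))
  | putW (s : State) (a : ℕ) (i e : WExp) (hi : i.Fits B s) (h : e.Fits B s) :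
      Exec B (.putW a i e) s (i.time + e.time + 1) (s.putW a (i.val s) (e.val s))
  | putR (s : State) (a : ℕ) (i : WExp) (e : RExp) (hi : i.Fits B s) (h : e.Fits B s) :
      Exec B (.putR a i e) s (i.time + e.time + 1) (s.putR a (i.val s) (e.val s))
  | seq (P R : Prog) (s₀ s₁ s₂ : State) (t₁ t₂ : ℕ)
      (h₁ : Exec B P s₀ t₁ s₁) (h₂ : Exec B R s₁ t₂ s₂) :
      Exec B (.seq P R) s₀ (t₁ + t₂) s₂
  | cond_true (b : BExp) (P R : Prog) (s s' : State) (t : ℕ) (hf : b.Fits B s)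
      (hb : b.Holds s) (h : Exec B P s t s') :
      Exec B (.cond b P R) s (b.time + t + 1) s'
  | cond_false (b : BExp) (P R : Prog) (s s' : State) (t : ℕ) (hf : b.Fits B s)
      (hb : ¬ b.Holds s) (h : Exec B R s t s') :
      Exec B (.cond b P R) s (b.time + t + 1) s'
  | loop_true (b : BExp) (P : Prog) (s₀ s₁ s₂ : State) (t₁ t₂ : ℕ) (hf : b.Fits B s₀)
      (hb : b.Holds s₀) (h₁ : Exec B P s₀ t₁ s₁) (h₂ : Exec B (.loop b P) s₁ t₂ s₂) :
      Exec B (.loop b P) s₀ (b.time + t₁ + t₂ + 1) s₂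
  | loop_false (b : BExp) (P : Prog) (s : State) (hf : b.Fits B s) (hb : ¬ b.Holds s) :
      Exec B (.loop b P) s (b.time + 1) s

/-! ### Input and output -/

/-- The list `L` enumerates, in some order and without repetitions, the pairs of a class and a
query in it.  Its length is `I.m`. -/
def Instance.Lists (I : Instance) (L : List (Fin I.p × Fin I.n)) : Prop :=
  L.Nodup ∧ ∀ j q, (j, q) ∈ L ↔ q ∈ I.cls j

open Classical in
/-- The initial memory contents.  Word registers 0, 1, 2 hold `n`, the number of classes, and `m`;
real array 0 holds the queries and real array 1 their weights; word array 0 tells which queries are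
keys; word arrays 1 and 2 hold the class identifiers and the queries of the pairs in `L`.  All other
cells hold `0`. -/
noncomputable def Instance.input (I : Instance) (L : List (Fin I.p × Fin I.n)) : State where
  wreg x := if x = 0 then I.n else if x = 1 then I.p else if x = 2 then I.m else 0
  rreg _ := 0
  warr a i :=
    if a = 0 then (if ∃ h : i < I.n, (⟨i, h⟩ : Fin I.n) ∈ I.keys then 1 else 0)
    else if a = 1 then (L.map fun c => (c.1 : ℕ)).getD i 0
    else if a = 2 then (L.map fun c => (c.2 : ℕ)).getD i 0
    else 0
  rarr a i :=
    if h : i < I.n then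
      if a = 0 then I.query ⟨i, h⟩ else if a = 1 then I.weight ⟨i, h⟩ else 0
    else 0

/-- The tree written out as a list of words in preorder, with two words per node. -/
def Tree.encode {n p : ℕ} : Tree n p → List ℕ
  | .leaf j => [0, (j : ℕ)]
  | .node (.lt k) yes no => [1, (k : ℕ)] ++ yes.encode ++ no.encode
  | .node (.eq k) yes no => [2, (k : ℕ)] ++ yes.encode ++ no.encode

/-- The memory contents report that there is no tree. -/
def State.ReportsInfeasible (s : State) : Prop := s.wreg 0 = 0

/-- The memory contents present the tree `T` and its cost `c`: word register 0 holds `1`, the first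
cells of word array 0 hold the words of `T`, word register 1 holds their number, and real register 0
holds `c`. -/
def State.ReportsTree (s : State) {n p : ℕ} (T : Tree n p) (c : ℝ) : Prop :=
  s.wreg 0 = 1 ∧ s.wreg 1 = T.encode.length ∧
    (List.range T.encode.length).map (s.warr 0) = T.encode ∧ s.rreg 0 = c

/-- The program `P` solves the instance, given in the order `L`, within `t` steps and with word
bound `B`: it presents a minimum-cost tree and its cost if there is a tree, and reports that there
is none otherwise. -/
def Prog.Solves (P : Prog) (I : Instance) (L : List (Fin I.p × Fin I.n)) (B t : ℕ) : Prop :=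
  ∃ t' ≤ t, ∃ s, Exec B P (I.input L) t' s ∧
    ((∃ T, I.IsDecisionTree T) → ∃ T, I.IsMinCost T ∧ s.ReportsTree T (I.cost T)) ∧
    ((¬ ∃ T, I.IsDecisionTree T) → s.ReportsInfeasible)

end TwoWay

namespace TwoWay

/-! ### Costs on sets of queries and pruning -/

section Cut
open Classical

variable {I : Instance}

/-! The algorithm is a dynamic program. The mathematical point is that `O(n^2 m)` subproblems
suffice, each solved in time `O(n)`.

Perturb the weights so that they are positive and pairwise distinct, and follow the path of a query
`q` in a tree that is optimal for them. The basic tool is an exchange argument. Take an allowed test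
`x`, put it above two copies of a subtree, one for each side of `x`, and prune from each copy the
nodes that no longer split anything. The new test costs the total weight of the queries that reach
the subtree, so in an optimal tree the pruning cannot save more than that (`Tree.OptOn.saving_le`).
If the sets that leave a path are each on one side of `x`, then every node of the path saves at
least the weight of the queries that continue past it and lie on the other side of `x`. Optimality
thus becomes an inequality about a list of weights with two types (`Desc.cut`), and the rest of the
structure theory is bookkeeping on such lists.

There are four consequences. Once the sets leaving the path of `q` weigh less than `q`, their
weights decrease (`Desc.decreasing`). After an equality test on a query lighter than `q`, no test on
the path of `q` separates the two (`Desc.same`, `Desc.lights_spec`). The path of `q` holds at most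
eight equality tests on lighter queries (`Desc.card_lights_le`): nine of them would put five on one
side of `q`, and two thresholds among those five give inequalities that contradict the decrease
(`not_tight_cuts`). Finally, if `g` is tested for equality at a node that a heavier query also
reaches, then the no-subtree alone would misclassify `g` (`Tree.OptOn.not_solvesOn`). Otherwise `g`
would follow the path of the heavier query, and a suitable threshold would improve on the tree.

Hence the set of queries at a node has a short description: an interval, its heaviest remaining
query `q`, the class `c` that answers `q`, and the number `s ≤ 8` of holes, which are exactly the
`s` heaviest queries of the interval that are lighter than `q` and outside `c`. A node either tests
`q` itself (only if `s = 0`), or makes the next hole, or splits the interval. A split never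
separates `q` from the holes or from the queries ranked between them, so the part without `q` is a
plain interval cut off at a rank. `Der` is the resulting recurrence. `Der.sound` shows that its
trees are correct, and `allBound` that it matches an optimal tree for the perturbed weights. The
perturbation enters only through the order of the queries by weight, which is fixed in advance by
breaking ties. So `exists_der_le` comes within every `ε` of the optimum, and the least derived cost
is the optimum itself (`Der.isMinCost`).

For the program, a pair of a class and a member of it fixes `c` and `q`, so there are at most `9 n^2
m` subproblems with holes. The thresholds, the weight of the set and the range of positions that
must stay together are found by linear scans, after which each candidate for the root takes constant
time. Entries are filled from short intervals to long ones, by increasing rank and by decreasing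
number of holes. A potential that drops along the stored references makes the reconstruction
terminate and bounds the output by `O(n^2)` words. -/

/-- The total weight of a set of queries. -/
def wsum {n : ℕ} (W : Fin n → ℝ) (R : Finset (Fin n)) : ℝ := ∑ q ∈ R, W q

/-- The queries in `R` that satisfy `u` (if `b`), or that do not (otherwise). -/
noncomputable def Test.side (I : Instance) (u : Test I.n) (b : Bool) (R : Finset (Fin I.n)) :
    Finset (Fin I.n) :=
  R.filter fun q => (u.Sat I q ↔ b = true)

/-- The yes-subtree or the no-subtree. -/
def kid {n p : ℕ} (b : Bool) (y z : Tree n p) : Tree n p := if b then y else z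

theorem Test.mem_side {u : Test I.n} {b : Bool} {R : Finset (Fin I.n)} {q : Fin I.n} :
    q ∈ u.side I b R ↔ q ∈ R ∧ (u.Sat I q ↔ b = true) := by
  simp [Test.side]

theorem Test.side_subset (u : Test I.n) (b : Bool) (R : Finset (Fin I.n)) : u.side I b R ⊆ R :=
  Finset.filter_subset _ _

theorem Test.side_disjoint (u : Test I.n) (b : Bool) (R : Finset (Fin I.n)) :
    Disjoint (u.side I b R) (u.side I (!b) R) := by
  rw [Finset.disjoint_left]
  intro q h1 h2
  rw [Test.mem_side] at h1 h2
  cases b <;> simp_all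

theorem Test.side_union (u : Test I.n) (b : Bool) (R : Finset (Fin I.n)) :
    u.side I b R ∪ u.side I (!b) R = R := by
  ext q
  simp only [Finset.mem_union, Test.mem_side]
  cases b <;> simp <;> tauto

theorem Test.sum_side (u : Test I.n) (b : Bool) (R : Finset (Fin I.n)) (f : Fin I.n → ℝ) :
    ∑ q ∈ u.side I b R, f q + ∑ q ∈ u.side I (!b) R, f q = ∑ q ∈ R, f q := by
  rw [← Finset.sum_union (u.side_disjoint b R), u.side_union b R]

theorem Test.wsum_side (u : Test I.n) (b : Bool) (R : Finset (Fin I.n)) (W : Fin I.n → ℝ) :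
    wsum W (u.side I b R) + wsum W (u.side I (!b) R) = wsum W R := u.sum_side b R W

theorem Test.side_side_comm (u v : Test I.n) (b c : Bool) (R : Finset (Fin I.n)) :
    u.side I b (v.side I c R) = v.side I c (u.side I b R) := by
  ext q; simp only [Test.mem_side]; tauto

theorem wsum_nonneg {n : ℕ} {W : Fin n → ℝ} (hW : ∀ q, 0 ≤ W q) (R : Finset (Fin n)) :
    0 ≤ wsum W R := Finset.sum_nonneg fun q _ => hW q

theorem wsum_mono {n : ℕ} {W : Fin n → ℝ} (hW : ∀ q, 0 ≤ W q) {R S : Finset (Fin n)} (h : R ⊆ S) :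
    wsum W R ≤ wsum W S := Finset.sum_le_sum_of_subset_of_nonneg h fun q _ _ => hW q

theorem le_wsum {n : ℕ} {W : Fin n → ℝ} (hW : ∀ q, 0 ≤ W q) {R : Finset (Fin n)} {q : Fin n}
    (h : q ∈ R) : W q ≤ wsum W R := Finset.single_le_sum (fun q _ => hW q) h

/-- The weighted sum of the depths of the queries in `R`. -/
noncomputable def Tree.wcost (I : Instance) (W : Fin I.n → ℝ) (T : Tree I.n I.p)
    (R : Finset (Fin I.n)) : ℝ := ∑ q ∈ R, W q * (T.depth I q : ℝ)

theorem Tree.wcost_nonneg {W : Fin I.n → ℝ} (hW : ∀ q, 0 ≤ W q) (T : Tree I.n I.p)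
    (R : Finset (Fin I.n)) : 0 ≤ T.wcost I W R :=
  Finset.sum_nonneg fun q _ => mul_nonneg (hW q) (Nat.cast_nonneg _)

theorem Tree.depth_node_of_mem {u : Test I.n} {y z : Tree I.n I.p} {b : Bool} {q : Fin I.n}
    (h : u.Sat I q ↔ b = true) : (Tree.node u y z).depth I q = (kid b y z).depth I q + 1 := by
  cases b <;> simp_all [Tree.depth, kid]

theorem Tree.answer_node_of_mem {u : Test I.n} {y z : Tree I.n I.p} {b : Bool} {q : Fin I.n}
    (h : u.Sat I q ↔ b = true) : (Tree.node u y z).answer I q = (kid b y z).answer I q := by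
  cases b <;> simp_all [Tree.answer, kid]

theorem Tree.wcost_node (W : Fin I.n → ℝ) (u : Test I.n) (y z : Tree I.n I.p) (b : Bool)
    (R : Finset (Fin I.n)) :
    (Tree.node u y z).wcost I W R = wsum W R + (kid b y z).wcost I W (u.side I b R) +
      (kid (!b) y z).wcost I W (u.side I (!b) R) := by
  have key : ∀ c : Bool, ∑ q ∈ u.side I c R, W q * ((Tree.node u y z).depth I q : ℝ) =
      wsum W (u.side I c R) + (kid c y z).wcost I W (u.side I c R) := by
    intro c
    rw [wsum, Tree.wcost, ← Finset.sum_add_distrib]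
    refine Finset.sum_congr rfl fun q hq => ?_
    rw [Tree.depth_node_of_mem (Test.mem_side.1 hq).2]
    push_cast; ring
  rw [Tree.wcost, ← u.sum_side b R, key, key, ← u.wsum_side b R]
  ring

/-- `T` uses allowed tests only and classifies the queries in `R`. -/
def Tree.SolvesOn (I : Instance) (T : Tree I.n I.p) (R : Finset (Fin I.n)) : Prop :=
  T.TestsAllowed I ∧ ∀ q ∈ R, q ∈ I.cls (T.answer I q)

/-- `T` has minimum cost among the trees that classify the queries in `R`. -/
def Tree.OptOn (I : Instance) (W : Fin I.n → ℝ) (T : Tree I.n I.p) (R : Finset (Fin I.n)) : Prop :=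
  T.SolvesOn I R ∧ ∀ T' : Tree I.n I.p, T'.SolvesOn I R → T.wcost I W R ≤ T'.wcost I W R

theorem Tree.SolvesOn.kid {u : Test I.n} {y z : Tree I.n I.p} {R : Finset (Fin I.n)}
    (h : (Tree.node u y z).SolvesOn I R) (b : Bool) : (kid b y z).SolvesOn I (u.side I b R) := by
  refine ⟨?_, fun q hq => ?_⟩
  · obtain ⟨⟨_, h1, h2⟩, _⟩ := h
    cases b <;> simpa [TwoWay.kid]
  · obtain ⟨hq1, hq2⟩ := Test.mem_side.1 hq
    have := h.2 q hq1
    rwa [Tree.answer_node_of_mem hq2] at this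

theorem Tree.SolvesOn.node {u : Test I.n} {y z : Tree I.n I.p} {R : Finset (Fin I.n)}
    (hu : u.Allowed I) (b : Bool) (h1 : (TwoWay.kid b y z).SolvesOn I (u.side I b R))
    (h2 : (TwoWay.kid (!b) y z).SolvesOn I (u.side I (!b) R)) :
    (Tree.node u y z).SolvesOn I R := by
  refine ⟨⟨hu, ?_⟩, fun q hq => ?_⟩
  · cases b
    · exact ⟨h2.1, h1.1⟩
    · exact ⟨h1.1, h2.1⟩
  · rw [← u.side_union b R, Finset.mem_union] at hq
    rcases hq with hq | hq
    · rw [Tree.answer_node_of_mem (Test.mem_side.1 hq).2]; exact h1.2 q hq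
    · rw [Tree.answer_node_of_mem (Test.mem_side.1 hq).2]; exact h2.2 q hq

theorem kid_cond {n p : ℕ} (b : Bool) (T T' : Tree n p) :
    kid b (cond b T T') (cond b T' T) = T ∧ kid (!b) (cond b T T') (cond b T' T) = T' := by
  cases b <;> simp [kid]

theorem Tree.OptOn.kid {W : Fin I.n → ℝ} {u : Test I.n} {y z : Tree I.n I.p}
    {R : Finset (Fin I.n)} (h : (Tree.node u y z).OptOn I W R) (b : Bool) :
    (TwoWay.kid b y z).OptOn I W (u.side I b R) := by
  refine ⟨h.1.kid b, fun T' hT' => ?_⟩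
  have e := kid_cond b T' (TwoWay.kid (!b) y z)
  have h2 : (Tree.node u (cond b T' (TwoWay.kid (!b) y z))
      (cond b (TwoWay.kid (!b) y z) T')).SolvesOn I R := by
    refine Tree.SolvesOn.node h.1.1.1 b ?_ ?_
    · rw [e.1]; exact hT'
    · rw [e.2]; exact h.1.kid (!b)
  have h3 := h.2 _ h2
  rw [Tree.wcost_node W u _ _ b, Tree.wcost_node W u _ _ b, e.1, e.2] at h3
  linarith

/-- A test with an empty side could be replaced by its other subtree, which saves one comparison for
every query in `R`. This is where strict positivity of the weights is needed. -/
theorem Tree.OptOn.side_nonempty {W : Fin I.n → ℝ} (hW : ∀ q, 0 < W q) {u : Test I.n}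
    {y z : Tree I.n I.p} {R : Finset (Fin I.n)} (h : (Tree.node u y z).OptOn I W R)
    (hR : R.Nonempty) (b : Bool) : (u.side I b R).Nonempty := by
  by_contra hne
  rw [Finset.not_nonempty_iff_eq_empty] at hne
  have hR' : u.side I (!b) R = R := by
    have := u.side_union b R
    rwa [hne, Finset.empty_union] at this
  have h1 := h.2 (TwoWay.kid (!b) y z) (by simpa [hR'] using h.1.kid (!b))
  rw [Tree.wcost_node W u _ _ b, hne, hR'] at h1
  have h0 : (TwoWay.kid b y z).wcost I W ∅ = 0 := by simp [Tree.wcost]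
  have : 0 < wsum W R := Finset.sum_pos (fun q _ => hW q) hR
  linarith

/-- Contract the nodes of `T` one of whose sides holds no query from `A`. -/
noncomputable def Tree.prune (I : Instance) : Tree I.n I.p → Finset (Fin I.n) → Tree I.n I.p
  | .leaf j, _ => .leaf j
  | .node u y z, A =>
    if u.side I true A = ∅ then z.prune I (u.side I false A)
    else if u.side I false A = ∅ then y.prune I (u.side I true A)
    else .node u (y.prune I (u.side I true A)) (z.prune I (u.side I false A))

theorem Test.side_eq_self {u : Test I.n} {b : Bool} {R : Finset (Fin I.n)}
    (h : u.side I (!b) R = ∅) : u.side I b R = R := by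
  have := u.side_union b R
  rwa [h, Finset.union_empty] at this

theorem Tree.SolvesOn.prune {T : Tree I.n I.p} {A : Finset (Fin I.n)} (h : T.SolvesOn I A) :
    (T.prune I A).SolvesOn I A := by
  induction T generalizing A with
  | leaf j => exact h
  | node u y z ihy ihz =>
    rw [Tree.prune]
    have hy := ihy (h.kid true)
    have hz := ihz (h.kid false)
    split_ifs with h1 h2
    · have e := Test.side_eq_self (b := false) h1
      rw [e] at hz ⊢
      exact hz
    · have e := Test.side_eq_self (b := true) h2
      rw [e] at hy ⊢
      exact hy
    · exact Tree.SolvesOn.node h.1.1 true hy hz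

/-- The cost on `A` of the pruned tree. -/
noncomputable def Tree.pcost (I : Instance) (W : Fin I.n → ℝ) (T : Tree I.n I.p)
    (A : Finset (Fin I.n)) : ℝ := (T.prune I A).wcost I W A

theorem Tree.pcost_node_of_empty (W : Fin I.n → ℝ) {u : Test I.n} {y z : Tree I.n I.p} {b : Bool}
    {A : Finset (Fin I.n)} (h : u.side I (!b) A = ∅) :
    (Tree.node u y z).pcost I W A = (kid b y z).pcost I W (u.side I b A) := by
  have e := Test.side_eq_self h
  cases b
  · simp only [Bool.not_false] at h
    simp [Tree.pcost, Tree.prune, h, kid, e]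
  · simp only [Bool.not_true] at h
    -- `prune` looks at the yes-side first, so when both sides are empty it descends into the
    -- no-subtree. The costs on the empty set vanish, so this does no harm.
    by_cases hA : A = ∅
    · subst hA; simp [Tree.pcost, Tree.wcost, Test.side]
    · rw [Tree.pcost, Tree.prune, if_neg (by rwa [e]), if_pos h, e]; rfl

/-- Equality holds if both sides are nonempty. Otherwise the root is contracted, and nonnegative
terms are dropped. -/
theorem Tree.pcost_node_le {W : Fin I.n → ℝ} (hW : ∀ q, 0 ≤ W q) (u : Test I.n)
    (y z : Tree I.n I.p) (b : Bool) (A : Finset (Fin I.n)) :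
    (Tree.node u y z).pcost I W A ≤ wsum W A + (kid b y z).pcost I W (u.side I b A) +
      (kid (!b) y z).pcost I W (u.side I (!b) A) := by
  have hA := wsum_nonneg hW A
  by_cases h1 : u.side I (!b) A = ∅
  · rw [Tree.pcost_node_of_empty W h1]
    have := Tree.wcost_nonneg hW ((kid (!b) y z).prune I (u.side I (!b) A)) (u.side I (!b) A)
    rw [← Tree.pcost] at this
    linarith
  by_cases h2 : u.side I (!(!b)) A = ∅
  · rw [Tree.pcost_node_of_empty W h2]
    have := Tree.wcost_nonneg hW ((kid b y z).prune I (u.side I b A)) (u.side I b A)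
    rw [← Tree.pcost] at this
    linarith
  · rw [Tree.pcost, Tree.prune, if_neg (by cases b <;> simp_all), if_neg (by cases b <;> simp_all),
      Tree.wcost_node W u _ _ b]
    apply le_of_eq
    cases b <;> rfl

theorem Tree.pcost_le {W : Fin I.n → ℝ} (hW : ∀ q, 0 ≤ W q) (T : Tree I.n I.p)
    (A : Finset (Fin I.n)) : T.pcost I W A ≤ T.wcost I W A := by
  induction T generalizing A with
  | leaf j => exact le_rfl
  | node u y z ihy ihz =>
    refine (Tree.pcost_node_le hW u y z true A).trans ?_
    rw [Tree.wcost_node W u y z true A]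
    have h1 := ihy (u.side I true A)
    have h2 := ihz (u.side I false A)
    simp only [kid, Bool.not_true, if_true, Bool.false_eq_true, if_false]
    linarith

/-- What is saved by testing `x` first, not counting the new test itself. -/
noncomputable def Tree.saving (I : Instance) (W : Fin I.n → ℝ) (x : Test I.n) (T : Tree I.n I.p)
    (R : Finset (Fin I.n)) : ℝ :=
  T.wcost I W R - T.pcost I W (x.side I true R) - T.pcost I W (x.side I false R)

theorem Tree.saving_eq (W : Fin I.n → ℝ) (x : Test I.n) (T : Tree I.n I.p) (R : Finset (Fin I.n))
    (c : Bool) : T.saving I W x R =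
      T.wcost I W R - T.pcost I W (x.side I c R) - T.pcost I W (x.side I (!c) R) := by
  cases c <;> simp only [Tree.saving, Bool.not_false, Bool.not_true]
  ring

/-- The competitor has `x` at the root and a pruned copy of `T` on each side. The root costs `wsum W
R`, so the pruning may save at most that much. -/
theorem Tree.OptOn.saving_le {W : Fin I.n → ℝ} {T : Tree I.n I.p}
    {R : Finset (Fin I.n)} (h : T.OptOn I W R) {x : Test I.n} (hx : x.Allowed I) :
    T.saving I W x R ≤ wsum W R := by
  have h1 : (Tree.node x (T.prune I (x.side I true R)) (T.prune I (x.side I false R))).SolvesOn I R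
      := by
    refine Tree.SolvesOn.node hx true ?_ ?_
    · exact Tree.SolvesOn.prune ⟨h.1.1, fun q hq => h.1.2 q (x.side_subset _ _ hq)⟩
    · exact Tree.SolvesOn.prune ⟨h.1.1, fun q hq => h.1.2 q (x.side_subset _ _ hq)⟩
  have h2 := h.2 _ h1
  rw [Tree.wcost_node W x _ _ true] at h2
  simp only [TwoWay.kid, Bool.not_true, if_true, Bool.false_eq_true, if_false] at h2
  rw [← Tree.pcost, ← Tree.pcost] at h2
  rw [Tree.saving]
  linarith

theorem Tree.wcost_side (W : Fin I.n → ℝ) (T : Tree I.n I.p) (x : Test I.n) (b : Bool)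
    (R : Finset (Fin I.n)) :
    T.wcost I W (x.side I b R) + T.wcost I W (x.side I (!b) R) = T.wcost I W R :=
  x.sum_side b R _

theorem Tree.saving_nonneg {W : Fin I.n → ℝ} (hW : ∀ q, 0 ≤ W q) (x : Test I.n) (T : Tree I.n I.p)
    (R : Finset (Fin I.n)) : 0 ≤ T.saving I W x R := by
  have h1 := T.pcost_le hW (x.side I true R)
  have h2 := T.pcost_le hW (x.side I false R)
  have h3 := T.wcost_side W x true R
  rw [Bool.not_true] at h3
  rw [Tree.saving]
  linarith

theorem Test.side_side_self (x : Test I.n) (b : Bool) (R : Finset (Fin I.n)) :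
    x.side I b (x.side I b R) = x.side I b R := by
  ext q; simp only [Test.mem_side]; tauto

theorem Test.side_side_not (x : Test I.n) (b : Bool) (R : Finset (Fin I.n)) :
    x.side I (!b) (x.side I b R) = ∅ := by
  ext q; simp only [Test.mem_side]; cases b <;> simp

/-- If the test tried at the top is the root's own test, then the root becomes redundant in both
copies and every query saves it. -/
theorem Tree.wsum_le_saving_node {W : Fin I.n → ℝ} (hW : ∀ q, 0 ≤ W q) (x : Test I.n)
    (y z : Tree I.n I.p) (R : Finset (Fin I.n)) :
    wsum W R ≤ (Tree.node x y z).saving I W x R := by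
  rw [Tree.saving, Tree.wcost_node W x y z true,
    Tree.pcost_node_of_empty W (b := true) (x.side_side_not true R),
    Tree.pcost_node_of_empty W (b := false) (x.side_side_not false R), Test.side_side_self,
    Test.side_side_self, Bool.not_true]
  have h1 := (TwoWay.kid true y z).pcost_le hW (x.side I true R)
  have h2 := (TwoWay.kid false y z).pcost_le hW (x.side I false R)
  linarith

/-- If the off-side of a node consists of queries of one kind with respect to `x`, then the other
kind saves one test there. -/
theorem Tree.saving_node_ge {W : Fin I.n → ℝ} (hW : ∀ q, 0 ≤ W q) (x u : Test I.n)
    (y z : Tree I.n I.p) (R : Finset (Fin I.n)) (b c : Bool)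
    (h : ∀ q ∈ u.side I (!b) R, (x.Sat I q ↔ c = true)) :
    wsum W (x.side I (!c) (u.side I b R)) + (kid b y z).saving I W x (u.side I b R) ≤
      (Tree.node u y z).saving I W x R := by
  have e1 : x.side I (!c) (u.side I (!b) R) = ∅ := by
    ext q
    simp only [Test.mem_side, Finset.notMem_empty, iff_false]
    rintro ⟨h1, h2⟩
    have := h q (Test.mem_side.2 h1)
    cases c <;> simp_all
  have e2 : x.side I c (u.side I (!b) R) = u.side I (!b) R := Test.side_eq_self e1
  -- In the copy for the kind other than `c`, nothing leaves at `u`, so `u` is contracted there and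
  -- each query of that kind saves one test. The copy for `c` pays for `u` as before.
  rw [Tree.saving_eq W x _ R c, Tree.saving_eq W x _ _ c, Tree.wcost_node W u y z b,
    Tree.pcost_node_of_empty W (b := b) (A := x.side I (!c) R)
      (by rw [Test.side_side_comm, e1])]
  have h1 := Tree.pcost_node_le hW u y z b (x.side I c R)
  have h2 := (TwoWay.kid (!b) y z).pcost_le hW (u.side I (!b) R)
  rw [Test.side_side_comm u x, Test.side_side_comm u x, e2] at h1
  rw [Test.side_side_comm u x]
  have h3 := x.wsum_side c R W
  have h4 : x.side I (!c) (u.side I b R) = x.side I (!c) R := by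
    have := u.side_union b (x.side I (!c) R)
    rw [Test.side_side_comm u x (!b), e1, Finset.union_empty, Test.side_side_comm] at this
    exact this
  rw [h4] at *
  linarith

/-! ### Paths -/

/-- `Desc I T R ℓ E RE`: a path of tests leads from the root of `T` to the subtree `E`; of the
queries in `R`, those in `RE` follow it to the end; `ℓ` lists the tests together with the sets of
queries that leave the path there. -/
inductive Desc (I : Instance) : Tree I.n I.p → Finset (Fin I.n) →
    List (Test I.n × Finset (Fin I.n)) → Tree I.n I.p → Finset (Fin I.n) → Prop
  | nil (T R) : Desc I T R [] T R
  | cons (b : Bool) (u y z R ℓ E RE) (h : Desc I (kid b y z) (u.side I b R) ℓ E RE) :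
      Desc I (.node u y z) R ((u, u.side I (!b) R) :: ℓ) E RE

theorem Desc.subset {T E : Tree I.n I.p} {R RE ℓ} (h : Desc I T R ℓ E RE) : RE ⊆ R := by
  induction h with
  | nil => exact fun _ h => h
  | cons b u y z R ℓ E RE h ih => exact ih.trans (u.side_subset _ _)

theorem Desc.opt {W : Fin I.n → ℝ} {T E : Tree I.n I.p} {R RE ℓ} (h : Desc I T R ℓ E RE)
    (ho : T.OptOn I W R) : E.OptOn I W RE := by
  induction h with
  | nil => exact ho
  | cons b u y z R ℓ E RE h ih => exact ih (ho.kid b)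

theorem Desc.trans {T E F : Tree I.n I.p} {R RE RF ℓ ℓ'} (h : Desc I T R ℓ E RE)
    (h' : Desc I E RE ℓ' F RF) : Desc I T R (ℓ ++ ℓ') F RF := by
  induction h with
  | nil => exact h'
  | cons b u y z R ℓ E RE h ih => exact .cons b u y z R _ F RF (ih h')

theorem Desc.split {T E : Tree I.n I.p} {R RE ℓ ℓ'} (h : Desc I T R (ℓ ++ ℓ') E RE) :
    ∃ F RF, Desc I T R ℓ F RF ∧ Desc I F RF ℓ' E RE := by
  induction ℓ generalizing T R with
  | nil => exact ⟨T, R, .nil _ _, h⟩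
  | cons a ℓ ih =>
    cases h with
    | cons b u y z R _ E RE h =>
      obtain ⟨F, RF, h1, h2⟩ := ih h
      exact ⟨F, RF, .cons b u y z R _ F RF h1, h2⟩

/-- The weight of the items of kind `c` on a list, plus `e c`. -/
def tot (c : Bool) : List (Bool × ℝ) → (Bool → ℝ) → ℝ
  | [], e => e c
  | (d, a) :: ℓ, e => (if d = c then a else 0) + tot c ℓ e

/-- For each item on the list, the weight of what follows it and is of the other kind. -/
def sep : List (Bool × ℝ) → (Bool → ℝ) → ℝ
  | [], _ => 0
  | (d, _) :: ℓ, e => tot (!d) ℓ e + sep ℓ e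

/-- `L` lists the kinds, with respect to `x`, and the weights of the sets on `ℓ`. -/
def Typed (I : Instance) (W : Fin I.n → ℝ) (x : Test I.n)
    (ℓ : List (Test I.n × Finset (Fin I.n))) (L : List (Bool × ℝ)) : Prop :=
  List.Forall₂ (fun s d => (∀ q ∈ s.2, (x.Sat I q ↔ d.1 = true)) ∧ d.2 = wsum W s.2) ℓ L

/-- The sets that leave the path and the set at its end partition `R`, and each leaving set lies
wholly on one side of `x`. -/
theorem Desc.tot_eq {W : Fin I.n → ℝ} {x : Test I.n} {T E : Tree I.n I.p} {R RE ℓ L}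
    (h : Desc I T R ℓ E RE) (ht : Typed I W x ℓ L) (c : Bool) :
    tot c L (fun c => wsum W (x.side I c RE)) = wsum W (x.side I c R) := by
  induction h generalizing L with
  | nil => cases ht; rfl
  | cons b u y z R ℓ E RE h ih =>
    obtain ⟨⟩ | ⟨⟨h1, h2⟩, h3⟩ := ht
    rename_i d L
    obtain ⟨d, a⟩ := d
    simp only at h1 h2
    rw [tot, ih h3, ← u.wsum_side b (x.side I c R), Test.side_side_comm u x,
      Test.side_side_comm u x, add_comm]
    congr 1
    split_ifs with hd
    · subst hd
      rw [h2]
      congr 1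
      ext q
      simp only [Test.mem_side] at h1 ⊢
      exact ⟨fun hq => ⟨hq, h1 q hq⟩, fun hq => hq.1⟩
    · rw [show x.side I c (u.side I (!b) R) = ∅ from ?_]
      · simp [wsum]
      · ext q
        simp only [Finset.notMem_empty, iff_false]
        intro hq
        rw [Test.mem_side] at hq
        have := (h1 q hq.1).symm.trans hq.2
        exact hd (Bool.eq_iff_iff.2 this)

/-- This iterates `Tree.saving_node_ge` along the path. By `Desc.tot_eq`, the term that `sep` adds
for a node is the weight of the queries of the other kind that continue past it. -/
theorem Desc.sep_le {W : Fin I.n → ℝ} (hW : ∀ q, 0 ≤ W q) {x : Test I.n} {T E : Tree I.n I.p}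
    {R RE ℓ L} (h : Desc I T R ℓ E RE) (ht : Typed I W x ℓ L) :
    sep L (fun c => wsum W (x.side I c RE)) + E.saving I W x RE ≤ T.saving I W x R := by
  induction h generalizing L with
  | nil => cases ht; simp [sep]
  | cons b u y z R ℓ E RE h ih =>
    obtain ⟨⟩ | ⟨⟨h1, h2⟩, h3⟩ := ht
    rename_i d L
    obtain ⟨d, a⟩ := d
    have h4 := Tree.saving_node_ge hW x u y z R b d h1
    have h5 := ih h3
    rw [sep, h.tot_eq h3]
    linarith

/-- In an optimal tree, inserting the test `x` at the top does not help. -/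
theorem Desc.cut {W : Fin I.n → ℝ} (hW : ∀ q, 0 ≤ W q) {x : Test I.n} (hx : x.Allowed I)
    {T E : Tree I.n I.p} {R RE ℓ L} (h : Desc I T R ℓ E RE) (ht : Typed I W x ℓ L)
    (ho : T.OptOn I W R) :
    sep L (fun c => wsum W (x.side I c RE)) + E.saving I W x RE ≤
      tot true L (fun c => wsum W (x.side I c RE)) +
      tot false L (fun c => wsum W (x.side I c RE)) := by
  rw [h.tot_eq ht, h.tot_eq ht]
  have h1 := x.wsum_side true R W
  rw [Bool.not_true] at h1
  rw [h1]
  exact (h.sep_le hW ht).trans (ho.saving_le hx)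

end Cut
end TwoWay

namespace TwoWay

/-! ### Lists of typed weights -/

section Lists

theorem tot_zero (c : Bool) (L : List (Bool × ℝ)) (e : Bool → ℝ) :
    tot c L e = tot c L (fun _ => 0) + e c := by
  induction L with
  | nil => simp [tot]
  | cons d L ih => rw [tot, tot, ih]; ring

theorem tot_nonneg {c : Bool} {L : List (Bool × ℝ)} {e : Bool → ℝ} (hL : ∀ d ∈ L, 0 ≤ d.2)
    (he : ∀ c, 0 ≤ e c) : 0 ≤ tot c L e := by
  induction L with
  | nil => exact he c
  | cons d L ih =>
    rw [tot]
    have h1 := ih fun d' hd' => hL d' (List.mem_cons_of_mem _ hd')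
    have h2 := hL d List.mem_cons_self
    split_ifs <;> linarith

theorem sep_nonneg {L : List (Bool × ℝ)} {e : Bool → ℝ} (hL : ∀ d ∈ L, 0 ≤ d.2)
    (he : ∀ c, 0 ≤ e c) : 0 ≤ sep L e := by
  induction L with
  | nil => exact le_rfl
  | cons d L ih =>
    rw [sep]
    have h0 : ∀ d' ∈ L, 0 ≤ d'.2 := fun d' hd' => hL d' (List.mem_cons_of_mem _ hd')
    have h1 := ih h0
    have h2 := tot_nonneg (c := !d.1) h0 he
    linarith

theorem le_tot {c : Bool} {L : List (Bool × ℝ)} {e : Bool → ℝ} (hL : ∀ d ∈ L, 0 ≤ d.2) :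
    e c ≤ tot c L e := by
  rw [tot_zero]
  have := tot_nonneg (c := c) (e := fun _ => 0) hL (fun _ => le_rfl)
  linarith

/-- Every item of kind `!o` is followed by at least `e o` of the other kind, and no item weighs more
than that. -/
theorem tot_not_le_sep {o : Bool} {ω : ℝ} {L : List (Bool × ℝ)} {e : Bool → ℝ}
    (hL : ∀ d ∈ L, 0 ≤ d.2 ∧ d.2 ≤ ω) (ho : ω ≤ e o) (he : ∀ c, 0 ≤ e c) :
    tot (!o) L (fun _ => 0) ≤ sep L e := by
  induction L with
  | nil => exact le_rfl
  | cons d L ih =>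
    have h0 : ∀ d' ∈ L, 0 ≤ d'.2 ∧ d'.2 ≤ ω := fun d' hd' => hL d' (List.mem_cons_of_mem _ hd')
    have h1 := ih h0
    have h2 := hL d List.mem_cons_self
    obtain ⟨c, a⟩ := d
    rw [sep, tot]
    split_ifs with hc
    · subst hc
      have := le_tot (c := o) (e := e) fun d hd => (h0 d hd).1
      rw [Bool.not_not]
      linarith
    · have := tot_nonneg (c := !c) (fun d hd => (h0 d hd).1) he
      linarith

/-- The leading item contributes everything of kind `o` that follows, including `e o`, which
strictly exceeds its own weight `a`. The remaining items of kind `!o` are paid for by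
`tot_not_le_sep`. -/
theorem tot_lt_sep {o : Bool} {ω a : ℝ} {L : List (Bool × ℝ)} {e : Bool → ℝ} (ha : a < ω)
    (hL : ∀ d ∈ L, 0 ≤ d.2 ∧ d.2 ≤ ω) (ho : ω ≤ e o) (he : ∀ c, 0 ≤ e c) :
    tot true ((!o, a) :: L) (fun _ => 0) + tot false ((!o, a) :: L) (fun _ => 0) <
      sep ((!o, a) :: L) e := by
  have h1 := tot_not_le_sep hL ho he
  rw [sep, tot, tot, Bool.not_not, tot_zero o L e]
  cases o <;> simp at h1 ⊢ <;> linarith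

/-- No saving by an additional test at the top. -/
def Tight (L : List (Bool × ℝ)) (e : Bool → ℝ) : Prop :=
  sep L e ≤ tot true L e + tot false L e

theorem le_sep_of_mem {o : Bool} {L : List (Bool × ℝ)} {e : Bool → ℝ} (hL : ∀ d ∈ L, 0 ≤ d.2)
    (he : ∀ c, 0 ≤ e c) {d : Bool × ℝ} (hd : d ∈ L) (hdo : d.1 = !o) : e o ≤ sep L e := by
  induction L with
  | nil => simp at hd
  | cons d' L ih =>
    have h0 : ∀ d' ∈ L, 0 ≤ d'.2 := fun d' hd' => hL d' (List.mem_cons_of_mem _ hd')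
    rw [sep]
    rcases List.mem_cons.1 hd with rfl | hd
    · have h1 := le_tot (c := o) (e := e) h0
      have h2 := sep_nonneg h0 he
      rw [hdo, Bool.not_not]
      linarith
    · have h1 := ih h0 hd
      have h2 := tot_nonneg (c := !d'.1) h0 he
      linarith

/-- Two leading items of opposite kinds already contribute both totals, short of `a`. Tightness
would leave `sep L e ≤ a`, but the later item of kind `!o` alone contributes at least `e o`. -/
theorem not_tight {o k : Bool} {a b : ℝ} {L : List (Bool × ℝ)} {e : Bool → ℝ}
    (hL : ∀ d ∈ L, 0 ≤ d.2) (he : ∀ c, 0 ≤ e c) (ha : a < e o) {d : Bool × ℝ} (hd : d ∈ L)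
    (hdo : d.1 = !o) : ¬ Tight ((k, a) :: (!k, b) :: L) e := by
  have h1 := le_sep_of_mem hL he hd hdo
  rw [Tight, sep, sep, tot, tot, tot, tot, tot, tot_zero _ L e, tot_zero true L e,
    tot_zero false L e, tot_zero _ L e]
  cases k <;> simp <;> linarith

variable {α : Type*} (κ : α → Bool) (a : α → ℝ)

/-- The list of the kinds and weights of the items on a list. -/
def kw (ℓ : List α) : List (Bool × ℝ) := ℓ.map fun s => (κ s, a s)

theorem kw_cons (s : α) (ℓ : List α) : kw κ a (s :: ℓ) = (κ s, a s) :: kw κ a ℓ := rfl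

variable {κ a}

theorem kw_nonneg {ℓ : List α} (h : ∀ s ∈ ℓ, 0 ≤ a s) : ∀ d ∈ kw κ a ℓ, 0 ≤ d.2 := by
  intro d hd
  obtain ⟨s, hs, rfl⟩ := List.mem_map.1 hd
  exact h s hs

/-- By `not_tight`, neighbours have the same kind as long as an item of kind `!o` follows both. So
everything before the last item of kind `!o` has one kind, which must be `!o` as there are two such
items. Hence the list is a block of kind `!o` followed by a block of kind `o`. -/
theorem tight_shape {o : Bool} {e : Bool → ℝ} (he : ∀ c, 0 ≤ e c) {ℓ : List α}
    (hℓ : ∀ s ∈ ℓ, 0 ≤ a s ∧ a s < e o)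
    (ht : ∀ ℓ₁ ℓ₂, ℓ = ℓ₁ ++ ℓ₂ → Tight (kw κ a ℓ₂) e)
    (h2 : 2 ≤ ℓ.countP (fun s => κ s = !o)) (h3 : ∃ t ∈ ℓ, κ t = o) :
    ∃ pre s s' suf, ℓ = pre ++ s :: s' :: suf ∧ suf ≠ [] ∧ (∀ r ∈ pre, κ r = !o) ∧ κ s = !o ∧
      κ s' = !o ∧ ∀ r ∈ suf, κ r = o := by
  induction ℓ with
  | nil => simp at h2
  | cons r ℓ ih =>
    have hℓ' : ∀ s ∈ ℓ, 0 ≤ a s ∧ a s < e o := fun s hs => hℓ s (List.mem_cons_of_mem _ hs)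
    have ht' : ∀ ℓ₁ ℓ₂, ℓ = ℓ₁ ++ ℓ₂ → Tight (kw κ a ℓ₂) e := fun ℓ₁ ℓ₂ h =>
      ht (r :: ℓ₁) ℓ₂ (by rw [h]; rfl)
    have hno : ∀ k : Bool, k = o ∨ k = !o := by intro k; cases k <;> cases o <;> simp
    have hne : o ≠ !o := by cases o <;> simp
    have key : ∀ r' ℓ', ℓ = r' :: ℓ' → ∀ s ∈ ℓ', κ s = !o → κ r = κ r' := by
      intro r' ℓ' hrl s hs ks
      by_contra hk
      have hk' : κ r' = !κ r := by cases h : κ r <;> cases h' : κ r' <;> simp_all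
      have h1 := ht [] (r :: ℓ) rfl
      rw [hrl, kw_cons, kw_cons, hk'] at h1
      refine not_tight (kw_nonneg fun s hs => (hℓ' s ?_).1) he (hℓ r List.mem_cons_self).2
        (List.mem_map.2 ⟨s, hs, rfl⟩) ks h1
      rw [hrl]; exact List.mem_cons_of_mem _ hs
    obtain ⟨t, ht1, ht2⟩ := h3
    by_cases htwo : 2 ≤ ℓ.countP (fun s => κ s = !o)
    · by_cases hown : ∃ t' ∈ ℓ, κ t' = o
      · obtain ⟨pre, s, s', suf, e1, e2, e3, e4, e5, e6⟩ := ih hℓ' ht' htwo hown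
        refine ⟨r :: pre, s, s', suf, by rw [e1]; rfl, e2, ?_, e4, e5, e6⟩
        intro r' hr'
        rcases List.mem_cons.1 hr' with rfl | hr'
        · cases pre with
          | nil => rw [key s (s' :: suf) e1 s' (by simp) e5, e4]
          | cons p pre => rw [key p _ e1 s (by simp) e4, e3 p (by simp)]
        · exact e3 r' hr'
      · push Not at hown
        have hr : κ r = o := by
          rcases List.mem_cons.1 ht1 with rfl | h
          · exact ht2
          · exact absurd ht2 (hown t h)
        exfalso
        cases ℓ with
        | nil => simp at htwo
        | cons r' ℓ' =>
          have hr' : κ r' = !o := (hno _).resolve_left (hown r' (by simp))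
          have : 0 < ℓ'.countP (fun s => κ s = !o) := by
            rw [List.countP_cons] at htwo
            split_ifs at htwo <;> omega
          obtain ⟨s, hs, ks⟩ := List.countP_pos_iff.1 this
          have := key r' ℓ' rfl s hs (by simpa using ks)
          rw [hr, hr'] at this
          exact hne this
    · rw [List.countP_cons] at h2
      have hr : κ r = !o := by
        by_contra hr
        simp [hr] at h2
        omega
      simp only [hr, decide_true, if_true] at h2
      have ht1' : t ∈ ℓ := by
        rcases List.mem_cons.1 ht1 with rfl | h
        · exact absurd (ht2.symm.trans hr) hne
        · exact h
      cases ℓ with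
      | nil => simp at ht1'
      | cons r' ℓ' =>
        rw [List.countP_cons] at h2 htwo
        rcases hno (κ r') with hk | hk
        · exfalso
          have : 0 < ℓ'.countP (fun s => κ s = !o) := by
            simp [hk] at h2
            simp; exact h2
          obtain ⟨s, hs, ks⟩ := List.countP_pos_iff.1 this
          have := key r' ℓ' rfl s hs (by simpa using ks)
          rw [hr, hk] at this
          exact hne this.symm
        · refine ⟨[], r, r', ℓ', rfl, ?_, by simp, hr, hk, ?_⟩
          · rintro rfl
            rw [List.mem_singleton] at ht1'
            rw [ht1', hk] at ht2
            exact hne ht2.symm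
          · intro s' hs'
            refine (hno _).resolve_right fun hk' => htwo ?_
            have : 0 < ℓ'.countP (fun s => κ s = !o) :=
              List.countP_pos_iff.2 ⟨s', hs', by simpa using hk'⟩
            simp only [hk, decide_true, if_true]
            omega

theorem le_sep_own {o : Bool} {e : Bool → ℝ} (he : ∀ c, 0 ≤ e c) {ℓ : List α} (hne : ℓ ≠ [])
    (h0 : ∀ s ∈ ℓ, 0 ≤ a s) (ho : ∀ r ∈ ℓ, κ r = o) : e (!o) ≤ sep (kw κ a ℓ) e := by
  cases ℓ with
  | nil => exact absurd rfl hne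
  | cons r ℓ =>
    have h1 : ∀ d ∈ kw κ a ℓ, 0 ≤ d.2 := kw_nonneg fun s hs => h0 s (List.mem_cons_of_mem _ hs)
    rw [kw_cons, sep, ho r (by simp)]
    have h2 := le_tot (c := !o) (e := e) h1
    have h3 := sep_nonneg h1 he
    linarith

theorem tot_own (o : Bool) {ℓ : List α} (ho : ∀ r ∈ ℓ, κ r = o) :
    tot o (kw κ a ℓ) (fun _ => 0) = (ℓ.map a).sum ∧
      tot (!o) (kw κ a ℓ) (fun _ => 0) = 0 := by
  induction ℓ with
  | nil => simp [kw, tot]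
  | cons r ℓ ih =>
    obtain ⟨h1, h2⟩ := ih fun r hr => ho r (List.mem_cons_of_mem _ hr)
    rw [kw_cons, tot, tot, h1, h2, ho r (by simp)]
    simp

/-- Both `s` and `s'` contribute all of kind `o`, namely the suffix and `e o`, and the suffix
contributes at least `e (!o)`. The right-hand side of tightness contains the weight of kind `o` and
`e (!o)` only once each, so one copy of the former must be covered by `a s + a s'`. -/
theorem tight_last {o : Bool} {e : Bool → ℝ} (he : ∀ c, 0 ≤ e c) {s s' : α} {suf : List α}
    (h0 : ∀ s ∈ suf, 0 ≤ a s) (ht : Tight (kw κ a (s :: s' :: suf)) e) (hne : suf ≠ [])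
    (hs : κ s = !o) (hs' : κ s' = !o) (ho : ∀ r ∈ suf, κ r = o) :
    e o + (suf.map a).sum ≤ a s + a s' := by
  have h1 := le_sep_own he hne h0 ho
  obtain ⟨h2, h3⟩ := tot_own (a := a) o ho
  rw [Tight, kw_cons, kw_cons, sep, sep, tot, tot, tot, tot, tot, hs, hs', Bool.not_not,
    tot_zero o _ e, tot_zero true _ e, tot_zero false _ e] at ht
  cases o <;> simp only [Bool.not_true, Bool.not_false] at * <;> simp [h2, h3] at ht <;> linarith

theorem add_le_sum_map {ℓ : List α} (h0 : ∀ s ∈ ℓ, 0 ≤ a s) {s t : α} (hs : s ∈ ℓ) (ht : t ∈ ℓ)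
    (hst : s ≠ t) : a s + a t ≤ (ℓ.map a).sum := by
  have hle : ∀ {ℓ : List α} {s : α}, (∀ s ∈ ℓ, 0 ≤ a s) → s ∈ ℓ → a s ≤ (ℓ.map a).sum := by
    intro ℓ s h0 hs
    refine List.single_le_sum ?_ _ (List.mem_map_of_mem hs)
    intro x hx
    obtain ⟨r, hr, rfl⟩ := List.mem_map.1 hx
    exact h0 r hr
  induction ℓ with
  | nil => simp at hs
  | cons r ℓ ih =>
    have h0' : ∀ s ∈ ℓ, 0 ≤ a s := fun s hs => h0 s (List.mem_cons_of_mem _ hs)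
    rw [List.map_cons, List.sum_cons]
    rcases List.mem_cons.1 hs with rfl | hs'
    · rcases List.mem_cons.1 ht with rfl | ht'
      · exact absurd rfl hst
      · have := hle h0' ht'
        linarith
    · rcases List.mem_cons.1 ht with rfl | ht'
      · have := hle h0' hs'
        linarith
      · have := ih h0' hs' ht'
        have := h0 r (by simp)
        linarith

theorem two_le_countP {P : α → Bool} {ℓ : List α} {s t : α} (hs : s ∈ ℓ) (ht : t ∈ ℓ)
    (hst : s ≠ t) (h1 : P s) (h2 : P t) : 2 ≤ ℓ.countP P := by
  induction ℓ with
  | nil => simp at hs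
  | cons r ℓ ih =>
    rw [List.countP_cons]
    rcases List.mem_cons.1 hs with rfl | hs'
    · rcases List.mem_cons.1 ht with rfl | ht'
      · exact absurd rfl hst
      · have : 0 < ℓ.countP P := List.countP_pos_iff.2 ⟨t, ht', h2⟩
        simp only [h1, if_true]
        omega
    · rcases List.mem_cons.1 ht with rfl | ht'
      · have : 0 < ℓ.countP P := List.countP_pos_iff.2 ⟨s, hs', h1⟩
        simp only [h2, if_true]
        omega
      · have := ih hs' ht'
        omega

/-- The last two items of a decreasing list are the lightest. -/
theorem last_two_le {pre suf : List α} {s s' : α}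
    (hs : (pre ++ s :: s' :: suf).Pairwise fun r r' => a r' ≤ a r) {t t' : α}
    (ht : t ∈ pre ∨ t = s ∨ t = s') (ht' : t' ∈ pre ∨ t' = s ∨ t' = s') (hne : t ≠ t') :
    a s + a s' ≤ a t + a t' := by
  rw [List.pairwise_append] at hs
  obtain ⟨_, h2, h3⟩ := hs
  have e1 : a s' ≤ a s := (List.pairwise_cons.1 h2).1 s' (by simp)
  have e2 : ∀ r ∈ pre, a s ≤ a r := fun r hr => h3 r hr s (by simp)
  rcases ht with ht | rfl | rfl <;> rcases ht' with ht' | rfl | rfl <;>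
    first
    | exact absurd rfl hne
    | (try have := e2 _ ht
       try have := e2 _ ht'
       linarith)

/-- Two cuts of a decreasing list of weights that cannot both be tight. -/
theorem not_tight_cuts {e e' : Bool → ℝ} (he : ∀ c, 0 ≤ e c) (he' : ∀ c, 0 ≤ e' c) {ω : ℝ}
    {κ' : α → Bool} {o o' : Bool} (ho : ω ≤ e o) (ho' : ω ≤ e' o') {ℓ : List α}
    (hℓ : ∀ s ∈ ℓ, 0 ≤ a s ∧ a s < ω) (hs : ℓ.Pairwise fun r r' => a r' ≤ a r)
    (ht : ∀ ℓ₁ ℓ₂, ℓ = ℓ₁ ++ ℓ₂ → Tight (kw κ a ℓ₂) e)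
    (ht' : ∀ ℓ₁ ℓ₂, ℓ = ℓ₁ ++ ℓ₂ → Tight (kw κ' a ℓ₂) e') {s₁ s₂ s₃ s₄ s₅ : α}
    (h₁ : s₁ ∈ ℓ) (h₂ : s₂ ∈ ℓ) (h₃ : s₃ ∈ ℓ) (h₄ : s₄ ∈ ℓ) (h₅ : s₅ ∈ ℓ) (h₁₂ : s₁ ≠ s₂)
    (h₃₄ : s₃ ≠ s₄) (k₁ : κ s₁ = !o) (k₂ : κ s₂ = !o) (k₃ : κ s₃ = o) (k₄ : κ s₄ = o)
    (k₃' : κ' s₃ = !o') (k₄' : κ' s₄ = !o') (k₅' : κ' s₅ = o') : False := by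
  have hω : ∀ s ∈ ℓ, 0 ≤ a s ∧ a s < e o := fun s h => ⟨(hℓ s h).1, (hℓ s h).2.trans_le ho⟩
  have hω' : ∀ s ∈ ℓ, 0 ≤ a s ∧ a s < e' o' := fun s h => ⟨(hℓ s h).1, (hℓ s h).2.trans_le ho'⟩
  have hno : ∀ k : Bool, k ≠ !k := by intro k; cases k <;> simp
  -- In the first cut, `s₃` and `s₄` lie in the suffix. There `tight_last` bounds `ω` plus the
  -- suffix by two weights that are each below `ω`.
  have h34 : a s₃ + a s₄ < ω := by
    obtain ⟨pre, s, s', suf, e1, e2, e3, e4, e5, e6⟩ := tight_shape he hω ht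
      (two_le_countP h₁ h₂ h₁₂ (by simpa using k₁) (by simpa using k₂)) ⟨s₃, h₃, k₃⟩
    have hmem : ∀ s ∈ suf, s ∈ ℓ := fun s hs => by rw [e1]; simp [hs]
    have h1 := tight_last he (fun s hs => (hℓ s (hmem s hs)).1) (ht pre _ e1) e2 e4 e5 e6
    have hsuf : ∀ t ∈ ℓ, κ t = o → t ∈ suf := by
      intro t h k
      rw [e1] at h
      simp only [List.mem_append, List.mem_cons] at h
      rcases h with h | rfl | rfl | h
      · exact absurd (k.symm.trans (e3 t h)) (hno o)
      · exact absurd (k.symm.trans e4) (hno o)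
      · exact absurd (k.symm.trans e5) (hno o)
      · exact h
    have h2 := add_le_sum_map (a := a) (fun s hs => (hℓ s (hmem s hs)).1) (hsuf s₃ h₃ k₃)
      (hsuf s₄ h₄ k₄) h₃₄
    have h3 := (hℓ s (by rw [e1]; simp)).2
    have h4 := (hℓ s' (by rw [e1]; simp)).2
    linarith
  obtain ⟨pre, s, s', suf, e1, e2, e3, e4, e5, e6⟩ := tight_shape he' hω' ht'
    (two_le_countP h₃ h₄ h₃₄ (by simpa using k₃') (by simpa using k₄')) ⟨s₅, h₅, k₅'⟩
  have hmem : ∀ s ∈ suf, s ∈ ℓ := fun s hs => by rw [e1]; simp [hs]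
  have h1 := tight_last he' (fun s hs => (hℓ s (hmem s hs)).1) (ht' pre _ e1) e2 e4 e5 e6
  have h2 : 0 ≤ (suf.map a).sum := List.sum_nonneg (by
    intro x hx
    obtain ⟨r, hr, rfl⟩ := List.mem_map.1 hx
    exact (hℓ r (hmem r hr)).1)
  have hpre : ∀ t ∈ ℓ, κ' t = !o' → t ∈ pre ∨ t = s ∨ t = s' := by
    intro t h k
    rw [e1] at h
    simp only [List.mem_append, List.mem_cons] at h
    rcases h with h | rfl | rfl | h
    · exact .inl h
    · exact .inr (.inl rfl)
    · exact .inr (.inr rfl)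
    · exact absurd ((e6 t h).symm.trans k) (hno o')
  rw [e1] at hs
  -- In the second cut, the last two opposite items weigh at least `ω` together. Since the list
  -- decreases, they weigh no more than `s₃` and `s₄`, which contradicts the bound from the first
  -- cut.
  have h3 := last_two_le hs (hpre s₃ h₃ k₃') (hpre s₄ h₄ k₄') h₃₄
  linarith

end Lists
end TwoWay

namespace TwoWay

/-! ### The structure of optimal trees -/

section Structure
open Classical

variable {I : Instance} {W : Fin I.n → ℝ}

theorem Test.sat_eq {g q : Fin I.n} : (Test.eq g).Sat I q ↔ q = g :=
  I.query_injective.eq_iff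

theorem wsum_singleton {n : ℕ} (W : Fin n → ℝ) (q : Fin n) : wsum W {q} = W q := by simp [wsum]

/-- The queries that leave a path at the test `u` are of one kind with respect to `x`, if `x`
separates two queries that stay on the path, or if `u` is an equality test. -/
theorem exists_kind (u x : Test I.n) (b : Bool) (R : Finset (Fin I.n))
    (h : (∃ g, u = .eq g ∧ b = false) ∨
      ∃ q₁ q₂, (u.Sat I q₁ ↔ b = true) ∧ (u.Sat I q₂ ↔ b = true) ∧ x.Sat I q₁ ∧ ¬ x.Sat I q₂) :
    ∃ c : Bool, ∀ q ∈ u.side I (!b) R, (x.Sat I q ↔ c = true) := by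
  have hsingle : ∀ g, u = .eq g → b = false →
      ∃ c : Bool, ∀ q ∈ u.side I (!b) R, (x.Sat I q ↔ c = true) := by
    rintro g rfl rfl
    refine ⟨decide (x.Sat I g), fun q hq => ?_⟩
    have := (Test.mem_side.1 hq).2
    rw [Test.sat_eq] at this
    simp only [Bool.not_false, iff_true] at this
    rw [this, decide_eq_true_iff]
  rcases h with ⟨g, h1, h2⟩ | ⟨q₁, q₂, h1, h2, h3, h4⟩
  · exact hsingle g h1 h2
  cases u with
  | eq g =>
    cases b with
    | false => exact hsingle g rfl rfl
    | true =>
      rw [Test.sat_eq] at h1 h2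
      have e1 : q₁ = g := by simpa using h1
      have e2 : q₂ = g := by simpa using h2
      rw [e1] at h3; rw [e2] at h4
      exact absurd h3 h4
  | lt k =>
    cases x with
    | eq g =>
      refine ⟨false, fun q hq => ?_⟩
      have h5 := (Test.mem_side.1 hq).2
      rw [Test.sat_eq] at h3 ⊢
      subst h3
      simp only [Bool.false_eq_true, iff_false]
      rintro rfl
      have := h1.symm.trans h5
      cases b <;> simp at this
    | lt k' =>
      simp only [Test.Sat] at h1 h2 h3 h4
      cases b with
      | false =>
        refine ⟨true, fun q hq => ?_⟩
        have h5 := (Test.mem_side.1 hq).2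
        simp only [Test.Sat, Bool.not_false, iff_true, Bool.false_eq_true, iff_false] at *
        linarith
      | true =>
        refine ⟨false, fun q hq => ?_⟩
        have h5 := (Test.mem_side.1 hq).2
        simp only [Test.Sat, Bool.not_true, iff_true, Bool.false_eq_true, iff_false] at *
        linarith

/-- The kind, with respect to `x`, of a set of queries of one kind. -/
noncomputable def kind (I : Instance) (x : Test I.n) (s : Test I.n × Finset (Fin I.n)) : Bool :=
  decide (∀ q ∈ s.2, x.Sat I q)

/-- The weight of the queries that leave a path at a node. -/
def offW (I : Instance) (W : Fin I.n → ℝ) (s : Test I.n × Finset (Fin I.n)) : ℝ := wsum W s.2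

/-- The kinds and the weights along a path. -/
noncomputable def kinds (I : Instance) (W : Fin I.n → ℝ) (x : Test I.n)
    (ℓ : List (Test I.n × Finset (Fin I.n))) : List (Bool × ℝ) := kw (kind I x) (offW I W) ℓ

/-- All items on the list are of one kind. -/
def Pure (I : Instance) (x : Test I.n) (ℓ : List (Test I.n × Finset (Fin I.n))) : Prop :=
  ∀ s ∈ ℓ, s.2.Nonempty ∧ ∃ c : Bool, ∀ q ∈ s.2, (x.Sat I q ↔ c = true)

theorem kind_eq {x : Test I.n} {s : Test I.n × Finset (Fin I.n)}
    (h : ∃ c : Bool, ∀ q ∈ s.2, (x.Sat I q ↔ c = true)) {q : Fin I.n} (hq : q ∈ s.2) :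
    x.Sat I q ↔ kind I x s = true := by
  obtain ⟨c, hc⟩ := h
  rw [kind, decide_eq_true_iff]
  refine ⟨fun h r hr => ?_, fun h => h q hq⟩
  rw [hc r hr, ← hc q hq]; exact h

theorem Pure.typed {x : Test I.n} {ℓ : List (Test I.n × Finset (Fin I.n))} (h : Pure I x ℓ) :
    Typed I W x ℓ (kinds I W x ℓ) := by
  rw [Typed, kinds, kw, List.forall₂_map_right_iff]
  rw [List.forall₂_same]
  exact fun s hs => ⟨fun q hq => kind_eq (h s hs).2 hq, rfl⟩

theorem Desc.off_nonempty (hW : ∀ q, 0 < W q) {T E : Tree I.n I.p} {R RE ℓ}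
    (h : Desc I T R ℓ E RE) (ho : T.OptOn I W R) (hR : R.Nonempty) : ∀ s ∈ ℓ, s.2.Nonempty := by
  induction h with
  | nil => simp
  | cons b u y z R ℓ E RE h ih =>
    intro s hs
    rcases List.mem_cons.1 hs with rfl | hs
    · exact ho.side_nonempty hW hR _
    · exact ih (ho.kid b) (ho.side_nonempty hW hR _) s hs

/-- The tests on the path of `q` send `g` the same way. -/
theorem Desc.agree {T E : Tree I.n I.p} {R RE ℓ} (h : Desc I T R ℓ E RE) {q g : Fin I.n}
    (hq : q ∈ RE) (hg : g ∈ RE) : ∀ s ∈ ℓ, (s.1.Sat I g ↔ s.1.Sat I q) := by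
  induction h with
  | nil => simp
  | cons b u y z R ℓ E RE h ih =>
    intro s hs
    rcases List.mem_cons.1 hs with rfl | hs
    · rw [(Test.mem_side.1 (h.subset hq)).2, (Test.mem_side.1 (h.subset hg)).2]
    · exact ih hq hg s hs

theorem Desc.pure (hW : ∀ q, 0 < W q) {x : Test I.n} {T E : Tree I.n I.p} {R RE ℓ}
    (h : Desc I T R ℓ E RE) (ho : T.OptOn I W R) {q : Fin I.n} (hq : q ∈ RE)
    (hx : ∀ s ∈ ℓ, (∃ g, s.1 = .eq g ∧ q ≠ g) ∨ ∃ q₁ q₂, (s.1.Sat I q₁ ↔ s.1.Sat I q) ∧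
      (s.1.Sat I q₂ ↔ s.1.Sat I q) ∧ x.Sat I q₁ ∧ ¬ x.Sat I q₂) : Pure I x ℓ := by
  intro s hs
  refine ⟨h.off_nonempty hW ho ⟨q, h.subset hq⟩ s hs, ?_⟩
  induction h with
  | nil => simp at hs
  | cons b u y z R ℓ E RE h ih =>
    rcases List.mem_cons.1 hs with rfl | hs
    · have hqu := (Test.mem_side.1 (h.subset hq)).2
      refine exists_kind u x b R ?_
      rcases hx _ hs with ⟨g, h1, h2⟩ | ⟨q₁, q₂, h1, h2, h3⟩
      · refine .inl ⟨g, h1, ?_⟩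
        rw [show u = .eq g from h1, Test.sat_eq] at hqu
        cases b
        · rfl
        · exact absurd (hqu.2 rfl) h2
      · exact .inr ⟨q₁, q₂, h1.trans hqu, h2.trans hqu, h3⟩
    · exact ih (ho.kid b) hq (fun s hs => hx s (List.mem_cons_of_mem _ hs)) hs

/-- In an optimal tree, the test `x` at the end of the path has queries on both sides, so it
separates two queries that stay on the path throughout. `exists_kind` then applies to every earlier
test. -/
theorem Desc.pure_of_node (hW : ∀ q, 0 < W q) {x : Test I.n} {T y z : Tree I.n I.p} {R RE ℓ}
    (h : Desc I T R ℓ (.node x y z) RE) (ho : T.OptOn I W R) (hR : RE.Nonempty) :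
    Pure I x ℓ := by
  have ho' := h.opt ho
  obtain ⟨q₁, h1⟩ := ho'.side_nonempty hW hR true
  obtain ⟨q₂, h2⟩ := ho'.side_nonempty hW hR false
  rw [Test.mem_side] at h1 h2
  obtain ⟨q, hq⟩ := hR
  refine h.pure hW ho hq fun s hs => .inr ⟨q₁, q₂, h.agree hq h1.1 s hs, h.agree hq h2.1 s hs, ?_⟩
  simpa using And.intro h1.2 h2.2

/-- The weights of the queries that leave the path of `q` decrease, once they are below the weight
of `q`. -/
theorem Desc.decreasing (hW : ∀ q, 0 < W q) {T E : Tree I.n I.p} {R RE s ℓ}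
    (h : Desc I T R (s :: ℓ) E RE) (ho : T.OptOn I W R) {q : Fin I.n} (hq : q ∈ RE)
    (hs : offW I W s < W q) :
    (s :: ℓ).Pairwise (fun r r' => offW I W r' ≤ offW I W r) ∧ ∀ r ∈ ℓ, offW I W r < W q := by
  have hW' : ∀ q, 0 ≤ W q := fun q => (hW q).le
  induction ℓ generalizing T R s with
  | nil => simp
  | cons s' ℓ ih =>
    cases h with
    | cons b u y z _ _ _ _ h =>
    have hd : Desc I (.node u y z) R [(u, u.side I (!b) R)] (kid b y z) (u.side I b R) :=
      .cons b u y z R _ _ _ (.nil _ _)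
    have hqR := h.subset hq
    generalize hT₁ : kid b y z = T₁ at h hd
    have ho₁ := ho.kid b
    rw [hT₁] at ho₁
    have hle : offW I W s' ≤ offW I W (u, u.side I (!b) R) := by
      cases h with
      | cons b' x y' z' _ _ _ _ h =>
      have hp := hd.pure_of_node hW ho ⟨q, hqR⟩
      -- The test of the second node is tried above the first. The second node is then saved for its
      -- whole set, so the inequality reduces to this: the side of `x` opposite to the first leaving
      -- set weighs at most that set.
      have h1 := hd.cut hW' ho₁.1.1.1 (hp.typed (W := W)) ho
      have h2 := Tree.wsum_le_saving_node hW' x y' z' (u.side I b R)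
      have h3 := x.wsum_side true (u.side I b R) W
      rw [Bool.not_true] at h3
      set c := kind I x (u, u.side I (!b) R)
      have h4 : wsum W (x.side I (!c) (u.side I b R)) ≤ offW I W (u, u.side I (!b) R) := by
        have e : kinds I W x [(u, u.side I (!b) R)] = [(c, offW I W (u, u.side I (!b) R))] := rfl
        rw [e, sep, sep, tot, tot, tot, tot, tot] at h1
        cases hc : c <;> simp [hc] at h1 ⊢ <;> linarith
      -- If `c = b'`, the bounded side is the one that leaves at the second node. Otherwise it
      -- contains `q`, which is heavier than the first leaving set.
      by_cases hc : c = b'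
      · rwa [hc] at h4
      · have hc' : (!c) = b' := by cases h : c <;> cases h' : b' <;> simp_all
        rw [hc'] at h4
        have := le_wsum hW' (h.subset hq)
        linarith
    obtain ⟨h1, h2⟩ := ih h ho₁ (hle.trans_lt hs)
    refine ⟨List.pairwise_cons.2 ⟨fun r hr => ?_, h1⟩, fun r hr => ?_⟩
    · rcases List.mem_cons.1 hr with rfl | hr
      · exact hle
      · exact ((List.pairwise_cons.1 h1).1 r hr).trans hle
    · rcases List.mem_cons.1 hr with rfl | hr
      · exact hle.trans_lt hs
      · exact h2 r hr

theorem Desc.off_eq {T E : Tree I.n I.p} {R RE ℓ} {h : Fin I.n} {S : Finset (Fin I.n)}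
    (hd : Desc I T R ((.eq h, S) :: ℓ) E RE) (hne : S.Nonempty) {q : Fin I.n} (hq : q ∈ RE)
    (hqh : q ≠ h) : S = {h} ∧ h ∈ R := by
  cases hd with
  | cons b u y z _ _ _ _ hd =>
  have h1 := (Test.mem_side.1 (hd.subset hq)).2
  rw [Test.sat_eq] at h1
  cases b with
  | true => exact absurd (h1.2 rfl) hqh
  | false =>
    obtain ⟨r, hr⟩ := hne
    have key : ∀ r ∈ (Test.eq h).side I (!false) R, r = h ∧ r ∈ R := by
      intro r hr
      rw [Test.mem_side, Test.sat_eq] at hr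
      exact ⟨hr.2.2 rfl, hr.1⟩
    obtain ⟨rfl, hrR⟩ := key r hr
    refine ⟨Finset.eq_singleton_iff_unique_mem.2 ⟨hr, fun r' hr' => (key r' hr').1⟩, hrR⟩

/-- After an equality test on `h`, the tests on the path of a heavier query do not separate it from
`h`. -/
theorem Desc.same (hW : ∀ q, 0 < W q) {T y z : Tree I.n I.p} {x : Test I.n} {R RE ℓ} {h : Fin I.n}
    {S : Finset (Fin I.n)} (hd : Desc I T R ((.eq h, S) :: ℓ) (.node x y z) RE)
    (ho : T.OptOn I W R) {q : Fin I.n} (hq : q ∈ RE) (hhq : W h < W q) :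
    x.Sat I h ↔ x.Sat I q := by
  have hW' : ∀ q, 0 ≤ W q := fun q => (hW q).le
  have hne := hd.off_nonempty hW ho ⟨q, hd.subset hq⟩
  obtain ⟨rfl, hR⟩ := hd.off_eq (hne _ List.mem_cons_self) hq (by rintro rfl; exact lt_irrefl _ hhq)
  have hoff : offW I W (.eq h, {h}) = W h := wsum_singleton W h
  obtain ⟨_, h2⟩ := hd.decreasing hW ho hq (by rw [hoff]; exact hhq)
  have hp := hd.pure_of_node hW ho ⟨q, hq⟩
  have h3 := hd.cut hW' (hd.opt ho).1.1.1 (hp.typed (W := W)) ho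
  have h4 := Tree.wsum_le_saving_node hW' x y z RE
  have h5 := x.wsum_side true RE W
  rw [Bool.not_true] at h5
  by_contra hcon
  set o : Bool := decide (x.Sat I q) with ho'
  have hk : kind I x (.eq h, {h}) = !o := by
    have := kind_eq (hp _ List.mem_cons_self).2 (q := h) (by simp)
    by_cases h6 : x.Sat I q <;> simp_all
  set e : Bool → ℝ := fun c => wsum W (x.side I c RE) with he
  have hqe : W q ≤ e o := le_wsum hW' (Test.mem_side.2 ⟨hq, by simp [ho']⟩)
  -- If `x` separated `h` from `q`, the path would begin with an item of the kind opposite to `q`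
  -- and lighter than `q`. The weight at the final node cancels on both sides of the cut, and what
  -- remains contradicts this strict inequality.
  have h6 := tot_lt_sep (o := o) (ω := W q) (a := W h) (L := kinds I W x ℓ) (e := e) hhq ?_ hqe
    (fun c => wsum_nonneg hW' _)
  · have e1 : kinds I W x ((.eq h, {h}) :: ℓ) = (!o, W h) :: kinds I W x ℓ := by
      rw [kinds, kw_cons, hk, hoff]; rfl
    rw [e1, tot_zero true _ e, tot_zero false _ e] at h3
    have e2 : e true = wsum W (x.side I true RE) := rfl
    have e3 : e false = wsum W (x.side I false RE) := rfl
    linarith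
  · intro d hd'
    obtain ⟨s, hs, rfl⟩ := List.mem_map.1 hd'
    exact ⟨wsum_nonneg hW' _, (h2 s hs).le⟩

/-- The queries lighter than `q` that are the subject of equality tests on the path. -/
noncomputable def lights (I : Instance) (W : Fin I.n → ℝ) (q : Fin I.n)
    (ℓ : List (Test I.n × Finset (Fin I.n))) : Finset (Fin I.n) :=
  Finset.univ.filter fun g => W g < W q ∧ ∃ S, (Test.eq g, S) ∈ ℓ

theorem mem_lights {q g : Fin I.n} {ℓ : List (Test I.n × Finset (Fin I.n))} :
    g ∈ lights I W q ℓ ↔ W g < W q ∧ ∃ S, (Test.eq g, S) ∈ ℓ := by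
  simp [lights]

theorem Desc.tail_of_mem {T E : Tree I.n I.p} {R RE ℓ} (h : Desc I T R ℓ E RE) {s}
    (hs : s ∈ ℓ) : ∃ ℓ₁ ℓ₂ F RF, ℓ = ℓ₁ ++ s :: ℓ₂ ∧ Desc I T R ℓ₁ F RF ∧
      Desc I F RF (s :: ℓ₂) E RE := by
  obtain ⟨ℓ₁, ℓ₂, rfl⟩ := List.append_of_mem hs
  obtain ⟨F, RF, h1, h2⟩ := h.split
  exact ⟨ℓ₁, ℓ₂, F, RF, rfl, h1, h2⟩

/-- A test after the equality test on a lighter query `g` sends `g` and `q` the same way. -/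
theorem Desc.same_of_mem (hW : ∀ q, 0 < W q) {T E : Tree I.n I.p} {R RE ℓ} {g : Fin I.n}
    {S : Finset (Fin I.n)} (hd : Desc I T R ((.eq g, S) :: ℓ) E RE) (ho : T.OptOn I W R)
    {q : Fin I.n} (hq : q ∈ RE) (hgq : W g < W q) : ∀ s ∈ ℓ, (s.1.Sat I g ↔ s.1.Sat I q) := by
  intro s hs
  obtain ⟨ℓ₁, ℓ₂, rfl⟩ := List.append_of_mem hs
  obtain ⟨F, RF, h1, h2⟩ := Desc.split (ℓ := (.eq g, S) :: ℓ₁) (ℓ' := s :: ℓ₂) hd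
  have hq' := h2.subset hq
  cases h2 with
  | cons b u y z _ _ _ _ h2 => exact h1.same hW ho hq' hgq

/-- Before its own equality test, `g` shares the path with `q`, so all tests agree on the two; after
it, `Desc.same` applies. Thus only the test for `g` separates them. -/
theorem Desc.lights_spec (hW : ∀ q, 0 < W q) {T E : Tree I.n I.p} {R RE ℓ}
    (h : Desc I T R ℓ E RE) (ho : T.OptOn I W R) {q g : Fin I.n} (hq : q ∈ RE)
    (hg : g ∈ lights I W q ℓ) : g ∈ R ∧ (Test.eq g, ({g} : Finset (Fin I.n))) ∈ ℓ ∧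
      (∀ s ∈ ℓ, s.1 ≠ .eq g → (s.1.Sat I g ↔ s.1.Sat I q)) ∧
      ∀ x y z, E = .node x y z → (x.Sat I g ↔ x.Sat I q) := by
  obtain ⟨hgq, S, hS⟩ := mem_lights.1 hg
  obtain ⟨ℓ₁, ℓ₂, F, RF, rfl, h1, h2⟩ := h.tail_of_mem hS
  have hne := h.off_nonempty hW ho ⟨q, h.subset hq⟩ _ hS
  obtain ⟨rfl, hgF⟩ := h2.off_eq hne hq (by rintro rfl; exact lt_irrefl _ hgq)
  refine ⟨h1.subset hgF, hS, fun s hs hsg => ?_, ?_⟩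
  · rcases List.mem_append.1 hs with hs | hs
    · exact h1.agree (h2.subset hq) hgF s hs
    · rcases List.mem_cons.1 hs with rfl | hs
      · exact absurd rfl hsg
      · exact h2.same_of_mem hW (h1.opt ho) hq hgq s hs
  · rintro x y z rfl
    exact h2.same hW (h1.opt ho) hq hgq

end Structure
end TwoWay

namespace TwoWay

/-! ### At most eight equality tests on lighter queries along a path -/

section Bound
open Classical

variable {I : Instance} {W : Fin I.n → ℝ}

theorem Desc.allowed {T E : Tree I.n I.p} {R RE ℓ} (h : Desc I T R ℓ E RE)
    (hT : T.TestsAllowed I) : ∀ s ∈ ℓ, s.1.Allowed I := by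
  induction h with
  | nil => simp
  | cons b u y z R ℓ E RE h ih =>
    intro s hs
    obtain ⟨h1, h2, h3⟩ := hT
    rcases List.mem_cons.1 hs with rfl | hs
    · exact h1
    · exact ih (by cases b <;> simpa [kid]) s hs

theorem kind_singleton (x : Test I.n) (u : Test I.n) (g : Fin I.n) :
    kind I x (u, {g}) = decide (x.Sat I g) := by simp [kind]

theorem exists_increasing {S : Finset (Fin I.n)} (h : 5 ≤ S.card) :
    ∃ g : Fin 5 → Fin I.n, StrictMono (fun i => I.query (g i)) ∧ ∀ i, g i ∈ S := by
  obtain ⟨S', h1, h2⟩ := Finset.exists_subset_card_eq h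
  have h3 : (S'.image I.query).card = 5 := by
    rw [Finset.card_image_of_injective _ I.query_injective, h2]
  have h4 : ∀ i, ∃ g ∈ S', I.query g = (S'.image I.query).orderEmbOfFin h3 i := fun i =>
    Finset.mem_image.1 (Finset.orderEmbOfFin_mem _ h3 i)
  choose g hg hg' using h4
  refine ⟨g, fun i j hij => ?_, fun i => h1 (hg i)⟩
  simp only [hg']
  exact ((S'.image I.query).orderEmbOfFin h3).strictMono hij

/-- Every tail of the path ends a path in an optimal subtree, so the cut inequality holds for it.
The saving at the end is nonnegative and is dropped. -/
theorem Desc.tight (hW : ∀ q, 0 < W q) {T E : Tree I.n I.p} {R RE ℓ} (h : Desc I T R ℓ E RE)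
    (ho : T.OptOn I W R) {x : Test I.n} (hx : x.Allowed I) (hp : Pure I x ℓ) :
    ∀ ℓ₁ ℓ₂, ℓ = ℓ₁ ++ ℓ₂ →
      Tight (kw (kind I x) (offW I W) ℓ₂) (fun c => wsum W (x.side I c RE)) := by
  have hW' : ∀ q, 0 ≤ W q := fun q => (hW q).le
  rintro ℓ₁ ℓ₂ rfl
  obtain ⟨F, RF, h1, h2⟩ := h.split
  have hp' : Pure I x ℓ₂ := fun s hs => hp s (List.mem_append_right _ hs)
  have h3 := h2.cut hW' hx (hp'.typed (W := W)) (h1.opt ho)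
  have h4 := E.saving_nonneg hW' x RE
  rw [Tight]
  rw [kinds] at h3
  linarith

/-- The path starts with an equality test on a query lighter than `q`, so the leaving weights
decrease from the very first item. Nine such tests leave five of the tested queries on one side of
`q`, and two thresholds among these five meet the hypotheses of `not_tight_cuts`. -/
theorem Desc.lights_head (hW : ∀ q, 0 < W q) {T E : Tree I.n I.p} {R RE ℓ S} {g₁ q : Fin I.n}
    (h : Desc I T R ((.eq g₁, S) :: ℓ) E RE) (ho : T.OptOn I W R) (hq : q ∈ RE)
    (hg : W g₁ < W q) : (lights I W q ((.eq g₁, S) :: ℓ)).card ≤ 8 := by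
  have hW' : ∀ q, 0 ≤ W q := fun q => (hW q).le
  by_contra hcard
  push Not at hcard
  set ℓ' := (Test.eq g₁, S) :: ℓ with hℓ'
  set H := lights I W q ℓ' with hH
  have hspec := fun g (hg : g ∈ H) => h.lights_spec hW ho hq hg
  have hgq : ∀ g ∈ H, W g < W q := fun g hg => (mem_lights.1 hg).1
  have hg₁ : g₁ ∈ H := mem_lights.2 ⟨hg, S, List.mem_cons_self⟩
  have hS : S = {g₁} := (h.off_eq (h.off_nonempty hW ho ⟨q, h.subset hq⟩ _ List.mem_cons_self) hq
    (by rintro rfl; exact lt_irrefl _ hg)).1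
  have hoff : ∀ g, offW I W (.eq g, {g}) = W g := fun g => wsum_singleton W g
  obtain ⟨hdec, hlt⟩ := h.decreasing hW ho hq (by rw [hS, hoff]; exact hg)
  have hℓ : ∀ s ∈ ℓ', 0 ≤ offW I W s ∧ offW I W s < W q := by
    intro s hs
    refine ⟨wsum_nonneg hW' _, ?_⟩
    rcases List.mem_cons.1 hs with rfl | hs
    · rw [hS, hoff]; exact hg
    · exact hlt s hs
  -- The path contains no equality test on `q`: such a test would separate `g₁` from `q`, which only
  -- the test for `g₁` may do.
  have heq : ∀ s ∈ ℓ', ∀ g, s.1 = .eq g → q ≠ g := by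
    rintro s hs g hsg rfl
    have hne : q ≠ g₁ := by rintro rfl; exact lt_irrefl _ hg
    have := (hspec g₁ hg₁).2.2.1 s hs (by rw [hsg]; intro h; exact hne (Test.eq.inj h))
    rw [hsg, Test.sat_eq, Test.sat_eq] at this
    exact hne (this.2 rfl).symm
  -- The comparisons on the path do not separate `q` from the members of `H`. Hence a threshold
  -- between two of these queries splits queries that agree on every comparison, and all leaving
  -- sets are pure.
  have hcut : ∀ k ∈ H, ∀ q₁ q₂, (q₁ = q ∨ q₁ ∈ H) → (q₂ = q ∨ q₂ ∈ H) →
      I.query q₁ < I.query k → I.query k ≤ I.query q₂ → (Test.lt k).Allowed I ∧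
      Pure I (.lt k) ℓ' := by
    intro k hk q₁ q₂ h1 h2 h3 h4
    have hkK := h.allowed ho.1.1 _ (hspec k hk).2.1
    refine ⟨⟨hkK, ⟨q₁, h3⟩, ⟨k, le_rfl⟩⟩, h.pure hW ho hq fun s hs => ?_⟩
    rcases hs1 : s.1 with k' | g
    · have key : ∀ r, (r = q ∨ r ∈ H) → ((Test.lt k').Sat I r ↔ (Test.lt k').Sat I q) := by
        rintro r (rfl | hr)
        · rfl
        · have := (hspec r hr).2.2.1 s hs (by rw [hs1]; simp)
          rwa [hs1] at this
      exact .inr ⟨q₁, q₂, key _ h1, key _ h2, h3, not_lt.2 h4⟩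
    · exact .inl ⟨g, rfl, heq s hs g hs1⟩
  have hqne : ∀ g ∈ H, I.query g ≠ I.query q := fun g hg h =>
    (hgq g hg).ne (by rw [I.query_injective h])
  have hmem : ∀ g ∈ H, (Test.eq g, ({g} : Finset (Fin I.n))) ∈ ℓ' := fun g hg => (hspec g hg).2.1
  have hitem : ∀ g g' : Fin I.n, g ≠ g' →
      (Test.eq g, ({g} : Finset (Fin I.n))) ≠ (Test.eq g', {g'}) := by
    intro g g' h h'
    exact h (Test.eq.inj (Prod.mk.inj h').1)
  have hown : ∀ (x : Test I.n), W q ≤ wsum W (x.side I (decide (x.Sat I q)) RE) := fun x =>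
    le_wsum hW' (Test.mem_side.2 ⟨hq, by simp⟩)
  -- two cuts at the queries `A` and `B`
  have main : ∀ A ∈ H, ∀ B ∈ H, ∀ s₁ ∈ H, ∀ s₂ ∈ H, ∀ s₃ ∈ H, ∀ s₄ ∈ H, ∀ s₅ ∈ H,
      (∃ q₁ q₂, (q₁ = q ∨ q₁ ∈ H) ∧ (q₂ = q ∨ q₂ ∈ H) ∧
        I.query q₁ < I.query A ∧ I.query A ≤ I.query q₂) →
      (∃ q₁ q₂, (q₁ = q ∨ q₁ ∈ H) ∧ (q₂ = q ∨ q₂ ∈ H) ∧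
        I.query q₁ < I.query B ∧ I.query B ≤ I.query q₂) →
      s₁ ≠ s₂ → s₃ ≠ s₄ →
      ¬ ((Test.lt A).Sat I s₁ ↔ (Test.lt A).Sat I q) →
      ¬ ((Test.lt A).Sat I s₂ ↔ (Test.lt A).Sat I q) →
      ((Test.lt A).Sat I s₃ ↔ (Test.lt A).Sat I q) →
      ((Test.lt A).Sat I s₄ ↔ (Test.lt A).Sat I q) →
      ¬ ((Test.lt B).Sat I s₃ ↔ (Test.lt B).Sat I q) →
      ¬ ((Test.lt B).Sat I s₄ ↔ (Test.lt B).Sat I q) →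
      ((Test.lt B).Sat I s₅ ↔ (Test.lt B).Sat I q) → False := by
    intro A hA B hB s₁ h1 s₂ h2 s₃ h3 s₄ h4 s₅ h5 hA' hB' h12 h34 k1 k2 k3 k4 k3' k4' k5'
    obtain ⟨a1, a2, a3, a4, a5, a6⟩ := hA'
    obtain ⟨b1, b2, b3, b4, b5, b6⟩ := hB'
    obtain ⟨alA, puA⟩ := hcut A hA a1 a2 a3 a4 a5 a6
    obtain ⟨alB, puB⟩ := hcut B hB b1 b2 b3 b4 b5 b6
    have hopp : ∀ (x : Test I.n) (g : Fin I.n), ¬ (x.Sat I g ↔ x.Sat I q) →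
        kind I x (.eq g, {g}) = !(decide (x.Sat I q)) := by
      intro x g hg
      rw [kind_singleton]
      by_cases h : x.Sat I g <;> by_cases h' : x.Sat I q <;> simp_all
    have hsam : ∀ (x : Test I.n) (g : Fin I.n), (x.Sat I g ↔ x.Sat I q) →
        kind I x (.eq g, {g}) = decide (x.Sat I q) := by
      intro x g hg
      rw [kind_singleton]
      simp [hg]
    exact not_tight_cuts (e := fun c => wsum W (Test.side I (.lt A) c RE))
      (e' := fun c => wsum W (Test.side I (.lt B) c RE)) (fun c => wsum_nonneg hW' _)
      (fun c => wsum_nonneg hW' _)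
      (hown (.lt A)) (hown (.lt B)) hℓ hdec (h.tight hW ho alA puA) (h.tight hW ho alB puB)
      (hmem s₁ h1) (hmem s₂ h2) (hmem s₃ h3) (hmem s₄ h4) (hmem s₅ h5) (hitem _ _ h12)
      (hitem _ _ h34) (hopp _ _ k1) (hopp _ _ k2) (hsam _ _ k3) (hsam _ _ k4) (hopp _ _ k3')
      (hopp _ _ k4') (hsam _ _ k5')
  have hsplit := Finset.card_filter_add_card_filter_not (s := H)
    (fun g => I.query g < I.query q)
  have hcases : 5 ≤ (H.filter fun g => I.query g < I.query q).card ∨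
      5 ≤ (H.filter fun g => ¬ I.query g < I.query q).card := by omega
  rcases hcases with h5 | h5
  · obtain ⟨g, hg1, hg2⟩ := exists_increasing h5
    have hg3 : ∀ i, g i ∈ H := fun i => (Finset.mem_filter.1 (hg2 i)).1
    have h4 : I.query (g 4) < I.query q := (Finset.mem_filter.1 (hg2 4)).2
    have i01 : I.query (g 0) < I.query (g 1) := hg1 (by decide)
    have i12 : I.query (g 1) < I.query (g 2) := hg1 (by decide)
    have i23 : I.query (g 2) < I.query (g 3) := hg1 (by decide)
    have i34 : I.query (g 3) < I.query (g 4) := hg1 (by decide)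
    have ne : ∀ i j, I.query (g i) < I.query (g j) → g i ≠ g j := fun i j h h' => by
      rw [h'] at h; exact lt_irrefl _ h
    -- The five queries lie below `q`. The threshold `g 2` cuts off `g 0` and `g 1`, while `g 2` and
    -- `g 3` stay with `q`. The threshold `g 4` cuts off `g 2` and `g 3`, while `g 4` stays, since
    -- `· < k` puts `k` on the no-side.
    refine main (g 2) (hg3 2) (g 4) (hg3 4) (g 0) (hg3 0) (g 1) (hg3 1) (g 2) (hg3 2) (g 3) (hg3 3)
      (g 4) (hg3 4) ⟨g 0, q, .inr (hg3 0), .inl rfl, by linarith, by linarith⟩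
      ⟨g 0, q, .inr (hg3 0), .inl rfl, by linarith, by linarith⟩ (ne _ _ i01) (ne _ _ i23)
      ?_ ?_ ?_ ?_ ?_ ?_ ?_ <;> simp only [Test.Sat]
    · intro h; have := h.1 (by linarith); linarith
    · intro h; have := h.1 (by linarith); linarith
    · constructor <;> intro h <;> linarith
    · constructor <;> intro h <;> linarith
    · intro h; have := h.1 (by linarith); linarith
    · intro h; have := h.1 (by linarith); linarith
    · constructor <;> intro h <;> linarith
  · obtain ⟨g, hg1, hg2⟩ := exists_increasing h5
    have hg3 : ∀ i, g i ∈ H := fun i => (Finset.mem_filter.1 (hg2 i)).1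
    have h4 : I.query q < I.query (g 0) := lt_of_le_of_ne
      (not_lt.1 (Finset.mem_filter.1 (hg2 0)).2) (hqne _ (hg3 0)).symm
    have i01 : I.query (g 0) < I.query (g 1) := hg1 (by decide)
    have i12 : I.query (g 1) < I.query (g 2) := hg1 (by decide)
    have i23 : I.query (g 2) < I.query (g 3) := hg1 (by decide)
    have i34 : I.query (g 3) < I.query (g 4) := hg1 (by decide)
    have ne : ∀ i j, I.query (g i) < I.query (g j) → g i ≠ g j := fun i j h h' => by
      rw [h'] at h; exact lt_irrefl _ h
    -- The mirrored choice: the threshold `g 3` cuts off `g 3` and `g 4`, and the threshold `g 1`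
    -- cuts off `g 1` and `g 2`, while `g 0` stays with `q`.
    refine main (g 3) (hg3 3) (g 1) (hg3 1) (g 3) (hg3 3) (g 4) (hg3 4) (g 1) (hg3 1) (g 2) (hg3 2)
      (g 0) (hg3 0) ⟨q, g 4, .inl rfl, .inr (hg3 4), by linarith, by linarith⟩
      ⟨q, g 4, .inl rfl, .inr (hg3 4), by linarith, by linarith⟩ (ne _ _ i34) (ne _ _ i12)
      ?_ ?_ ?_ ?_ ?_ ?_ ?_ <;> simp only [Test.Sat]
    · intro h; have := h.2 (by linarith); linarith
    · intro h; have := h.2 (by linarith); linarith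
    · constructor <;> intro h <;> linarith
    · constructor <;> intro h <;> linarith
    · intro h; have := h.2 (by linarith); linarith
    · intro h; have := h.2 (by linarith); linarith
    · constructor <;> intro h <;> linarith

/-- On the path of `q` in an optimal tree, at most eight equality tests are on lighter queries. -/
theorem Desc.card_lights_le (hW : ∀ q, 0 < W q) {T E : Tree I.n I.p} {R RE ℓ}
    (h : Desc I T R ℓ E RE) (ho : T.OptOn I W R) {q : Fin I.n} (hq : q ∈ RE) :
    (lights I W q ℓ).card ≤ 8 := by
  induction h with
  | nil => simp [lights]
  | cons b u y z R ℓ E RE h ih =>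
    by_cases hu : ∃ g, u = .eq g ∧ W g < W q
    · obtain ⟨g, rfl, hg⟩ := hu
      exact (Desc.cons b _ y z R ℓ E RE h).lights_head hW ho hq hg
    · push Not at hu
      refine (Finset.card_le_card fun g hg => ?_).trans (ih (ho.kid b) hq)
      rw [mem_lights] at hg ⊢
      obtain ⟨h1, S, h2⟩ := hg
      refine ⟨h1, S, (List.mem_cons.1 h2).resolve_left fun h3 => ?_⟩
      exact absurd h1 (not_lt.2 (hu g (Prod.mk.inj h3).1.symm))

/-- There are infinitely many trees, but the cost is a monotone function of the vector of depths. By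
Dickson's lemma every set of such vectors is partially well ordered, so its image in the reals is
well founded and has a least element. -/
theorem exists_optOn (hW : ∀ q, 0 ≤ W q) {R : Finset (Fin I.n)} (h : ∃ T : Tree I.n I.p, T.SolvesOn I R) :
    ∃ T : Tree I.n I.p, T.OptOn I W R := by
  set D : Set (Fin I.n → ℕ) := {d | ∃ T : Tree I.n I.p, T.SolvesOn I R ∧ d = fun q => T.depth I q}
  set f : (Fin I.n → ℕ) → ℝ := fun d => ∑ q ∈ R, W q * (d q : ℝ)
  have hf : Monotone f := fun d d' hd => Finset.sum_le_sum fun q _ =>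
    mul_le_mul_of_nonneg_left (Nat.cast_le.2 (hd q)) (hW q)
  have hD : D.IsPWO := Set.isPWO_of_wellQuasiOrderedLE D
  have hwf := (hD.image_of_monotone hf).isWF
  have hne : (f '' D).Nonempty := by
    obtain ⟨T, hT⟩ := h
    exact ⟨_, _, ⟨T, hT, rfl⟩, rfl⟩
  obtain ⟨d, ⟨T, hT, rfl⟩, hd⟩ := hwf.min_mem hne
  refine ⟨T, hT, fun T' hT' => ?_⟩
  have := hwf.min_le hne (Set.mem_image_of_mem f (show (fun q => T'.depth I q) ∈ D from
    ⟨T', hT', rfl⟩))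
  rw [← hd] at this
  exact this

end Bound
end TwoWay

namespace TwoWay

/-! ### The recurrence -/

section Recurrence
open Classical

/-- The position of a query in the order of the queries. -/
noncomputable def Instance.pos (I : Instance) (y : Fin I.n) : ℕ :=
  (Finset.univ.filter fun j => I.query j < I.query y).card

/-- The order by weight, ties being broken by the position in the input. -/
def Instance.lighter (I : Instance) (a b : Fin I.n) : Prop :=
  I.weight a < I.weight b ∨ I.weight a = I.weight b ∧ a < b

/-- The rank of a query in the order by weight, counted from one. -/
noncomputable def Instance.rk (I : Instance) (y : Fin I.n) : ℕ :=
  (Finset.univ.filter fun j => I.lighter j y).card + 1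

variable {I : Instance}

theorem card_lt_card_below {n : ℕ} {r : Fin n → Fin n → Prop} (hirr : ∀ a, ¬ r a a)
    (htr : ∀ a b c, r a b → r b c → r a c) {a b : Fin n} (h : r a b) :
    (Finset.univ.filter fun j => r j a).card < (Finset.univ.filter fun j => r j b).card := by
  refine Finset.card_lt_card ⟨fun j hj => ?_, fun hsub => ?_⟩
  · simp only [Finset.mem_filter, Finset.mem_univ, true_and] at hj ⊢
    exact htr _ _ _ hj h
  · have := hsub (show a ∈ _ by simpa using h)
    simp only [Finset.mem_filter, Finset.mem_univ, true_and] at this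
    exact hirr a this

theorem Instance.pos_lt {a b : Fin I.n} : I.pos a < I.pos b ↔ I.query a < I.query b := by
  have key : ∀ a b : Fin I.n, I.query a < I.query b → I.pos a < I.pos b := fun a b h =>
    card_lt_card_below (r := fun j a => I.query j < I.query a) (fun a => lt_irrefl _)
      (fun a b c => lt_trans) h
  refine ⟨fun h => ?_, key a b⟩
  rcases lt_trichotomy (I.query a) (I.query b) with h' | h' | h'
  · exact h'
  · rw [I.query_injective h'] at h; exact absurd h (lt_irrefl _)
  · exact absurd (key b a h') h.asymm

theorem Instance.pos_lt_n (y : Fin I.n) : I.pos y < I.n := by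
  have : (Finset.univ.filter fun j => I.query j < I.query y) ⊂ Finset.univ :=
    Finset.filter_ssubset.2 ⟨y, Finset.mem_univ _, lt_irrefl _⟩
  simpa [Instance.pos] using Finset.card_lt_card this

theorem Instance.lighter_trichotomy (a b : Fin I.n) : I.lighter a b ∨ a = b ∨ I.lighter b a := by
  rcases lt_trichotomy (I.weight a) (I.weight b) with h | h | h
  · exact .inl (.inl h)
  · rcases lt_trichotomy a b with h' | h' | h'
    · exact .inl (.inr ⟨h, h'⟩)
    · exact .inr (.inl h')
    · exact .inr (.inr (.inr ⟨h.symm, h'⟩))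
  · exact .inr (.inr (.inl h))

theorem Instance.rk_lt {a b : Fin I.n} : I.rk a < I.rk b ↔ I.lighter a b := by
  have key : ∀ a b : Fin I.n, I.lighter a b → I.rk a < I.rk b := fun a b h =>
    Nat.succ_lt_succ <| card_lt_card_below (r := I.lighter)
      (fun a h => by rcases h with h | ⟨_, h⟩ <;> exact lt_irrefl _ h)
      (fun a b c h h' => by
        rcases h with h | ⟨h, h1⟩ <;> rcases h' with h' | ⟨h', h2⟩
        · exact .inl (h.trans h')
        · exact .inl (h' ▸ h)
        · exact .inl (h ▸ h')
        · exact .inr ⟨h.trans h', h1.trans h2⟩) h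
  refine ⟨fun h => ?_, key a b⟩
  rcases I.lighter_trichotomy a b with h' | rfl | h'
  · exact h'
  · exact absurd h (lt_irrefl _)
  · exact absurd (key b a h') h.asymm

theorem Instance.rk_injective (I : Instance) : Function.Injective I.rk := by
  intro a b h
  rcases I.lighter_trichotomy a b with h' | h' | h'
  · exact absurd h (I.rk_lt.2 h').ne
  · exact h'
  · exact absurd h (I.rk_lt.2 h').ne'

theorem Instance.one_le_rk (y : Fin I.n) : 1 ≤ I.rk y := Nat.le_add_left _ _

theorem Instance.rk_le (y : Fin I.n) : I.rk y ≤ I.n := by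
  have : (Finset.univ.filter fun j => I.lighter j y) ⊂ Finset.univ :=
    Finset.filter_ssubset.2 ⟨y, Finset.mem_univ _, fun h => by
      rcases h with h | ⟨_, h⟩ <;> exact lt_irrefl _ h⟩
  have := Finset.card_lt_card this
  rw [Finset.card_univ, Fintype.card_fin] at this
  rw [Instance.rk]
  omega

theorem Instance.weight_le {a b : Fin I.n} (h : I.rk a < I.rk b) : I.weight a ≤ I.weight b := by
  rcases I.rk_lt.1 h with h | ⟨h, _⟩
  · exact h.le
  · exact h.le

/-- The position of `y` is between `l` and `r`. -/
def Instance.Within (I : Instance) (l r : ℕ) (y : Fin I.n) : Prop := l ≤ I.pos y ∧ I.pos y ≤ r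

/-- The highest rank below `b` of a query between `l` and `r` outside the class `c`; zero if there
is none. -/
noncomputable def Instance.nextRk (I : Instance) (l r : ℕ) (c : Fin I.p) (b : ℕ) : ℕ :=
  (Finset.univ.filter fun y => I.Within l r y ∧ y ∉ I.cls c ∧ I.rk y < b).sup I.rk

theorem Instance.le_nextRk {l r b : ℕ} {c : Fin I.p} {y : Fin I.n} (h1 : I.Within l r y)
    (h2 : y ∉ I.cls c) (h3 : I.rk y < b) : I.rk y ≤ I.nextRk l r c b :=
  Finset.le_sup (f := I.rk) (by simp [h1, h2, h3])

theorem Instance.exists_nextRk {l r b : ℕ} {c : Fin I.p} (h : I.nextRk l r c b ≠ 0) :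
    ∃ y, I.Within l r y ∧ y ∉ I.cls c ∧ I.rk y < b ∧ I.rk y = I.nextRk l r c b := by
  have hne : (Finset.univ.filter fun y => I.Within l r y ∧ y ∉ I.cls c ∧ I.rk y < b).Nonempty := by
    by_contra hne
    rw [Finset.not_nonempty_iff_eq_empty] at hne
    rw [Instance.nextRk, hne] at h
    exact h rfl
  obtain ⟨y, hy, hy'⟩ := Finset.exists_mem_eq_sup _ hne I.rk
  simp only [Finset.mem_filter, Finset.mem_univ, true_and] at hy
  exact ⟨y, hy.1, hy.2.1, hy.2.2, hy'.symm⟩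

theorem Instance.nextRk_eq {l r b : ℕ} {c : Fin I.p} {y : Fin I.n} (h1 : I.Within l r y)
    (h2 : y ∉ I.cls c) (h3 : I.rk y < b)
    (h4 : ∀ z, I.Within l r z → z ∉ I.cls c → I.rk z < b → I.rk z ≤ I.rk y) :
    I.nextRk l r c b = I.rk y := by
  refine le_antisymm (Finset.sup_le fun z hz => ?_) (I.le_nextRk h1 h2 h3)
  simp only [Finset.mem_filter, Finset.mem_univ, true_and] at hz
  exact h4 z hz.1 hz.2.1 hz.2.2

theorem Instance.nextRk_eq_zero {l r b : ℕ} {c : Fin I.p}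
    (h : ∀ z, I.Within l r z → I.rk z < b → z ∈ I.cls c) : I.nextRk l r c b = 0 := by
  by_contra h0
  obtain ⟨y, h1, h2, h3, _⟩ := I.exists_nextRk h0
  exact h2 (h y h1 h3)

theorem Instance.nextRk_le (l r : ℕ) (c : Fin I.p) (b : ℕ) : I.nextRk l r c b ≤ b := by
  by_cases h : I.nextRk l r c b = 0
  · rw [h]; exact Nat.zero_le _
  · obtain ⟨y, _, _, h3, h4⟩ := I.exists_nextRk h
    omega

/-- The rank of the `s`-th heaviest query outside `c`, lighter than `q`, between `l` and `r`. -/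
noncomputable def Instance.thr (I : Instance) (l r : ℕ) (c : Fin I.p) (q : Fin I.n) : ℕ → ℕ
  | 0 => I.rk q
  | s + 1 => I.nextRk l r c (I.thr l r c q s)

theorem Instance.thr_anti (l r : ℕ) (c : Fin I.p) (q : Fin I.n) : Antitone (I.thr l r c q) :=
  antitone_nat_of_succ_le fun _ => I.nextRk_le l r c _

theorem Instance.thr_le (l r : ℕ) (c : Fin I.p) (q : Fin I.n) (s : ℕ) :
    I.thr l r c q s ≤ I.rk q := I.thr_anti l r c q (Nat.zero_le s)

/-- The queries between `l` and `r` of rank below `t`. -/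
noncomputable def Instance.below (I : Instance) (l r t : ℕ) : Finset (Fin I.n) :=
  Finset.univ.filter fun y => I.Within l r y ∧ I.rk y < t

/-- The queries between `l` and `r` that are no heavier than `q`, without the `s` heaviest ones
that are lighter than `q` and outside `c`. -/
noncomputable def Instance.holed (I : Instance) (l r : ℕ) (c : Fin I.p) (q : Fin I.n) (s : ℕ) :
    Finset (Fin I.n) :=
  Finset.univ.filter fun y =>
    I.Within l r y ∧ I.rk y ≤ I.rk q ∧ (y ∈ I.cls c ∨ I.rk y < I.thr l r c q s)

theorem Instance.mem_below {l r t : ℕ} {y : Fin I.n} :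
    y ∈ I.below l r t ↔ I.Within l r y ∧ I.rk y < t := by simp [Instance.below]

theorem Instance.mem_holed {l r s : ℕ} {c : Fin I.p} {q y : Fin I.n} : y ∈ I.holed l r c q s ↔
    I.Within l r y ∧ I.rk y ≤ I.rk q ∧ (y ∈ I.cls c ∨ I.rk y < I.thr l r c q s) := by
  simp [Instance.holed]

/-- All queries between `l` and `r` with rank between that of the last hole and that of `q` are on
the side `[l', r']`. -/
def Instance.Keeps (I : Instance) (l r l' r' : ℕ) (c : Fin I.p) (q : Fin I.n) (s : ℕ) : Prop :=
  ∀ y, I.Within l r y → I.thr l r c q s ≤ I.rk y → I.rk y ≤ I.rk q → I.Within l' r' y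

/-- The holes all lie in the smaller interval, so the successive heaviest queries outside `c` are
the same there. -/
theorem Instance.Keeps.thr_eq {l r l' r' s : ℕ} {c : Fin I.p} {q : Fin I.n}
    (h : I.Keeps l r l' r' c q s) (hsub : ∀ y, I.Within l' r' y → I.Within l r y) :
    ∀ s' ≤ s, I.thr l' r' c q s' = I.thr l r c q s' := by
  intro s'
  induction s' with
  | zero => exact fun _ => rfl
  | succ s' ih =>
    intro hs
    rw [Instance.thr, Instance.thr, ih (by omega)]
    by_cases h0 : I.nextRk l r c (I.thr l r c q s') = 0
    · rw [h0]
      refine I.nextRk_eq_zero fun z hz hz' => ?_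
      by_contra hzc
      have h1 := I.le_nextRk (hsub z hz) hzc hz'
      have h2 := I.one_le_rk z
      omega
    · obtain ⟨y, h1, h2, h3, h4⟩ := I.exists_nextRk h0
      have h5 : I.Within l' r' y := by
        refine h y h1 ?_ (h3.le.trans (I.thr_le l r c q s'))
        rw [h4]
        exact I.thr_anti l r c q hs
      rw [← h4]
      refine I.nextRk_eq h5 h2 h3 fun z hz hzc hz' => ?_
      rw [h4]
      exact I.le_nextRk (hsub z hz) hzc hz'

theorem Instance.lt_sat {k y : Fin I.n} : (Test.lt k).Sat I y ↔ I.pos y < I.pos k := I.pos_lt.symm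

/-- No query left of `k` has a rank between the last threshold and that of `q`. So on that side
neither the holes nor the members of `c` above the threshold matter, and a plain rank bound
describes what is left. -/
theorem Instance.holed_split_right {l r s : ℕ} {c : Fin I.p} {q k : Fin I.n} (hlk : l < I.pos k)
    (hkr : I.pos k ≤ r) (h : I.Keeps l r (I.pos k) r c q s) :
    (Test.lt k).side I true (I.holed l r c q s) = I.below l (I.pos k - 1) (I.thr l r c q s) ∧
    (Test.lt k).side I false (I.holed l r c q s) = I.holed (I.pos k) r c q s := by
  have hthr := h.thr_eq (fun y hy => ⟨by have := hy.1; omega, hy.2⟩) s le_rfl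
  have hle := I.thr_le l r c q s
  constructor <;> ext y <;>
    simp only [Test.mem_side, I.lt_sat, I.mem_holed, I.mem_below, Instance.Within, iff_true,
      Bool.false_eq_true, iff_false, hthr]
  · constructor
    · rintro ⟨⟨h1, h2, h3⟩, h4⟩
      refine ⟨by omega, ?_⟩
      by_contra h5
      have := h y h1 (by omega) h2
      have := this.1
      omega
    · rintro ⟨h1, h2⟩
      exact ⟨⟨by omega, by omega, .inr h2⟩, by omega⟩
  · constructor
    · rintro ⟨⟨h1, h2, h3⟩, h4⟩
      exact ⟨by omega, h2, h3⟩
    · rintro ⟨h1, h2, h3⟩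
      exact ⟨⟨by omega, h2, h3⟩, by omega⟩

theorem Instance.holed_split_left {l r s : ℕ} {c : Fin I.p} {q k : Fin I.n} (hlk : l < I.pos k)
    (hkr : I.pos k ≤ r) (h : I.Keeps l r l (I.pos k - 1) c q s) :
    (Test.lt k).side I true (I.holed l r c q s) = I.holed l (I.pos k - 1) c q s ∧
    (Test.lt k).side I false (I.holed l r c q s) = I.below (I.pos k) r (I.thr l r c q s) := by
  have hthr := h.thr_eq (fun y hy => ⟨hy.1, by have := hy.2; omega⟩) s le_rfl
  have hle := I.thr_le l r c q s
  constructor <;> ext y <;>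
    simp only [Test.mem_side, I.lt_sat, I.mem_holed, I.mem_below, Instance.Within, iff_true,
      Bool.false_eq_true, iff_false, hthr]
  · constructor
    · rintro ⟨⟨h1, h2, h3⟩, h4⟩
      exact ⟨by omega, h2, h3⟩
    · rintro ⟨h1, h2, h3⟩
      exact ⟨⟨by omega, h2, h3⟩, by omega⟩
  · constructor
    · rintro ⟨⟨h1, h2, h3⟩, h4⟩
      refine ⟨by omega, ?_⟩
      by_contra h5
      have := h y h1 (by omega) h2
      have := this.2
      omega
    · rintro ⟨h1, h2⟩
      exact ⟨⟨by omega, by omega, .inr h2⟩, by omega⟩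

theorem Instance.holed_eq_top {l r : ℕ} {c : Fin I.p} {q : Fin I.n} :
    (Test.eq q).side I false (I.holed l r c q 0) = I.below l r (I.rk q) := by
  ext y
  simp only [Test.mem_side, Test.sat_eq, I.mem_holed, I.mem_below, Bool.false_eq_true, iff_false,
    Instance.thr]
  constructor
  · rintro ⟨⟨h1, h2, h3⟩, h4⟩
    exact ⟨h1, lt_of_le_of_ne h2 fun h => h4 (I.rk_injective h)⟩
  · rintro ⟨h1, h2⟩
    exact ⟨⟨h1, h2.le, .inr h2⟩, by rintro rfl; exact lt_irrefl _ h2⟩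

theorem Instance.holed_eq_next {l r s : ℕ} {c : Fin I.p} {q h : Fin I.n}
    (h1 : I.Within l r h) (h2 : h ∉ I.cls c) (h3 : I.rk h = I.thr l r c q (s + 1)) :
    (Test.eq h).side I false (I.holed l r c q s) = I.holed l r c q (s + 1) := by
  have hlt : I.rk h < I.thr l r c q s := by
    have : I.nextRk l r c (I.thr l r c q s) ≠ 0 := by
      have := I.one_le_rk h
      rw [Instance.thr] at h3
      omega
    obtain ⟨y, _, _, h6, h7⟩ := I.exists_nextRk this
    rw [Instance.thr] at h3
    omega
  ext y
  simp only [Test.mem_side, Test.sat_eq, I.mem_holed, Bool.false_eq_true, iff_false]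
  constructor
  · rintro ⟨⟨h4, h5, h6⟩, h7⟩
    refine ⟨h4, h5, ?_⟩
    rcases Classical.em (y ∈ I.cls c) with hy | hy
    · exact .inl hy
    · right
      have h8 := I.le_nextRk h4 hy (h6.resolve_left hy)
      rw [Instance.thr] at h3 ⊢
      rw [← h3] at h8 ⊢
      exact lt_of_le_of_ne h8 fun h => h7 (I.rk_injective h)
  · rintro ⟨h4, h5, h6⟩
    refine ⟨⟨h4, h5, h6.imp_right fun h => ?_⟩, ?_⟩
    · omega
    · rintro rfl
      rcases h6 with h6 | h6
      · exact h2 h6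
      · omega

/-- The subproblems of the recurrence: the sets `below l r t`, and the sets `holed l r c q s` where
`(c, q)` is the `e`-th pair of the list. -/
inductive Cell (m : ℕ) : Type
  | all (l r t : ℕ)
  | top (l r : ℕ) (e : Fin m) (s : ℕ)

variable {L : List (Fin I.p × Fin I.n)}

/-- The set of queries of a subproblem. -/
noncomputable def Cell.set (I : Instance) (L : List (Fin I.p × Fin I.n)) :
    Cell L.length → Finset (Fin I.n)
  | .all l r t => I.below l r t
  | .top l r e s => I.holed l r (L.get e).1 (L.get e).2 s

/-- The total weight of the queries of a subproblem. -/
noncomputable def Cell.weight (I : Instance) (L : List (Fin I.p × Fin I.n)) (σ : Cell L.length) : ℝ :=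
  wsum I.weight (σ.set I L)

/-- `e` is a pair whose query is the heaviest one of `below l r t`. -/
def IsTop (I : Instance) (L : List (Fin I.p × Fin I.n)) (l r t : ℕ) (e : Fin L.length) : Prop :=
  I.Within l r (L.get e).2 ∧ I.rk (L.get e).2 < t ∧
    ∀ y, I.Within l r y → I.rk y < t → I.rk y ≤ I.rk (L.get e).2

/-- The trees that the recurrence considers, with their costs. -/
inductive Der (I : Instance) (L : List (Fin I.p × Fin I.n)) (lab : Fin I.n → Fin I.p) :
    Cell L.length → Tree I.n I.p → ℝ → Prop
  | all (l r t e T v) (h : IsTop I L l r t e) (hT : Der I L lab (.top l r e 0) T v) :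
      Der I L lab (.all l r t) T v
  | leaf (l r e s) (h : I.thr l r (L.get e).1 (L.get e).2 (s + 1) = 0) :
      Der I L lab (.top l r e s) (.leaf (L.get e).1) 0
  | eqTop (l r e T v) (h : I.thr l r (L.get e).1 (L.get e).2 1 ≠ 0) (hk : (L.get e).2 ∈ I.keys)
      (hT : Der I L lab (.all l r (I.rk (L.get e).2)) T v) :
      Der I L lab (.top l r e 0) (.node (.eq (L.get e).2) (.leaf (L.get e).1) T)
        (Cell.weight I L (.top l r e 0) + v)
  | eqNext (l r e s h T v) (hs : s < 8) (h1 : I.Within l r h) (h2 : h ∉ I.cls (L.get e).1)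
      (h3 : I.rk h = I.thr l r (L.get e).1 (L.get e).2 (s + 1)) (hk : h ∈ I.keys)
      (hT : Der I L lab (.top l r e (s + 1)) T v) :
      Der I L lab (.top l r e s) (.node (.eq h) (.leaf (lab h)) T)
        (Cell.weight I L (.top l r e s) + v)
  | right (l r e s k T v T' v') (h : I.thr l r (L.get e).1 (L.get e).2 (s + 1) ≠ 0)
      (hk : k ∈ I.keys) (hlk : l < I.pos k) (hkr : I.pos k ≤ r)
      (hK : I.Keeps l r (I.pos k) r (L.get e).1 (L.get e).2 s)
      (hT : Der I L lab (.all l (I.pos k - 1) (I.thr l r (L.get e).1 (L.get e).2 s)) T v)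
      (hT' : Der I L lab (.top (I.pos k) r e s) T' v') :
      Der I L lab (.top l r e s) (.node (.lt k) T T') (Cell.weight I L (.top l r e s) + (v + v'))
  | left (l r e s k T v T' v') (h : I.thr l r (L.get e).1 (L.get e).2 (s + 1) ≠ 0)
      (hk : k ∈ I.keys) (hlk : l < I.pos k) (hkr : I.pos k ≤ r)
      (hK : I.Keeps l r l (I.pos k - 1) (L.get e).1 (L.get e).2 s)
      (hT : Der I L lab (.top l (I.pos k - 1) e s) T v)
      (hT' : Der I L lab (.all (I.pos k) r (I.thr l r (L.get e).1 (L.get e).2 s)) T' v') :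
      Der I L lab (.top l r e s) (.node (.lt k) T T') (Cell.weight I L (.top l r e s) + (v + v'))

/-- With no holes the threshold is the rank of `q`, so the set differs from the queries of smaller
rank only by `q`, which is kept as a member of its class. -/
theorem IsTop.set_eq (hL : ∀ j q, (j, q) ∈ L → q ∈ I.cls j) {l r t : ℕ} {e : Fin L.length}
    (h : IsTop I L l r t e) : I.below l r t = I.holed l r (L.get e).1 (L.get e).2 0 := by
  ext y
  simp only [I.mem_below, I.mem_holed, Instance.thr]
  constructor
  · rintro ⟨h1, h2⟩
    have h3 := h.2.2 y h1 h2
    refine ⟨h1, h3, ?_⟩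
    by_cases h4 : I.rk y < I.rk (L.get e).2
    · exact .inr h4
    · have : y = (L.get e).2 := I.rk_injective (by omega)
      rw [this]
      exact .inl (hL _ _ (List.get_mem L e))
  · rintro ⟨h1, h2, _⟩
    exact ⟨h1, h2.trans_lt h.2.1⟩

theorem Tree.wcost_leaf (W : Fin I.n → ℝ) (j : Fin I.p) (R : Finset (Fin I.n)) :
    (Tree.leaf j : Tree I.n I.p).wcost I W R = 0 := by simp [Tree.wcost, Tree.depth]

theorem Test.side_eq_true {g : Fin I.n} {R : Finset (Fin I.n)} {y : Fin I.n}
    (h : y ∈ (Test.eq g).side I true R) : y = g := by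
  rw [Test.mem_side, Test.sat_eq] at h
  exact h.2.2 rfl

theorem lt_allowed {k : Fin I.n} (hk : k ∈ I.keys) {l : ℕ} (h : l < I.pos k) :
    (Test.lt k).Allowed I := by
  refine ⟨hk, ?_, ⟨k, le_rfl⟩⟩
  by_contra hne
  push Not at hne
  have : I.pos k = 0 := by
    rw [Instance.pos, Finset.card_eq_zero]
    exact Finset.filter_eq_empty_iff.2 fun j _ => not_lt.2 (hne j)
  omega

/-- The trees that the recurrence considers are correct. -/
theorem Der.sound (hL : ∀ j q, (j, q) ∈ L → q ∈ I.cls j) {lab : Fin I.n → Fin I.p}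
    (hlab : ∀ y, y ∈ I.cls (lab y)) {σ : Cell L.length} {T : Tree I.n I.p} {v : ℝ}
    (h : Der I L lab σ T v) : T.SolvesOn I (σ.set I L) ∧ T.wcost I I.weight (σ.set I L) = v := by
  induction h with
  | all l r t e T v h hT ih =>
    rw [Cell.set, h.set_eq hL]
    exact ih
  | leaf l r e s h =>
    refine ⟨⟨trivial, fun y hy => ?_⟩, Tree.wcost_leaf _ _ _⟩
    rw [Cell.set, I.mem_holed] at hy
    rw [Tree.answer]
    by_contra hyc
    have h1 := I.le_nextRk hy.1 hyc (hy.2.2.resolve_left hyc)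
    rw [Instance.thr] at h
    have := I.one_le_rk y
    omega
  | eqTop l r e T v h hk hT ih =>
    have e1 : (Test.eq (L.get e).2).side I false (Cell.set I L (.top l r e 0)) =
      Cell.set I L (.all l r (I.rk (L.get e).2)) := I.holed_eq_top
    refine ⟨Tree.SolvesOn.node hk true ⟨trivial, fun y hy => ?_⟩ ?_, ?_⟩
    · rw [Test.side_eq_true hy]
      exact hL _ _ (List.get_mem L e)
    · rw [Bool.not_true, e1]
      exact ih.1
    · rw [Tree.wcost_node _ _ _ _ true, Bool.not_true, e1]
      simp only [kid, if_true, Bool.false_eq_true, if_false, Tree.wcost_leaf, ih.2, Cell.weight]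
      ring
  | eqNext l r e s h T v hs h1 h2 h3 hk hT ih =>
    have e1 : (Test.eq h).side I false (Cell.set I L (.top l r e s)) =
      Cell.set I L (.top l r e (s + 1)) := I.holed_eq_next h1 h2 h3
    refine ⟨Tree.SolvesOn.node hk true ⟨trivial, fun y hy => ?_⟩ ?_, ?_⟩
    · rw [Test.side_eq_true hy]
      exact hlab h
    · rw [Bool.not_true, e1]
      exact ih.1
    · rw [Tree.wcost_node _ _ _ _ true, Bool.not_true, e1]
      simp only [kid, if_true, Bool.false_eq_true, if_false, Tree.wcost_leaf, ih.2, Cell.weight]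
      ring
  | right l r e s k T v T' v' h hk hlk hkr hK hT hT' ih ih' =>
    obtain ⟨e1, e2⟩ := I.holed_split_right hlk hkr hK
    refine ⟨Tree.SolvesOn.node (lt_allowed hk hlk) true ?_ ?_, ?_⟩
    · rw [Cell.set, e1]; exact ih.1
    · rw [Bool.not_true, Cell.set, e2]; exact ih'.1
    · rw [Tree.wcost_node _ _ _ _ true, Bool.not_true, Cell.weight, Cell.set, e1, e2, ← ih.2,
        ← ih'.2, add_assoc]
      rfl
  | left l r e s k T v T' v' h hk hlk hkr hK hT hT' ih ih' =>
    obtain ⟨e1, e2⟩ := I.holed_split_left hlk hkr hK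
    refine ⟨Tree.SolvesOn.node (lt_allowed hk hlk) true ?_ ?_, ?_⟩
    · rw [Cell.set, e1]; exact ih.1
    · rw [Bool.not_true, Cell.set, e2]; exact ih'.1
    · rw [Tree.wcost_node _ _ _ _ true, Bool.not_true, Cell.weight, Cell.set, e1, e2, ← ih.2,
        ← ih'.2, add_assoc]
      rfl

/-- A potential that bounds the size of the trees of a subproblem. -/
noncomputable def Cell.potential (I : Instance) (L : List (Fin I.p × Fin I.n)) :
    Cell L.length → ℕ
  | .all l r t => (2 * (r - l) + 1) * (10 * I.n + 1) + t * 10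
  | .top l r e s => (2 * (r - l) + 1) * (10 * I.n + 1) + I.rk (L.get e).2 * 10 + (9 - s)

/-- The factor `2 * (r - l) + 1` loses one unit when an interval is split in two. With `a = 10 * n +
1`, this unit pays for the rank term of the part without `q`. -/
theorem potential_split {l r k a : ℕ} (h1 : l < k) (h2 : k ≤ r) :
    (2 * (k - 1 - l) + 1) * a + (2 * (r - k) + 1) * a + a = (2 * (r - l) + 1) * a := by
  obtain ⟨i, rfl⟩ := Nat.exists_eq_add_of_lt h1
  obtain ⟨j, rfl⟩ := Nat.exists_eq_add_of_le h2
  have e1 : l + i + 1 - 1 - l = i := by omega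
  have e2 : l + i + 1 + j - (l + i + 1) = j := by omega
  have e3 : l + i + 1 + j - l = i + 1 + j := by omega
  rw [e1, e2, e3]
  ring

/-- Every rule lowers the potential, and a split lowers its sum over both parts. An equality test
with its leaf takes four words, which accounts for the factor. -/
theorem Der.length_le {lab : Fin I.n → Fin I.p} {σ : Cell L.length} {T : Tree I.n I.p} {v : ℝ}
    (h : Der I L lab σ T v) : T.encode.length ≤ 4 * σ.potential I L := by
  induction h with
  | all l r t e T v h hT ih =>
    have := h.2.1
    simp only [Cell.potential] at ih ⊢
    omega
  | leaf l r e s h =>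
    have := I.one_le_rk (L.get e).2
    simp only [Cell.potential, Tree.encode, List.length_cons, List.length_nil]
    omega
  | eqTop l r e T v h hk hT ih =>
    simp only [Cell.potential, Tree.encode, List.length_append, List.length_cons,
      List.length_nil] at ih ⊢
    omega
  | eqNext l r e s h T v hs h1 h2 h3 hk hT ih =>
    simp only [Cell.potential, Tree.encode, List.length_append, List.length_cons,
      List.length_nil] at ih ⊢
    omega
  | right l r e s k T v T' v' h hk hlk hkr hK hT hT' ih ih' =>
    have h1 := potential_split (a := 10 * I.n + 1) hlk hkr
    have h2 := I.thr_le l r (L.get e).1 (L.get e).2 s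
    have h3 := I.rk_le (L.get e).2
    simp only [Cell.potential, Tree.encode, List.length_append, List.length_cons,
      List.length_nil] at ih ih' ⊢
    omega
  | left l r e s k T v T' v' h hk hlk hkr hK hT hT' ih ih' =>
    have h1 := potential_split (a := 10 * I.n + 1) hlk hkr
    have h2 := I.thr_le l r (L.get e).1 (L.get e).2 s
    have h3 := I.rk_le (L.get e).2
    simp only [Cell.potential, Tree.encode, List.length_append, List.length_cons,
      List.length_nil] at ih ih' ⊢
    omega

end Recurrence
end TwoWay

namespace TwoWay

/-! ### Equality tests and the class of a heavier query -/

section Redundant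
open Classical

variable {I : Instance} {W : Fin I.n → ℝ}

theorem exists_desc_leaf (T : Tree I.n I.p) {R : Finset (Fin I.n)} {q : Fin I.n} (hq : q ∈ R) :
    ∃ ℓ j RE, Desc I T R ℓ (.leaf j) RE ∧ q ∈ RE := by
  induction T generalizing R with
  | leaf j => exact ⟨[], j, R, .nil _ _, hq⟩
  | node u y z ihy ihz =>
    by_cases hu : u.Sat I q
    · obtain ⟨ℓ, j, RE, h1, h2⟩ := ihy (R := u.side I true R)
        (Test.mem_side.2 ⟨hq, by simpa using hu⟩)
      exact ⟨_, j, RE, .cons true u y z R ℓ _ RE h1, h2⟩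
    · obtain ⟨ℓ, j, RE, h1, h2⟩ := ihz (R := u.side I false R)
        (Test.mem_side.2 ⟨hq, by simpa using hu⟩)
      exact ⟨_, j, RE, .cons false u y z R ℓ _ RE h1, h2⟩

theorem Desc.depth_eq {T E : Tree I.n I.p} {R RE ℓ} (h : Desc I T R ℓ E RE) {q : Fin I.n}
    (hq : q ∈ RE) : T.depth I q = ℓ.length + E.depth I q := by
  induction h with
  | nil => simp
  | cons b u y z R ℓ E RE h ih =>
    rw [Tree.depth_node_of_mem (Test.mem_side.1 (h.subset hq)).2, ih hq, List.length_cons]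
    omega

theorem Desc.off_not_same {T E : Tree I.n I.p} {R RE ℓ} (h : Desc I T R ℓ E RE) {q : Fin I.n}
    (hq : q ∈ RE) : ∀ s ∈ ℓ, ∀ x ∈ s.2, ¬ (s.1.Sat I x ↔ s.1.Sat I q) := by
  induction h with
  | nil => simp
  | cons b u y z R ℓ E RE h ih =>
    intro s hs x hx
    rcases List.mem_cons.1 hs with rfl | hs
    · have h1 := (Test.mem_side.1 hx).2
      have h2 := (Test.mem_side.1 (h.subset hq)).2
      intro h3
      have := h1.symm.trans (h3.trans h2)
      cases b <;> simp at this
    · exact ih hq s hs x hx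

/-- The side of the threshold `t` on which a test on the path of `q` sends other queries. -/
noncomputable def leftOf (I : Instance) (q : Fin I.n) (t : ℝ)
    (s : Test I.n × Finset (Fin I.n)) : Bool :=
  match s.1 with
  | .lt k => decide (I.query k ≤ I.query q)
  | .eq g => decide (I.query g < t)

/-- The hypothesis `hk` says that `k` lies between the comparisons that enclose `q` from both sides.
So the queries sent off by a comparison are all beyond `k` in its direction, and an equality test
sends off only its own key. -/
theorem Desc.typed_leftOf {T E : Tree I.n I.p} {R RE ℓ} (h : Desc I T R ℓ E RE) {q k : Fin I.n}
    (hq : q ∈ RE) (hne : ∀ s ∈ ℓ, ∀ g, s.1 = .eq g → g ≠ q)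
    (hk : ∀ s ∈ ℓ, ∀ k', s.1 = .lt k' → (I.query k' ≤ I.query q → I.query k' ≤ I.query k) ∧
      (I.query q < I.query k' → I.query k ≤ I.query k')) :
    Typed I W (.lt k) ℓ (kw (leftOf I q (I.query k)) (offW I W) ℓ) := by
  rw [Typed, kw, List.forall₂_map_right_iff, List.forall₂_same]
  intro s hs
  refine ⟨fun x hx => ?_, rfl⟩
  have h1 := h.off_not_same hq s hs x hx
  rw [leftOf]
  rcases hs1 : s.1 with k' | g
  · rw [hs1] at h1
    obtain ⟨h2, h3⟩ := hk s hs k' hs1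
    simp only [Test.Sat, decide_eq_true_iff] at h1 ⊢
    by_cases h4 : I.query k' ≤ I.query q
    · have h5 := h2 h4
      simp only [h4, iff_true]
      by_contra h6
      exact h1 ⟨fun h => by linarith, fun h => by linarith⟩
    · have h5 := h3 (not_le.1 h4)
      simp only [h4, iff_false]
      intro h6
      exact h1 ⟨fun h => not_le.1 h4, fun h => by linarith⟩
  · rw [hs1, Test.sat_eq, Test.sat_eq] at h1
    have h2 := hne s hs g hs1
    have : x = g := by
      by_contra h3
      exact h1 ⟨fun h => absurd h h3, fun h => absurd h.symm h2⟩
    simp [Test.Sat, this]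

/-- Each item is followed by at least the final weight of the other kind, so the items need only be
counted. Their own weights play no role. -/
theorem count_mul_le_sep {α : Type*} {κ : α → Bool} {a : α → ℝ} {e : Bool → ℝ} {ℓ : List α}
    (h0 : ∀ s ∈ ℓ, 0 ≤ a s) (o : Bool) :
    (ℓ.countP (fun s => κ s = o) : ℝ) * e (!o) + (ℓ.countP (fun s => κ s = !o) : ℝ) * e o ≤
      sep (kw κ a ℓ) e := by
  induction ℓ with
  | nil => simp [kw, sep]
  | cons s ℓ ih =>
    have h0' : ∀ s ∈ ℓ, 0 ≤ a s := fun s hs => h0 s (List.mem_cons_of_mem _ hs)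
    have h1 := ih h0'
    have h2 := le_tot (c := !κ s) (e := e) (kw_nonneg (κ := κ) h0')
    rw [kw_cons, sep, List.countP_cons, List.countP_cons]
    push_cast
    cases hk : κ s <;> cases o <;> simp [hk] at h1 h2 ⊢ <;> linarith

theorem countP_le_one_of_pairwise {α : Type*} {r : α → α → Prop} {p : α → Prop} [DecidablePred p]
    {l : List α} (hl : l.Pairwise r) (h : ∀ x ∈ l, ∀ y ∈ l, p x → p y → ¬ r x y) :
    l.countP (fun x => decide (p x)) ≤ 1 := by
  induction l with
  | nil => simp
  | cons x l ih =>
    rw [List.pairwise_cons] at hl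
    rw [List.countP_cons]
    by_cases hx : p x
    · have : l.countP (fun x => decide (p x)) = 0 := by
        rw [List.countP_eq_zero]
        intro y hy hp
        exact h x List.mem_cons_self y (List.mem_cons_of_mem _ hy) hx (by simpa using hp)
          (hl.1 y hy)
      simp [this, hx]
    · simpa [hx] using ih hl.2 fun x hx y hy =>
        h x (List.mem_cons_of_mem _ hx) y (List.mem_cons_of_mem _ hy)

theorem length_le_countP_add {α : Type*} {p q r : α → Prop} [DecidablePred p] [DecidablePred q]
    [DecidablePred r] {l : List α}
    (h : ∀ x ∈ l, p x ∨ q x ∨ r x) :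
    l.length ≤ l.countP (fun x => decide (p x)) + l.countP (fun x => decide (q x)) +
      l.countP (fun x => decide (r x)) := by
  induction l with
  | nil => simp
  | cons x l ih =>
    have h1 := ih fun x hx => h x (List.mem_cons_of_mem _ hx)
    have h2 := h x List.mem_cons_self
    rw [List.countP_cons, List.countP_cons, List.countP_cons, List.length_cons]
    rcases h2 with h2 | h2 | h2 <;> simp only [h2, decide_true, if_true] <;> omega

/-- The key of a test. -/
def Test.key {n : ℕ} : Test n → Fin n
  | .lt k => k
  | .eq k => k

/-- A query `h` need not be tested for equality if, without the test, it would end at the leaf of a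
heavier query `q` of the same class. -/
theorem Desc.not_redundant (hW : ∀ q, 0 < W q) {T E : Tree I.n I.p} {R RE ℓ}
    (hd : Desc I T R ℓ E RE) {h q : Fin I.n} (hh : h ∈ RE) (hq : q ∈ RE) (hhq : W h < W q)
    (hs : ∀ x : Test I.n, x.Allowed I → T.saving I W x R ≤ ℓ.length * W h) (hD : 2 ≤ ℓ.length)
    (hal : ∀ s ∈ ℓ, s.1.Allowed I) (hhk : h ∈ I.keys)
    (hne : ∀ s ∈ ℓ, ∀ g, s.1 = .eq g → g ≠ h ∧ g ≠ q)
    (hdis : ℓ.Pairwise fun s s' => ∀ g, s.1 = .eq g → s'.1 ≠ .eq g) : False := by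
  have hW' : ∀ q, 0 ≤ W q := fun q => (hW q).le
  have hagree : ∀ s ∈ ℓ, ∀ k, s.1 = .lt k →
      (I.query k ≤ I.query h ↔ I.query k ≤ I.query q) := by
    intro s hs k hk
    have := hd.agree hq hh s hs
    rw [hk] at this
    simp only [Test.Sat] at this
    rw [← not_lt, ← not_lt, this]
  have hkey : ∀ s ∈ ℓ, ∀ k, s.1 = .lt k → k ∈ I.keys := fun s hs k hk => by
    have := hal s hs; rw [hk] at this; exact this.1
  have hkey' : ∀ s ∈ ℓ, ∀ k, s.1 = .eq k → k ∈ I.keys := fun s hs k hk => by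
    have := hal s hs; rw [hk] at this; exact this
  have hqh : I.query q ≠ I.query h := fun h' => by
    rw [I.query_injective h'] at hhq; exact lt_irrefl _ hhq
  have hlen : ∀ (κ : Test I.n × Finset (Fin I.n) → Bool) (o : Bool),
      ℓ.countP (fun s => κ s = o) + ℓ.countP (fun s => κ s = !o) = ℓ.length := by
    intro κ o
    rw [List.length_eq_countP_add_countP (fun s => decide (κ s = o))]
    congr 1
    apply List.countP_congr
    intro s _
    cases κ s <;> cases o <;> simp
  -- the effect of a threshold
  have basic : ∀ k ∈ I.keys, (∃ y, I.query y < I.query k) →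
      (∀ s ∈ ℓ, ∀ k', s.1 = .lt k' → (I.query k' ≤ I.query q → I.query k' ≤ I.query k) ∧
        (I.query q < I.query k' → I.query k ≤ I.query k')) → ∀ o : Bool,
      (ℓ.countP (fun s => leftOf I q (I.query k) s = o) : ℝ) *
          wsum W ((Test.lt k).side I (!o) RE) +
        (ℓ.countP (fun s => leftOf I q (I.query k) s = !o) : ℝ) *
          wsum W ((Test.lt k).side I o RE) ≤ ℓ.length * W h := by
    intro k hk hy hp o
    have h1 := hd.sep_le hW' (hd.typed_leftOf hq (fun s hs g hg => (hne s hs g hg).2) hp)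
    have h2 := hs (.lt k) ⟨hk, hy, k, le_rfl⟩
    have h3 := E.saving_nonneg hW' (.lt k) RE
    have h4 := count_mul_le_sep (κ := leftOf I q (I.query k)) (a := offW I W)
      (e := fun c => wsum W ((Test.lt k).side I c RE)) (ℓ := ℓ) (fun s _ => wsum_nonneg hW' _) o
    linarith
  -- A threshold between `h` and `q` makes each item on the side of `q` contribute at least `W h`,
  -- and each item across from `q` at least `W q > W h`. One item of the latter sort already brings
  -- the sum above `ℓ.length * W h`.
  have sepa : ∀ k ∈ I.keys, (∃ y, I.query y < I.query k) →
      (∀ s ∈ ℓ, ∀ k', s.1 = .lt k' → (I.query k' ≤ I.query q → I.query k' ≤ I.query k) ∧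
        (I.query q < I.query k' → I.query k ≤ I.query k')) →
      ¬ (I.query h < I.query k ↔ I.query q < I.query k) →
      (∃ s ∈ ℓ, leftOf I q (I.query k) s = !decide (I.query q < I.query k)) → False := by
    rintro k hk hy hp hsep ⟨s, hs, hs'⟩
    set o := decide (I.query q < I.query k) with ho
    have h1 := basic k hk hy hp o
    have h2 := hlen (leftOf I q (I.query k)) o
    have h3 : W q ≤ wsum W ((Test.lt k).side I o RE) :=
      le_wsum hW' (Test.mem_side.2 ⟨hq, by simp [ho, Test.Sat]⟩)
    have h4 : W h ≤ wsum W ((Test.lt k).side I (!o) RE) := by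
      refine le_wsum hW' (Test.mem_side.2 ⟨hh, ?_⟩)
      simp only [Test.Sat, ho, Bool.not_eq_true', decide_eq_false_iff_not]
      tauto
    have h5 : (0 : ℝ) < ℓ.countP (fun s => leftOf I q (I.query k) s = !o) := by
      exact_mod_cast List.countP_pos_iff.2 ⟨s, hs, by simpa using hs'⟩
    have h6 : ((ℓ.countP (fun s => leftOf I q (I.query k) s = o) : ℕ) : ℝ) +
        ((ℓ.countP (fun s => leftOf I q (I.query k) s = !o) : ℕ) : ℝ) = ℓ.length := by
      exact_mod_cast h2
    have h7 := mul_le_mul_of_nonneg_left h4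
      (Nat.cast_nonneg (α := ℝ) (ℓ.countP (fun s => leftOf I q (I.query k) s = o)))
    have h8 := mul_le_mul_of_nonneg_left h3 h5.le
    have h9 := mul_lt_mul_of_pos_left hhq h5
    rw [← h6] at h1
    linarith
  -- If the threshold has `h` and `q` on the same side, each item across from them contributes at
  -- least `W h + W q > 2 * W h`. Half of the items suffice to exceed `ℓ.length * W h`.
  have nons : ∀ k ∈ I.keys, (∃ y, I.query y < I.query k) →
      (∀ s ∈ ℓ, ∀ k', s.1 = .lt k' → (I.query k' ≤ I.query q → I.query k' ≤ I.query k) ∧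
        (I.query q < I.query k' → I.query k ≤ I.query k')) →
      (I.query h < I.query k ↔ I.query q < I.query k) →
      ℓ.length ≤ 2 * ℓ.countP (fun s =>
        leftOf I q (I.query k) s = !decide (I.query q < I.query k)) → False := by
    intro k hk hy hp hsep hcnt
    set o := decide (I.query q < I.query k) with ho
    have h1 := basic k hk hy hp o
    have h3 : W h + W q ≤ wsum W ((Test.lt k).side I o RE) := by
      have : ({h, q} : Finset (Fin I.n)) ⊆ (Test.lt k).side I o RE := by
        intro x hx
        rw [Finset.mem_insert, Finset.mem_singleton] at hx
        rcases hx with rfl | rfl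
        · exact Test.mem_side.2 ⟨hh, by simp only [Test.Sat, ho, decide_eq_true_iff]; exact hsep⟩
        · exact Test.mem_side.2 ⟨hq, by simp [ho, Test.Sat]⟩
      refine le_trans (le_of_eq ?_) (wsum_mono hW' this)
      rw [wsum, Finset.sum_pair]
      rintro rfl
      exact lt_irrefl _ hhq
    have h4 := wsum_nonneg hW' ((Test.lt k).side I (!o) RE)
    set N := ℓ.countP (fun s => leftOf I q (I.query k) s = !o)
    set M := ℓ.countP (fun s => leftOf I q (I.query k) s = o)
    have h5 : (ℓ.length : ℝ) ≤ 2 * N := by exact_mod_cast hcnt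
    have h6 : (2 : ℝ) ≤ ℓ.length := by exact_mod_cast hD
    have h7 := mul_le_mul_of_nonneg_left h3 (Nat.cast_nonneg (α := ℝ) N)
    have h8 := mul_nonneg (Nat.cast_nonneg (α := ℝ) M) h4
    have h9 := mul_le_mul_of_nonneg_right h5 (hW' h)
    have h10 : (0 : ℝ) < N := by linarith
    have h11 := mul_lt_mul_of_pos_left hhq h10
    linarith
  have hltq : ∀ s ∈ ℓ, ∀ k, s.1 = .lt k → I.query q < I.query k → I.query h < I.query k := by
    intro s hs k hk h1
    by_contra h2
    exact absurd ((hagree s hs k hk).1 (not_lt.1 h2)) (not_le.2 h1)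
  have hneq : ∀ s ∈ ℓ, ∀ g, s.1 = .eq g → I.query g ≠ I.query h ∧ I.query g ≠ I.query q :=
    fun s hs g hg => ⟨fun h' => (hne s hs g hg).1 (I.query_injective h'),
      fun h' => (hne s hs g hg).2 (I.query_injective h')⟩
  have hlh : ∀ s ∈ ℓ, ∀ k', s.1 = .lt k' → (I.query k' ≤ I.query q → I.query k' ≤ I.query h) ∧
        (I.query q < I.query k' → I.query h ≤ I.query k') := fun s hs k' hk' =>
    ⟨(hagree s hs k' hk').2, fun h' => (hltq s hs k' hk' h').le⟩
  have hdis1 : ∀ s ∈ ℓ, ∀ k, s.1.key = k → k ∈ I.keys := by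
    rintro s hs k rfl
    rcases hs1 : s.1 with k | k
    · exact hkey s hs k hs1
    · exact hkey' s hs k hs1
  have hlow : ∀ s ∈ ℓ, ∀ k, s.1 = .lt k → ∃ y, I.query y < I.query k := fun s hs k hk => by
    have := hal s hs; rw [hk] at this; exact this.2.1
  have hne0 : ℓ ≠ [] := by rintro rfl; simp at hD
  -- If `q < h`, thresholds above `q` force all keys of the path below `q`, and the largest of these
  -- keys then gives a contradiction. If `h < q`, fewer than half of the items are left of `h`,
  -- fewer than half have keys above `q`, and at most one equality test lies in between.
  rcases lt_or_gt_of_ne hqh with hlt | hlt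
  · by_cases c1 : ∃ s ∈ ℓ, leftOf I q (I.query h) s = false
    · exact sepa h hhk ⟨q, hlt⟩ hlh (by simp [hlt]) (by simpa [hlt] using c1)
    have c1' : ∀ s ∈ ℓ, leftOf I q (I.query h) s = true := fun s hs => by
      by_contra h'
      exact c1 ⟨s, hs, by simpa using h'⟩
    have c1l : ∀ s ∈ ℓ, ∀ k, s.1 = .lt k → I.query k ≤ I.query q := fun s hs k hk => by
      have := c1' s hs; simpa [leftOf, hk] using this
    have c1e : ∀ s ∈ ℓ, ∀ k, s.1 = .eq k → I.query k < I.query h := fun s hs k hk => by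
      have := c1' s hs; simpa [leftOf, hk] using this
    have c2 : ∀ s ∈ ℓ, ∀ g, s.1 = .eq g → I.query g < I.query q := by
      intro s hs g hg
      by_contra h'
      have h1 : I.query q < I.query g := lt_of_le_of_ne (not_lt.1 h') (hneq s hs g hg).2.symm
      refine sepa g (hkey' s hs g hg) ⟨q, h1⟩ (fun s' hs' k' hk' => ⟨fun h2 => h2.trans h1.le,
        fun h2 => absurd (c1l s' hs' k' hk') (not_le.2 h2)⟩) ?_ ⟨s, hs, ?_⟩
      · simp [h1, (c1e s hs g hg).le]
      · simp [leftOf, hg, h1]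
    obtain ⟨s, hs, hmax⟩ := ℓ.toFinset.exists_max_image (fun s => I.query s.1.key)
      (by simpa [List.toFinset_nonempty_iff] using hne0)
    simp only [List.mem_toFinset] at hs hmax
    have hkq : I.query s.1.key ≤ I.query q := by
      rcases hs1 : s.1 with k | k
      · exact c1l s hs k hs1
      · exact (c2 s hs k hs1).le
    have hone : ℓ.countP (fun s' => decide (s'.1 = .eq s.1.key)) ≤ 1 :=
      countP_le_one_of_pairwise hdis fun x hx y hy h1 h2 h3 => h3 _ h1 h2
    -- At the largest key of the path, the only item that is not on the left is the equality test on
    -- that very key, which occurs at most once. As the path has at least two tests, at least half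
    -- of the items are on the left.
    have hsum := hlen (leftOf I q (I.query s.1.key)) true
    have hle : ℓ.countP (fun s' => leftOf I q (I.query s.1.key) s' = !true) ≤
        ℓ.countP (fun s' => decide (s'.1 = .eq s.1.key)) := by
      refine List.countP_mono_left fun s' hs' h1 => ?_
      have h2 := hmax s' hs'
      rcases hs1 : s'.1 with k | k
      · rw [hs1] at h2
        have := c1l s' hs' k hs1
        simp [leftOf, hs1] at h1
        linarith
      · rw [hs1] at h2
        simp [leftOf, hs1] at h1
        have h3 : k = s.1.key := I.query_injective (le_antisymm h2 h1)
        simp [h3]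
    -- The threshold is allowed only if some query lies below it. If none did, the path would
    -- consist of equality tests on a single key, and there is at most one of those.
    have hex : ∃ y, I.query y < I.query s.1.key := by
      by_contra h'
      push Not at h'
      have : ∀ s' ∈ ℓ, s'.1 = .eq s.1.key := by
        intro s' hs'
        have h2 := hmax s' hs'
        rcases hs1 : s'.1 with k | k
        · rw [hs1] at h2
          obtain ⟨y, hy⟩ := hlow s' hs' k hs1
          exact absurd (h' y) (not_le.2 (hy.trans_le h2))
        · rw [hs1] at h2
          have h3 : k = s.1.key := I.query_injective (le_antisymm h2 (h' k))
          rw [h3]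
      rw [List.countP_eq_length.2 (by simpa using this)] at hone
      omega
    refine nons s.1.key (hdis1 s hs _ rfl) hex (fun s' hs' k' hk' => ⟨fun _ => ?_,
      fun h2 => absurd (c1l s' hs' k' hk') (not_le.2 h2)⟩) ?_ ?_
    · have := hmax s' hs'
      rwa [hk'] at this
    · exact iff_of_false (not_lt.2 (hkq.trans hlt.le)) (not_lt.2 hkq)
    · rw [decide_eq_false (not_lt.2 hkq)]
      have hle' := hle.trans hone
      change ℓ.length ≤ 2 * ℓ.countP (fun s' => leftOf I q (I.query s.1.key) s' = true)
      linarith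
  · have ha : 2 * ℓ.countP (fun s => leftOf I q (I.query h) s = true) < ℓ.length := by
      by_contra h'
      have h1 : 0 < ℓ.countP (fun s => leftOf I q (I.query h) s = true) := by omega
      obtain ⟨s, hs, h2⟩ := List.countP_pos_iff.1 h1
      refine nons h hhk ?_ hlh (by simp [hlt.le]) ?_
      · rcases hs1 : s.1 with k | k
        · have h3 : I.query k ≤ I.query q := by simpa [leftOf, hs1] using h2
          obtain ⟨y, hy⟩ := hlow s hs k hs1
          exact ⟨y, hy.trans_le ((hagree s hs k hs1).2 h3)⟩
        · exact ⟨k, by simpa [leftOf, hs1] using h2⟩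
      · simp only [not_lt.2 hlt.le, decide_false, Bool.not_false]
        omega
    have hc : 2 * ℓ.countP (fun s => decide (I.query q < I.query s.1.key)) < ℓ.length := by
      by_contra h'
      have h1 : 0 < ℓ.countP (fun s => decide (I.query q < I.query s.1.key)) := by omega
      obtain ⟨s₀, hs₀, h2⟩ := List.countP_pos_iff.1 h1
      obtain ⟨s, hs, hmin⟩ := (ℓ.toFinset.filter
        fun s => I.query q < I.query s.1.key).exists_min_image (fun s => I.query s.1.key)
        ⟨s₀, by simpa using ⟨hs₀, by simpa using h2⟩⟩
      simp only [Finset.mem_filter, List.mem_toFinset] at hs hmin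
      refine nons s.1.key (hdis1 s hs.1 _ rfl) ⟨q, hs.2⟩ (fun s' hs' k' hk' =>
        ⟨fun h3 => h3.trans hs.2.le, fun h3 => ?_⟩) (by simp [hs.2, hlt.trans hs.2]) ?_
      · have := hmin s' ⟨hs', by rwa [hk']⟩
        rwa [hk'] at this
      · simp only [hs.2, decide_true, Bool.not_true]
        refine (not_lt.1 h').trans (Nat.mul_le_mul_left _ (List.countP_mono_left fun s' hs' h3 => ?_))
        have h3 : I.query q < I.query s'.1.key := by simpa using h3
        have h4 := hmin s' ⟨hs', h3⟩
        rcases hs1 : s'.1 with k | k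
        · rw [hs1] at h3
          simpa [leftOf, hs1, Test.key] using h3
        · rw [hs1] at h4
          have h5 : I.query s.1.key ≤ I.query k := h4
          simp [leftOf, hs1, h5]
    set mid : Test I.n × Finset (Fin I.n) → Prop := fun s =>
      ∃ g, s.1 = .eq g ∧ I.query h < I.query g ∧ I.query g < I.query q with hmid
    -- A key between `h` and `q` is itself a separating threshold, so no item may be left of it. In
    -- particular there is at most one such key, and if there is one, no item is left of `h`.
    have hm : ∀ s ∈ ℓ, ∀ g, s.1 = .eq g → I.query h < I.query g → I.query g < I.query q →
        ∀ s' ∈ ℓ, leftOf I q (I.query g) s' ≠ true := by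
      intro s hs g hg h1 h2 s' hs' h3
      refine sepa g (hkey' s hs g hg) ⟨h, h1⟩ (fun s' hs' k' hk' => ⟨fun h4 => ?_, fun h4 =>
        (h2.trans h4).le⟩) (by simp [h1, h2.le]) ⟨s', hs', ?_⟩
      · exact ((hagree s' hs' k' hk').2 h4).trans h1.le
      · simpa [not_lt.2 h2.le] using h3
    have hb : ℓ.countP (fun s => decide (mid s)) ≤ 1 := by
      refine countP_le_one_of_pairwise (p := mid) hdis ?_
      rintro s hs s' hs' ⟨g, hg, h1, h2⟩ ⟨g', hg', h1', h2'⟩ h3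
      have hgg : g ≠ g' := by rintro rfl; exact h3 g hg hg'
      rcases lt_or_gt_of_ne (fun h' => hgg (I.query_injective h')) with h4 | h4
      · exact hm s' hs' g' hg' h1' h2' s hs (by simpa [leftOf, hg] using h4)
      · exact hm s hs g hg h1 h2 s' hs' (by simpa [leftOf, hg'] using h4)
    have hall := length_le_countP_add (l := ℓ)
      (p := fun s => leftOf I q (I.query h) s = true) (q := mid)
      (r := fun s => I.query q < I.query s.1.key) (by
        intro s hs
        rcases hs1 : s.1 with k | k
        · by_cases h1 : I.query k ≤ I.query q
          · exact .inl (by simpa [leftOf, hs1] using h1)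
          · exact .inr (.inr (not_le.1 h1))
        · obtain ⟨h1, h2⟩ := hneq s hs k hs1
          rcases lt_or_gt_of_ne h1 with h1 | h1
          · exact .inl (by simpa [leftOf, hs1] using h1)
          · rcases lt_or_gt_of_ne h2 with h2 | h2
            · exact .inr (.inl ⟨k, hs1, h1, h2⟩)
            · exact .inr (.inr h2))
    rcases Nat.eq_zero_or_pos (ℓ.countP fun s => decide (mid s)) with h0 | h0
    · omega
    · obtain ⟨s, hs, hs'⟩ := List.countP_pos_iff.1 h0
      obtain ⟨g, hg, h1, h2⟩ : mid s := by simpa using hs'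
      have h3 := hm s hs g hg h1 h2
      have : ℓ.countP (fun s => leftOf I q (I.query h) s = true) = 0 := by
        rw [List.countP_eq_zero]
        intro s' hs' h4
        refine h3 s' hs' ?_
        rcases hs1 : s'.1 with k | k
        · simpa [leftOf, hs1] using h4
        · have h5 : I.query k < I.query h := by simpa [leftOf, hs1] using h4
          simpa [leftOf, hs1] using h5.trans h1
      omega

theorem Desc.off_subset {T E : Tree I.n I.p} {R RE ℓ} (h : Desc I T R ℓ E RE) :
    ∀ s ∈ ℓ, s.2 ⊆ R := by
  induction h with
  | nil => simp
  | cons b u y z R ℓ E RE h ih =>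
    intro s hs
    rcases List.mem_cons.1 hs with rfl | hs
    · exact u.side_subset _ _
    · exact (ih s hs).trans (u.side_subset _ _)

/-- The path in a larger set of queries. -/
theorem Desc.superset {T E : Tree I.n I.p} {R RE ℓ} (h : Desc I T R ℓ E RE) {q : Fin I.n}
    (hq : q ∈ RE) {R' : Finset (Fin I.n)} (hR : R ⊆ R') :
    ∃ ℓ' RE', Desc I T R' ℓ' E RE' ∧ ℓ'.map Prod.fst = ℓ.map Prod.fst ∧
      ∀ y ∈ R', (∀ s ∈ ℓ, (s.1.Sat I y ↔ s.1.Sat I q)) → y ∈ RE' := by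
  induction h generalizing R' with
  | nil T R => exact ⟨[], R', .nil _ _, rfl, fun y hy _ => hy⟩
  | cons b u y z R ℓ E RE h ih =>
    have hsub : u.side I b R ⊆ u.side I b R' := fun x hx => by
      rw [Test.mem_side] at hx ⊢
      exact ⟨hR hx.1, hx.2⟩
    obtain ⟨ℓ', RE', h1, h2, h3⟩ := ih hq hsub
    refine ⟨_, _, .cons b u y z R' ℓ' E RE' h1, by simp [h2], fun x hx h4 => h3 x ?_ ?_⟩
    · rw [Test.mem_side]
      exact ⟨hx, (h4 _ List.mem_cons_self).trans (Test.mem_side.1 (h.subset hq)).2⟩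
    · exact fun s hs => h4 s (List.mem_cons_of_mem _ hs)

/-- All queries past a test for `g` on which `q` continues agree with `q` on that test. Repeating it
would send nobody off, which optimality excludes. -/
theorem Desc.eq_pairwise (hW : ∀ q, 0 < W q) {T E : Tree I.n I.p} {R RE ℓ}
    (h : Desc I T R ℓ E RE) (ho : T.OptOn I W R) {q : Fin I.n} (hq : q ∈ RE)
    (hne : ∀ s ∈ ℓ, ∀ g, s.1 = .eq g → g ≠ q) :
    ℓ.Pairwise fun s s' => ∀ g, s.1 = .eq g → s'.1 ≠ .eq g := by
  induction h with
  | nil => exact List.Pairwise.nil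
  | cons b u y z R ℓ E RE h ih =>
    have hne' := fun s hs => hne s (List.mem_cons_of_mem _ hs)
    have hqs := h.subset hq
    refine List.Pairwise.cons (fun s hs g hg hg' => ?_) (ih (ho.kid b) hq hne')
    subst hg
    obtain ⟨x, hx⟩ := h.off_nonempty hW (ho.kid b) ⟨q, hqs⟩ s hs
    have h1 := h.off_not_same hq s hs x hx
    have h2 := (Test.mem_side.1 (h.off_subset s hs hx)).2
    have h3 := (Test.mem_side.1 hqs).2
    rw [hg'] at h1
    exact h1 (h2.trans h3.symm)

/-- The same exchange as in `Tree.OptOn.saving_le`, but the two pruned copies are taken from an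
arbitrary competitor `z` instead of `T` itself. -/
theorem Tree.OptOn.wcost_le {T z : Tree I.n I.p} {R : Finset (Fin I.n)} (h : T.OptOn I W R)
    (hz : z.SolvesOn I R) {x : Test I.n} (hx : x.Allowed I) :
    T.wcost I W R ≤ wsum W R + z.wcost I W R - z.saving I W x R := by
  have h1 : (Tree.node x (z.prune I (x.side I true R)) (z.prune I (x.side I false R))).SolvesOn I R
      := by
    refine Tree.SolvesOn.node hx true ?_ ?_
    · exact Tree.SolvesOn.prune ⟨hz.1, fun q hq => hz.2 q (x.side_subset _ _ hq)⟩
    · exact Tree.SolvesOn.prune ⟨hz.1, fun q hq => hz.2 q (x.side_subset _ _ hq)⟩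
  have h2 := h.2 _ h1
  rw [Tree.wcost_node W x _ _ true] at h2
  simp only [TwoWay.kid, Bool.not_true, if_true, Bool.false_eq_true, if_false] at h2
  rw [← Tree.pcost, ← Tree.pcost] at h2
  rw [Tree.saving]
  linarith

/-- A query that an optimal tree tests for equality does not belong to the class of a heavier
query. -/
theorem Tree.OptOn.not_solvesOn (hW : ∀ q, 0 < W q) {g q : Fin I.n} {y z : Tree I.n I.p}
    {R : Finset (Fin I.n)} (ho : (Tree.node (.eq g) y z).OptOn I W R) (hg : g ∈ R) (hq : q ∈ R)
    (hgq : W g < W q) : ¬ z.SolvesOn I R := by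
  intro hz
  have hW' : ∀ q, 0 ≤ W q := fun q => (hW q).le
  have hne : q ≠ g := by rintro rfl; exact lt_irrefl _ hgq
  have hq' : q ∈ (Test.eq g).side I false R := Test.mem_side.2 ⟨hq, by rw [Test.sat_eq]; simpa⟩
  obtain ⟨ℓ, j, RE, hd, hqE⟩ := exists_desc_leaf z hq'
  have hsame := Desc.same_of_mem hW (.cons false (.eq g) y z R ℓ _ RE hd) ho hqE hgq
  have hnot : ∀ u : Test I.n, (u.Sat I g ↔ u.Sat I q) → ∀ k, u = .eq k → k ≠ g ∧ k ≠ q := by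
    rintro _ h k rfl
    rw [Test.sat_eq, Test.sat_eq] at h
    constructor
    · rintro rfl; exact hne (h.1 rfl)
    · rintro rfl; exact hne (h.2 rfl).symm
  obtain ⟨ℓ', RE', hd', hmap, hmem⟩ := hd.superset hqE (Test.side_subset _ _ R)
  have hgE := hmem g hg hsame
  have hqE' := hmem q hq fun _ _ => Iff.rfl
  have hmap' : ∀ s ∈ ℓ', ∃ s' ∈ ℓ, s'.1 = s.1 := fun s hs => by
    have : s.1 ∈ ℓ.map Prod.fst := by rw [← hmap]; exact List.mem_map_of_mem hs
    simpa using this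
  have hdis := hd.eq_pairwise hW (ho.kid false) hqE fun s hs k hk => (hnot _ (hsame s hs) k hk).2
  have hdis' : ℓ'.Pairwise fun s s' => ∀ g, s.1 = .eq g → s'.1 ≠ .eq g := by
    rw [← List.pairwise_map (f := Prod.fst) (R := fun u u' : Test I.n => ∀ g, u = .eq g → u' ≠ .eq g)]
      at hdis ⊢
    rwa [hmap]
  -- Without its test, `g` follows the path of `q` to the end, and so makes `ℓ'.length` tests.
  have hdep : z.wcost I W ((Test.eq g).side I true R) = W g * ℓ'.length := by
    have : (Test.eq g).side I true R = {g} := by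
      ext x
      rw [Test.mem_side, Test.sat_eq, Finset.mem_singleton]
      constructor
      · rintro ⟨_, h⟩; simpa using h
      · rintro rfl; exact ⟨hg, by simp⟩
    rw [this, Tree.wcost, Finset.sum_singleton, hd'.depth_eq hgE]
    simp [Tree.depth]
  have h1 := Tree.wcost_node W (.eq g) y z true R
  have h2 := z.wcost_side W (.eq g) true R
  have h3 := Tree.wcost_nonneg hW' y ((Test.eq g).side I true R)
  have h4 := ho.2 z hz
  rw [Bool.not_true] at h1 h2
  simp only [TwoWay.kid, if_true, Bool.false_eq_true, if_false] at h1
  have h5 : W g + W q ≤ wsum W R := by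
    have h6 : ({g, q} : Finset (Fin I.n)) ⊆ R := by
      rw [Finset.insert_subset_iff, Finset.singleton_subset_iff]
      exact ⟨hg, hq⟩
    refine le_trans (le_of_eq ?_) (wsum_mono hW' h6)
    rw [wsum, Finset.sum_pair hne.symm]
  -- Replacing the node by `z` must not help, so `wsum W R ≤ W g * ℓ'.length`. The left-hand side is
  -- at least `W g + W q`, which exceeds `W g`.
  have hD : 2 ≤ ℓ'.length := by
    by_contra hlt
    have h7 : (ℓ'.length : ℝ) ≤ 1 := by exact_mod_cast (by omega : ℓ'.length ≤ 1)
    have h8 := mul_le_mul_of_nonneg_left h7 (hW' g)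
    have h9 := hW q
    linarith
  refine hd'.not_redundant hW hgE hqE' hgq (fun x hx => ?_) hD (hd'.allowed hz.1) ho.1.1.1
    (fun s hs k hk => ?_) hdis'
  -- The cost of the given tree contains `wsum W R` and the cost of `z` away from `g`. Comparison
  -- with the competitor built from `z` and `x` leaves exactly the cost of `g` in `z` as a bound on
  -- the saving.
  · have h7 := ho.wcost_le hz hx
    linarith
  · obtain ⟨s', hs', he⟩ := hmap' s hs
    exact hnot _ (hsame s' hs') k (he.trans hk)

end Redundant
end TwoWay

namespace TwoWay

/-! ### The recurrence finds an optimal tree -/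

section Complete
open Classical

variable {I : Instance} {L : List (Fin I.p × Fin I.n)} {W : Fin I.n → ℝ}

theorem Desc.nonempty (hW : ∀ q, 0 < W q) {T E : Tree I.n I.p} {R RE ℓ}
    (h : Desc I T R ℓ E RE) (ho : T.OptOn I W R) (hR : R.Nonempty) : RE.Nonempty := by
  induction h with
  | nil => exact hR
  | cons b u y z R ℓ E RE h ih => exact ih (ho.kid b) (ho.side_nonempty hW hR b)

/-- Two queries that no test on the path of one of them separates end at the same leaf. -/
theorem answer_eq_of_same {T : Tree I.n I.p} {R : Finset (Fin I.n)} {g y : Fin I.n} (hy : y ∈ R)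
    (h : ∀ ℓ x y' z' RE, Desc I T R ℓ (.node x y' z') RE → y ∈ RE → (x.Sat I g ↔ x.Sat I y)) :
    T.answer I g = T.answer I y := by
  induction T generalizing R with
  | leaf j => rfl
  | node u y' z' ih1 ih2 =>
    have h0 := h [] u y' z' R (.nil _ _) hy
    by_cases hu : u.Sat I y
    · rw [Tree.answer_node_of_mem (b := true) (by simpa using h0.2 hu),
        Tree.answer_node_of_mem (b := true) (by simpa using hu)]
      exact ih1 (R := u.side I true R) (Test.mem_side.2 ⟨hy, by simpa using hu⟩)
        fun ℓ x y'' z'' RE hd => h _ x y'' z'' RE (.cons true u y' z' R ℓ _ RE hd)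
    · rw [Tree.answer_node_of_mem (b := false) (by simpa using fun h => hu (h0.1 h)),
        Tree.answer_node_of_mem (b := false) (by simpa using hu)]
      exact ih2 (R := u.side I false R) (Test.mem_side.2 ⟨hy, by simpa using hu⟩)
        fun ℓ x y'' z'' RE hd => h _ x y'' z'' RE (.cons false u y' z' R ℓ _ RE hd)

/-- The holes of `holed l r c q s` that are lighter than `q`. -/
noncomputable def Instance.holes (I : Instance) (l r : ℕ) (c : Fin I.p) (q : Fin I.n) (s : ℕ) :
    Finset (Fin I.n) :=
  Finset.univ.filter fun y =>
    I.Within l r y ∧ y ∉ I.cls c ∧ I.thr l r c q s ≤ I.rk y ∧ I.rk y < I.rk q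

theorem Instance.mem_holes {l r s : ℕ} {c : Fin I.p} {q y : Fin I.n} : y ∈ I.holes l r c q s ↔
    I.Within l r y ∧ y ∉ I.cls c ∧ I.thr l r c q s ≤ I.rk y ∧ I.rk y < I.rk q := by
  simp [Instance.holes]

/-- For the sets `holed l r c q s`, the recurrence is as good as the subtree `T` of the optimal tree
`T₀`. -/
def TopBound (I : Instance) (L : List (Fin I.p × Fin I.n)) (lab : Fin I.n → Fin I.p)
    (W : Fin I.n → ℝ) (T₀ T : Tree I.n I.p) : Prop :=
  ∀ R ℓ, Desc I T₀ Finset.univ ℓ T R → ∀ l r (e : Fin L.length) s,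
    R = I.holed l r (L.get e).1 (L.get e).2 s → (L.get e).2 ∈ R →
    T.answer I (L.get e).2 = (L.get e).1 →
    I.holes l r (L.get e).1 (L.get e).2 s ⊆ lights I W (L.get e).2 ℓ →
    (I.holes l r (L.get e).1 (L.get e).2 s).card = s →
    I.thr l r (L.get e).1 (L.get e).2 s ≠ 0 →
    ∃ T' v, Der I L lab (.top l r e s) T' v ∧ v ≤ T.wcost I I.weight R

/-- For the sets `below l r t`, the recurrence is as good as the subtree `T` of the optimal tree
`T₀`. -/
def AllBound (I : Instance) (L : List (Fin I.p × Fin I.n)) (lab : Fin I.n → Fin I.p)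
    (T₀ T : Tree I.n I.p) : Prop :=
  ∀ R ℓ, Desc I T₀ Finset.univ ℓ T R → ∀ l r t, R = I.below l r t →
    ∃ T' v, Der I L lab (.all l r t) T' v ∧ v ≤ T.wcost I I.weight R

variable {lab : Fin I.n → Fin I.p} {T₀ T : Tree I.n I.p}

theorem univ_nonempty (I : Instance) : (Finset.univ : Finset (Fin I.n)).Nonempty :=
  ⟨⟨0, I.n_pos⟩, Finset.mem_univ _⟩

/-- The subproblem to use is the one for the heaviest query of the set and the class by which `T`
answers it. It starts without holes, so the conditions on the holes are void. -/
theorem TopBound.allBound (hL : ∀ j q, (j, q) ∈ L ↔ q ∈ I.cls j) (hW : ∀ q, 0 < W q)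
    (hT₀ : T₀.OptOn I W Finset.univ) (h : TopBound I L lab W T₀ T) : AllBound I L lab T₀ T := by
  intro R ℓ hd l r t hR
  obtain ⟨q, hq, hmax⟩ := R.exists_max_image I.rk (hd.nonempty hW hT₀ (univ_nonempty I))
  have hans := (hd.opt hT₀).1.2 q hq
  obtain ⟨e, he⟩ := List.mem_iff_get.1 ((hL _ _).2 hans)
  have e1 : (L.get e).1 = T.answer I q := by rw [he]
  have e2 : (L.get e).2 = q := by rw [he]
  have htop : IsTop I L l r t e := by
    rw [IsTop, e2]
    rw [hR, I.mem_below] at hq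
    refine ⟨hq.1, hq.2, fun y h1 h2 => hmax y ?_⟩
    rw [hR, I.mem_below]
    exact ⟨h1, h2⟩
  have hR' : R = I.holed l r (L.get e).1 (L.get e).2 0 := by
    rw [hR, htop.set_eq fun j q h => (hL j q).1 h]
  have h0 : I.holes l r (L.get e).1 (L.get e).2 0 = ∅ := by
    ext y
    simp only [I.mem_holes, Instance.thr, Finset.notMem_empty, iff_false]
    omega
  obtain ⟨T', v, h1, h2⟩ := h R ℓ hd l r e 0 hR' (by rwa [e2]) (by rw [e1, e2])
    (by rw [h0]; exact Finset.empty_subset _) (by rw [h0]; rfl)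
    (by rw [Instance.thr]; have := I.one_le_rk (L.get e).2; omega)
  exact ⟨T', v, .all l r t e T' v htop h1, h2⟩

theorem exists_thr {l r s : ℕ} {c : Fin I.p} {q : Fin I.n} (hs : s ≠ 0)
    (h : I.thr l r c q s ≠ 0) : ∃ g ∈ I.holes l r c q s, I.rk g = I.thr l r c q s := by
  obtain ⟨s, rfl⟩ := Nat.exists_eq_succ_of_ne_zero hs
  rw [Instance.thr] at h
  obtain ⟨g, h1, h2, h3, h4⟩ := I.exists_nextRk h
  exact ⟨g, I.mem_holes.2 ⟨h1, h2, h4.ge, h3.trans_le (I.thr_le l r c q s)⟩, h4⟩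

/-- In an optimal tree, the queries that must not be separated from `q` are not. -/
theorem same_of_within (hW : ∀ q, 0 < W q) (hrk : ∀ a b, I.rk a < I.rk b ↔ W a < W b)
    (hT₀ : T₀.OptOn I W Finset.univ) {u : Test I.n} {y z : Tree I.n I.p} {ℓ l r s}
    {c : Fin I.p} {q : Fin I.n} (hd : Desc I T₀ Finset.univ ℓ (.node u y z) (I.holed l r c q s))
    (hq : q ∈ I.holed l r c q s) (hh : I.holes l r c q s ⊆ lights I W q ℓ)
    (h0 : I.thr l r c q s ≠ 0) {x : Fin I.n} (h1 : I.Within l r x) (h2 : I.thr l r c q s ≤ I.rk x)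
    (h3 : I.rk x ≤ I.rk q) : u.Sat I x ↔ u.Sat I q := by
  rcases Nat.lt_or_eq_of_le h3 with h3' | h3'
  · by_cases hc : x ∈ I.cls c
    · have hs : s ≠ 0 := by
        rintro rfl
        rw [Instance.thr] at h2
        omega
      -- A member `x` of `c` is not a hole. The lightest hole `g` is lighter than both `x` and `q`,
      -- and `x` and `q` reach this node, so the test sends `g` the same way as each of them.
      obtain ⟨g, hg, hg'⟩ := exists_thr hs h0
      have hxR : x ∈ I.holed l r c q s := I.mem_holed.2 ⟨h1, h3, .inl hc⟩
      have hgx : I.rk g < I.rk x := by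
        refine lt_of_le_of_ne (by omega) fun h => ?_
        rw [I.rk_injective h] at hg
        exact (I.mem_holes.1 hg).2.1 hc
      have hgl := hh hg
      have hgl' : g ∈ lights I W x ℓ :=
        mem_lights.2 ⟨(hrk _ _).1 hgx, (mem_lights.1 hgl).2⟩
      rw [← (hd.lights_spec hW hT₀ hxR hgl').2.2.2 _ _ _ rfl]
      exact (hd.lights_spec hW hT₀ hq hgl).2.2.2 _ _ _ rfl
    · exact (hd.lights_spec hW hT₀ hq (hh (I.mem_holes.2 ⟨h1, hc, h2, h3'⟩))).2.2.2 _ _ _ rfl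
  · rw [I.rk_injective h3']

theorem Instance.Keeps.holes_eq {l r l' r' s : ℕ} {c : Fin I.p} {q : Fin I.n}
    (h : I.Keeps l r l' r' c q s) (hsub : ∀ y, I.Within l' r' y → I.Within l r y) :
    I.holes l' r' c q s = I.holes l r c q s := by
  ext y
  rw [I.mem_holes, I.mem_holes, h.thr_eq hsub s le_rfl]
  constructor
  · rintro ⟨h1, h2, h3, h4⟩
    exact ⟨hsub y h1, h2, h3, h4⟩
  · rintro ⟨h1, h2, h3, h4⟩
    exact ⟨h y h1 h3 h4.le, h2, h3, h4⟩

theorem lights_mono {q : Fin I.n} {ℓ ℓ' : List (Test I.n × Finset (Fin I.n))} (h : ℓ ⊆ ℓ') :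
    lights I W q ℓ ⊆ lights I W q ℓ' := by
  intro g hg
  rw [mem_lights] at hg ⊢
  obtain ⟨h1, S, h2⟩ := hg
  exact ⟨h1, S, h h2⟩

theorem topBound_leaf (hT₀ : T₀.OptOn I W Finset.univ) (j : Fin I.p) :
    TopBound I L lab W T₀ (.leaf j) := by
  intro R ℓ hd l r e s hR hq hans hh hcard h0
  refine ⟨_, 0, .leaf l r e s (I.nextRk_eq_zero fun z h1 h2 => ?_), ?_⟩
  · have h3 := (hd.opt hT₀).1.2 z
    rw [Tree.answer] at hans h3
    rw [hans] at h3
    apply h3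
    rw [hR, I.mem_holed]
    exact ⟨h1, h2.le.trans (I.thr_le _ _ _ _ s), .inr h2⟩
  · rw [Tree.wcost_leaf]

/-- By `same_of_within`, the comparison keeps `q` together with the holes and the queries ranked
between them. So the part with `q` has the same holes in a shorter interval, and the other part is a
plain interval with a rank bound. -/
theorem topBound_lt (hW : ∀ q, 0 < W q) (hrk : ∀ a b, I.rk a < I.rk b ↔ W a < W b)
    (hT₀ : T₀.OptOn I W Finset.univ) {k : Fin I.n} {y z : Tree I.n I.p}
    (hy : TopBound I L lab W T₀ y) (hy' : AllBound I L lab T₀ y)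
    (hz : TopBound I L lab W T₀ z) (hz' : AllBound I L lab T₀ z) :
    TopBound I L lab W T₀ (.node (.lt k) y z) := by
  intro R ℓ hd l r e s hR hq hans hh hcard h0
  -- If nothing outside `c` is left, a leaf costs zero and the structure of `T` is irrelevant.
  by_cases hn : I.thr l r (L.get e).1 (L.get e).2 (s + 1) = 0
  · exact ⟨_, 0, .leaf l r e s hn, Tree.wcost_nonneg I.weight_nonneg _ _⟩
  have ho := hd.opt hT₀
  have hRne := hd.nonempty hW hT₀ (univ_nonempty I)
  have hk : k ∈ I.keys := ho.1.1.1.1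
  obtain ⟨z₁, hz₁⟩ := ho.side_nonempty hW hRne true
  obtain ⟨z₂, hz₂⟩ := ho.side_nonempty hW hRne false
  rw [Test.mem_side, I.lt_sat, hR, I.mem_holed] at hz₁ hz₂
  simp only [iff_true, Bool.false_eq_true, iff_false, Instance.Within] at hz₁ hz₂
  have hlk : l < I.pos k := by omega
  have hkr : I.pos k ≤ r := by omega
  subst hR
  have hsame := fun x => same_of_within hW hrk hT₀ hd hq hh h0 (x := x)
  have hdy : Desc I T₀ Finset.univ _ y _ := hd.trans (.cons true (.lt k) y z _ [] _ _ (.nil _ _))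
  have hdz : Desc I T₀ Finset.univ _ z _ := hd.trans (.cons false (.lt k) y z _ [] _ _ (.nil _ _))
  have hcost := Tree.wcost_node I.weight (.lt k) y z true (I.holed l r (L.get e).1 (L.get e).2 s)
  by_cases hqk : (Test.lt k).Sat I (L.get e).2
  · have hK : I.Keeps l r l (I.pos k - 1) (L.get e).1 (L.get e).2 s := fun x h1 h2 h3 => by
      have := (hsame x h1 h2 h3).2 hqk
      rw [I.lt_sat] at this
      exact ⟨h1.1, by omega⟩
    have hsub : ∀ y, I.Within l (I.pos k - 1) y → I.Within l r y :=
      fun y hy => ⟨hy.1, by have := hy.2; omega⟩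
    obtain ⟨e1, e2⟩ := I.holed_split_left hlk hkr hK
    rw [Bool.not_true] at hcost
    rw [e1] at hdy hcost
    rw [e2] at hdz hcost
    obtain ⟨T₁, v₁, h1, h1'⟩ := hy _ _ hdy l (I.pos k - 1) e s rfl
      (by rw [← e1, Test.mem_side]; exact ⟨hq, by simpa using hqk⟩)
      (by rwa [Tree.answer_node_of_mem (b := true) (by simpa using hqk)] at hans)
      (by rw [hK.holes_eq hsub]; exact hh.trans (lights_mono (List.subset_append_left _ _)))
      (by rwa [hK.holes_eq hsub]) (by rwa [hK.thr_eq hsub s le_rfl])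
    obtain ⟨T₂, v₂, h2, h2'⟩ := hz' _ _ hdz _ _ _ rfl
    refine ⟨_, _, .left l r e s k T₁ v₁ T₂ v₂ hn hk hlk hkr hK h1 h2, ?_⟩
    rw [hcost, Cell.weight, Cell.set]
    simp only [kid, if_true, Bool.false_eq_true, if_false]
    linarith
  · have hK : I.Keeps l r (I.pos k) r (L.get e).1 (L.get e).2 s := fun x h1 h2 h3 => by
      have : ¬ (Test.lt k).Sat I x := fun h => hqk ((hsame x h1 h2 h3).1 h)
      rw [I.lt_sat] at this
      exact ⟨by omega, h1.2⟩
    have hsub : ∀ y, I.Within (I.pos k) r y → I.Within l r y :=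
      fun y hy => ⟨by have := hy.1; omega, hy.2⟩
    obtain ⟨e1, e2⟩ := I.holed_split_right hlk hkr hK
    rw [Bool.not_true] at hcost
    rw [e1] at hdy hcost
    rw [e2] at hdz hcost
    obtain ⟨T₁, v₁, h1, h1'⟩ := hy' _ _ hdy _ _ _ rfl
    obtain ⟨T₂, v₂, h2, h2'⟩ := hz _ _ hdz (I.pos k) r e s rfl
      (by rw [← e2, Test.mem_side]; exact ⟨hq, by simpa using hqk⟩)
      (by rwa [Tree.answer_node_of_mem (b := false) (by simpa using hqk)] at hans)
      (by rw [hK.holes_eq hsub]; exact hh.trans (lights_mono (List.subset_append_left _ _)))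
      (by rwa [hK.holes_eq hsub]) (by rwa [hK.thr_eq hsub s le_rfl])
    refine ⟨_, _, .right l r e s k T₁ v₁ T₂ v₂ hn hk hlk hkr hK h1 h2, ?_⟩
    rw [hcost, Cell.weight, Cell.set]
    simp only [kid, if_true, Bool.false_eq_true, if_false]
    linarith

/-- A test for a lighter query `g` must make the next hole. Without the test, `g` would end at the
leaf of `q`, so `g` is outside `c` by `Tree.OptOn.not_solvesOn`. Any heavier query in the set that
lies outside `c` would end at that leaf as well, which is labelled `c`; so `g` is the heaviest one.
-/
theorem topBound_eq (hW : ∀ q, 0 < W q) (hrk : ∀ a b, I.rk a < I.rk b ↔ W a < W b)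
    (hT₀ : T₀.OptOn I W Finset.univ) {g : Fin I.n} {y z : Tree I.n I.p}
    (hz : TopBound I L lab W T₀ z) (hz' : AllBound I L lab T₀ z) :
    TopBound I L lab W T₀ (.node (.eq g) y z) := by
  intro R ℓ hd l r e s hR hq hans hh hcard h0
  by_cases hn : I.thr l r (L.get e).1 (L.get e).2 (s + 1) = 0
  · exact ⟨_, 0, .leaf l r e s hn, Tree.wcost_nonneg I.weight_nonneg _ _⟩
  have ho := hd.opt hT₀
  have hRne := hd.nonempty hW hT₀ (univ_nonempty I)
  have hg : g ∈ I.keys := ho.1.1.1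
  have hgR : g ∈ R := by
    obtain ⟨x, hx⟩ := ho.side_nonempty hW hRne true
    have := Test.side_eq_true hx
    rw [← this]
    exact (Test.mem_side.1 hx).1
  subst hR
  have hdz : Desc I T₀ Finset.univ _ z _ := hd.trans (.cons false (.eq g) y z _ [] _ _ (.nil _ _))
  have hcost := Tree.wcost_node I.weight (.eq g) y z true (I.holed l r (L.get e).1 (L.get e).2 s)
  have hy0 := Tree.wcost_nonneg I.weight_nonneg y
    ((Test.eq g).side I true (I.holed l r (L.get e).1 (L.get e).2 s))
  rw [Bool.not_true] at hcost
  by_cases hgq : g = (L.get e).2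
  · have hs : s = 0 := by
      by_contra hs
      obtain ⟨h, hh1, hh2⟩ := exists_thr hs h0
      have h3 := (hd.lights_spec hW hT₀ hq (hh hh1)).2.2.2 _ _ _ rfl
      rw [Test.sat_eq, Test.sat_eq, hgq] at h3
      have h4 := (I.mem_holes.1 hh1).2.2.2
      rw [h3.2 rfl] at h4
      exact lt_irrefl _ h4
    subst hs
    subst hgq
    rw [I.holed_eq_top] at hdz hcost
    obtain ⟨T', v, h1, h2⟩ := hz' _ _ hdz _ _ _ rfl
    refine ⟨_, _, .eqTop l r e T' v hn hg h1, ?_⟩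
    rw [hcost, Cell.weight, Cell.set]
    simp only [kid, if_true, Bool.false_eq_true, if_false]
    linarith
  · have hgq' : I.rk g < I.rk (L.get e).2 :=
      lt_of_le_of_ne (I.mem_holed.1 hgR).2.1 fun h => hgq (I.rk_injective h)
    have hmem : ∀ x ∈ I.holed l r (L.get e).1 (L.get e).2 s, I.rk g < I.rk x →
        x ∈ (Test.eq g).side I false (I.holed l r (L.get e).1 (L.get e).2 s) := by
      intro x hx hgx
      rw [Test.mem_side, Test.sat_eq]
      refine ⟨hx, ?_⟩
      simp only [Bool.false_eq_true, iff_false]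
      rintro rfl
      exact lt_irrefl _ hgx
    have hansg : ∀ x ∈ I.holed l r (L.get e).1 (L.get e).2 s, I.rk g < I.rk x →
        z.answer I g = z.answer I x := by
      intro x hx hgx
      refine answer_eq_of_same (hmem x hx hgx) fun ℓ' u y' z' RE hd' hxE => ?_
      exact Desc.same hW (.cons false (.eq g) y z _ ℓ' _ RE hd') ho hxE ((hrk _ _).1 hgx)
    have hzq : z.answer I (L.get e).2 = (L.get e).1 := by
      rwa [Tree.answer_node_of_mem (b := false)
        (by rw [Test.sat_eq]; simpa using fun h => hgq h.symm)] at hans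
    have hgc : z.answer I g = (L.get e).1 := (hansg _ hq hgq').trans hzq
    have hgnot : g ∉ I.cls (L.get e).1 := by
      intro hgin
      have h1 : z.SolvesOn I (I.holed l r (L.get e).1 (L.get e).2 s) := by
        refine ⟨ho.1.1.2.2, fun x hx => ?_⟩
        by_cases hxg : x = g
        · rw [hxg, hgc]; exact hgin
        · exact (ho.1.kid false).2 x (Test.mem_side.2 ⟨hx, by rw [Test.sat_eq]; simpa using hxg⟩)
      exact ho.not_solvesOn hW hgR hq ((hrk _ _).1 hgq') h1
    have hthr : I.rk g = I.thr l r (L.get e).1 (L.get e).2 (s + 1) := by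
      have h1 := I.mem_holed.1 hgR
      refine (I.nextRk_eq h1.1 hgnot (h1.2.2.resolve_left hgnot) fun x h2 h3 h4 => ?_).symm
      by_contra hlt
      push Not at hlt
      have hx : x ∈ I.holed l r (L.get e).1 (L.get e).2 s :=
        I.mem_holed.2 ⟨h2, h4.le.trans (I.thr_le _ _ _ _ s), .inr h4⟩
      have h5 := (ho.1.kid false).2 x (hmem x hx hlt)
      rw [kid, if_neg (by simp), ← hansg x hx hlt, hgc] at h5
      exact h3 h5
    have hgW := I.mem_holed.1 hgR
    have hholes : I.holes l r (L.get e).1 (L.get e).2 (s + 1) =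
        insert g (I.holes l r (L.get e).1 (L.get e).2 s) := by
      have h2 := hgW.2.2.resolve_left hgnot
      ext x
      rw [Finset.mem_insert, I.mem_holes, I.mem_holes, ← hthr]
      constructor
      · rintro ⟨h3, h4, h5, h6⟩
        by_cases hxg : x = g
        · exact .inl hxg
        · right
          refine ⟨h3, h4, ?_, h6⟩
          by_contra h7
          have h8 := I.le_nextRk h3 h4 (not_le.1 h7)
          have hthr2 := hthr
          rw [Instance.thr] at hthr2
          rw [← hthr2] at h8
          exact hxg (I.rk_injective (le_antisymm h8 h5))
      · rintro (rfl | ⟨h3, h4, h5, h6⟩)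
        · exact ⟨hgW.1, hgnot, le_rfl, hgq'⟩
        · exact ⟨h3, h4, by omega, h6⟩
    have hgS : g ∉ I.holes l r (L.get e).1 (L.get e).2 s := fun h => by
      have h1 := (I.mem_holes.1 h).2.2.1
      have h2 := hgW.2.2.resolve_left hgnot
      omega
    have hcard' : (I.holes l r (L.get e).1 (L.get e).2 (s + 1)).card = s + 1 := by
      rw [hholes, Finset.card_insert_of_notMem hgS, hcard]
    rw [I.holed_eq_next hgW.1 hgnot hthr] at hdz hcost
    have hqz : (L.get e).2 ∈ I.holed l r (L.get e).1 (L.get e).2 (s + 1) := by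
      rw [← I.holed_eq_next hgW.1 hgnot hthr]
      exact hmem _ hq hgq'
    have hh' : I.holes l r (L.get e).1 (L.get e).2 (s + 1) ⊆ lights I W (L.get e).2
        (ℓ ++ [(.eq g, (Test.eq g).side I (!false) (I.holed l r (L.get e).1 (L.get e).2 s))]) := by
      rw [hholes]
      refine Finset.insert_subset ?_ (hh.trans (lights_mono (List.subset_append_left _ _)))
      exact mem_lights.2 ⟨(hrk _ _).1 hgq', _, List.mem_append_right _ List.mem_cons_self⟩
    -- All `s + 1` holes are light queries tested on the path of `q`, of which there are at most
    -- eight.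
    have hs : s < 8 := by
      have h1 := hdz.card_lights_le hW hT₀ hqz
      have h2 := Finset.card_le_card hh'
      omega
    obtain ⟨T', v, h1, h2⟩ := hz _ _ hdz l r e (s + 1) rfl hqz hzq hh' hcard'
      (by rw [← hthr]; have := I.one_le_rk g; omega)
    refine ⟨_, _, .eqNext l r e s g T' v hs hgW.1 hgnot hthr hg h1, ?_⟩
    rw [hcost, Cell.weight, Cell.set]
    simp only [kid, if_true, Bool.false_eq_true, if_false]
    linarith

/-- An optimal tree is no better than what the recurrence finds. -/
theorem allBound (hL : ∀ j q, (j, q) ∈ L ↔ q ∈ I.cls j) (hW : ∀ q, 0 < W q)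
    (hrk : ∀ a b, I.rk a < I.rk b ↔ W a < W b) (hT₀ : T₀.OptOn I W Finset.univ)
    (T : Tree I.n I.p) : AllBound I L lab T₀ T := by
  refine TopBound.allBound hL hW hT₀ (W := W) ?_
  induction T with
  | leaf j => exact topBound_leaf hT₀ j
  | node u y z ihy ihz =>
    have hy := ihy.allBound hL hW hT₀
    have hz := ihz.allBound hL hW hT₀
    cases u with
    | lt k => exact topBound_lt hW hrk hT₀ ihy hy ihz hz
    | eq g => exact topBound_eq hW hrk hT₀ ihz hz

end Complete
end TwoWay

namespace TwoWay

/-! ### Optimality of the recurrence -/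

section Optimality

variable {I : Instance} {L : List (Fin I.p × Fin I.n)} {lab : Fin I.n → Fin I.p}

theorem Instance.below_univ (I : Instance) : I.below 0 (I.n - 1) (I.n + 1) = Finset.univ := by
  ext y
  have h1 := I.pos_lt_n y
  have h2 := I.rk_le y
  simp only [I.mem_below, Instance.Within, Finset.mem_univ, iff_true]
  omega

theorem Instance.isDecisionTree_iff {T : Tree I.n I.p} :
    I.IsDecisionTree T ↔ T.SolvesOn I Finset.univ := by
  simp [Instance.IsDecisionTree, Tree.SolvesOn]

theorem Instance.cost_eq (T : Tree I.n I.p) : I.cost T = T.wcost I I.weight Finset.univ := rfl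

/-- The subproblem that contains all queries. -/
def Instance.root (I : Instance) (m : ℕ) : Cell m := .all 0 (I.n - 1) (I.n + 1)

/-- Adding `δ * rk` to the weights makes them positive and distinct in the order that the recurrence
uses. `T'` gets dearer by at most `ε`, and passing back to the original weights only lowers the cost
of the tree that is optimal for the perturbed ones. -/
theorem exists_der_le (hL : ∀ j q, (j, q) ∈ L ↔ q ∈ I.cls j) {T' : Tree I.n I.p}
    (hT' : I.IsDecisionTree T') {ε : ℝ} (hε : 0 < ε) :
    ∃ T v, Der I L lab (I.root L.length) T v ∧ v ≤ I.cost T' + ε := by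
  rw [Instance.isDecisionTree_iff] at hT'
  set M : ℝ := T'.wcost I (fun q => (I.rk q : ℝ)) Finset.univ with hM
  have hM0 : 0 ≤ M := Tree.wcost_nonneg (fun q => Nat.cast_nonneg _) _ _
  -- Chosen so that `δ * M ≤ ε`; the summand `1` avoids a zero denominator.
  set δ : ℝ := ε / (M + 1) with hδ
  have hδ0 : 0 < δ := by positivity
  set W : Fin I.n → ℝ := fun q => I.weight q + δ * I.rk q with hWdef
  have hW : ∀ q, 0 < W q := fun q => by
    have h1 := I.weight_nonneg q
    have h2 : (0 : ℝ) < I.rk q := by exact_mod_cast I.one_le_rk q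
    have := mul_pos hδ0 h2
    simp only [hWdef]
    linarith
  have hlt : ∀ a b, I.rk a < I.rk b → W a < W b := fun a b h => by
    have h1 := I.weight_le h
    have h2 : (I.rk a : ℝ) < I.rk b := by exact_mod_cast h
    have := mul_lt_mul_of_pos_left h2 hδ0
    simp only [hWdef]
    linarith
  have hrk : ∀ a b, I.rk a < I.rk b ↔ W a < W b := by
    refine fun a b => ⟨hlt a b, fun h => ?_⟩
    by_contra h'
    rcases Nat.lt_or_eq_of_le (not_lt.1 h') with h2 | h2
    · exact absurd (hlt _ _ h2) h.asymm
    · rw [I.rk_injective h2] at h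
      exact lt_irrefl _ h
  obtain ⟨T₀, hT₀⟩ := exists_optOn (W := W) (fun q => (hW q).le) ⟨T', hT'⟩
  obtain ⟨T, v, h1, h2⟩ := allBound (lab := lab) hL hW hrk hT₀ T₀ _ _ (.nil _ _) 0 (I.n - 1)
    (I.n + 1) I.below_univ.symm
  refine ⟨T, v, h1, h2.trans ?_⟩
  have h3 : T₀.wcost I I.weight Finset.univ ≤ T₀.wcost I W Finset.univ :=
    Finset.sum_le_sum fun q _ => mul_le_mul_of_nonneg_right
      (by simp only [hWdef]; have := mul_nonneg hδ0.le (Nat.cast_nonneg (α := ℝ) (I.rk q)); linarith)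
      (Nat.cast_nonneg _)
  have h4 : T'.wcost I W Finset.univ = I.cost T' + δ * M := by
    rw [Instance.cost, hM, Tree.wcost, Tree.wcost, Finset.mul_sum, ← Finset.sum_add_distrib]
    exact Finset.sum_congr rfl fun q _ => by simp only [hWdef]; ring
  have h5 : δ * M ≤ ε := by
    rw [hδ, div_mul_eq_mul_div, div_le_iff₀ (by linarith)]
    nlinarith
  have h6 := hT₀.2 T' hT'
  linarith

/-- The derived trees do not depend on the perturbation, so the least derived cost is at most
`I.cost T' + ε` for every `ε > 0`. -/
theorem Der.isMinCost (hL : ∀ j q, (j, q) ∈ L ↔ q ∈ I.cls j) (hlab : ∀ y, y ∈ I.cls (lab y))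
    {T : Tree I.n I.p} {v : ℝ} (h : Der I L lab (I.root L.length) T v)
    (hv : ∀ T' v', Der I L lab (I.root L.length) T' v' → v ≤ v') :
    I.IsMinCost T ∧ v = I.cost T := by
  obtain ⟨h1, h2⟩ := h.sound (fun j q => (hL j q).1) hlab
  rw [Instance.root, Cell.set, I.below_univ] at h1 h2
  rw [Instance.IsMinCost, Instance.isDecisionTree_iff, Instance.cost_eq T, h2]
  refine ⟨⟨h1, fun T' hT' => le_of_forall_pos_le_add fun ε hε => ?_⟩, rfl⟩
  obtain ⟨T'', v'', h3, h4⟩ := exists_der_le (lab := lab) hL hT' hε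
  exact (hv _ _ h3).trans h4

theorem exists_der (hL : ∀ j q, (j, q) ∈ L ↔ q ∈ I.cls j) (hlab : ∀ y, y ∈ I.cls (lab y)) :
    (∃ T, I.IsDecisionTree T) ↔ ∃ T v, Der I L lab (I.root L.length) T v := by
  constructor
  · rintro ⟨T', hT'⟩
    obtain ⟨T, v, h, _⟩ := exists_der_le (lab := lab) hL hT' one_pos
    exact ⟨T, v, h⟩
  · rintro ⟨T, v, h⟩
    have := (h.sound (fun j q => (hL j q).1) hlab).1
    rw [Instance.root, Cell.set, I.below_univ] at this
    exact ⟨T, I.isDecisionTree_iff.2 this⟩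

theorem Instance.Lists.length_eq (hL : I.Lists L) : L.length = I.m := by
  classical
  have h1 : L.toFinset = (Finset.univ.sigma (fun j => I.cls j)).map
      ((Equiv.sigmaEquivProd _ _).toEmbedding) := by
    ext ⟨j, q⟩
    simp only [List.mem_toFinset, hL.2, Finset.mem_map, Finset.mem_sigma, Finset.mem_univ, true_and]
    constructor
    · intro h
      exact ⟨⟨j, q⟩, h, rfl⟩
    · rintro ⟨⟨j', q'⟩, h, h'⟩
      cases h'
      exact h
  rw [← List.toFinset_card_of_nodup hL.1, h1, Finset.card_map, Finset.card_sigma]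
  rfl

theorem Instance.n_le_m (I : Instance) : I.n ≤ I.m := by
  classical
  have h1 : (Finset.univ : Finset (Fin I.n)) ⊆ Finset.univ.biUnion I.cls := fun q _ => by
    obtain ⟨j, hj⟩ := I.cls_cover q
    exact Finset.mem_biUnion.2 ⟨j, Finset.mem_univ _, hj⟩
  have h2 := (Finset.card_le_card h1).trans Finset.card_biUnion_le
  rwa [Finset.card_univ, Fintype.card_fin] at h2

/-- The classes are distinct, so at most one of them is empty, and each of the others contributes at
least one pair. -/
theorem Instance.p_le (I : Instance) : I.p ≤ I.m + 1 := by
  classical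
  have h1 : (Finset.univ.filter fun j => I.cls j = ∅).card ≤ 1 :=
    Finset.card_le_one.2 fun a ha b hb => I.cls_injective (by
      rw [(Finset.mem_filter.1 ha).2, (Finset.mem_filter.1 hb).2])
  have h2 : (Finset.univ.filter fun j => ¬ I.cls j = ∅).card ≤ I.m := by
    rw [Finset.card_eq_sum_ones, Finset.sum_filter]
    refine Finset.sum_le_sum fun j _ => ?_
    by_cases h : I.cls j = ∅
    · simp [h]
    · rw [if_pos h]
      exact Finset.card_pos.2 (Finset.nonempty_iff_ne_empty.2 h)
  have h3 := Finset.card_filter_add_card_filter_not (s := (Finset.univ : Finset (Fin I.p)))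
    (fun j => I.cls j = ∅)
  rw [Finset.card_univ, Fintype.card_fin] at h3
  omega

end Optimality
end TwoWay

namespace TwoWay

/-! ### Reasoning about programs -/

/-- All words in the memory are below `X`. -/
structure Bdd (X : ℕ) (s : State) : Prop where
  wreg : ∀ x, s.wreg x < X
  warr : ∀ a i, s.warr a i < X

/-- The constants in the expression are at most `16`. -/
def WExp.plain : WExp → Bool
  | .const c => c ≤ 16
  | .reg _ => true
  | .get _ i => i.plain
  | .add e f => e.plain && f.plain
  | .sub e f => e.plain && f.plain
  | .mul e f => e.plain && f.plain

/-- The expression is short and has small constants. -/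
def WExp.ok (e : WExp) : Bool := e.plain && e.time ≤ 40

def RExp.ok : RExp → Bool
  | .zero => true
  | .reg _ => true
  | .get _ i => i.ok
  | .add e f => e.ok && f.ok

def BExp.ok : BExp → Bool
  | .wlt e f => e.ok && f.ok
  | .weq e f => e.ok && f.ok
  | .rlt e f => e.ok && f.ok
  | .not b => b.ok
  | .and b c => b.ok && c.ok
  | .or b c => b.ok && c.ok

/-- An expression evaluated with `t` operations has a value below `X ^ t`: for `a < X ^ i` and `b <
X ^ j`, both sum and product stay below `X ^ (i + j + 1)`. The exponent `k` is separate so that all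
subexpressions share one word bound. -/
theorem WExp.fits_aux {X : ℕ} (hX : 16 < X) {s : State} (hs : Bdd X s) (e : WExp)
    (he : e.plain = true) {k : ℕ} (hk : e.time ≤ k) :
    e.val s < X ^ e.time ∧ e.Fits (X ^ k) s := by
  have hX1 : 1 ≤ X := by omega
  have hmono : ∀ i j, i ≤ j → X ^ i ≤ X ^ j := fun i j h => Nat.pow_le_pow_right hX1 h
  have hadd : ∀ a b i j, a < X ^ i → b < X ^ j → a + b < X ^ (i + j + 1) := fun a b i j h1 h2 => by
    have h3 := hmono i (i + j) (by omega)
    have h4 := hmono j (i + j) (by omega)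
    rw [pow_succ]
    have : X ^ (i + j) * 2 ≤ X ^ (i + j) * X := Nat.mul_le_mul_left _ (by omega)
    omega
  have hmul : ∀ a b i j, a < X ^ i → b < X ^ j → a * b < X ^ (i + j + 1) := fun a b i j h1 h2 => by
    refine (Nat.mul_lt_mul'' h1 h2).trans_le ?_
    rw [← pow_add]
    exact hmono _ _ (by omega)
  induction e generalizing k with
  | const c =>
    simp only [WExp.plain, decide_eq_true_eq] at he
    simp only [WExp.time] at hk
    have := hmono 1 k hk
    rw [pow_one] at this
    simp only [WExp.val, WExp.time, WExp.Fits, pow_one]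
    omega
  | reg x =>
    simp only [WExp.time] at hk
    have := hmono 1 k hk
    rw [pow_one] at this
    simp only [WExp.val, WExp.time, WExp.Fits, pow_one]
    have := hs.wreg x
    omega
  | get a i ih =>
    simp only [WExp.plain, WExp.time] at he hk
    have h1 := (ih he (k := k) (by omega)).2
    have h2 := hs.warr a (i.val s)
    have h3 := hmono 1 k (by omega)
    have h4 := hmono 1 (i.time + 1) (by omega)
    rw [pow_one] at h3 h4
    simp only [WExp.val, WExp.time, WExp.Fits]
    exact ⟨by omega, h1, by omega⟩
  | add e f ihe ihf =>
    simp only [WExp.plain, Bool.and_eq_true, WExp.time] at he hk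
    have h1 := ihe he.1 (k := k) (by omega)
    have h2 := ihf he.2 (k := k) (by omega)
    have h3 := hadd _ _ _ _ h1.1 h2.1
    exact ⟨h3, h1.2, h2.2, h3.trans_le (hmono _ _ hk)⟩
  | sub e f ihe ihf =>
    simp only [WExp.plain, Bool.and_eq_true, WExp.time] at he hk
    have h1 := ihe he.1 (k := k) (by omega)
    have h2 := ihf he.2 (k := k) (by omega)
    have h3 := hmono e.time (e.time + f.time + 1) (by omega)
    refine ⟨?_, h1.2, h2.2⟩
    simp only [WExp.val, WExp.time]
    omega
  | mul e f ihe ihf =>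
    simp only [WExp.plain, Bool.and_eq_true, WExp.time] at he hk
    have h1 := ihe he.1 (k := k) (by omega)
    have h2 := ihf he.2 (k := k) (by omega)
    have h3 := hmul _ _ _ _ h1.1 h2.1
    exact ⟨h3, h1.2, h2.2, h3.trans_le (hmono _ _ hk)⟩

theorem WExp.fits {X : ℕ} (hX : 16 < X) {s : State} (hs : Bdd X s) {e : WExp}
    (he : e.ok = true) : e.Fits (X ^ 40) s := by
  simp only [WExp.ok, Bool.and_eq_true, decide_eq_true_eq] at he
  exact (e.fits_aux hX hs he.1 he.2).2

theorem RExp.fits {X : ℕ} (hX : 16 < X) {s : State} (hs : Bdd X s) {e : RExp}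
    (he : e.ok = true) : e.Fits (X ^ 40) s := by
  induction e with
  | zero => trivial
  | reg x => trivial
  | get a i => exact WExp.fits hX hs he
  | add e f ihe ihf =>
    simp only [RExp.ok, Bool.and_eq_true] at he
    exact ⟨ihe he.1, ihf he.2⟩

theorem BExp.fits {X : ℕ} (hX : 16 < X) {s : State} (hs : Bdd X s) {b : BExp}
    (hb : b.ok = true) : b.Fits (X ^ 40) s := by
  induction b with
  | wlt e f =>
    simp only [BExp.ok, Bool.and_eq_true] at hb
    exact ⟨WExp.fits hX hs hb.1, WExp.fits hX hs hb.2⟩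
  | weq e f =>
    simp only [BExp.ok, Bool.and_eq_true] at hb
    exact ⟨WExp.fits hX hs hb.1, WExp.fits hX hs hb.2⟩
  | rlt e f =>
    simp only [BExp.ok, Bool.and_eq_true] at hb
    exact ⟨RExp.fits hX hs hb.1, RExp.fits hX hs hb.2⟩
  | not b ih => exact ih hb
  | and b c ihb ihc =>
    simp only [BExp.ok, Bool.and_eq_true] at hb
    exact ⟨ihb hb.1, ihc hb.2⟩
  | or b c ihb ihc =>
    simp only [BExp.ok, Bool.and_eq_true] at hb
    exact ⟨ihb hb.1, ihc hb.2⟩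

/-! #### Memory accesses -/

section Memory

variable (s : State) (x y a i j v : ℕ) (w : ℝ)

@[simp] theorem State.setW_wreg : (s.setW x v).wreg y = if y = x then v else s.wreg y := by
  simp [State.setW, Function.update_apply]

@[simp] theorem State.setW_rreg : (s.setW x v).rreg = s.rreg := rfl

@[simp] theorem State.setW_warr : (s.setW x v).warr = s.warr := rfl

@[simp] theorem State.setW_rarr : (s.setW x v).rarr = s.rarr := rfl

@[simp] theorem State.setR_wreg : (s.setR x w).wreg = s.wreg := rfl

@[simp] theorem State.setR_rreg : (s.setR x w).rreg y = if y = x then w else s.rreg y := by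
  simp [State.setR, Function.update_apply]

@[simp] theorem State.setR_warr : (s.setR x w).warr = s.warr := rfl

@[simp] theorem State.setR_rarr : (s.setR x w).rarr = s.rarr := rfl

@[simp] theorem State.putW_wreg : (s.putW a i v).wreg = s.wreg := rfl

@[simp] theorem State.putW_rreg : (s.putW a i v).rreg = s.rreg := rfl

@[simp] theorem State.putW_warr : (s.putW a i v).warr y =
    if y = a then Function.update (s.warr a) i v else s.warr y := by
  simp only [State.putW, Function.update_apply]

@[simp] theorem State.putW_rarr : (s.putW a i v).rarr = s.rarr := rfl

@[simp] theorem State.putR_wreg : (s.putR a i w).wreg = s.wreg := rfl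

@[simp] theorem State.putR_rreg : (s.putR a i w).rreg = s.rreg := rfl

@[simp] theorem State.putR_warr : (s.putR a i w).warr = s.warr := rfl

@[simp] theorem State.putR_rarr : (s.putR a i w).rarr y =
    if y = a then Function.update (s.rarr a) i w else s.rarr y := by
  simp only [State.putR, Function.update_apply]

end Memory

/-! #### What a program writes -/

/-- The program writes to word register `x`. -/
def Prog.wW (x : ℕ) : Prog → Bool
  | .setW y _ => Nat.beq y x
  | .seq P R => P.wW x || R.wW x
  | .cond _ P R => P.wW x || R.wW x
  | .loop _ P => P.wW x
  | _ => false

/-- The program writes to real register `x`. -/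
def Prog.wR (x : ℕ) : Prog → Bool
  | .setR y _ => Nat.beq y x
  | .seq P R => P.wR x || R.wR x
  | .cond _ P R => P.wR x || R.wR x
  | .loop _ P => P.wR x
  | _ => false

/-- The program writes to word array `x`. -/
def Prog.aW (x : ℕ) : Prog → Bool
  | .putW y _ _ => Nat.beq y x
  | .seq P R => P.aW x || R.aW x
  | .cond _ P R => P.aW x || R.aW x
  | .loop _ P => P.aW x
  | _ => false

/-- The program writes to real array `x`. -/
def Prog.aR (x : ℕ) : Prog → Bool
  | .putR y _ _ => Nat.beq y x
  | .seq P R => P.aR x || R.aR x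
  | .cond _ P R => P.aR x || R.aR x
  | .loop _ P => P.aR x
  | _ => false

/-- The states agree except where the program writes. -/
structure Frame (P : Prog) (s s' : State) : Prop where
  w : ∀ x, P.wW x = false → s'.wreg x = s.wreg x
  r : ∀ x, P.wR x = false → s'.rreg x = s.rreg x
  a : ∀ x, P.aW x = false → s'.warr x = s.warr x
  b : ∀ x, P.aR x = false → s'.rarr x = s.rarr x

theorem Frame.refl (P : Prog) (s : State) : Frame P s s :=
  ⟨fun _ _ => rfl, fun _ _ => rfl, fun _ _ => rfl, fun _ _ => rfl⟩

theorem Frame.mono {P R : Prog} {s s' : State} (h : Frame P s s')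
    (hw : ∀ x, R.wW x = false → P.wW x = false) (hr : ∀ x, R.wR x = false → P.wR x = false)
    (ha : ∀ x, R.aW x = false → P.aW x = false) (hb : ∀ x, R.aR x = false → P.aR x = false) :
    Frame R s s' :=
  ⟨fun x hx => h.w x (hw x hx), fun x hx => h.r x (hr x hx), fun x hx => h.a x (ha x hx),
    fun x hx => h.b x (hb x hx)⟩

theorem Frame.trans {P : Prog} {s s' s'' : State} (h : Frame P s s') (h' : Frame P s' s'') :
    Frame P s s'' :=
  ⟨fun x hx => (h'.w x hx).trans (h.w x hx), fun x hx => (h'.r x hx).trans (h.r x hx),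
    fun x hx => (h'.a x hx).trans (h.a x hx), fun x hx => (h'.b x hx).trans (h.b x hx)⟩

theorem nat_beq_false {y x : ℕ} (h : Nat.beq y x = false) : x ≠ y := by
  rintro rfl
  simp at h

/-- What a program writes is read off its syntax. So the side conditions for carrying an invariant
past a subprogram are Boolean computations, proved by `rfl`. -/
theorem Exec.frame {B : ℕ} {P : Prog} {s s' : State} {t : ℕ} (h : Exec B P s t s') :
    Frame P s s' := by
  induction h with
  | skip s => exact Frame.refl _ _
  | setW s x e h =>
    refine ⟨fun y hy => ?_, fun _ _ => rfl, fun _ _ => rfl, fun _ _ => rfl⟩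
    rw [State.setW_wreg, if_neg (nat_beq_false hy)]
  | setR s x e h =>
    refine ⟨fun _ _ => rfl, fun y hy => ?_, fun _ _ => rfl, fun _ _ => rfl⟩
    rw [State.setR_rreg, if_neg (nat_beq_false hy)]
  | putW s a i e hi h =>
    refine ⟨fun _ _ => rfl, fun _ _ => rfl, fun y hy => ?_, fun _ _ => rfl⟩
    rw [State.putW_warr, if_neg (nat_beq_false hy)]
  | putR s a i e hi h =>
    refine ⟨fun _ _ => rfl, fun _ _ => rfl, fun _ _ => rfl, fun y hy => ?_⟩
    rw [State.putR_rarr, if_neg (nat_beq_false hy)]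
  | seq P R s₀ s₁ s₂ t₁ t₂ h₁ h₂ ih₁ ih₂ =>
    refine (ih₁.mono ?_ ?_ ?_ ?_).trans (ih₂.mono ?_ ?_ ?_ ?_) <;> intro x hx <;>
      simp only [Prog.wW, Prog.wR, Prog.aW, Prog.aR, Bool.or_eq_false_iff] at hx <;>
      first | exact hx.1 | exact hx.2
  | cond_true b P R s s' t hf hb h ih =>
    refine ih.mono ?_ ?_ ?_ ?_ <;> intro x hx <;>
      simp only [Prog.wW, Prog.wR, Prog.aW, Prog.aR, Bool.or_eq_false_iff] at hx <;> exact hx.1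
  | cond_false b P R s s' t hf hb h ih =>
    refine ih.mono ?_ ?_ ?_ ?_ <;> intro x hx <;>
      simp only [Prog.wW, Prog.wR, Prog.aW, Prog.aR, Bool.or_eq_false_iff] at hx <;> exact hx.2
  | loop_true b P s₀ s₁ s₂ t₁ t₂ hf hb h₁ h₂ ih₁ ih₂ =>
    exact (ih₁.mono (R := .loop b P) (fun x hx => hx) (fun x hx => hx) (fun x hx => hx) (fun x hx => hx)).trans ih₂
  | loop_false b P s hf hb => exact Frame.refl _ _

/-! #### Total correctness with time bounds -/

/-- Started in `s`, the program halts within `T` steps in a state that satisfies `Q`. -/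
def Run (X : ℕ) (P : Prog) (T : ℕ) (s : State) (Q : State → Prop) : Prop :=
  ∃ t ≤ T, ∃ s', Exec (X ^ 40) P s t s' ∧ Bdd X s' ∧ Q s'

theorem Run.mono {X : ℕ} {P : Prog} {T T' : ℕ} {s : State} {Q Q' : State → Prop}
    (h : Run X P T s Q) (hT : T ≤ T') (hQ : ∀ s', Bdd X s' → Frame P s s' → Q s' → Q' s') :
    Run X P T' s Q' := by
  obtain ⟨t, ht, s', h1, h2, h3⟩ := h
  exact ⟨t, ht.trans hT, s', h1, h2, hQ s' h2 h1.frame h3⟩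

theorem Run.seq {X : ℕ} {P R : Prog} {T T' T'' : ℕ} {s : State} {Q Q' : State → Prop}
    (h : Run X P T s Q) (h' : ∀ s', Bdd X s' → Frame P s s' → Q s' → Run X R T' s' Q')
    (hT : T + T' ≤ T'') : Run X (.seq P R) T'' s Q' := by
  obtain ⟨t, ht, s', h1, h2, h3⟩ := h
  obtain ⟨t', ht', s'', h1', h2', h3'⟩ := h' s' h2 h1.frame h3
  exact ⟨t + t', by omega, s'', .seq _ _ _ _ _ _ _ h1 h1', h2', h3'⟩

theorem Run.cond {X : ℕ} (hX : 16 < X) {b : BExp} {P R : Prog} {T T' : ℕ} {s : State}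
    {Q : State → Prop} (hs : Bdd X s) (hb : b.ok = true) (h : b.Holds s → Run X P T s Q)
    (h' : ¬ b.Holds s → Run X R T s Q) (hT : b.time + T + 1 ≤ T') :
    Run X (.cond b P R) T' s Q := by
  have hf := BExp.fits hX hs hb
  by_cases hbs : b.Holds s
  · obtain ⟨t, ht, s', h1, h2, h3⟩ := h hbs
    exact ⟨_, by omega, s', .cond_true _ _ _ _ _ _ hf hbs h1, h2, h3⟩
  · obtain ⟨t, ht, s', h1, h2, h3⟩ := h' hbs
    exact ⟨_, by omega, s', .cond_false _ _ _ _ _ _ hf hbs h1, h2, h3⟩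

/-- The weakest precondition of a program without loops. -/
def Prog.wp (X : ℕ) : Prog → (State → Prop) → State → Prop
  | .skip, Q, s => Q s
  | .setW x e, Q, s => e.val s < X ∧ Q (s.setW x (e.val s))
  | .setR x e, Q, s => Q (s.setR x (e.val s))
  | .putW a i e, Q, s => e.val s < X ∧ Q (s.putW a (i.val s) (e.val s))
  | .putR a i e, Q, s => Q (s.putR a (i.val s) (e.val s))
  | .seq P R, Q, s => P.wp X (R.wp X Q) s
  | .cond b P R, Q, s => (b.Holds s → P.wp X Q s) ∧ (¬ b.Holds s → R.wp X Q s)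
  | .loop _ _, _, _ => False

/-- An upper bound for the running time of a program without loops. -/
def Prog.tmax : Prog → ℕ
  | .skip => 1
  | .setW _ e => e.time + 1
  | .setR _ e => e.time + 1
  | .putW _ i e => i.time + e.time + 1
  | .putR _ i e => i.time + e.time + 1
  | .seq P R => P.tmax + R.tmax
  | .cond b P R => b.time + (P.tmax + R.tmax) + 1
  | .loop _ _ => 0

/-- All expressions in the program are short and have small constants. -/
def Prog.ok : Prog → Bool
  | .skip => true
  | .setW _ e => e.ok
  | .setR _ e => e.ok
  | .putW _ i e => i.ok && e.ok
  | .putR _ i e => i.ok && e.ok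
  | .seq P R => P.ok && R.ok
  | .cond b P R => b.ok && P.ok && R.ok
  | .loop b P => b.ok && P.ok

theorem Bdd.setW {X : ℕ} {s : State} (hs : Bdd X s) {x v : ℕ} (hv : v < X) :
    Bdd X (s.setW x v) := by
  refine ⟨fun y => ?_, hs.warr⟩
  rw [State.setW_wreg]
  split_ifs
  · exact hv
  · exact hs.wreg y

theorem Bdd.putW {X : ℕ} {s : State} (hs : Bdd X s) {a i v : ℕ} (hv : v < X) :
    Bdd X (s.putW a i v) := by
  refine ⟨hs.wreg, fun b j => ?_⟩
  rw [State.putW_warr]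
  split_ifs
  · rw [Function.update_apply]
    split_ifs
    · exact hv
    · exact hs.warr a j
  · exact hs.warr b j

/-- The weakest precondition asks only that values written to memory are below `X`. Intermediate
values are controlled by the length of the expressions, which is what the larger word bound `X ^ 40`
is for. -/
theorem Run.flat {X : ℕ} (hX : 16 < X) {P : Prog} {s : State} {Q : State → Prop} (hs : Bdd X s)
    (hP : P.ok = true) (h : P.wp X Q s) {T : ℕ} (hT : P.tmax ≤ T) : Run X P T s Q := by
  induction P generalizing s Q T with
  | skip => exact ⟨1, hT, s, .skip s, hs, h⟩
  | setW x e => exact ⟨_, hT, _, .setW s x e (WExp.fits hX hs hP), hs.setW h.1, h.2⟩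
  | setR x e => exact ⟨_, hT, _, .setR s x e (RExp.fits hX hs hP), ⟨hs.wreg, hs.warr⟩, h⟩
  | putW a i e =>
    simp only [Prog.ok, Bool.and_eq_true] at hP
    exact ⟨_, hT, _, .putW s a i e (WExp.fits hX hs hP.1) (WExp.fits hX hs hP.2), hs.putW h.1, h.2⟩
  | putR a i e =>
    simp only [Prog.ok, Bool.and_eq_true] at hP
    exact ⟨_, hT, _, .putR s a i e (WExp.fits hX hs hP.1) (RExp.fits hX hs hP.2),
      ⟨hs.wreg, hs.warr⟩, h⟩
  | seq P R ihP ihR =>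
    simp only [Prog.ok, Bool.and_eq_true] at hP
    exact (ihP hs hP.1 h le_rfl).seq (fun s' hs' _ h' => ihR hs' hP.2 h' le_rfl) hT
  | cond b P R ihP ihR =>
    simp only [Prog.ok, Bool.and_eq_true] at hP
    exact Run.cond hX hs hP.1.1 (fun hb => ihP hs hP.1.2 (h.1 hb) (Nat.le_add_right _ _))
      (fun hb => ihR hs hP.2 (h.2 hb) (Nat.le_add_left _ _)) hT
  | loop b P => exact h.elim

/-- The loop that lets word register `i` run from `0` to the value of word register `N`. -/
def Prog.for (i N : ℕ) (P : Prog) : Prog :=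
  .seq (.setW i (.const 0))
    (.loop (.wlt (.reg i) (.reg N)) (.seq P (.setW i (.add (.reg i) (.const 1)))))

/-- The time bound may depend on the iteration. The amortized count over the pairs in
`pairLoop_spec` and over the ranks in `intervalProg_spec` relies on this. -/
theorem Run.for {X : ℕ} (hX : 16 < X) {i N : ℕ} {P : Prog} (hiN : Nat.beq i N = false)
    (hi : P.wW i = false) (hN : P.wW N = false) {s : State} (hs : Bdd X s)
    (Inv : ℕ → State → Prop) (T : ℕ → ℕ) (h0 : Inv 0 (s.setW i 0))
    (hstep : ∀ j < s.wreg N, ∀ s₁, Bdd X s₁ → Frame (.for i N P) s s₁ → s₁.wreg i = j → Inv j s₁ →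
      Run X P (T j) s₁ fun s₂ => Inv (j + 1) (s₂.setW i (j + 1))) {T' : ℕ}
    (hT : (∑ j ∈ Finset.range (s.wreg N), (T j + 8)) + 8 ≤ T') :
    Run X (.for i N P) T' s (Inv (s.wreg N)) := by
  have hiN' : i ≠ N := fun h => nat_beq_false hiN h.symm
  have key : ∀ d j s₁, j + d = s.wreg N → Bdd X s₁ → Frame (.for i N P) s s₁ → s₁.wreg i = j →
      Inv j s₁ → Run X (.loop (.wlt (.reg i) (.reg N)) (.seq P (.setW i (.add (.reg i) (.const 1)))))
        ((∑ j ∈ Finset.Ico j (s.wreg N), (T j + 8)) + 4) s₁ (Inv (s.wreg N)) := by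
    intro d
    induction d with
    | zero =>
      intro j s₁ hj hs₁ hf h1 h2
      have hNs : s₁.wreg N = s.wreg N := hf.w N (by simp [Prog.for, Prog.wW, hN, hiN])
      refine ⟨4, by omega, s₁, ?_, hs₁, by rwa [← hj]⟩
      refine Exec.loop_false _ _ _ (BExp.fits hX hs₁ rfl) ?_
      simp only [BExp.Holds, WExp.val]
      omega
    | succ d ih =>
      intro j s₁ hj hs₁ hf h1 h2
      have hNs : s₁.wreg N = s.wreg N := hf.w N (by simp [Prog.for, Prog.wW, hN, hiN])
      obtain ⟨t, ht, s₂, h3, h4, h5⟩ := hstep j (by omega) s₁ hs₁ hf h1 h2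
      have hf2 := h3.frame
      have h6 : s₂.wreg i = j := (hf2.w i hi).trans h1
      have h7 : (WExp.add (.reg i) (.const 1)).val s₂ = j + 1 := by simp [WExp.val, h6]
      -- The incremented counter is at most the limit, which is itself a stored word.
      have h8 : j + 1 < X := by
        have := hs.wreg N
        omega
      have hf3 : Frame (.for i N P) s₁ (s₂.setW i (j + 1)) := by
        have e := Exec.seq P (.setW i (.add (.reg i) (.const 1))) _ _ _ _ _ h3
          (.setW s₂ i (.add (.reg i) (.const 1)) (WExp.fits hX h4 rfl))
        rw [h7] at e
        refine e.frame.mono ?_ ?_ ?_ ?_ <;> intro x hx <;>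
          simp only [Prog.for, Prog.wW, Prog.wR, Prog.aW, Prog.aR, Bool.or_eq_false_iff] at hx ⊢ <;>
          tauto
      obtain ⟨t', ht', s₃, h9, h10, h11⟩ := ih (j + 1) (s₂.setW i (j + 1)) (by omega)
        (h4.setW h8) (hf.trans hf3) (by simp) h5
      refine ⟨_, ?_, s₃, Exec.loop_true _ _ s₁ (s₂.setW i (j + 1)) s₃ _ t' (BExp.fits hX hs₁ rfl) ?_
        (.seq _ _ _ s₂ _ t _ h3 (by rw [← h7]; exact .setW s₂ i _ (WExp.fits hX h4 rfl))) h9, h10,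
        h11⟩
      · rw [Finset.sum_eq_sum_Ico_succ_bot (by omega)]
        simp only [BExp.time, WExp.time]
        omega
      · simp only [BExp.Holds, WExp.val]
        omega
  have h1 := key (s.wreg N) 0 (s.setW i 0) (by omega) (hs.setW (by omega)) ?_ (by simp) h0
  · refine Run.seq (Q := fun s' => s' = s.setW i 0) (T := 2) (Run.flat hX hs rfl ?_ le_rfl)
      ?_ (le_trans (by omega) hT) (T' := (∑ j ∈ Finset.range (s.wreg N), (T j + 8)) + 6)
    · simp only [Prog.wp, WExp.val, and_true]; omega
    · rintro s' _ _ rfl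
      rw [Finset.range_eq_Ico]
      exact h1.mono (by omega) fun _ _ _ h => h
  · refine ⟨fun x hx => ?_, fun _ _ => rfl, fun _ _ => rfl, fun _ _ => rfl⟩
    simp only [Prog.for, Prog.wW, Bool.or_eq_false_iff] at hx
    rw [State.setW_wreg, if_neg (nat_beq_false hx.1)]

/-- The rule for loops whose iterations all have the same time bound. -/
theorem Run.for_const {X : ℕ} (hX : 16 < X) {i N : ℕ} {P : Prog} (hiN : Nat.beq i N = false)
    (hi : P.wW i = false) (hN : P.wW N = false) {s : State} (hs : Bdd X s)
    (Inv : ℕ → State → Prop) (T : ℕ) (h0 : Inv 0 (s.setW i 0))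
    (hstep : ∀ j < s.wreg N, ∀ s₁, Bdd X s₁ → Frame (.for i N P) s s₁ → s₁.wreg i = j → Inv j s₁ →
      Run X P T s₁ fun s₂ => Inv (j + 1) (s₂.setW i (j + 1))) {T' : ℕ}
    (hT : s.wreg N * (T + 8) + 8 ≤ T') : Run X (.for i N P) T' s (Inv (s.wreg N)) := by
  refine Run.for hX hiN hi hN hs Inv (fun _ => T) h0 hstep ?_
  simpa using hT

/-- The rule for loops that consume a supply. -/
theorem Run.while {X : ℕ} (hX : 16 < X) {b : BExp} {P : Prog} (hb : b.ok = true) {T : ℕ}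
    (Inv : ℕ → State → Prop)
    (hstep : ∀ k s, Bdd X s → Inv k s → b.Holds s →
      Run X P T s fun s' => ∃ k' < k, Inv k' s') {k : ℕ} {s : State} (hs : Bdd X s)
    (h : Inv k s) {T' : ℕ} (hT : (k + 1) * (b.time + T + 1) ≤ T') :
    Run X (.loop b P) T' s fun s' => (∃ k, Inv k s') ∧ ¬ b.Holds s' := by
  induction k using Nat.strong_induction_on generalizing s T' with
  | _ k ih =>
    have hf := BExp.fits hX hs hb
    by_cases hbs : b.Holds s
    · obtain ⟨t, ht, s', h1, h2, k', hk', h3⟩ := hstep k s hs h hbs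
      obtain ⟨t', ht', s'', h4, h5, h6⟩ := ih k' hk' h2 h3 le_rfl
      refine ⟨_, ?_, s'', .loop_true _ _ _ s' _ t t' hf hbs h1 h4, h5, h6⟩
      have h7 : (k' + 1 + 1) * (b.time + T + 1) ≤ (k + 1) * (b.time + T + 1) :=
        Nat.mul_le_mul_right _ (by omega)
      rw [Nat.add_mul (k' + 1)] at h7
      omega
    · refine ⟨_, ?_, s, .loop_false _ _ _ hf hbs, hs, ⟨k, h⟩, hbs⟩
      rw [Nat.add_mul] at hT
      omega

end TwoWay

namespace TwoWay

/-! ### Preprocessing -/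

/-- The programs one after the other. -/
def Prog.block : List Prog → Prog
  | [] => .skip
  | P :: l => .seq P (Prog.block l)

attribute [simp] Prog.block Prog.wp BExp.Holds RExp.val WExp.val

/-- The sum of the first terms. -/
def psum {M : Type*} [AddCommMonoid M] {n : ℕ} (f : Fin n → M) (j : ℕ) : M :=
  ∑ i : Fin n, if (i : ℕ) < j then f i else 0

theorem psum_zero {M : Type*} [AddCommMonoid M] {n : ℕ} (f : Fin n → M) : psum f 0 = 0 := by
  simp [psum]

theorem psum_succ {M : Type*} [AddCommMonoid M] {n : ℕ} (f : Fin n → M) {j : ℕ} (hj : j < n) :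
    psum f (j + 1) = psum f j + f ⟨j, hj⟩ := by
  have : f ⟨j, hj⟩ = ∑ i : Fin n, if i = ⟨j, hj⟩ then f i else 0 := by simp
  rw [this, psum, psum, ← Finset.sum_add_distrib]
  refine Finset.sum_congr rfl fun i _ => ?_
  have : i = ⟨j, hj⟩ ↔ (i : ℕ) = j := Fin.ext_iff
  by_cases h1 : (i : ℕ) < j
  · simp [h1, this, h1.ne, Nat.lt_succ_of_lt h1]
  · by_cases h2 : (i : ℕ) = j
    · simp [h2, this]
    · have h3 : ¬ (i : ℕ) < j + 1 := by omega
      simp [h1, h3, this, h2]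

theorem psum_all {M : Type*} [AddCommMonoid M] {n : ℕ} (f : Fin n → M) :
    psum f n = ∑ i, f i := by
  simp [psum]

theorem psum_le {n : ℕ} {p : Fin n → Prop} [DecidablePred p] (j : ℕ) :
    psum (fun i => if p i then 1 else 0) j ≤ (Finset.univ.filter p).card := by
  rw [psum, Finset.card_filter]
  exact Finset.sum_le_sum fun i _ => by split_ifs <;> simp

theorem psum_card {n : ℕ} {p : Fin n → Prop} [DecidablePred p] :
    psum (fun i => if p i then 1 else 0) n = (Finset.univ.filter p).card := by
  rw [psum_all, Finset.card_filter]

variable {I : Instance} {L : List (Fin I.p × Fin I.n)}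

/-- The memory holds the instance. -/
structure Given (I : Instance) (L : List (Fin I.p × Fin I.n)) (s : State) : Prop where
  n : s.wreg 0 = I.n
  m : s.wreg 2 = L.length
  key : ∀ y : Fin I.n, s.warr 0 y = 1 ↔ y ∈ I.keys
  cls : ∀ e : Fin L.length, s.warr 1 e = (L.get e).1
  qry : ∀ e : Fin L.length, s.warr 2 e = (L.get e).2
  query : ∀ y : Fin I.n, s.rarr 0 y = I.query y
  weight : ∀ y : Fin I.n, s.rarr 1 y = I.weight y

/-- The program does not destroy the instance. -/
def Prog.spares (P : Prog) : Bool :=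
  !(P.wW 0 || P.wW 2 || P.aW 0 || P.aW 1 || P.aW 2 || P.aR 0 || P.aR 1)

theorem Given.frame {P : Prog} {s s' : State} (h : Given I L s) (hf : Frame P s s')
    (hP : P.spares = true) : Given I L s' := by
  simp only [Prog.spares, Bool.not_eq_true', Bool.or_eq_false_iff] at hP
  obtain ⟨⟨⟨⟨⟨⟨h0, h2⟩, h3⟩, h4⟩, h5⟩, h6⟩, h7⟩ := hP
  constructor
  · rw [hf.w 0 h0]; exact h.n
  · rw [hf.w 2 h2]; exact h.m
  · rw [hf.a 0 h3]; exact h.key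
  · rw [hf.a 1 h4]; exact h.cls
  · rw [hf.a 2 h5]; exact h.qry
  · rw [hf.b 0 h6]; exact h.query
  · rw [hf.b 1 h7]; exact h.weight

/-- Counts the queries below and the queries lighter than the one in register `8`. -/
def rankLoop : Prog :=
  .for 9 0 (.block [
    .cond (.rlt (.get 0 (.reg 9)) (.get 0 (.reg 8))) (.setW 10 (.add (.reg 10) (.const 1))) .skip,
    .cond (.or (.rlt (.get 1 (.reg 9)) (.get 1 (.reg 8)))
        (.and (.not (.rlt (.get 1 (.reg 8)) (.get 1 (.reg 9)))) (.wlt (.reg 9) (.reg 8))))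
      (.setW 11 (.add (.reg 11) (.const 1))) .skip])

open Classical in
theorem rankLoop_spec {X : ℕ} (hX : 16 < X) {s : State} (hs : Bdd X s) (hn : I.n + 2 < X) (h : Given I L s)
    (y : Fin I.n) (hy : s.wreg 8 = y) (h10 : s.wreg 10 = 0) (h11 : s.wreg 11 = 1) :
    Run X rankLoop (108 * I.n + 8) s fun s' => s'.wreg 10 = I.pos y ∧ s'.wreg 11 = I.rk y := by
  have key := Run.for_const hX (i := 9) (N := 0) (P := .block [
    .cond (.rlt (.get 0 (.reg 9)) (.get 0 (.reg 8))) (.setW 10 (.add (.reg 10) (.const 1))) .skip,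
    .cond (.or (.rlt (.get 1 (.reg 9)) (.get 1 (.reg 8)))
        (.and (.not (.rlt (.get 1 (.reg 8)) (.get 1 (.reg 9)))) (.wlt (.reg 9) (.reg 8))))
      (.setW 11 (.add (.reg 11) (.const 1))) .skip]) rfl rfl rfl hs
    (fun j s => s.wreg 10 = psum (fun i => if I.query i < I.query y then 1 else 0) j ∧
      s.wreg 11 = psum (fun i => if I.lighter i y then 1 else 0) j + 1) 100
    (T' := 108 * I.n + 8) ?_ ?_ ?_
  · refine key.mono le_rfl ?_
    rintro s' _ _ ⟨h1, h2⟩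
    rw [h.n, psum_card] at h1 h2
    exact ⟨h1, h2⟩
  · simp [psum_zero, h10, h11]
  · rintro j hj s₁ hs₁ hf hj' ⟨h1, h2⟩
    rw [h.n] at hj
    have hg := h.frame hf rfl
    have h8 : s₁.wreg 8 = y := (hf.w 8 rfl).trans hy
    have b1 := psum_le (p := fun i => I.query i < I.query y) j
    have b2 := psum_le (p := fun i => I.lighter i y) j
    have b3 := I.pos_lt_n y
    have b4 := I.rk_le y
    rw [Instance.pos] at b3
    rw [Instance.rk] at b4
    refine Run.flat hX hs₁ rfl ?_ (by decide)
    have e1 := hg.query ⟨j, hj⟩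
    have e2 := hg.weight ⟨j, hj⟩
    simp only at e1 e2
    -- Reals can only be compared by `<`. Once the first disjunct fails, the negated reverse
    -- comparison expresses equality of the weights.
    have e3 : I.lighter ⟨j, hj⟩ y ↔ (I.weight ⟨j, hj⟩ < I.weight y ∨
        ¬ I.weight y < I.weight ⟨j, hj⟩ ∧ j < (y : ℕ)) := by
      rw [Instance.lighter, Fin.lt_def]
      constructor
      · rintro (h | ⟨h, h'⟩)
        · exact .inl h
        · exact .inr ⟨h.le.not_gt, h'⟩
      · rintro (h | ⟨h, h'⟩)
        · exact .inl h
        · rcases (not_lt.1 h).lt_or_eq with h | h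
          · exact .inl h
          · exact .inr ⟨h, h'⟩
    have b5 : psum (fun i => if I.query i < I.query y then 1 else 0) j + 1 < X := by omega
    have b6 : psum (fun i => if I.lighter i y then 1 else 0) j + 1 + 1 < X := by omega
    by_cases c1 : I.query ⟨j, hj⟩ < I.query y <;> by_cases c2 : I.lighter ⟨j, hj⟩ y <;>
      simp [-not_lt, hj', h8, e1, e2, hg.query, hg.weight, h1, h2, psum_succ _ hj, ← e3, c1, c2,
        b5, b6]
  · rw [h.n]; omega

/-- Computes the positions, the ranks, and the queries in the order of their ranks. -/
def rankProg : Prog :=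
  .for 8 0 (.block [.setW 10 (.const 0), .setW 11 (.const 1), rankLoop,
    .putW 3 (.reg 8) (.reg 10), .putW 4 (.reg 8) (.reg 11),
    .putW 7 (.sub (.reg 11) (.const 1)) (.reg 8)])

/-- The arrays `3`, `4` and `7` hold the positions, the ranks, and the queries in the order of
their ranks. -/
def Ranked (I : Instance) (s : State) (y : Fin I.n) : Prop :=
  s.warr 3 y = I.pos y ∧ s.warr 4 y = I.rk y ∧ s.warr 7 (I.rk y - 1) = y

theorem rankProg_spec {X : ℕ} (hX : 16 < X) {s : State} (hs : Bdd X s) (hn : I.n + 2 < X)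
    (h : Given I L s) :
    Run X rankProg (1000 * (I.n * I.n)) s fun s' => ∀ y, Ranked I s' y := by
  have hn0 := I.n_pos
  have key := Run.for_const hX (i := 8) (N := 0) (P := .block [.setW 10 (.const 0),
    .setW 11 (.const 1), rankLoop, .putW 3 (.reg 8) (.reg 10), .putW 4 (.reg 8) (.reg 11),
    .putW 7 (.sub (.reg 11) (.const 1)) (.reg 8)]) rfl rfl rfl hs
    (fun j s => ∀ y : Fin I.n, (y : ℕ) < j → Ranked I s y) (108 * I.n + 100)
    (T' := 1000 * (I.n * I.n)) (by simp) ?_ (by rw [h.n]; nlinarith)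
  · refine key.mono le_rfl fun s' _ _ h' y => h' y ?_
    rw [h.n]
    exact y.2
  · intro j hj s₁ hs₁ hf hj' hinv
    rw [h.n] at hj
    have hg := h.frame hf rfl
    refine Run.seq (T := 10) (T' := 108 * I.n + 90) (Q := fun s₂ => s₂.wreg 10 = 0)
      (Run.flat hX hs₁ rfl (by simp; omega) (by decide)) (fun s₂ hs₂ hf₂ h10 => ?_) (by omega)
    refine Run.seq (T := 10) (T' := 108 * I.n + 80) (Q := fun s₂ => s₂.wreg 11 = 1)
      (Run.flat hX hs₂ rfl (by simp; omega) (by decide)) (fun s₃ hs₃ hf₃ h11 => ?_) (by omega)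
    have h8 : s₃.wreg 8 = j := (hf₃.w 8 rfl).trans ((hf₂.w 8 rfl).trans hj')
    refine Run.seq (rankLoop_spec hX hs₃ hn ((hg.frame hf₂ rfl).frame hf₃ rfl) ⟨j, hj⟩ h8
      ((hf₃.w 10 rfl).trans h10) h11) (T' := 60) (fun s₄ hs₄ hf₄ h4 => ?_) (by omega)
    have b1 := I.pos_lt_n ⟨j, hj⟩
    have b2 := I.rk_le ⟨j, hj⟩
    have h8' := (hf₄.w 8 rfl).trans h8
    refine Run.flat hX hs₄ rfl ?_ (by decide)
    simp only [Prog.block, Prog.wp, WExp.val, State.putW_wreg, h4.1, h4.2, h8', Ranked,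
      State.setW_warr, State.putW_warr]
    refine ⟨by omega, by omega, by omega, fun y hy => ?_⟩
    simp only [Nat.reduceEqDiff, if_true, if_false]
    rw [Function.update_apply, Function.update_apply, Function.update_apply]
    have e3 : s₄.warr 3 = s₁.warr 3 := by rw [hf₄.a 3 rfl, hf₃.a 3 rfl, hf₂.a 3 rfl]
    have e4 : s₄.warr 4 = s₁.warr 4 := by rw [hf₄.a 4 rfl, hf₃.a 4 rfl, hf₂.a 4 rfl]
    have e7 : s₄.warr 7 = s₁.warr 7 := by rw [hf₄.a 7 rfl, hf₃.a 7 rfl, hf₂.a 7 rfl]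
    by_cases hyj : (y : ℕ) = j
    · have : y = ⟨j, hj⟩ := Fin.ext hyj
      subst this
      simp
    · have h6 := hinv y (by omega)
      -- Ranks are distinct and start at one, so the new entry of the inverse table overwrites no
      -- earlier one.
      have h7 : I.rk y - 1 ≠ I.rk ⟨j, hj⟩ - 1 := fun h' => hyj (by
        have h8 := I.one_le_rk y
        have h9 := I.one_le_rk ⟨j, hj⟩
        have := I.rk_injective (show I.rk y = I.rk ⟨j, hj⟩ by omega)
        rw [this])
      rw [if_neg hyj, if_neg hyj, if_neg h7, e3, e4, e7]
      exact h6

/-- Row-major addressing is injective as long as the minor index stays below the row length. All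
tables are laid out in this way. -/
theorem mul_add_inj {n a b c d : ℕ} (hb : b < n) (hd : d < n) :
    a * n + b = c * n + d ↔ a = c ∧ b = d := by
  constructor
  · intro h
    have hn : 0 < n := by omega
    have h1 : (a * n + b) / n = (c * n + d) / n := by rw [h]
    rw [mul_comm a, mul_comm c, Nat.mul_add_div hn, Nat.mul_add_div hn, Nat.div_eq_of_lt hb,
      Nat.div_eq_of_lt hd] at h1
    have h2 : a = c := by omega
    subst h2
    exact ⟨rfl, by omega⟩
  · rintro ⟨rfl, rfl⟩
    rfl

/-- Computes the characteristic vectors of the classes, and a class of each query. -/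
def memProg : Prog :=
  .for 8 2 (.block [.putW 5 (.add (.mul (.get 1 (.reg 8)) (.reg 0)) (.get 2 (.reg 8))) (.const 1),
    .putW 6 (.get 2 (.reg 8)) (.get 1 (.reg 8))])

theorem memProg_spec {X : ℕ} (hX : 16 < X) {s : State} (hs : Bdd X s) (h : Given I L s)
    (hL : ∀ j q, (j, q) ∈ L ↔ q ∈ I.cls j) (h0 : ∀ i, s.warr 5 i = 0) :
    Run X memProg (100 * L.length + 8) s fun s' =>
      (∀ (c : Fin I.p) (y : Fin I.n), s'.warr 5 (c * I.n + y) = 1 ↔ y ∈ I.cls c) ∧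
      ∀ y : Fin I.n, ∃ c : Fin I.p, s'.warr 6 y = c ∧ y ∈ I.cls c := by
  have key := Run.for_const hX (i := 8) (N := 2) (P := .block [
    .putW 5 (.add (.mul (.get 1 (.reg 8)) (.reg 0)) (.get 2 (.reg 8))) (.const 1),
    .putW 6 (.get 2 (.reg 8)) (.get 1 (.reg 8))]) rfl rfl rfl hs
    (fun j s => (∀ (c : Fin I.p) (y : Fin I.n), s.warr 5 (c * I.n + y) = 1 ↔
        ∃ e : Fin L.length, (e : ℕ) < j ∧ L.get e = (c, y)) ∧
      ∀ y : Fin I.n, (∃ e : Fin L.length, (e : ℕ) < j ∧ (L.get e).2 = y) →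
        ∃ c : Fin I.p, s.warr 6 y = c ∧ y ∈ I.cls c) 90
    (T' := 100 * L.length + 8) ?_ ?_ (by rw [h.m]; omega)
  · refine key.mono le_rfl ?_
    rintro s' _ _ ⟨h1, h2⟩
    rw [h.m] at h1 h2
    constructor
    · intro c y
      rw [h1, ← hL, List.mem_iff_get]
      exact ⟨fun ⟨e, _, he⟩ => ⟨e, he⟩, fun ⟨e, he⟩ => ⟨e, e.2, he⟩⟩
    · intro y
      obtain ⟨c, hc⟩ := I.cls_cover y
      obtain ⟨e, he⟩ := List.mem_iff_get.1 ((hL c y).2 hc)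
      exact h2 y ⟨e, e.2, by rw [he]⟩
  · simp [h0]
  · rintro j hj s₁ hs₁ hf hj' ⟨h1, h2⟩
    rw [h.m] at hj
    have hg := h.frame hf rfl
    have e1 := hg.cls ⟨j, hj⟩
    have e2 := hg.qry ⟨j, hj⟩
    simp only at e1 e2
    refine Run.flat hX hs₁ rfl ?_ (by decide)
    have b1 : ((L.get ⟨j, hj⟩).1 : ℕ) < X := by rw [← e1]; exact hs₁.warr _ _
    simp only [Prog.block, Prog.wp, WExp.val, State.putW_wreg, State.setW_warr, State.putW_warr, hj',
      e1, e2, hg.n, Nat.reduceEqDiff, if_true, if_false]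
    refine ⟨by omega, b1, fun c y => ?_, fun y hy => ?_⟩
    · simp only [Function.update_apply, mul_add_inj y.2 (L.get ⟨j, hj⟩).2.2]
      have e3 : (c : ℕ) = (L.get ⟨j, hj⟩).1 ∧ (y : ℕ) = (L.get ⟨j, hj⟩).2 ↔
          L.get ⟨j, hj⟩ = (c, y) := by
        rw [← Fin.ext_iff, ← Fin.ext_iff, Prod.ext_iff]
        exact ⟨fun ⟨h, h'⟩ => ⟨h.symm, h'.symm⟩, fun ⟨h, h'⟩ => ⟨h.symm, h'.symm⟩⟩
      simp only [e3]
      by_cases hc : L.get ⟨j, hj⟩ = (c, y)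
      · rw [if_pos hc]
        exact iff_of_true rfl ⟨⟨j, hj⟩, Nat.lt_succ_self j, hc⟩
      · rw [if_neg hc, h1]
        constructor
        · rintro ⟨e, he, he'⟩
          exact ⟨e, by omega, he'⟩
        · rintro ⟨e, he, he'⟩
          refine ⟨e, lt_of_le_of_ne (Nat.lt_succ_iff.1 he) ?_, he'⟩
          rintro rfl
          exact hc he'
    · rw [Function.update_apply]
      by_cases hc : (y : ℕ) = (L.get ⟨j, hj⟩).2
      · rw [if_pos hc, Fin.ext hc]
        exact ⟨_, rfl, (hL _ _).1 (List.get_mem L _)⟩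
      · rw [if_neg hc]
        obtain ⟨e, he, he'⟩ := hy
        refine h2 y ⟨e, lt_of_le_of_ne (Nat.lt_succ_iff.1 he) ?_, he'⟩
        rintro rfl
        exact hc (congrArg Fin.val he'.symm)

/-- The memory holds the instance and the result of the preprocessing. -/
structure Setup (I : Instance) (L : List (Fin I.p × Fin I.n)) (lab : Fin I.n → Fin I.p)
    (s : State) : Prop where
  given : Given I L s
  ranked : ∀ y, Ranked I s y
  mem : ∀ (c : Fin I.p) (y : Fin I.n), s.warr 5 (c * I.n + y) = 1 ↔ y ∈ I.cls c
  any : ∀ y : Fin I.n, s.warr 6 y = lab y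

/-- The program does not destroy the instance and the result of the preprocessing. -/
def Prog.keeps (P : Prog) : Bool :=
  P.spares && !(P.aW 3 || P.aW 4 || P.aW 5 || P.aW 6 || P.aW 7)

theorem Setup.frame {lab : Fin I.n → Fin I.p} {P : Prog} {s s' : State} (h : Setup I L lab s)
    (hf : Frame P s s') (hP : P.keeps = true) : Setup I L lab s' := by
  simp only [Prog.keeps, Bool.and_eq_true, Bool.not_eq_true', Bool.or_eq_false_iff] at hP
  obtain ⟨h0, ⟨⟨⟨h3, h4⟩, h5⟩, h6⟩, h7⟩ := hP
  constructor
  · exact h.given.frame hf h0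
  · intro y
    rw [Ranked, hf.a 3 h3, hf.a 4 h4, hf.a 7 h7]
    exact h.ranked y
  · rw [hf.a 5 h5]; exact h.mem
  · rw [hf.a 6 h6]; exact h.any

theorem setup_spec {X : ℕ} (hX : 16 < X) {s : State} (hs : Bdd X s) (hn : I.n + 2 < X)
    (h : Given I L s) (hL : ∀ j q, (j, q) ∈ L ↔ q ∈ I.cls j) (h0 : ∀ i, s.warr 5 i = 0) :
    Run X (.seq rankProg memProg) (1000 * (I.n * I.n) + (100 * L.length + 8)) s fun s' =>
      ∃ lab : Fin I.n → Fin I.p, (∀ y, y ∈ I.cls (lab y)) ∧ Setup I L lab s' := by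
  refine (rankProg_spec hX hs hn h).seq (fun s₁ hs₁ hf₁ h₁ => ?_) le_rfl
  refine (memProg_spec hX hs₁ (h.frame hf₁ rfl) hL ?_).mono le_rfl fun s₂ hs₂ hf₂ ⟨h2, h3⟩ => ?_
  · rw [hf₁.a 5 rfl]; exact h0
  · choose lab hl using h3
    refine ⟨lab, fun y => (hl y).2, (h.frame hf₁ rfl).frame hf₂ rfl, fun y => ?_, h2,
      fun y => (hl y).1⟩
    rw [Ranked, hf₂.a 3 rfl, hf₂.a 4 rfl, hf₂.a 7 rfl]
    exact h₁ y

end TwoWay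

namespace TwoWay

/-! ### Thresholds and sums -/

section Inner
open Classical

variable {I : Instance} {L : List (Fin I.p × Fin I.n)} {lab : Fin I.n → Fin I.p}

/-- Registers `4`, `5`, `10`, `11` and `12` hold the interval, the class, the query and its rank. -/
structure Focus (I : Instance) (l r : ℕ) (c : Fin I.p) (q : Fin I.n) (s : State) : Prop where
  left : s.wreg 4 = l
  right : s.wreg 5 = r
  cls : s.wreg 10 = c
  qry : s.wreg 11 = q
  rank : s.wreg 12 = I.rk q

theorem Focus.frame {l r : ℕ} {c : Fin I.p} {q : Fin I.n} {P : Prog} {s s' : State}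
    (h : Focus I l r c q s) (hf : Frame P s s')
    (hP : (P.wW 4 || P.wW 5 || P.wW 10 || P.wW 11 || P.wW 12) = false) : Focus I l r c q s' := by
  simp only [Bool.or_eq_false_iff] at hP
  obtain ⟨⟨⟨⟨h1, h2⟩, h3⟩, h4⟩, h5⟩ := hP
  exact ⟨(hf.w 4 h1).trans h.left, (hf.w 5 h2).trans h.right, (hf.w 10 h3).trans h.cls,
    (hf.w 11 h4).trans h.qry, (hf.w 12 h5).trans h.rank⟩

/-- The query in register `8` is in the interval. -/
def withinExp : BExp :=
  .and (.not (.wlt (.get 3 (.reg 8)) (.reg 4))) (.not (.wlt (.reg 5) (.get 3 (.reg 8))))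

/-- The query in register `8` is in the class. -/
def memExp : BExp := .weq (.get 5 (.add (.mul (.reg 10) (.reg 0)) (.reg 8))) (.const 1)

theorem withinExp_holds {s : State} (h : Setup I L lab s) {l r : ℕ} (h4 : s.wreg 4 = l)
    (h5 : s.wreg 5 = r) (y : Fin I.n) (hy : s.wreg 8 = y) :
    withinExp.Holds s ↔ I.Within l r y := by
  simp [withinExp, h4, h5, hy, (h.ranked y).1, Instance.Within]

theorem memExp_holds {s : State} (h : Setup I L lab s) {c : Fin I.p} (h10 : s.wreg 10 = c)
    (y : Fin I.n) (hy : s.wreg 8 = y) : memExp.Holds s ↔ y ∈ I.cls c := by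
  simp [memExp, h10, hy, h.given.n, h.mem c y]

/-- Finds the heaviest query in the interval, outside the class, and of rank below register `13`. -/
def nextLoop : Prog :=
  .for 8 0 (.cond (.and withinExp (.and (.not memExp)
      (.and (.wlt (.get 4 (.reg 8)) (.reg 13)) (.wlt (.reg 14) (.get 4 (.reg 8))))))
    (.block [.setW 14 (.get 4 (.reg 8)), .setW 15 (.reg 8)]) .skip)

/-- Ranks start at one, so the initial value zero of register `14` lies below all of them and at the
end means that there is no such query. Only otherwise does register `15` hold something meaningful.
-/
theorem nextLoop_spec {X : ℕ} (hX : 16 < X) {s : State} (hs : Bdd X s) (h : Setup I L lab s)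
    {l r : ℕ} {c : Fin I.p} {q : Fin I.n} (hF : Focus I l r c q s) (h14 : s.wreg 14 = 0) {b : ℕ}
    (hb : s.wreg 13 = b) :
    Run X nextLoop (108 * I.n + 8) s fun s' => s'.wreg 14 = I.nextRk l r c b ∧
      (I.nextRk l r c b ≠ 0 → ∃ y : Fin I.n, I.Within l r y ∧ y ∉ I.cls c ∧
        I.rk y = I.nextRk l r c b ∧ s'.wreg 15 = y) := by
  have key := Run.for_const hX (i := 8) (N := 0) (P := .cond (.and withinExp (.and (.not memExp)
      (.and (.wlt (.get 4 (.reg 8)) (.reg 13)) (.wlt (.reg 14) (.get 4 (.reg 8))))))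
    (.block [.setW 14 (.get 4 (.reg 8)), .setW 15 (.reg 8)]) .skip) rfl rfl rfl hs
    (fun j s => (∀ y : Fin I.n, (y : ℕ) < j → I.Within l r y → y ∉ I.cls c → I.rk y < b →
        I.rk y ≤ s.wreg 14) ∧
      (s.wreg 14 = 0 ∨ ∃ y : Fin I.n, I.Within l r y ∧ y ∉ I.cls c ∧ I.rk y < b ∧
        s.wreg 14 = I.rk y ∧ s.wreg 15 = y)) 100 (T' := 108 * I.n + 8) ?_ ?_
        (by rw [h.given.n]; omega)
  · refine key.mono le_rfl ?_
    rintro s' _ _ ⟨h1, h2⟩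
    rw [h.given.n] at h1
    have h1' := fun y => h1 y y.2
    rcases h2 with h2 | ⟨y, h3, h4, h5, h6, h7⟩
    · have : I.nextRk l r c b = 0 := I.nextRk_eq_zero fun z hz hz' => by
        by_contra hzc
        have := h1' z hz hzc hz'
        have := I.one_le_rk z
        omega
      rw [this]
      exact ⟨h2, fun h => absurd rfl h⟩
    · have : I.nextRk l r c b = I.rk y := I.nextRk_eq h3 h4 h5 fun z hz hzc hz' => by
        have := h1' z hz hzc hz'
        omega
      rw [this]
      exact ⟨h6, fun _ => ⟨y, h3, h4, rfl, h7⟩⟩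
  · simp [h14]
  · rintro j hj s₁ hs₁ hf hj' ⟨h1, h2⟩
    rw [h.given.n] at hj
    have hg := h.frame hf rfl
    have e13 : s₁.wreg 13 = b := (hf.w 13 rfl).trans hb
    have e4 := (hg.ranked ⟨j, hj⟩).2.1
    simp only at e4
    have ew := withinExp_holds hg ((hf.w 4 rfl).trans hF.left) ((hf.w 5 rfl).trans hF.right) ⟨j, hj⟩ hj'
    have em := memExp_holds hg ((hf.w 10 rfl).trans hF.cls) ⟨j, hj⟩ hj'
    have b1 : I.rk ⟨j, hj⟩ < X := by rw [← e4]; exact hs₁.warr _ _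
    have b2 : j < X := by rw [← hj']; exact hs₁.wreg _
    have hlast : ∀ y : Fin I.n, (y : ℕ) < j + 1 → (y : ℕ) < j ∨ y = ⟨j, hj⟩ := fun y hy => by
      rw [Fin.ext_iff]
      simp only
      omega
    refine Run.flat hX hs₁ rfl ?_ (by decide)
    simp only [Prog.wp, Prog.block, BExp.Holds, ew, em, WExp.val, hj', e4, e13, State.setW_wreg,
      Nat.reduceEqDiff, if_true, if_false]
    refine ⟨fun ⟨c1, c2, c3, c4⟩ => ⟨b1, b2, fun y hy d1 d2 d3 => ?_, .inr ⟨_, c1, c2, c3, rfl, rfl⟩⟩,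
      fun hc => ⟨fun y hy d1 d2 d3 => ?_, h2⟩⟩
    · rcases hlast y hy with hy | rfl
      · exact (h1 y hy d1 d2 d3).trans c4.le
      · exact le_rfl
    · rcases hlast y hy with hy | rfl
      · exact h1 y hy d1 d2 d3
      · by_contra hc'
        exact hc ⟨d1, d2, d3, not_le.1 hc'⟩

/-- Arrays `14` and `15` hold the thresholds and the queries of these ranks. -/
structure Thresholds (I : Instance) (l r : ℕ) (c : Fin I.p) (q : Fin I.n) (s : State) (i : ℕ) :
    Prop where
  thr : ∀ j ≤ i, s.warr 14 j = I.thr l r c q j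
  qry : ∀ j < i, I.thr l r c q (j + 1) ≠ 0 → ∃ y : Fin I.n, I.Within l r y ∧ y ∉ I.cls c ∧
    I.rk y = I.thr l r c q (j + 1) ∧ s.warr 15 (j + 1) = y

/-- Computes the thresholds.  Register `19` holds `9`. -/
def thrProg : Prog :=
  .seq (.putW 14 (.const 0) (.reg 12))
    (.for 18 19 (.block [.setW 13 (.get 14 (.reg 18)), .setW 14 (.const 0), nextLoop,
      .putW 14 (.add (.reg 18) (.const 1)) (.reg 14),
      .putW 15 (.add (.reg 18) (.const 1)) (.reg 15)]))

/-- An entry with `s ≤ 8` holes needs the thresholds of index `s` and `s + 1`, so nine steps after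
the initial one suffice, each a linear scan. -/
theorem thrProg_spec {X : ℕ} (hX : 16 < X) {s : State} (hs : Bdd X s) (h : Setup I L lab s)
    {l r : ℕ} {c : Fin I.p} {q : Fin I.n} (hF : Focus I l r c q s) (h19 : s.wreg 19 = 9) :
    Run X thrProg (2000 * I.n) s fun s' => Thresholds I l r c q s' 9 := by
  have hn0 := I.n_pos
  refine Run.seq (T := 10) (T' := 9 * (108 * I.n + 108) + 8) (Q := fun s₁ => s₁.warr 14 0 = I.rk q)
    (Run.flat hX hs rfl ?_ (by decide)) (fun s₁ hs₁ hf₁ h1 => ?_) (by omega)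
  · have := hs.wreg 12
    rw [hF.rank] at this
    simp [hF.rank, this]
  have h19' : s₁.wreg 19 = 9 := (hf₁.w 19 rfl).trans h19
  have key := Run.for_const hX (i := 18) (N := 19) (P := .block [.setW 13 (.get 14 (.reg 18)),
      .setW 14 (.const 0), nextLoop, .putW 14 (.add (.reg 18) (.const 1)) (.reg 14),
      .putW 15 (.add (.reg 18) (.const 1)) (.reg 15)]) rfl rfl rfl hs₁
    (fun j s => Thresholds I l r c q s j) (108 * I.n + 100)
    (T' := 9 * (108 * I.n + 108) + 8) ?_ ?_ (by rw [h19'])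
  · rwa [h19'] at key
  · refine ⟨fun j hj => ?_, fun j hj => absurd hj (by omega)⟩
    obtain rfl : j = 0 := by omega
    exact h1
  · rintro j hj s₂ hs₂ hf₂ hj' hinv
    have hg := (h.frame hf₁ rfl).frame hf₂ rfl
    have hF' := (hF.frame hf₁ rfl).frame hf₂ rfl
    refine Run.seq (T := 10) (T' := 108 * I.n + 80) (Q := fun s => s.wreg 13 = I.thr l r c q j)
      (Run.flat hX hs₂ rfl ?_ (by decide)) (fun s₃ hs₃ hf₃ h3 => ?_) (by omega)
    · have := hs₂.warr 14 j
      rw [hinv.thr j le_rfl] at this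
      simp [hj', hinv.thr j le_rfl, this]
    refine Run.seq (T := 10) (T' := 108 * I.n + 70) (Q := fun s => s.wreg 14 = 0)
      (Run.flat hX hs₃ rfl (by simp; omega) (by decide)) (fun s₄ hs₄ hf₄ h4 => ?_) (by omega)
    refine Run.seq (nextLoop_spec hX hs₄ ((hg.frame hf₃ rfl).frame hf₄ rfl)
      ((hF'.frame hf₃ rfl).frame hf₄ rfl) h4 ((hf₄.w 13 rfl).trans h3)) (T' := 60)
      (fun s₅ hs₅ hf₅ ⟨h5, h6⟩ => ?_) (by omega)
    refine Run.flat hX hs₅ rfl ?_ (by decide)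
    have e18 : s₅.wreg 18 = j := by rw [hf₅.w 18 rfl, hf₄.w 18 rfl, hf₃.w 18 rfl, hj']
    have e14 : s₅.warr 14 = s₂.warr 14 := by rw [hf₅.a 14 rfl, hf₄.a 14 rfl, hf₃.a 14 rfl]
    have e15 : s₅.warr 15 = s₂.warr 15 := by rw [hf₅.a 15 rfl, hf₄.a 15 rfl, hf₃.a 15 rfl]
    have b1 := hs₅.wreg 14
    have b2 := hs₅.wreg 15
    simp only [Prog.wp, Prog.block, WExp.val, State.putW_wreg, e18]
    refine ⟨b1, b2, ?_, ?_⟩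
    · intro i hi
      simp only [State.setW_warr, State.putW_warr, Nat.reduceEqDiff, if_true, if_false,
        Function.update_apply]
      by_cases hij : i = j + 1
      · rw [if_pos hij, h5, hij, Instance.thr]
      · rw [if_neg hij, e14]
        exact hinv.thr i (by omega)
    · intro i hi h0
      simp only [State.setW_warr, State.putW_warr, Nat.reduceEqDiff, if_true, if_false,
        Function.update_apply]
      by_cases hij : i = j
      · subst hij
        rw [if_pos rfl]
        rw [Instance.thr] at h0 ⊢
        exact h6 h0
      · rw [if_neg (by omega), e15]
        exact hinv.qry i (by omega) h0

/-- The body of `sumLoop`. -/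
def sumBody : Prog :=
  .cond (.and withinExp (.not (.wlt (.reg 12) (.get 4 (.reg 8)))))
    (.block [
      .cond (.or memExp (.wlt (.get 4 (.reg 8)) (.reg 13)))
        (.setR 1 (.add (.reg 1) (.get 1 (.reg 8)))) .skip,
      .cond (.not (.wlt (.get 4 (.reg 8)) (.reg 13)))
        (.block [
          .cond (.wlt (.get 3 (.reg 8)) (.reg 16)) (.setW 16 (.get 3 (.reg 8))) .skip,
          .cond (.wlt (.reg 17) (.get 3 (.reg 8))) (.setW 17 (.get 3 (.reg 8))) .skip])
        .skip])
    .skip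

/-- Computes the weight of the set of queries, and the first and the last position of a query that
must not be separated from the heaviest one. -/
def sumLoop : Prog := .for 8 0 sumBody

/-- The queries that must stay with `q` are on one side of a threshold if and only if their extreme
positions are. So one scan for the minimum and the maximum replaces a scan for every threshold. The
defaults `I.n` and `0` are never reached from the wrong side by a position `I.pos k` with `l < I.pos
k`. -/
theorem sumLoop_spec {X : ℕ} (hX : 16 < X) {s : State} (hs : Bdd X s) (h : Setup I L lab s)
    {l r i : ℕ} {c : Fin I.p} {q : Fin I.n} (hF : Focus I l r c q s) (h1 : s.rreg 1 = 0)
    (h16 : s.wreg 16 = I.n) (h17 : s.wreg 17 = 0) (h13 : s.wreg 13 = I.thr l r c q i) :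
    Run X sumLoop (308 * I.n + 8) s fun s' =>
      s'.rreg 1 = wsum I.weight (I.holed l r c q i) ∧
      (∀ k : Fin I.n, l < I.pos k → I.pos k ≤ r →
        (I.pos k ≤ s'.wreg 16 ↔ I.Keeps l r (I.pos k) r c q i) ∧
        (s'.wreg 17 < I.pos k ↔ I.Keeps l r l (I.pos k - 1) c q i)) := by
  set R : Fin I.n → Prop := fun y => I.Within l r y ∧ I.thr l r c q i ≤ I.rk y ∧ I.rk y ≤ I.rk q
    with hR
  have key := Run.for_const hX (i := 8) (N := 0) (P := sumBody) rfl rfl rfl hs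
    (fun j s => s.rreg 1 = psum (fun y => if y ∈ I.holed l r c q i then I.weight y else 0) j ∧
      ((∀ y : Fin I.n, (y : ℕ) < j → R y → s.wreg 16 ≤ I.pos y ∧ I.pos y ≤ s.wreg 17) ∧
      (s.wreg 16 = I.n ∨ ∃ y, R y ∧ I.pos y = s.wreg 16) ∧
      (s.wreg 17 = 0 ∨ ∃ y, R y ∧ I.pos y = s.wreg 17))) 300 (T' := 308 * I.n + 8) ?_ ?_
        (by rw [h.given.n]; omega)
  · refine key.mono le_rfl ?_
    rintro s' _ _ ⟨d1, d2, d3, d4⟩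
    rw [h.given.n] at d1 d2
    have d2' := fun y => d2 y y.2
    refine ⟨?_, fun k hlk hkr => ⟨?_, ?_⟩⟩
    · rw [d1, psum_all, wsum, Finset.sum_ite_mem, Finset.univ_inter]
    · constructor
      · intro hk y e1 e2 e3
        have := d2' y ⟨e1, e2, e3⟩
        exact ⟨by omega, e1.2⟩
      · intro hK
        rcases d3 with d3 | ⟨y, ⟨e1, e2, e3⟩, e4⟩
        · rw [d3]; exact (I.pos_lt_n k).le
        · rw [← e4]; exact (hK y e1 e2 e3).1
    · constructor
      · intro hk y e1 e2 e3
        have := d2' y ⟨e1, e2, e3⟩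
        exact ⟨e1.1, by omega⟩
      · intro hK
        rcases d4 with d4 | ⟨y, ⟨e1, e2, e3⟩, e4⟩
        · omega
        · have := (hK y e1 e2 e3).2
          omega
  · simp [psum_zero, h1, h16, h17]
  · rintro j hj s₁ hs₁ hf hj' ⟨d1, d2⟩
    rw [h.given.n] at hj
    have hg := h.frame hf rfl
    have e13 : s₁.wreg 13 = I.thr l r c q i := (hf.w 13 rfl).trans h13
    have e12 : s₁.wreg 12 = I.rk q := (hf.w 12 rfl).trans hF.rank
    obtain ⟨e3, e4, _⟩ := hg.ranked ⟨j, hj⟩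
    have ewt := hg.given.weight ⟨j, hj⟩
    simp only at e3 e4 ewt
    have ew := withinExp_holds hg ((hf.w 4 rfl).trans hF.left) ((hf.w 5 rfl).trans hF.right) ⟨j, hj⟩ hj'
    have em := memExp_holds hg ((hf.w 10 rfl).trans hF.cls) ⟨j, hj⟩ hj'
    have b3 : I.pos ⟨j, hj⟩ < X := by rw [← e3]; exact hs₁.warr _ _
    have hlast : ∀ y : Fin I.n, (y : ℕ) < j + 1 → (y : ℕ) < j ∨ y = ⟨j, hj⟩ := fun y hy => by
      rw [Fin.ext_iff]
      simp only
      omega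
    have eh := I.mem_holed (l := l) (r := r) (s := i) (c := c) (q := q) (y := ⟨j, hj⟩)
    -- The update of the extreme positions is the same whether or not the weight of the query has
    -- just been added, so it is treated once for both cases.
    have hmid : ∀ s₂ : State, s₂.wreg = s₁.wreg → s₂.warr = s₁.warr →
        s₂.rreg 1 = psum (fun y => if y ∈ I.holed l r c q i then I.weight y else 0) (j + 1) →
        I.Within l r ⟨j, hj⟩ → I.rk ⟨j, hj⟩ ≤ I.rk q → (Prog.block [
      .cond (.not (.wlt (.get 4 (.reg 8)) (.reg 13)))
        (.block [
          .cond (.wlt (.get 3 (.reg 8)) (.reg 16)) (.setW 16 (.get 3 (.reg 8))) .skip,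
          .cond (.wlt (.reg 17) (.get 3 (.reg 8))) (.setW 17 (.get 3 (.reg 8))) .skip])
        .skip]).wp X (fun s₂ => (s₂.setW 8 (j + 1)).rreg 1 =
            psum (fun y => if y ∈ I.holed l r c q i then I.weight y else 0) (j + 1) ∧
      ((∀ y : Fin I.n, (y : ℕ) < j + 1 → R y → (s₂.setW 8 (j + 1)).wreg 16 ≤ I.pos y ∧
          I.pos y ≤ (s₂.setW 8 (j + 1)).wreg 17) ∧
      ((s₂.setW 8 (j + 1)).wreg 16 = I.n ∨ ∃ y, R y ∧ I.pos y = (s₂.setW 8 (j + 1)).wreg 16) ∧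
      ((s₂.setW 8 (j + 1)).wreg 17 = 0 ∨ ∃ y, R y ∧ I.pos y = (s₂.setW 8 (j + 1)).wreg 17))) s₂ := by
      intro s₂ hw ha hr hwi hrq
      simp only [Prog.wp, Prog.block, BExp.Holds, WExp.val, hw, ha, hj', e4, e3, e13,
        State.setW_wreg, State.setW_warr, State.setW_rreg, Nat.reduceEqDiff, if_true, if_false, hr,
        true_and]
      refine ⟨fun c1 => ?_, fun c1 => ⟨fun y hy hy' => ?_, d2.2⟩⟩
      · have hRj : R ⟨j, hj⟩ := ⟨hwi, not_lt.1 c1, hrq⟩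
        refine ⟨fun c2 => ⟨b3, fun c3 => ⟨b3, ?_, ?_, ?_⟩, fun c3 => ⟨?_, ?_, d2.2.2⟩⟩,
          fun c2 => ⟨fun c3 => ⟨b3, ?_, d2.2.1, ?_⟩, fun c3 => ⟨?_, d2.2⟩⟩⟩
        · intro y hy hy'
          rcases hlast y hy with hy | rfl
          · have := d2.1 y hy hy'; omega
          · exact ⟨le_rfl, le_rfl⟩
        · exact .inr ⟨_, hRj, rfl⟩
        · exact .inr ⟨_, hRj, rfl⟩
        · intro y hy hy'
          rcases hlast y hy with hy | rfl
          · have := d2.1 y hy hy'; omega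
          · omega
        · exact .inr ⟨_, hRj, rfl⟩
        · intro y hy hy'
          rcases hlast y hy with hy | rfl
          · have := d2.1 y hy hy'; omega
          · omega
        · exact .inr ⟨_, hRj, rfl⟩
        · intro y hy hy'
          rcases hlast y hy with hy | rfl
          · have := d2.1 y hy hy'; omega
          · omega
      · rcases hlast y hy with hy | rfl
        · exact d2.1 y hy hy'
        · exact absurd hy'.2.1 (not_le.2 (not_not.1 c1))
    refine Run.flat hX hs₁ rfl ?_ (by decide)
    rw [sumBody, Prog.wp, BExp.Holds, BExp.Holds, BExp.Holds, ew]
    simp only [WExp.val, hj', e12, e4, not_lt]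
    refine ⟨fun ⟨c1, c2⟩ => ?_, fun c1 => ?_⟩
    · rw [Prog.block, Prog.wp, Prog.wp, BExp.Holds, em, BExp.Holds]
      simp only [WExp.val, hj', e13, e4]
      constructor
      · intro c3
        refine hmid _ rfl rfl ?_ c1 c2
        simp only [RExp.val, WExp.val, State.setR_rreg, if_true, hj', ewt, d1]
        rw [psum_succ _ hj, if_pos (eh.2 ⟨c1, c2, c3⟩)]
      · intro c3
        refine hmid _ rfl rfl ?_ c1 c2
        rw [d1, psum_succ _ hj, if_neg (fun h' => c3 (eh.1 h').2.2), add_zero]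
    · simp only [Prog.wp, State.setW_wreg, State.setW_rreg, Nat.reduceEqDiff, if_false]
      refine ⟨?_, fun y hy hy' => ?_, d2.2⟩
      · rw [d1, psum_succ _ hj, if_neg (fun h' => c1 ⟨(eh.1 h').1, (eh.1 h').2.1⟩), add_zero]
      · rcases hlast y hy with hy | rfl
        · exact d2.1 y hy hy'
        · exact absurd ⟨hy'.1, hy'.2.2⟩ c1

end Inner
end TwoWay

namespace TwoWay

/-! ### The tables -/

section Tables

variable {I : Instance} {L : List (Fin I.p × Fin I.n)} {lab : Fin I.n → Fin I.p}

/-- The place of a subproblem in the tables. -/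
def Cell.addr (I : Instance) {m : ℕ} : Cell m → ℕ
  | .all _ _ _ => 0
  | .top l r e s => ((l * I.n + r) * m + e) * 9 + s

/-- The subproblems that have a place in the tables. -/
def Cell.Valid (I : Instance) (L : List (Fin I.p × Fin I.n)) : Cell L.length → Prop
  | .all _ _ _ => False
  | .top l r e s => I.Within l r (L.get e).2 ∧ r < I.n ∧ s ≤ 8

theorem Cell.Valid.addr_inj {σ τ : Cell L.length} (hσ : σ.Valid I L) (hτ : τ.Valid I L)
    (h : σ.addr I = τ.addr I) : σ = τ := by
  cases σ with
  | all => exact hσ.elim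
  | top l r e s =>
    cases τ with
    | all => exact hτ.elim
    | top l' r' e' s' =>
      obtain ⟨_, h2, h3⟩ := hσ
      obtain ⟨_, h5, h6⟩ := hτ
      simp only [Cell.addr] at h
      rw [mul_add_inj (by omega) (by omega), mul_add_inj e.2 e'.2, mul_add_inj h2 h5] at h
      obtain ⟨⟨⟨rfl, rfl⟩, he⟩, rfl⟩ := h
      rw [Fin.ext he]

/-- `v` is the lowest cost that the recurrence finds. -/
def Best (I : Instance) (L : List (Fin I.p × Fin I.n)) (lab : Fin I.n → Fin I.p)
    (σ : Cell L.length) (v : ℝ) : Prop :=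
  (∃ T, Der I L lab σ T v) ∧ ∀ T v', Der I L lab σ T v' → v ≤ v'

/-- A table entry: the kind of the root (`0` if there is no tree, `1` for a leaf, `2` for an equality
test, `3` for a comparison), its key, a label, the places of two subproblems, and the cost. -/
structure Entry where
  kind : ℕ
  key : ℕ
  label : ℕ
  fst : ℕ
  snd : ℕ
  val : ℝ

/-- The entry describes a tree. -/
inductive Choice (I : Instance) (L : List (Fin I.p × Fin I.n)) (lab : Fin I.n → Fin I.p)
    (σ : Cell L.length) : Entry → Prop
  | leaf (j : Fin I.p) (k a b : ℕ) (v : ℝ) (h : Der I L lab σ (.leaf j) v) :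
      Choice I L lab σ ⟨1, k, j, a, b, v⟩
  | eq (g : Fin I.n) (j : Fin I.p) (τ : Cell L.length) (b : ℕ) (v' v : ℝ) (hτ : τ.Valid I L)
      (hp : τ.potential I L < σ.potential I L) (hb : Best I L lab τ v')
      (h : ∀ T, Der I L lab τ T v' → Der I L lab σ (.node (.eq g) (.leaf j) T) v) :
      Choice I L lab σ ⟨2, g, j, τ.addr I, b, v⟩
  | lt (k : Fin I.n) (j : ℕ) (τ τ' : Cell L.length) (v' v'' v : ℝ) (hτ : τ.Valid I L)
      (hτ' : τ'.Valid I L) (hp : τ.potential I L < σ.potential I L)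
      (hp' : τ'.potential I L < σ.potential I L) (hb : Best I L lab τ v') (hb' : Best I L lab τ' v'')
      (h : ∀ T T', Der I L lab τ T v' → Der I L lab τ' T' v'' →
        Der I L lab σ (.node (.lt k) T T') v) :
      Choice I L lab σ ⟨3, k, j, τ.addr I, τ'.addr I, v⟩

theorem Choice.exists_der {σ : Cell L.length} {E : Entry} (h : Choice I L lab σ E) :
    ∃ T, Der I L lab σ T E.val := by
  cases h with
  | leaf j k a b v h => exact ⟨_, h⟩
  | eq g j τ b v' v hτ hp hb h =>
    obtain ⟨T, hT⟩ := hb.1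
    exact ⟨_, h T hT⟩
  | lt k j τ τ' v' v'' v hτ hτ' hp hp' hb hb' h =>
    obtain ⟨T, hT⟩ := hb.1
    obtain ⟨T', hT'⟩ := hb'.1
    exact ⟨_, h T T' hT hT'⟩

/-- The entry describes the best of the trees in `U`. -/
def Opt (I : Instance) (L : List (Fin I.p × Fin I.n)) (lab : Fin I.n → Fin I.p)
    (σ : Cell L.length) (U : Tree I.n I.p → Prop) (E : Entry) : Prop :=
  (E.kind = 0 ∧ ∀ T v, Der I L lab σ T v → ¬ U T) ∨
    (E.kind ≠ 0 ∧ Choice I L lab σ E ∧ ∀ T v, Der I L lab σ T v → U T → E.val ≤ v)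

theorem Opt.best {σ : Cell L.length} {E : Entry} (h : Opt I L lab σ (fun _ => True) E)
    (h0 : E.kind ≠ 0) : Best I L lab σ E.val := by
  rcases h with ⟨h, _⟩ | ⟨_, h1, h2⟩
  · exact absurd h h0
  · exact ⟨h1.exists_der, fun T v hT => h2 T v hT trivial⟩

theorem Opt.none {σ : Cell L.length} {E : Entry} (h : Opt I L lab σ (fun _ => True) E)
    (h0 : E.kind = 0) (T : Tree I.n I.p) (v : ℝ) : ¬ Der I L lab σ T v := by
  rcases h with ⟨_, h⟩ | ⟨h, _⟩
  · exact fun hT => h T v hT trivial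
  · exact absurd h0 h

theorem Opt.congr {σ : Cell L.length} {E : Entry} {U V : Tree I.n I.p → Prop}
    (h : Opt I L lab σ U E) (hUV : ∀ T v, Der I L lab σ T v → (V T → U T)) :
    Opt I L lab σ V E := by
  rcases h with ⟨h1, h2⟩ | ⟨h1, h2, h3⟩
  · exact .inl ⟨h1, fun T v hT hV => h2 T v hT (hUV T v hT hV)⟩
  · exact .inr ⟨h1, h2, fun T v hT hV => h3 T v hT (hUV T v hT hV)⟩

/-- The entries for the sets `below l r t`: the place of the best subproblem plus one, and its
cost. -/
def AllEntry (I : Instance) (L : List (Fin I.p × Fin I.n)) (lab : Fin I.n → Fin I.p)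
    (σ : Cell L.length) (g : ℕ) (v : ℝ) : Prop :=
  (g = 0 ∧ ∀ T v, ¬ Der I L lab σ T v) ∨
    ∃ τ : Cell L.length, τ.Valid I L ∧ g = τ.addr I + 1 ∧ τ.potential I L ≤ σ.potential I L ∧
      Best I L lab τ v ∧ (∀ T, Der I L lab τ T v → Der I L lab σ T v) ∧
      ∀ T v', Der I L lab σ T v' → v ≤ v'

/-- The test at the root. -/
def Tree.root {n p : ℕ} : Tree n p → Option (Test n)
  | .leaf _ => none
  | .node u _ _ => some u

/-! ### The optimum for each kind of root -/

section Rules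

variable {l r s : ℕ} {e : Fin L.length}

/-- A vanishing next threshold rules out every other rule: the next hole would have rank zero, and
the remaining rules demand a nonzero threshold. -/
theorem opt_leaf (h : I.thr l r (L.get e).1 (L.get e).2 (s + 1) = 0) (k a b : ℕ) :
    Opt I L lab (.top l r e s) (fun _ => True) ⟨1, k, (L.get e).1, a, b, 0⟩ := by
  refine .inr ⟨by simp, .leaf _ _ _ _ _ (.leaf l r e s h), fun T v hT _ => ?_⟩
  cases hT with
  | leaf => exact le_rfl
  | eqTop l r e T v h' hk hT => exact absurd h h'
  | eqNext l r e s g T v hs h1 h2 h3 hk hT =>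
    have := I.one_le_rk g
    omega
  | right => contradiction
  | left => contradiction

theorem opt_start (h : I.thr l r (L.get e).1 (L.get e).2 (s + 1) ≠ 0) (E : Entry)
    (hE : E.kind = 0) : Opt I L lab (.top l r e s) (fun T => T.root = none) E := by
  refine .inl ⟨hE, fun T v hT => ?_⟩
  cases hT with
  | leaf l r e s h' => exact absurd h' h
  | eqTop | eqNext | right | left => simp [Tree.root]

/-- `q` belongs to its own class, so a root that tests for `q` cannot come from the rule for holes.
-/
theorem opt_eqTop (hL : ∀ j q, (j, q) ∈ L → q ∈ I.cls j)
    (h : I.thr l r (L.get e).1 (L.get e).2 1 ≠ 0) {g : ℕ} {v : ℝ}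
    (ha : AllEntry I L lab (.all l r (I.rk (L.get e).2)) g v) (hk : (L.get e).2 ∈ I.keys)
    (hg : g ≠ 0) (b : ℕ) : Opt I L lab (.top l r e 0) (fun T => T.root = some (.eq (L.get e).2))
      ⟨2, (L.get e).2, (L.get e).1, g - 1, b, Cell.weight I L (.top l r e 0) + v⟩ := by
  rcases ha with ⟨h1, _⟩ | ⟨τ, h1, rfl, h3, h4, h5, h6⟩
  · exact absurd h1 hg
  refine .inr ⟨by simp, .eq _ _ τ b v _ h1 ?_ h4 fun T hT => .eqTop l r e T v h hk (h5 T hT), ?_⟩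
  · refine h3.trans_lt ?_
    simp only [Cell.potential]
    omega
  · intro T v' hT hr
    cases hT with
    | leaf => simp [Tree.root] at hr
    | eqTop l r e T v' h' hk' hT =>
      have := h6 _ _ hT
      simp only
      linarith
    | eqNext l r e s g T v hs h1 h2 h3 hk hT =>
      simp only [Tree.root, Option.some.injEq, Test.eq.injEq] at hr
      subst hr
      exact absurd (hL _ _ (List.get_mem L e)) h2
    | right | left => simp [Tree.root] at hr

theorem opt_eqTop_none (hL : ∀ j q, (j, q) ∈ L → q ∈ I.cls j) {g : ℕ} {v : ℝ}
    (ha : AllEntry I L lab (.all l r (I.rk (L.get e).2)) g v)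
    (h : ¬ (s = 0 ∧ (L.get e).2 ∈ I.keys ∧ g ≠ 0)) (E : Entry) (hE : E.kind = 0) :
    Opt I L lab (.top l r e s) (fun T => T.root = some (.eq (L.get e).2)) E := by
  refine .inl ⟨hE, fun T v' hT hr => ?_⟩
  cases hT with
  | leaf => simp [Tree.root] at hr
  | eqTop l r e T v' h' hk' hT =>
    rcases ha with ⟨h1, h2⟩ | ⟨τ, h1, rfl, h3, h4, h5, h6⟩
    · exact h2 _ _ hT
    · exact h ⟨rfl, hk', by omega⟩
  | eqNext l r e s g T v hs h1 h2 h3 hk hT =>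
    simp only [Tree.root, Option.some.injEq, Test.eq.injEq] at hr
    subst hr
    exact absurd (hL _ _ (List.get_mem L e)) h2
  | right | left => simp [Tree.root] at hr

/-- Whatever tree has a hole-making root, its no-subtree is derived for the same cell with one more
hole. Hence the best value of that cell bounds all competitors. -/
theorem opt_eqNext (hv : Cell.Valid I L (.top l r e s)) (hs : s < 8) {g : Fin I.n}
    (h1 : I.Within l r g) (h2 : g ∉ I.cls (L.get e).1)
    (h3 : I.rk g = I.thr l r (L.get e).1 (L.get e).2 (s + 1)) (hk : g ∈ I.keys) {E : Entry}
    (hE : Opt I L lab (.top l r e (s + 1)) (fun _ => True) E) (h0 : E.kind ≠ 0) (b : ℕ) :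
    Opt I L lab (.top l r e s) (fun T => ∃ g, g ≠ (L.get e).2 ∧ T.root = some (.eq g))
      ⟨2, g, lab g, Cell.addr I (Cell.top l r e (s + 1)), b,
        Cell.weight I L (.top l r e s) + E.val⟩ := by
  refine .inr ⟨by simp, .eq _ _ (.top l r e (s + 1)) b E.val _ ⟨hv.1, hv.2.1, by omega⟩ ?_
    (hE.best h0) fun T hT => .eqNext l r e s g T E.val hs h1 h2 h3 hk hT, ?_⟩
  · simp only [Cell.potential]
    omega
  · rintro T v' hT ⟨g', hg', hr⟩
    cases hT with
    | leaf => simp [Tree.root] at hr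
    | eqTop l r e T v' h' hk' hT =>
      simp only [Tree.root, Option.some.injEq, Test.eq.injEq] at hr
      exact absurd hr.symm hg'
    | eqNext l r e s g T v hs h1 h2 h3 hk hT =>
      have := (hE.best h0).2 _ _ hT
      simp only
      linarith
    | right | left => simp [Tree.root] at hr

theorem opt_eqNext_none {g : Fin I.n} (h3 : I.rk g = I.thr l r (L.get e).1 (L.get e).2 (s + 1))
    {E : Entry} (hE : s < 8 → Opt I L lab (.top l r e (s + 1)) (fun _ => True) E)
    (h : ¬ (s < 8 ∧ g ∈ I.keys ∧ E.kind ≠ 0)) (E' : Entry) (hE' : E'.kind = 0) :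
    Opt I L lab (.top l r e s) (fun T => ∃ g, g ≠ (L.get e).2 ∧ T.root = some (.eq g)) E' := by
  refine .inl ⟨hE', ?_⟩
  rintro T v' hT ⟨g', hg', hr⟩
  cases hT with
  | leaf => simp [Tree.root] at hr
  | eqTop l r e T v' h' hk' hT =>
    simp only [Tree.root, Option.some.injEq, Test.eq.injEq] at hr
    exact absurd hr.symm hg'
  | eqNext l r e s g'' T v hs h1 h2 h3' hk hT =>
    rw [I.rk_injective (h3'.trans h3.symm)] at hk
    exact h ⟨hs, hk, fun h0 => (hE hs).none h0 _ _ hT⟩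
  | right | left => simp [Tree.root] at hr

/-- `q` itself is among the queries that must stay together, and it cannot be on both sides. So for
each key at most one of the two split rules applies. -/
theorem keeps_not_both (hv : Cell.Valid I L (.top l r e s)) {k : Fin I.n}
    (h1 : I.Keeps l r (I.pos k) r (L.get e).1 (L.get e).2 s)
    (h2 : I.Keeps l r l (I.pos k - 1) (L.get e).1 (L.get e).2 s) : ¬ l < I.pos k := by
  have h3 := (h1 _ hv.1 (I.thr_le _ _ _ _ s) le_rfl).1
  have h4 := (h2 _ hv.1 (I.thr_le _ _ _ _ s) le_rfl).2
  omega

/-- Both parts are shorter intervals, so their potentials drop by at least `10 * n + 1`, more than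
the rank terms can add. The second half covers the case that one part has no tree. -/
theorem opt_right (hv : Cell.Valid I L (.top l r e s))
    (h : I.thr l r (L.get e).1 (L.get e).2 (s + 1) ≠ 0) {k : Fin I.n}
    (hk : k ∈ I.keys) (hlk : l < I.pos k) (hkr : I.pos k ≤ r)
    (hK : I.Keeps l r (I.pos k) r (L.get e).1 (L.get e).2 s) {g : ℕ} {v : ℝ} {E : Entry}
    (ha : AllEntry I L lab (.all l (I.pos k - 1) (I.thr l r (L.get e).1 (L.get e).2 s)) g v)
    (hE : Opt I L lab (.top (I.pos k) r e s) (fun _ => True) E) (j : ℕ) :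
    (g ≠ 0 → E.kind ≠ 0 → Opt I L lab (.top l r e s) (fun T => T.root = some (.lt k))
      ⟨3, k, j, g - 1, Cell.addr I (Cell.top (I.pos k) r e s),
        Cell.weight I L (.top l r e s) + (v + E.val)⟩) ∧
    (¬ (g ≠ 0 ∧ E.kind ≠ 0) → ∀ E' : Entry, E'.kind = 0 →
      Opt I L lab (.top l r e s) (fun T => T.root = some (.lt k)) E') := by
  have hnot := fun h2 => keeps_not_both hv hK h2 hlk
  constructor
  · intro hg h0
    rcases ha with ⟨h1, _⟩ | ⟨τ, h1, rfl, h3, h4, h5, h6⟩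
    · exact absurd h1 hg
    have hE' := hE.best h0
    have h7 := potential_split (a := 10 * I.n + 1) hlk hkr
    have h8 := I.thr_le l r (L.get e).1 (L.get e).2 s
    have h9 := I.rk_le (L.get e).2
    refine .inr ⟨by simp, .lt k j τ (.top (I.pos k) r e s) v E.val _ h1
      ⟨hK _ hv.1 (I.thr_le _ _ _ _ s) le_rfl, hv.2⟩ (h3.trans_lt ?_) ?_ h4 hE' fun T T' hT hT' =>
        .right l r e s k T v T' E.val h hk hlk hkr hK (h5 T hT) hT', ?_⟩
    · have h10 : 0 < (2 * (r - I.pos k) + 1) * (10 * I.n + 1) := by positivity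
      simp only [Cell.potential]
      omega
    · have h10 : 0 < (2 * (I.pos k - 1 - l) + 1) * (10 * I.n + 1) := by positivity
      simp only [Cell.potential]
      omega
    · intro T v' hT hr
      cases hT with
      | leaf | eqTop | eqNext => simp [Tree.root] at hr
      | right l r e s k' T v T' v' h' hk' hlk' hkr' hK' hT hT' =>
        simp only [Tree.root, Option.some.injEq, Test.lt.injEq] at hr
        subst hr
        have h11 := h6 _ _ hT
        have h12 := hE'.2 _ _ hT'
        simp only
        linarith
      | left l r e s k' T v T' v' h' hk' hlk' hkr' hK' hT hT' =>
        simp only [Tree.root, Option.some.injEq, Test.lt.injEq] at hr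
        subst hr
        exact (hnot hK').elim
  · refine fun hn E' hE' => .inl ⟨hE', fun T v' hT hr => ?_⟩
    cases hT with
    | leaf | eqTop | eqNext => simp [Tree.root] at hr
    | right l r e s k' T v T' v' h' hk' hlk' hkr' hK' hT hT' =>
      simp only [Tree.root, Option.some.injEq, Test.lt.injEq] at hr
      subst hr
      refine hn ⟨fun hg => ?_, fun h0 => hE.none h0 _ _ hT'⟩
      rcases ha with ⟨_, h2⟩ | ⟨τ, h1, rfl, h3, h4, h5, h6⟩
      · exact h2 _ _ hT
      · omega
    | left l r e s k' T v T' v' h' hk' hlk' hkr' hK' hT hT' =>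
      simp only [Tree.root, Option.some.injEq, Test.lt.injEq] at hr
      subst hr
      exact (hnot hK').elim

theorem opt_left (hv : Cell.Valid I L (.top l r e s))
    (h : I.thr l r (L.get e).1 (L.get e).2 (s + 1) ≠ 0) {k : Fin I.n}
    (hk : k ∈ I.keys) (hlk : l < I.pos k) (hkr : I.pos k ≤ r)
    (hK : I.Keeps l r l (I.pos k - 1) (L.get e).1 (L.get e).2 s) {g : ℕ} {v : ℝ} {E : Entry}
    (ha : AllEntry I L lab (.all (I.pos k) r (I.thr l r (L.get e).1 (L.get e).2 s)) g v)
    (hE : Opt I L lab (.top l (I.pos k - 1) e s) (fun _ => True) E) (j : ℕ) :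
    (g ≠ 0 → E.kind ≠ 0 → Opt I L lab (.top l r e s) (fun T => T.root = some (.lt k))
      ⟨3, k, j, Cell.addr I (Cell.top l (I.pos k - 1) e s), g - 1,
        Cell.weight I L (.top l r e s) + (E.val + v)⟩) ∧
    (¬ (g ≠ 0 ∧ E.kind ≠ 0) → ∀ E' : Entry, E'.kind = 0 →
      Opt I L lab (.top l r e s) (fun T => T.root = some (.lt k)) E') := by
  have hnot := fun h2 => keeps_not_both hv h2 hK hlk
  constructor
  · intro hg h0
    rcases ha with ⟨h1, _⟩ | ⟨τ, h1, rfl, h3, h4, h5, h6⟩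
    · exact absurd h1 hg
    have hE' := hE.best h0
    have h7 := potential_split (a := 10 * I.n + 1) hlk hkr
    have h8 := I.thr_le l r (L.get e).1 (L.get e).2 s
    have h9 := I.rk_le (L.get e).2
    have h13 := I.pos_lt_n k
    refine .inr ⟨by simp, .lt k j (.top l (I.pos k - 1) e s) τ E.val v _
      ⟨hK _ hv.1 (I.thr_le _ _ _ _ s) le_rfl, by omega, hv.2.2⟩ h1 ?_ (h3.trans_lt ?_) hE' h4
        fun T T' hT hT' => .left l r e s k T E.val T' v h hk hlk hkr hK hT (h5 T' hT'), ?_⟩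
    · have h10 : 0 < (2 * (r - I.pos k) + 1) * (10 * I.n + 1) := by positivity
      simp only [Cell.potential]
      omega
    · have h10 : 0 < (2 * (I.pos k - 1 - l) + 1) * (10 * I.n + 1) := by positivity
      simp only [Cell.potential]
      omega
    · intro T v' hT hr
      cases hT with
      | leaf | eqTop | eqNext => simp [Tree.root] at hr
      | left l r e s k' T v T' v' h' hk' hlk' hkr' hK' hT hT' =>
        simp only [Tree.root, Option.some.injEq, Test.lt.injEq] at hr
        subst hr
        have h11 := h6 _ _ hT'
        have h12 := hE'.2 _ _ hT
        simp only
        linarith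
      | right l r e s k' T v T' v' h' hk' hlk' hkr' hK' hT hT' =>
        simp only [Tree.root, Option.some.injEq, Test.lt.injEq] at hr
        subst hr
        exact (hnot hK').elim
  · refine fun hn E' hE' => .inl ⟨hE', fun T v' hT hr => ?_⟩
    cases hT with
    | leaf | eqTop | eqNext => simp [Tree.root] at hr
    | left l r e s k' T v T' v' h' hk' hlk' hkr' hK' hT hT' =>
      simp only [Tree.root, Option.some.injEq, Test.lt.injEq] at hr
      subst hr
      refine hn ⟨fun hg => ?_, fun h0 => hE.none h0 _ _ hT⟩
      rcases ha with ⟨_, h2⟩ | ⟨τ, h1, rfl, h3, h4, h5, h6⟩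
      · exact h2 _ _ hT'
      · omega
    | right l r e s k' T v T' v' h' hk' hlk' hkr' hK' hT hT' =>
      simp only [Tree.root, Option.some.injEq, Test.lt.injEq] at hr
      subst hr
      exact (hnot hK').elim

theorem opt_split_none {k : Fin I.n}
    (h : ¬ (k ∈ I.keys ∧ l < I.pos k ∧ I.pos k ≤ r ∧
      (I.Keeps l r (I.pos k) r (L.get e).1 (L.get e).2 s ∨
        I.Keeps l r l (I.pos k - 1) (L.get e).1 (L.get e).2 s))) (E' : Entry) (hE' : E'.kind = 0) :
    Opt I L lab (.top l r e s) (fun T => T.root = some (.lt k)) E' := by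
  refine .inl ⟨hE', fun T v' hT hr => ?_⟩
  cases hT with
  | leaf | eqTop | eqNext => simp [Tree.root] at hr
  | left l r e s k' T v T' v' h' hk' hlk' hkr' hK' hT hT' =>
    simp only [Tree.root, Option.some.injEq, Test.lt.injEq] at hr
    subst hr
    exact h ⟨hk', hlk', hkr', .inr hK'⟩
  | right l r e s k' T v T' v' h' hk' hlk' hkr' hK' hT hT' =>
    simp only [Tree.root, Option.some.injEq, Test.lt.injEq] at hr
    subst hr
    exact h ⟨hk', hlk', hkr', .inl hK'⟩

end Rules

/-- The entry at place `a` of the tables. -/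
def entryAt (s : State) (a : ℕ) : Entry :=
  ⟨s.warr 8 a, s.warr 9 a, s.warr 10 a, s.warr 11 a, s.warr 12 a, s.rarr 2 a⟩

/-- The best tree so far. -/
def current (s : State) : Entry :=
  ⟨s.wreg 22, s.wreg 23, s.wreg 24, s.wreg 25, s.wreg 26, s.rreg 2⟩

/-- The candidate. -/
def candidate (s : State) : Entry :=
  ⟨s.wreg 28, s.wreg 29, s.wreg 30, s.wreg 31, s.wreg 32, s.rreg 3⟩

/-- Takes the candidate if it is better. -/
def offer : Prog :=
  .cond (.and (.not (.weq (.reg 28) (.const 0))) (.or (.weq (.reg 22) (.const 0))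
      (.rlt (.reg 3) (.reg 2))))
    (.block [.setW 22 (.reg 28), .setW 23 (.reg 29), .setW 24 (.reg 30), .setW 25 (.reg 31),
      .setW 26 (.reg 32), .setR 2 (.reg 3)]) .skip

/-- The order of the comparisons matters: real costs are compared only when both entries describe
trees, since the cost field of an entry of kind zero means nothing. -/
theorem offer_spec {X : ℕ} (hX : 16 < X) {s : State} (hs : Bdd X s) {σ : Cell L.length}
    {U V : Tree I.n I.p → Prop} (h : Opt I L lab σ U (current s))
    (h' : Opt I L lab σ V (candidate s)) :
    Run X offer 40 s fun s' => Opt I L lab σ (fun T => U T ∨ V T) (current s') := by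
  refine Run.flat hX hs rfl ?_ (by decide)
  simp only [offer, Prog.wp, Prog.block, BExp.Holds, WExp.val, RExp.val, current, State.setW_wreg,
    State.setW_rreg, State.setR_wreg, State.setR_rreg, Nat.reduceEqDiff, if_true, if_false]
  have hc : (current s).kind = s.wreg 22 := rfl
  have hc' : (candidate s).kind = s.wreg 28 := rfl
  have hv : (current s).val = s.rreg 2 := rfl
  have hv' : (candidate s).val = s.rreg 3 := rfl
  refine ⟨fun ⟨c1, c2⟩ => ⟨hs.wreg _, hs.wreg _, hs.wreg _, hs.wreg _, hs.wreg _, ?_⟩, fun c => ?_⟩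
  · change Opt I L lab σ _ (candidate s)
    rcases h' with ⟨h1', _⟩ | ⟨h1', h2', h3'⟩
    · exact absurd h1' c1
    refine .inr ⟨h1', h2', fun T v hT hU => ?_⟩
    rcases hU with hU | hU
    · rcases h with ⟨h1, h2⟩ | ⟨h1, h2, h3⟩
      · exact absurd hU (h2 T v hT)
      · have h4 := h3 T v hT hU
        have h5 := c2.resolve_left h1
        rw [hv] at h4
        rw [hv']
        linarith
    · exact h3' T v hT hU
  · change Opt I L lab σ _ (current s)
    rcases h with ⟨h1, h2⟩ | ⟨h1, h2, h3⟩
    · refine .inl ⟨h1, fun T v hT hU => ?_⟩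
      rcases hU with hU | hU
      · exact h2 T v hT hU
      · rcases h' with ⟨h1', h2'⟩ | ⟨h1', h2', h3'⟩
        · exact h2' T v hT hU
        · exact c ⟨h1', .inl h1⟩
    · refine .inr ⟨h1, h2, fun T v hT hU => ?_⟩
      rcases hU with hU | hU
      · exact h3 T v hT hU
      · rcases h' with ⟨h1', h2'⟩ | ⟨h1', h2', h3'⟩
        · exact absurd hU (h2' T v hT)
        · have h4 := h3' T v hT hU
          have h5 : ¬ s.rreg 3 < s.rreg 2 := fun h5 => c ⟨h1', .inr h5⟩
          rw [hv'] at h4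
          rw [hv]
          linarith

end Tables
end TwoWay

namespace TwoWay

/-! ### The computation of a table entry -/

section CellProg

variable {I : Instance} {L : List (Fin I.p × Fin I.n)} {lab : Fin I.n → Fin I.p}

/-- The table entry of the subproblem is correct. -/
def TopOK (I : Instance) (L : List (Fin I.p × Fin I.n)) (lab : Fin I.n → Fin I.p) (st : State)
    (σ : Cell L.length) : Prop := Opt I L lab σ (fun _ => True) (entryAt st (σ.addr I))

/-- The place of the set `below l r t` in the tables. -/
def allAddr (I : Instance) (l r t : ℕ) : ℕ := (l * I.n + r) * (I.n + 2) + t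

/-- The table entry of the set `below l r t` is correct. -/
def AllOK (I : Instance) (L : List (Fin I.p × Fin I.n)) (lab : Fin I.n → Fin I.p) (st : State)
    (l r t : ℕ) : Prop :=
  AllEntry I L lab (.all l r t) (st.warr 13 (allAddr I l r t)) (st.rarr 3 (allAddr I l r t))

/-- The program does not write to the tables for the sets `holed l r c q s`. -/
def Prog.sparesTop (P : Prog) : Bool :=
  !(P.aW 8 || P.aW 9 || P.aW 10 || P.aW 11 || P.aW 12 || P.aR 2)

/-- The program does not write to the tables for the sets `below l r t`. -/
def Prog.sparesAll (P : Prog) : Bool := !(P.aW 13 || P.aR 3)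

theorem TopOK.frame {P : Prog} {st st' : State} {σ : Cell L.length} (h : TopOK I L lab st σ)
    (hf : Frame P st st') (hP : P.sparesTop = true) : TopOK I L lab st' σ := by
  simp only [Prog.sparesTop, Bool.not_eq_true', Bool.or_eq_false_iff] at hP
  obtain ⟨⟨⟨⟨⟨h1, h2⟩, h3⟩, h4⟩, h5⟩, h6⟩ := hP
  rw [TopOK, entryAt, hf.a 8 h1, hf.a 9 h2, hf.a 10 h3, hf.a 11 h4, hf.a 12 h5, hf.b 2 h6]
  exact h

theorem AllOK.frame {P : Prog} {st st' : State} {l r t : ℕ} (h : AllOK I L lab st l r t)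
    (hf : Frame P st st') (hP : P.sparesAll = true) : AllOK I L lab st' l r t := by
  simp only [Prog.sparesAll, Bool.not_eq_true', Bool.or_eq_false_iff] at hP
  rw [AllOK, hf.a 13 hP.1, hf.b 3 hP.2]
  exact h

/-- The table entries for the interval are correct. -/
def IntervalOK (I : Instance) (L : List (Fin I.p × Fin I.n)) (lab : Fin I.n → Fin I.p) (st : State)
    (l r : ℕ) : Prop :=
  (∀ t, 1 ≤ t → t ≤ I.n + 1 → AllOK I L lab st l r t) ∧
    ∀ e s, Cell.Valid I L (.top l r e s) → TopOK I L lab st (.top l r e s)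

/-- What is known while the entries for an interval and a pair are computed. -/
structure Base (I : Instance) (L : List (Fin I.p × Fin I.n)) (lab : Fin I.n → Fin I.p) (l r : ℕ)
    (e : Fin L.length) (st : State) : Prop where
  setup : Setup I L lab st
  focus : Focus I l r (L.get e).1 (L.get e).2 st
  pair : st.wreg 7 = e
  all : AllOK I L lab st l r (I.rk (L.get e).2)
  sub : ∀ l' r', l ≤ l' → l' ≤ r' → r' ≤ r → (l < l' ∨ r' < r) → IntervalOK I L lab st l' r'

/-- The program does not destroy what is known. -/
def Prog.rests (P : Prog) : Bool :=
  P.keeps && P.sparesTop && P.sparesAll &&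
    !(P.wW 4 || P.wW 5 || P.wW 10 || P.wW 11 || P.wW 12 || P.wW 7)

theorem Base.frame {l r : ℕ} {e : Fin L.length} {P : Prog} {st st' : State}
    (h : Base I L lab l r e st) (hf : Frame P st st') (hP : P.rests = true) :
    Base I L lab l r e st' := by
  simp only [Prog.rests, Bool.and_eq_true, Bool.not_eq_true', Bool.or_eq_false_iff] at hP
  obtain ⟨⟨⟨h1, h2⟩, h3⟩, ⟨⟨⟨⟨h4, h5⟩, h6⟩, h7⟩, h8⟩, h9⟩ := hP
  exact ⟨h.setup.frame hf h1, h.focus.frame hf (by simp [*]), (hf.w 7 h9).trans h.pair,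
    h.all.frame hf h3, fun l' r' a b c d => ⟨fun t ht ht' => ((h.sub l' r' a b c d).1 t ht ht').frame
      hf h3, fun e s hv => ((h.sub l' r' a b c d).2 e s hv).frame hf h2⟩⟩

/-- What is known while an entry is computed. -/
structure Work (I : Instance) (L : List (Fin I.p × Fin I.n)) (lab : Fin I.n → Fin I.p) (l r : ℕ)
    (e : Fin L.length) (s : ℕ) (st : State) : Prop where
  base : Base I L lab l r e st
  num : st.wreg 21 = s
  thr : st.wreg 13 = I.thr l r (L.get e).1 (L.get e).2 s
  next : s < 8 → TopOK I L lab st (.top l r e (s + 1))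
  query : ∃ y : Fin I.n, I.Within l r y ∧ y ∉ I.cls (L.get e).1 ∧
    I.rk y = I.thr l r (L.get e).1 (L.get e).2 (s + 1) ∧ st.wreg 15 = y
  sum : st.rreg 1 = Cell.weight I L (.top l r e s)
  split : ∀ k : Fin I.n, l < I.pos k → I.pos k ≤ r →
    (I.pos k ≤ st.wreg 16 ↔ I.Keeps l r (I.pos k) r (L.get e).1 (L.get e).2 s) ∧
    (st.wreg 17 < I.pos k ↔ I.Keeps l r l (I.pos k - 1) (L.get e).1 (L.get e).2 s)

/-- The program does not destroy what is known. -/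
def Prog.works (P : Prog) : Bool :=
  P.rests && !(P.wW 21 || P.wW 13 || P.wW 15 || P.wR 1 || P.wW 16 || P.wW 17)

theorem Work.frame {l r s : ℕ} {e : Fin L.length} {P : Prog} {st st' : State}
    (h : Work I L lab l r e s st) (hf : Frame P st st') (hP : P.works = true) :
    Work I L lab l r e s st' := by
  simp only [Prog.works, Bool.and_eq_true, Bool.not_eq_true', Bool.or_eq_false_iff] at hP
  obtain ⟨h1, ⟨⟨⟨⟨h2, h3⟩, h4⟩, h5⟩, h6⟩, h7⟩ := hP
  have h8 : P.sparesTop = true := by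
    simp only [Prog.rests, Bool.and_eq_true] at h1
    exact h1.1.1.2
  refine ⟨h.base.frame hf h1, (hf.w 21 h2).trans h.num, (hf.w 13 h3).trans h.thr,
    fun hs => (h.next hs).frame hf h8, ?_, (hf.r 1 h5).trans h.sum, ?_⟩
  · rw [hf.w 15 h4]; exact h.query
  · rw [hf.w 16 h6, hf.w 17 h7]; exact h.split

/-- The place in the tables of the subproblem for the pair in register `7`. -/
def topExp (a b s : WExp) : WExp :=
  .add (.mul (.add (.mul (.add (.mul a (.reg 0)) b) (.reg 2)) (.reg 7)) (.const 9)) s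

/-- The place in the tables of the set of queries between two positions up to a rank. -/
def allExp (a b t : WExp) : WExp :=
  .add (.mul (.add (.mul a (.reg 0)) b) (.add (.reg 0) (.const 2))) t

/-- The candidate that tests for the heaviest query. -/
def candTop : Prog := .block [.setW 28 (.const 0),
  .cond (.and (.weq (.reg 21) (.const 0)) (.and (.weq (.get 0 (.reg 11)) (.const 1))
      (.not (.weq (.get 13 (allExp (.reg 4) (.reg 5) (.reg 12))) (.const 0)))))
    (.block [.setW 28 (.const 2), .setW 29 (.reg 11), .setW 30 (.reg 10),
      .setW 31 (.sub (.get 13 (allExp (.reg 4) (.reg 5) (.reg 12))) (.const 1)),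
      .setW 32 (.const 0), .setR 3 (.add (.reg 1) (.get 3 (allExp (.reg 4) (.reg 5) (.reg 12))))])
    .skip]

/-- The candidate that tests for the next query outside the class. -/
def candNext : Prog := .block [.setW 28 (.const 0),
  .cond (.and (.wlt (.reg 21) (.const 8)) (.and (.weq (.get 0 (.reg 15)) (.const 1))
      (.not (.weq (.get 8 (topExp (.reg 4) (.reg 5) (.add (.reg 21) (.const 1)))) (.const 0)))))
    (.block [.setW 28 (.const 2), .setW 29 (.reg 15), .setW 30 (.get 6 (.reg 15)),
      .setW 31 (topExp (.reg 4) (.reg 5) (.add (.reg 21) (.const 1))), .setW 32 (.const 0),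
      .setR 3 (.add (.reg 1) (.get 2 (topExp (.reg 4) (.reg 5) (.add (.reg 21) (.const 1)))))])
    .skip]

/-- The candidate that splits the interval at the position in register `33`, if the queries that
must not be separated are on the right. -/
def candRight : Prog :=
  .cond (.and
      (.not (.weq (.get 13 (allExp (.reg 4) (.sub (.reg 33) (.const 1)) (.reg 13))) (.const 0)))
      (.not (.weq (.get 8 (topExp (.reg 33) (.reg 5) (.reg 21))) (.const 0))))
    (.block [.setW 28 (.const 3), .setW 29 (.reg 8), .setW 30 (.const 0),
      .setW 31 (.sub (.get 13 (allExp (.reg 4) (.sub (.reg 33) (.const 1)) (.reg 13))) (.const 1)),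
      .setW 32 (topExp (.reg 33) (.reg 5) (.reg 21)),
      .setR 3 (.add (.reg 1) (.add (.get 3 (allExp (.reg 4) (.sub (.reg 33) (.const 1)) (.reg 13)))
        (.get 2 (topExp (.reg 33) (.reg 5) (.reg 21)))))])
    .skip

/-- The candidate that splits the interval at the position in register `33`, if the queries that
must not be separated are on the left. -/
def candLeft : Prog :=
  .cond (.and
      (.not (.weq (.get 13 (allExp (.reg 33) (.reg 5) (.reg 13))) (.const 0)))
      (.not (.weq (.get 8 (topExp (.reg 4) (.sub (.reg 33) (.const 1)) (.reg 21))) (.const 0))))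
    (.block [.setW 28 (.const 3), .setW 29 (.reg 8), .setW 30 (.const 0),
      .setW 31 (topExp (.reg 4) (.sub (.reg 33) (.const 1)) (.reg 21)),
      .setW 32 (.sub (.get 13 (allExp (.reg 33) (.reg 5) (.reg 13))) (.const 1)),
      .setR 3 (.add (.reg 1) (.add (.get 2 (topExp (.reg 4) (.sub (.reg 33) (.const 1)) (.reg 21)))
        (.get 3 (allExp (.reg 33) (.reg 5) (.reg 13)))))])
    .skip

/-- The candidate that splits at the query in register `8`. -/
def candSplit : Prog := .block [.setW 28 (.const 0), .setW 33 (.get 3 (.reg 8)),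
  .cond (.and (.weq (.get 0 (.reg 8)) (.const 1)) (.and (.wlt (.reg 4) (.reg 33))
      (.not (.wlt (.reg 5) (.reg 33)))))
    (.cond (.not (.wlt (.reg 16) (.reg 33))) candRight
      (.cond (.wlt (.reg 17) (.reg 33)) candLeft .skip))
    .skip]

/-! ### Correctness of the candidates -/

section Candidates

variable {X l r s : ℕ} {e : Fin L.length} {st : State}

theorem candTop_spec (hX : 16 < X) (hs : Bdd X st) (hL : ∀ j q, (j, q) ∈ L → q ∈ I.cls j)
    (h : Work I L lab l r e s st) (h0 : I.thr l r (L.get e).1 (L.get e).2 (s + 1) ≠ 0) :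
    Run X candTop 150 st fun st' => Opt I L lab (.top l r e s)
      (fun T => T.root = some (.eq (L.get e).2)) (candidate st') := by
  have hg := h.base.setup.given
  have hF := h.base.focus
  have hall := h.base.all
  rw [AllOK, allAddr] at hall
  have b1 := hs.wreg 11
  have b2 := hs.wreg 10
  have b3 := hs.warr 13 ((l * I.n + r) * (I.n + 2) + I.rk (L.get e).2)
  rw [hF.qry] at b1
  rw [hF.cls] at b2
  refine Run.flat hX hs rfl ?_ (by decide)
  simp only [candTop, Prog.wp, Prog.block, BExp.Holds, WExp.val, RExp.val, candidate, allExp,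
    State.setW_wreg, State.setW_rreg, State.setW_warr, State.setW_rarr, State.setR_wreg,
    State.setR_rreg, Nat.reduceEqDiff, if_true, if_false, h.num, hF.left, hF.right, hF.cls, hF.qry,
    hF.rank, hg.n, hg.key, h.sum]
  refine ⟨by omega, fun ⟨c1, c2, c3⟩ => ⟨by omega, b1, b2, by omega, by omega, ?_⟩, fun c => ?_⟩
  · subst c1
    exact opt_eqTop hL h0 hall c2 c3 0
  · exact opt_eqTop_none hL hall c _ rfl

theorem candNext_spec (hX : 16 < X) (hs : Bdd X st)
    (hroom : ∀ σ : Cell L.length, σ.Valid I L → σ.addr I + 1 < X)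
    (hv : Cell.Valid I L (.top l r e s)) (h : Work I L lab l r e s st) :
    Run X candNext 150 st fun st' => Opt I L lab (.top l r e s)
      (fun T => ∃ g, g ≠ (L.get e).2 ∧ T.root = some (.eq g)) (candidate st') := by
  have hg := h.base.setup.given
  have hF := h.base.focus
  obtain ⟨y, h1, h2, h3, h15⟩ := h.query
  have hn := h.next
  rw [TopOK, entryAt, Cell.addr] at hn
  have b1 := hs.wreg 15
  have b2 := hs.warr 6 (y : ℕ)
  rw [h15] at b1
  rw [h.base.setup.any y] at b2
  have b3 : s < 8 → _ := fun hs8 =>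
    hroom (.top l r e (s + 1)) ⟨hv.1, hv.2.1, by omega⟩
  rw [Cell.addr] at b3
  refine Run.flat hX hs rfl ?_ (by decide)
  simp only [candNext, Prog.wp, Prog.block, BExp.Holds, WExp.val, RExp.val, candidate, topExp,
    State.setW_wreg, State.setW_rreg, State.setW_warr, State.setW_rarr, State.setR_wreg,
    State.setR_rreg, Nat.reduceEqDiff, if_true, if_false, h.num, hF.left, hF.right, h15,
    h.base.pair, hg.n, hg.m, hg.key, h.sum, h.base.setup.any]
  refine ⟨by omega, fun ⟨c1, c2, c3⟩ => ⟨by omega, b1, b2, ?_, by omega, ?_⟩, fun c => ?_⟩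
  · have := b3 c1
    omega
  · exact opt_eqNext hv c1 h1 h2 h3 c2 (hn c1) c3 0
  · exact opt_eqNext_none h3 hn c _ rfl

theorem candSplit_spec (hX : 16 < X) (hs : Bdd X st)
    (hroom : ∀ σ : Cell L.length, σ.Valid I L → σ.addr I + 1 < X)
    (hv : Cell.Valid I L (.top l r e s)) (h : Work I L lab l r e s st)
    (h0 : I.thr l r (L.get e).1 (L.get e).2 (s + 1) ≠ 0) (k : Fin I.n) (h8 : st.wreg 8 = k) :
    Run X candSplit 350 st fun st' => Opt I L lab (.top l r e s)
      (fun T => T.root = some (.lt k)) (candidate st') := by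
  have hg := h.base.setup.given
  have hF := h.base.focus
  have hpos := (h.base.setup.ranked k).1
  have b1 := hs.wreg 8
  have b2 := hs.warr 3 (k : ℕ)
  rw [h8] at b1
  rw [hpos] at b2
  -- The threshold is used as the rank index of an entry for a shorter interval, and the tables are
  -- known to be correct only for indices from `1` to `I.n + 1`. It is nonzero because the next
  -- threshold, which is no larger, is nonzero.
  have hthr : 1 ≤ I.thr l r (L.get e).1 (L.get e).2 s ∧
      I.thr l r (L.get e).1 (L.get e).2 s ≤ I.n + 1 := by
    have h1 := I.thr_anti l r (L.get e).1 (L.get e).2 (Nat.le_succ s)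
    have h2 := I.thr_le l r (L.get e).1 (L.get e).2 s
    have h3 := I.rk_le (L.get e).2
    rw [Nat.succ_eq_add_one] at h1
    omega
  have hlt := I.pos_lt_n k
  refine Run.flat hX hs rfl ?_ (by decide)
  simp only [candSplit, Prog.wp, Prog.block, BExp.Holds, WExp.val, State.setW_wreg, State.setW_warr,
    Nat.reduceEqDiff, if_true, if_false, hF.left, hF.right, h8, hpos, hg.key]
  refine ⟨by omega, b2, fun ⟨c1, c2, c3⟩ => ⟨fun c4 => ?_, fun c4 => ⟨fun c5 => ?_, fun c5 => ?_⟩⟩,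
    fun c => ?_⟩
  · have hK := (h.split k c2 (not_lt.1 c3)).1.1 (not_lt.1 c4)
    have ha := (h.base.sub l (I.pos k - 1) le_rfl (by omega) (by omega) (by omega)).1 _ hthr.1 hthr.2
    have hv' : Cell.Valid I L (.top (I.pos k) r e s) :=
      ⟨hK _ hv.1 (I.thr_le _ _ _ _ s) le_rfl, hv.2⟩
    have ht := (h.base.sub (I.pos k) r (by omega) (by omega) le_rfl (by omega)).2 e s hv'
    have b3 := hroom _ hv'
    have b4 := hs.warr 13 (allAddr I l (I.pos k - 1) (I.thr l r (L.get e).1 (L.get e).2 s))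
    have key := opt_right hv h0 c1 c2 (not_lt.1 c3) hK ha ht 0
    simp only [entryAt, Cell.addr, allAddr] at key b3 b4
    simp only [candRight, Prog.wp, Prog.block, BExp.Holds, WExp.val, RExp.val, candidate, topExp,
      allExp, State.setW_wreg, State.setW_rreg, State.setW_warr, State.setW_rarr, State.setR_wreg,
      State.setR_rreg, Nat.reduceEqDiff, if_true, if_false, h.num, hF.left, hF.right, h8,
      h.base.pair, hg.n, hg.m, h.sum, h.thr]
    refine ⟨fun ⟨c5, c6⟩ => ⟨by omega, b1, by omega, by omega, by omega, ?_⟩, fun c => ?_⟩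
    · exact key.1 c5 c6
    · exact key.2 c _ rfl
  · have hK := (h.split k c2 (not_lt.1 c3)).2.1 c5
    have ha := (h.base.sub (I.pos k) r (by omega) (by omega) le_rfl (by omega)).1 _ hthr.1 hthr.2
    have hv' : Cell.Valid I L (.top l (I.pos k - 1) e s) :=
      ⟨hK _ hv.1 (I.thr_le _ _ _ _ s) le_rfl, by omega, hv.2.2⟩
    have ht := (h.base.sub l (I.pos k - 1) le_rfl (by omega) (by omega) (by omega)).2 e s hv'
    have b3 := hroom _ hv'
    have b4 := hs.warr 13 (allAddr I (I.pos k) r (I.thr l r (L.get e).1 (L.get e).2 s))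
    have key := opt_left hv h0 c1 c2 (not_lt.1 c3) hK ha ht 0
    simp only [entryAt, Cell.addr, allAddr] at key b3 b4
    simp only [candLeft, Prog.wp, Prog.block, BExp.Holds, WExp.val, RExp.val, candidate, topExp,
      allExp, State.setW_wreg, State.setW_rreg, State.setW_warr, State.setW_rarr, State.setR_wreg,
      State.setR_rreg, Nat.reduceEqDiff, if_true, if_false, h.num, hF.left, hF.right, h8,
      h.base.pair, hg.n, hg.m, h.sum, h.thr]
    refine ⟨fun ⟨c5, c6⟩ => ⟨by omega, b1, by omega, by omega, by omega, ?_⟩, fun c => ?_⟩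
    · exact key.1 c5 c6
    · exact key.2 c _ rfl
  · refine opt_split_none (fun ⟨d1, d2, d3, d4⟩ => ?_) _ (by simp [candidate])
    rcases d4 with d4 | d4
    · exact c4 (not_lt.2 ((h.split k d2 d3).1.2 d4))
    · exact c5 ((h.split k d2 d3).2.2 d4)
  · refine opt_split_none (fun ⟨d1, d2, d3, d4⟩ => ?_) _ (by simp [candidate])
    exact c ⟨d1, d2, not_lt.2 d3⟩

end Candidates

end CellProg
end TwoWay

namespace TwoWay

theorem Frame.setW (st : State) (x v : ℕ) : Frame (.setW x (.const 0)) st (st.setW x v) :=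
  ⟨fun y hy => by rw [State.setW_wreg, if_neg (nat_beq_false hy)], fun _ _ => rfl,
    fun _ _ => rfl, fun _ _ => rfl⟩

/-! ### All entries for one interval and one pair -/

section CellLoop

variable {I : Instance} {L : List (Fin I.p × Fin I.n)} {lab : Fin I.n → Fin I.p}
variable {X l r s : ℕ} {e : Fin L.length} {st : State}

/-- Tries all splits. -/
def splitLoop : Prog := .for 8 0 (.seq candSplit offer)

theorem splitLoop_spec (hX : 16 < X) (hs : Bdd X st)
    (hroom : ∀ σ : Cell L.length, σ.Valid I L → σ.addr I + 1 < X)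
    (hv : Cell.Valid I L (.top l r e s)) (h : Work I L lab l r e s st)
    (h0 : I.thr l r (L.get e).1 (L.get e).2 (s + 1) ≠ 0) {U : Tree I.n I.p → Prop}
    (hU : Opt I L lab (.top l r e s) U (current st)) :
    Run X splitLoop (398 * I.n + 8) st fun st' => Opt I L lab (.top l r e s)
      (fun T => U T ∨ ∃ k, T.root = some (.lt k)) (current st') := by
  have hg := h.base.setup.given
  have key := Run.for_const hX (i := 8) (N := 0) (P := .seq candSplit offer) rfl rfl rfl hs
    (fun j st => Opt I L lab (.top l r e s)
      (fun T => U T ∨ ∃ k : Fin I.n, (k : ℕ) < j ∧ T.root = some (.lt k)) (current st)) 390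
    (T' := 398 * I.n + 8) ?_ ?_ (by rw [hg.n]; omega)
  · refine key.mono le_rfl fun st' _ _ h' => h'.congr fun T _ _ hT => ?_
    rw [hg.n]
    rcases hT with hT | ⟨k, hk⟩
    · exact .inl hT
    · exact .inr ⟨k, k.2, hk⟩
  · exact Opt.congr (U := U) hU fun T _ _ hT => hT.resolve_right fun ⟨_, hk, _⟩ => absurd hk (by omega)
  · intro j hj s₁ hs₁ hf hj' hinv
    rw [hg.n] at hj
    have hw := h.frame hf rfl
    refine Run.seq (candSplit_spec hX hs₁ hroom hv hw h0 ⟨j, hj⟩ hj') (T' := 40)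
      (fun s₂ hs₂ hf₂ h2 => ?_) le_rfl
    have hc : current s₂ = current s₁ := by
      simp only [current, hf₂.w 22 rfl, hf₂.w 23 rfl, hf₂.w 24 rfl, hf₂.w 25 rfl, hf₂.w 26 rfl,
        hf₂.r 2 rfl]
    rw [← hc] at hinv
    refine (offer_spec hX hs₂ hinv h2).mono le_rfl fun s₃ _ _ h3 => ?_
    have hc' : current (s₃.setW 8 (j + 1)) = current s₃ := by simp [current]
    rw [hc']
    refine h3.congr fun T _ _ hT => ?_
    rcases hT with hT | ⟨k, hk, hk'⟩
    · exact .inl (.inl hT)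
    · rcases Nat.lt_succ_iff_lt_or_eq.1 hk with hk | hk
      · exact .inl (.inr ⟨k, hk, hk'⟩)
      · exact .inr (by rw [hk', show k = ⟨j, hj⟩ from Fin.ext hk])

/-- Computes an entry whose tree is not a leaf. -/
def fullProg : Prog :=
  .seq (.block [.setR 1 .zero, .setW 16 (.reg 0), .setW 17 (.const 0)]) (.seq sumLoop
    (.seq (.setW 22 (.const 0)) (.seq candTop (.seq offer (.seq candNext (.seq offer splitLoop))))))

theorem fullProg_spec (hX : 16 < X) (hs : Bdd X st) (hL : ∀ j q, (j, q) ∈ L → q ∈ I.cls j)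
    (hroom : ∀ σ : Cell L.length, σ.Valid I L → σ.addr I + 1 < X)
    (hv : Cell.Valid I L (.top l r e s)) (hb : Base I L lab l r e st) (h21 : st.wreg 21 = s)
    (h13 : st.wreg 13 = I.thr l r (L.get e).1 (L.get e).2 s)
    (hnext : s < 8 → TopOK I L lab st (.top l r e (s + 1)))
    (hq : ∃ y : Fin I.n, I.Within l r y ∧ y ∉ I.cls (L.get e).1 ∧
      I.rk y = I.thr l r (L.get e).1 (L.get e).2 (s + 1) ∧ st.wreg 15 = y)
    (h0 : I.thr l r (L.get e).1 (L.get e).2 (s + 1) ≠ 0) :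
    Run X fullProg (706 * I.n + 500) st fun st' =>
      Opt I L lab (.top l r e s) (fun _ => True) (current st') := by
  have b0 := hs.wreg 0
  refine Run.seq (T := 20) (T' := 706 * I.n + 450) (Q := fun st => st.rreg 1 = 0 ∧
    st.wreg 16 = I.n ∧ st.wreg 17 = 0) (Run.flat hX hs rfl ?_ (by decide))
    (fun s₁ hs₁ hf₁ ⟨h1, h2, h3⟩ => ?_) (by omega)
  · simp only [Prog.wp, Prog.block, WExp.val, RExp.val, State.setW_wreg, State.setW_rreg,
      State.setR_wreg, State.setR_rreg, Nat.reduceEqDiff, if_true, if_false]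
    exact ⟨b0, by omega, trivial, hb.setup.given.n, trivial⟩
  have hb₁ := hb.frame hf₁ rfl
  refine Run.seq (sumLoop_spec hX hs₁ hb₁.setup hb₁.focus h1 h2 h3 ((hf₁.w 13 rfl).trans h13))
    (T' := 398 * I.n + 440) (fun s₂ hs₂ hf₂ ⟨h4, h5⟩ => ?_) (by omega)
  have hw₂ : Work I L lab l r e s s₂ := by
    refine ⟨hb₁.frame hf₂ rfl, ?_, ?_, ?_, ?_, h4, h5⟩
    · rw [hf₂.w 21 rfl, hf₁.w 21 rfl, h21]
    · rw [hf₂.w 13 rfl, hf₁.w 13 rfl, h13]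
    · exact fun hs8 => ((hnext hs8).frame hf₁ rfl).frame hf₂ rfl
    · rw [hf₂.w 15 rfl, hf₁.w 15 rfl]
      exact hq
  refine Run.seq (T := 10) (T' := 398 * I.n + 420) (Q := fun st => st.wreg 22 = 0)
    (Run.flat hX hs₂ rfl (by simp; omega) (by decide)) (fun s₃ hs₃ hf₃ h6 => ?_) (by omega)
  have hw₃ := hw₂.frame hf₃ rfl
  refine Run.seq (candTop_spec hX hs₃ hL hw₃ h0) (T' := 398 * I.n + 260)
    (fun s₄ hs₄ hf₄ h7 => ?_) (by omega)
  have hc₄ := opt_start (lab := lab) h0 (current s₄) ((hf₄.w 22 rfl).trans h6)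
  have hw₄ := hw₃.frame hf₄ rfl
  refine Run.seq (offer_spec hX hs₄ hc₄ h7) (T' := 398 * I.n + 220)
    (fun s₅ hs₅ hf₅ h8 => ?_) (by omega)
  have hw₅ := hw₄.frame hf₅ rfl
  refine Run.seq (candNext_spec hX hs₅ hroom hv hw₅) (T' := 398 * I.n + 60)
    (fun s₆ hs₆ hf₆ h9 => ?_) (by omega)
  have hw₆ := hw₅.frame hf₆ rfl
  have hc₆ : current s₆ = current s₅ := by
    simp only [current, hf₆.w 22 rfl, hf₆.w 23 rfl, hf₆.w 24 rfl, hf₆.w 25 rfl, hf₆.w 26 rfl,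
      hf₆.r 2 rfl]
  rw [← hc₆] at h8
  refine Run.seq (offer_spec hX hs₆ h8 h9) (T' := 398 * I.n + 8)
    (fun s₇ hs₇ hf₇ h10 => ?_) (by omega)
  refine (splitLoop_spec hX hs₇ hroom hv (hw₆.frame hf₇ rfl) h0 h10).mono le_rfl
    fun s₈ _ _ h11 => h11.congr fun T _ _ _ => ?_
  -- The candidates exhaust the possible roots: no test, a comparison, the test for `q`, and an
  -- equality test on another query.
  rcases hr : T.root with _ | (k | g)
  · exact .inl (.inl (.inl rfl))
  · exact .inr ⟨k, rfl⟩
  · by_cases hgq : g = (L.get e).2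
    · exact .inl (.inl (.inr (by rw [hgq])))
    · exact .inl (.inr ⟨g, hgq, rfl⟩)

/-- Makes the current entry a leaf. -/
def leafProg : Prog := .block [.setW 22 (.const 1), .setW 23 (.const 0), .setW 24 (.reg 10),
  .setW 25 (.const 0), .setW 26 (.const 0), .setR 2 .zero]

/-- Writes the current entry to the tables. -/
def storeProg : Prog := .block [
  .putW 8 (topExp (.reg 4) (.reg 5) (.reg 21)) (.reg 22),
  .putW 9 (topExp (.reg 4) (.reg 5) (.reg 21)) (.reg 23),
  .putW 10 (topExp (.reg 4) (.reg 5) (.reg 21)) (.reg 24),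
  .putW 11 (topExp (.reg 4) (.reg 5) (.reg 21)) (.reg 25),
  .putW 12 (topExp (.reg 4) (.reg 5) (.reg 21)) (.reg 26),
  .putR 2 (topExp (.reg 4) (.reg 5) (.reg 21)) (.reg 2)]

/-- Computes the entry for the number of holes in register `21`. -/
def cellProg : Prog :=
  .seq (.block [.setW 13 (.get 14 (.reg 21)), .setW 14 (.get 14 (.add (.reg 21) (.const 1))),
      .setW 15 (.get 15 (.add (.reg 21) (.const 1)))])
    (.seq (.cond (.weq (.reg 14) (.const 0)) leafProg fullProg) storeProg)

theorem storeProg_spec (hX : 16 < X) (hs : Bdd X st) (hv : Cell.Valid I L (.top l r e s))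
    (hb : Base I L lab l r e st) (h21 : st.wreg 21 = s)
    (hc : Opt I L lab (.top l r e s) (fun _ => True) (current st)) :
    Run X storeProg 120 st fun st' => TopOK I L lab st' (.top l r e s) ∧
      ∀ τ : Cell L.length, τ.Valid I L → τ ≠ .top l r e s → TopOK I L lab st τ →
        TopOK I L lab st' τ := by
  have hg := hb.setup.given
  have hF := hb.focus
  refine Run.flat hX hs rfl ?_ (by decide)
  have haddr : ((l * I.n + r) * L.length + (e : ℕ)) * 9 + s = Cell.addr I (Cell.top l r e s) := rfl
  simp only [storeProg, Prog.wp, Prog.block, WExp.val, RExp.val, topExp, State.putW_wreg,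
    State.putW_rreg, TopOK, entryAt, State.putW_warr,
    State.putW_rarr, State.putR_warr, State.putR_rarr, Nat.reduceEqDiff, if_true, if_false,
    hF.left, hF.right, h21, hb.pair, hg.n, hg.m, haddr]
  refine ⟨hs.wreg _, hs.wreg _, hs.wreg _, hs.wreg _, hs.wreg _, ?_, fun τ hτ hne hok => ?_⟩
  · simp only [Function.update_self]
    -- The six writes go to the place of this cell only, and valid cells have distinct places, so
    -- the other entries survive.
    exact hc
  · have : τ.addr I ≠ Cell.addr I (Cell.top l r e s) := fun h => hne (hτ.addr_inj hv h)
    simp only [Function.update_of_ne this]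
    exact hok

theorem cellProg_spec (hX : 16 < X) (hs : Bdd X st) (hL : ∀ j q, (j, q) ∈ L → q ∈ I.cls j)
    (hroom : ∀ σ : Cell L.length, σ.Valid I L → σ.addr I + 1 < X)
    (hv : Cell.Valid I L (.top l r e s)) (hb : Base I L lab l r e st) (h21 : st.wreg 21 = s)
    (hthr : Thresholds I l r (L.get e).1 (L.get e).2 st 9)
    (hnext : s < 8 → TopOK I L lab st (.top l r e (s + 1))) :
    Run X cellProg (706 * I.n + 700) st fun st' => TopOK I L lab st' (.top l r e s) ∧
      ∀ τ : Cell L.length, τ.Valid I L → τ ≠ .top l r e s → TopOK I L lab st τ →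
        TopOK I L lab st' τ := by
  have hs8 : s ≤ 8 := hv.2.2
  refine Run.seq (T := 20) (T' := 706 * I.n + 650) (Q := fun st₁ =>
    st₁.wreg 13 = I.thr l r (L.get e).1 (L.get e).2 s ∧
    st₁.wreg 14 = I.thr l r (L.get e).1 (L.get e).2 (s + 1) ∧
    st₁.wreg 15 = st.warr 15 (s + 1)) (Run.flat hX hs rfl ?_ (by decide))
    (fun s₁ hs₁ hf₁ ⟨h1, h2, h3⟩ => ?_) (by omega)
  · simp only [Prog.wp, Prog.block, WExp.val, State.setW_wreg, State.setW_warr, Nat.reduceEqDiff,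
      if_true, if_false, h21]
    exact ⟨hs.warr _ _, hs.warr _ _, hs.warr _ _, hthr.thr _ (by omega), hthr.thr _ (by omega),
      trivial⟩
  have hb₁ := hb.frame hf₁ rfl
  have h21₁ := (hf₁.w 21 rfl).trans h21
  refine Run.seq (T := 706 * I.n + 510) (T' := 120)
    (Q := fun st' => Opt I L lab (.top l r e s) (fun _ => True) (current st')) ?_
    (fun s₂ hs₂ hf₂ h4 => ?_) (by omega)
  · refine Run.cond hX hs₁ rfl (T := 706 * I.n + 500) (fun hc => ?_) (fun hc => ?_) (by
      simp only [BExp.time, WExp.time]; omega)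
    · simp only [BExp.Holds, WExp.val, h2] at hc
      refine Run.flat hX hs₁ rfl ?_ (le_trans (by decide : _ ≤ 400) (by omega))
      simp only [leafProg, Prog.wp, Prog.block, WExp.val, RExp.val, current, State.setW_wreg,
        State.setW_rreg, State.setR_wreg, State.setR_rreg, Nat.reduceEqDiff, if_true, if_false,
        hb₁.focus.cls]
      refine ⟨by omega, by omega, ?_, by omega, by omega, opt_leaf hc _ _ _⟩
      rw [← hb₁.focus.cls]
      exact hs₁.wreg _
    · simp only [BExp.Holds, WExp.val, h2] at hc
      refine fullProg_spec hX hs₁ hL hroom hv hb₁ h21₁ h1 (fun h => (hnext h).frame hf₁ rfl) ?_ hc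
      rw [h3]
      exact hthr.qry s (by omega) hc
  · have hb₂ := hb₁.frame hf₂ rfl
    refine (storeProg_spec hX hs₂ hv hb₂ ((hf₂.w 21 rfl).trans h21₁) h4).mono le_rfl ?_
    rintro s₃ _ _ ⟨h5, h6⟩
    exact ⟨h5, fun τ hτ hne hok => h6 τ hτ hne ((hok.frame hf₁ rfl).frame hf₂ rfl)⟩

/-- Computes the entries for all numbers of holes. -/
def cellLoop : Prog := .for 20 19 (.seq (.setW 21 (.sub (.const 8) (.reg 20))) cellProg)

theorem Thresholds.frame {l r i : ℕ} {c : Fin I.p} {q : Fin I.n} {P : Prog} {st st' : State}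
    (h : Thresholds I l r c q st i) (hf : Frame P st st') (h1 : P.aW 14 = false)
    (h2 : P.aW 15 = false) : Thresholds I l r c q st' i :=
  ⟨by rw [hf.a 14 h1]; exact h.thr, by rw [hf.a 15 h2]; exact h.qry⟩

/-- The entry with `s` holes refers to the one with `s + 1`, so the number of holes runs down from
`8`. At `s = 8` the rule for a further hole is unavailable and nothing is needed beforehand. -/
theorem cellLoop_spec (hX : 16 < X) (hs : Bdd X st) (hL : ∀ j q, (j, q) ∈ L → q ∈ I.cls j)
    (hroom : ∀ σ : Cell L.length, σ.Valid I L → σ.addr I + 1 < X)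
    (hq : I.Within l r (L.get e).2) (hr : r < I.n) (hb : Base I L lab l r e st)
    (h19 : st.wreg 19 = 9) (hthr : Thresholds I l r (L.get e).1 (L.get e).2 st 9) :
    Run X cellLoop (9 * (706 * I.n + 720) + 8) st fun st' =>
      (∀ s ≤ 8, TopOK I L lab st' (.top l r e s)) ∧
      ∀ τ : Cell L.length, τ.Valid I L → (∀ s, τ ≠ .top l r e s) → TopOK I L lab st τ →
        TopOK I L lab st' τ := by
  have key := Run.for_const hX (i := 20) (N := 19)
    (P := .seq (.setW 21 (.sub (.const 8) (.reg 20))) cellProg) rfl rfl rfl hs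
    (fun j st' => Base I L lab l r e st' ∧ (∀ s ≤ 8, 9 ≤ s + j → TopOK I L lab st' (.top l r e s)) ∧
      ∀ τ : Cell L.length, τ.Valid I L → (∀ s, τ ≠ .top l r e s) → TopOK I L lab st τ →
        TopOK I L lab st' τ) (706 * I.n + 712) (T' := 9 * (706 * I.n + 720) + 8) ?_ ?_
        (by rw [h19])
  · refine key.mono le_rfl ?_
    rintro st' _ _ ⟨_, h1, h2⟩
    rw [h19] at h1
    exact ⟨fun s hs8 => h1 s hs8 (by omega), h2⟩
  · refine ⟨?_, fun s hs8 h9 => absurd h9 (by omega), fun τ _ _ h => h⟩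
    exact hb.frame (Frame.setW _ 20 0) rfl
  · rintro j hj s₁ hs₁ hf₁ hj' ⟨hb₁, h1, h2⟩
    rw [h19] at hj
    refine Run.seq (T := 10) (T' := 706 * I.n + 700) (Q := fun st => st.wreg 21 = 8 - j)
      (Run.flat hX hs₁ rfl ?_ (by decide)) (fun s₂ hs₂ hf₂ h3 => ?_) (by omega)
    · simp only [Prog.wp, WExp.val, State.setW_wreg, if_true, hj']
      exact ⟨by omega, trivial⟩
    have hb₂ := hb₁.frame hf₂ rfl
    have hthr₂ := (hthr.frame hf₁ rfl rfl).frame hf₂ rfl rfl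
    refine (cellProg_spec hX hs₂ hL hroom (s := 8 - j) ⟨hq, hr, by omega⟩ hb₂ h3 hthr₂
      fun h8 => (h1 _ (by omega) (by omega)).frame hf₂ rfl).mono le_rfl ?_
    rintro s₃ hs₃ hf₃ ⟨h4, h5⟩
    have hok : ∀ τ : Cell L.length, TopOK I L lab s₃ τ → TopOK I L lab (s₃.setW 20 (j + 1)) τ :=
      fun τ h => h
    have htop : ∀ τ : Cell L.length, τ.Valid I L → τ ≠ .top l r e (8 - j) → TopOK I L lab s₁ τ →
        TopOK I L lab s₃ τ := fun τ hτ hne h => h5 τ hτ hne (h.frame hf₂ rfl)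
    refine ⟨⟨?_, ?_, ?_, ?_, ?_⟩, fun s hs8 h9 => hok _ ?_, fun τ hτ hne h => hok _ ?_⟩
    · exact (hb₂.setup.frame hf₃ rfl).frame (Frame.setW _ 20 (j + 1)) rfl
    · exact ⟨(hf₃.w 4 rfl).trans hb₂.focus.left, (hf₃.w 5 rfl).trans hb₂.focus.right,
        (hf₃.w 10 rfl).trans hb₂.focus.cls, (hf₃.w 11 rfl).trans hb₂.focus.qry,
        (hf₃.w 12 rfl).trans hb₂.focus.rank⟩
    · exact (hf₃.w 7 rfl).trans hb₂.pair
    · have : AllOK I L lab s₃ l r (I.rk (L.get e).2) := hb₂.all.frame hf₃ rfl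
      exact this
    · intro l' r' a b c d
      have h6 := hb₁.sub l' r' a b c d
      refine ⟨fun t ht ht' => ?_, fun e' s' hv' => ?_⟩
      · have : AllOK I L lab s₃ l' r' t := ((h6.1 t ht ht').frame hf₂ rfl).frame hf₃ rfl
        exact this
      refine htop _ hv' (fun h => ?_) (h6.2 e' s' hv')
      cases h
      omega
    · by_cases h10 : s = 8 - j
      · rw [h10]; exact h4
      · refine htop _ ⟨hq, hr, hs8⟩ (fun h => ?_) (h1 s hs8 (by omega))
        cases h
        exact h10 rfl
    · exact htop τ hτ (hne _) (h2 τ hτ hne h)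

end CellLoop
end TwoWay

namespace TwoWay

/-! ### The order in which the tables are filled -/

section Sweep

variable {I : Instance} {L : List (Fin I.p × Fin I.n)} {lab : Fin I.n → Fin I.p}

/-- Ranks are injective with values in `1, …, n`, hence take each of them. This lets the sweep visit
the queries rank by rank. -/
theorem Instance.exists_rk (I : Instance) {t : ℕ} (h1 : 1 ≤ t) (h2 : t ≤ I.n) :
    ∃ y, I.rk y = t := by
  have hinj : Function.Injective fun y : Fin I.n =>
      (⟨I.rk y - 1, by have := I.rk_le y; have := I.one_le_rk y; omega⟩ : Fin I.n) := by
    intro a b h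
    have h3 := I.one_le_rk a
    have h4 := I.one_le_rk b
    have h5 : I.rk a - 1 = I.rk b - 1 := congrArg Fin.val h
    exact I.rk_injective (by omega)
  obtain ⟨y, hy⟩ := Finite.surjective_of_injective hinj ⟨t - 1, by omega⟩
  have h3 := I.one_le_rk y
  have h4 : I.rk y - 1 = t - 1 := congrArg Fin.val hy
  exact ⟨y, by omega⟩

theorem allEntry_one (l r : ℕ) (v : ℝ) : AllEntry I L lab (.all l r 1) 0 v := by
  refine .inl ⟨rfl, fun T v' hT => ?_⟩
  cases hT with
  | all l r t e T v h hT =>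
    have := h.2.1
    have := I.one_le_rk (L.get e).2
    omega

theorem IsTop.succ_iff {l r t : ℕ} (h : ∀ y, I.Within l r y → I.rk y ≠ t) (e : Fin L.length) :
    IsTop I L l r (t + 1) e ↔ IsTop I L l r t e := by
  constructor
  · rintro ⟨h1, h2, h3⟩
    have := h _ h1
    exact ⟨h1, by omega, fun y hy hy' => h3 y hy (by omega)⟩
  · rintro ⟨h1, h2, h3⟩
    refine ⟨h1, by omega, fun y hy hy' => h3 y hy ?_⟩
    have := h y hy
    omega

/-- Raising the rank bound past a query outside the interval leaves the set unchanged, so the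
derivations are the same and the entry may be copied. -/
theorem AllEntry.succ {l r t g : ℕ} {v : ℝ} (h : ∀ y, I.Within l r y → I.rk y ≠ t)
    (ha : AllEntry I L lab (.all l r t) g v) : AllEntry I L lab (.all l r (t + 1)) g v := by
  have key : ∀ T v', Der I L lab (.all l r (t + 1)) T v' ↔ Der I L lab (.all l r t) T v' := by
    intro T v'
    constructor
    · intro hT
      cases hT with
      | all l r t e T v h' hT => exact .all _ _ _ _ _ _ ((IsTop.succ_iff h e).1 h') hT
    · intro hT
      cases hT with
      | all l r t e T v h' hT => exact .all _ _ _ _ _ _ ((IsTop.succ_iff h e).2 h') hT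
  rcases ha with ⟨h1, h2⟩ | ⟨τ, h1, h2, h3, h4, h5, h6⟩
  · exact .inl ⟨h1, fun T v' hT => h2 T v' ((key T v').1 hT)⟩
  · refine .inr ⟨τ, h1, h2, h3.trans ?_, h4, fun T hT => (key _ _).2 (h5 T hT),
      fun T v' hT => h6 T v' ((key _ _).1 hT)⟩
    simp only [Cell.potential]
    omega

/-- The best of the subproblems with heaviest query `q` for the first `k` pairs. -/
def PartEntry (I : Instance) (L : List (Fin I.p × Fin I.n)) (lab : Fin I.n → Fin I.p)
    (l r : ℕ) (q : Fin I.n) (k g : ℕ) (v : ℝ) : Prop :=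
  (g = 0 ∧ ∀ e : Fin L.length, (e : ℕ) < k → (L.get e).2 = q →
      ∀ T v', ¬ Der I L lab (.top l r e 0) T v') ∨
    ∃ e : Fin L.length, (L.get e).2 = q ∧ g = Cell.addr I (.top l r e 0) + 1 ∧
      Best I L lab (.top l r e 0) v ∧ ∀ e' : Fin L.length, (e' : ℕ) < k → (L.get e').2 = q →
        ∀ T v', Der I L lab (.top l r e' 0) T v' → v ≤ v'

theorem PartEntry.zero {l r : ℕ} {q : Fin I.n} {v : ℝ} : PartEntry I L lab l r q 0 0 v :=
  .inl ⟨rfl, fun _ h => absurd h (Nat.not_lt_zero _)⟩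

theorem PartEntry.skip {l r g : ℕ} {q : Fin I.n} {v : ℝ} {e : Fin L.length}
    (h : PartEntry I L lab l r q e g v) (he : (L.get e).2 ≠ q) :
    PartEntry I L lab l r q (e + 1) g v := by
  have key : ∀ e' : Fin L.length, (e' : ℕ) < e + 1 → (L.get e').2 = q → (e' : ℕ) < e := by
    intro e' h1 h2
    refine lt_of_le_of_ne (Nat.lt_succ_iff.1 h1) fun h3 => he ?_
    rw [← h2, Fin.ext h3]
  rcases h with ⟨h1, h2⟩ | ⟨τ, h1, h2, h3, h4⟩
  · exact .inl ⟨h1, fun e' h5 h6 => h2 e' (key e' h5 h6) h6⟩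
  · exact .inr ⟨τ, h1, h2, h3, fun e' h5 h6 => h4 e' (key e' h5 h6) h6⟩

theorem PartEntry.keep {l r g : ℕ} {q : Fin I.n} {v : ℝ} {e : Fin L.length} {E : Entry}
    (h : PartEntry I L lab l r q e g v) (hE : Opt I L lab (.top l r e 0) (fun _ => True) E)
    (hc : ¬ (E.kind ≠ 0 ∧ (g = 0 ∨ E.val < v))) : PartEntry I L lab l r q (e + 1) g v := by
  have key : ∀ e' : Fin L.length, (e' : ℕ) < e + 1 → (e' : ℕ) < e ∨ e' = e := by
    intro e' h1
    rcases Nat.lt_succ_iff_lt_or_eq.1 h1 with h2 | h2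
    · exact .inl h2
    · exact .inr (Fin.ext h2)
  rcases h with ⟨h1, h2⟩ | ⟨τ, h1, h2, h3, h4⟩
  · refine .inl ⟨h1, fun e' h5 h6 => ?_⟩
    rcases key e' h5 with h7 | rfl
    · exact h2 e' h7 h6
    · exact hE.none (by_contra fun h0 => hc ⟨h0, .inl h1⟩)
  · refine .inr ⟨τ, h1, h2, h3, fun e' h5 h6 T v' hT => ?_⟩
    rcases key e' h5 with h7 | rfl
    · exact h4 e' h7 h6 T v' hT
    · by_cases h0 : E.kind = 0
      · exact absurd hT (hE.none h0 T v')
      · have h8 := (hE.best h0).2 T v' hT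
        have h9 : ¬ E.val < v := fun h9 => hc ⟨h0, .inr h9⟩
        linarith

theorem PartEntry.replace {l r g : ℕ} {q : Fin I.n} {v : ℝ} {e : Fin L.length} {E : Entry}
    (h : PartEntry I L lab l r q e g v) (hE : Opt I L lab (.top l r e 0) (fun _ => True) E)
    (he : (L.get e).2 = q) (h0 : E.kind ≠ 0) (hc : g = 0 ∨ E.val < v) :
    PartEntry I L lab l r q (e + 1) (Cell.addr I (.top l r e 0) + 1) E.val := by
  refine .inr ⟨e, he, rfl, hE.best h0, fun e' h1 h2 T v' hT => ?_⟩
  rcases Nat.lt_succ_iff_lt_or_eq.1 h1 with h3 | h3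
  · rcases h with ⟨h4, h5⟩ | ⟨τ, h4, h5, h6, h7⟩
    · exact absurd hT (h5 e' h3 h2 T v')
    · have h8 := h7 e' h3 h2 T v' hT
      rcases hc with hc | hc
      · omega
      · linarith
  · rw [Fin.ext h3] at hT
    exact (hE.best h0).2 T v' hT

/-- If `q` lies in the interval, the pairs on top of the set up to rank `I.rk q` are exactly those
with query `q`. So the best over all scanned pairs is the best over the choices of a class. -/
theorem PartEntry.allEntry {l r g : ℕ} {q : Fin I.n} {v : ℝ}
    (h : PartEntry I L lab l r q L.length g v) (hr : r < I.n) (hq : I.Within l r q) :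
    AllEntry I L lab (.all l r (I.rk q + 1)) g v := by
  have key : ∀ e : Fin L.length, IsTop I L l r (I.rk q + 1) e → (L.get e).2 = q := by
    rintro e ⟨h1, h2, h3⟩
    have := h3 q hq (by omega)
    exact I.rk_injective (by omega)
  rcases h with ⟨h1, h2⟩ | ⟨e, h1, h2, h3, h4⟩
  · refine .inl ⟨h1, fun T v' hT => ?_⟩
    cases hT with
    | all l r t e T v h hT => exact h2 e e.2 (key e h) _ _ hT
  · refine .inr ⟨.top l r e 0, ⟨by rw [h1]; exact hq, hr, by omega⟩, h2, ?_, h3, fun T hT => ?_, ?_⟩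
    · simp only [Cell.potential, h1]
      omega
    · refine .all l r _ e T v ⟨by rw [h1]; exact hq, by rw [h1]; omega, fun y hy hy' => ?_⟩ hT
      rw [h1]
      omega
    · intro T v' hT
      cases hT with
      | all l r t e T v h hT => exact h4 e e.2 (key e h) _ _ hT

theorem allAddr_inj {l r t l' r' t' : ℕ} (hr : r < I.n) (hr' : r' < I.n) (ht : t ≤ I.n + 1)
    (ht' : t' ≤ I.n + 1) (h : allAddr I l r t = allAddr I l' r' t') : l = l' ∧ r = r' ∧ t = t' := by
  simp only [allAddr] at h
  rw [mul_add_inj (by omega) (by omega), mul_add_inj hr hr'] at h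
  tauto

/-- The interval `[l', r']` comes before `[l, r]`. -/
def Instance.Before (I : Instance) (l r l' r' : ℕ) : Prop :=
  l' ≤ r' ∧ r' < I.n ∧ (l < l' ∨ l' = l ∧ r' < r)

/-- The interval `[l, r]` is at work.  The tables for the intervals before it are filled, and so are
the entries of `[l, r]` for the sets `below l r t` with `t ≤ a` and for the pairs of rank at most `j`
and the first `k` pairs of the next rank. -/
structure Progress (I : Instance) (L : List (Fin I.p × Fin I.n)) (lab : Fin I.n → Fin I.p)
    (l r a j k : ℕ) (st : State) : Prop where
  setup : Setup I L lab st
  nine : st.wreg 19 = 9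
  all : ∀ l' r' t, 1 ≤ t → t ≤ I.n + 1 → (I.Before l r l' r' ∨ l' = l ∧ r' = r ∧ t ≤ a) →
    AllOK I L lab st l' r' t
  top : ∀ l' r' e s, Cell.Valid I L (.top l' r' e s) → (I.Before l r l' r' ∨ l' = l ∧ r' = r ∧
    (I.rk (L.get e).2 ≤ j ∨ I.rk (L.get e).2 = j + 1 ∧ (e : ℕ) < k)) →
    TopOK I L lab st (.top l' r' e s)

/-- The program neither destroys the instance nor writes to the tables. -/
def Prog.sparesTables (P : Prog) : Bool := P.keeps && P.sparesTop && P.sparesAll && !P.wW 19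

theorem Progress.frame {l r a j k : ℕ} {P : Prog} {st st' : State}
    (h : Progress I L lab l r a j k st) (hf : Frame P st st') (hP : P.sparesTables = true) :
    Progress I L lab l r a j k st' := by
  simp only [Prog.sparesTables, Bool.and_eq_true, Bool.not_eq_true'] at hP
  obtain ⟨⟨⟨h1, h2⟩, h3⟩, h4⟩ := hP
  exact ⟨h.setup.frame hf h1, (hf.w 19 h4).trans h.nine,
    fun l' r' t a b c => (h.all l' r' t a b c).frame hf h3,
    fun l' r' e s a b => (h.top l' r' e s a b).frame hf h2⟩

theorem Progress.finish {l r : ℕ} {st : State} (h : Progress I L lab l r (I.n + 1) I.n 0 st) :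
    Progress I L lab l (r + 1) 0 0 0 st := by
  refine ⟨h.setup, h.nine, fun l' r' t a b c => h.all l' r' t a b ?_,
    fun l' r' e s a b => h.top l' r' e s a ?_⟩
  · rcases c with ⟨c1, c2, c3⟩ | c
    · by_cases h1 : l' = l ∧ r' = r
      · exact .inr ⟨h1.1, h1.2, b⟩
      · exact .inl ⟨c1, c2, by omega⟩
    · omega
  · have h2 := I.rk_le (L.get e).2
    have h3 := I.one_le_rk (L.get e).2
    rcases b with ⟨c1, c2, c3⟩ | c
    · by_cases h1 : l' = l ∧ r' = r
      · exact .inr ⟨h1.1, h1.2, .inl h2⟩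
      · exact .inl ⟨c1, c2, by omega⟩
    · omega

/-- Reaching the right end `I.n` completes the row of `l + 1`. Moving to `l` asks for nothing new,
as intervals with `r' < l` are empty. -/
theorem Progress.left {l : ℕ} {st : State} (h : Progress I L lab (l + 1) I.n 0 0 0 st) :
    Progress I L lab l l 0 0 0 st := by
  refine ⟨h.setup, h.nine, fun l' r' t a b c => h.all l' r' t a b ?_,
    fun l' r' e s a b => h.top l' r' e s a ?_⟩
  · rcases c with ⟨c1, c2, c3⟩ | c
    · exact .inl ⟨c1, c2, by omega⟩
    · omega
  · have h3 := I.one_le_rk (L.get e).2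
    rcases b with ⟨c1, c2, c3⟩ | c
    · exact .inl ⟨c1, c2, by omega⟩
    · omega

/-- The place in the tables of the queries up to the rank in register `12`. -/
def nextExp : WExp := allExp (.reg 4) (.reg 5) (.add (.reg 12) (.const 1))

/-- The place in the tables of the subproblem without holes for the pair in register `7`. -/
def pairExp : WExp := topExp (.reg 4) (.reg 5) (.const 0)

/-- Takes the subproblem of the pair in register `7` into account. -/
def mergeProg : Prog :=
  .cond (.and (.not (.weq (.get 8 pairExp) (.const 0)))
      (.or (.weq (.get 13 nextExp) (.const 0)) (.rlt (.get 2 pairExp) (.get 3 nextExp))))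
    (.seq (.putW 13 nextExp (.add pairExp (.const 1))) (.putR 3 nextExp (.get 2 pairExp))) .skip

/-- Computes the entries for the pair in register `7`. -/
def pairProg : Prog :=
  .seq (.setW 10 (.get 1 (.reg 7))) (.seq thrProg (.seq cellLoop mergeProg))

/-- Computes the entries for all pairs with the query in register `11`. -/
def pairLoop : Prog :=
  .for 7 2 (.cond (.weq (.get 2 (.reg 7)) (.reg 11)) pairProg .skip)

/-- Computes the entries for the query in register `11`. -/
def queryProg : Prog := .seq (.putW 13 nextExp (.const 0)) pairLoop

/-- Copies an entry if the query is not in the interval. -/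
def copyProg : Prog := .block [.putW 13 nextExp (.get 13 (allExp (.reg 4) (.reg 5) (.reg 12))),
  .putR 3 nextExp (.get 3 (allExp (.reg 4) (.reg 5) (.reg 12)))]

/-- Computes the entries for the rank in register `6`. -/
def rankStep : Prog :=
  .seq (.seq (.setW 11 (.get 7 (.reg 6))) (.setW 12 (.add (.reg 6) (.const 1))))
    (.cond (.and (.not (.wlt (.get 3 (.reg 11)) (.reg 4))) (.not (.wlt (.reg 5) (.get 3 (.reg 11)))))
      queryProg copyProg)

/-- Computes the entries for the interval in registers `4` and `5`. -/
def intervalProg : Prog :=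
  .seq (.putW 13 (allExp (.reg 4) (.reg 5) (.const 1)) (.const 0)) (.for 6 0 rankStep)

/-- Computes the entries for the intervals with the left end in register `4`. -/
def rowProg : Prog := .for 9 36 (.seq (.setW 5 (.add (.reg 4) (.reg 9))) intervalProg)

/-- Fills the tables. -/
def sweepProg : Prog := .seq (.setW 19 (.const 9)) (.for 3 0
  (.seq (.seq (.setW 4 (.sub (.sub (.reg 0) (.const 1)) (.reg 3)))
    (.setW 36 (.add (.reg 3) (.const 1)))) rowProg))

variable {X l r k : ℕ} {st : State}

/-- What is known while the pairs with query `q` are processed. -/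
structure PairInv (I : Instance) (L : List (Fin I.p × Fin I.n)) (lab : Fin I.n → Fin I.p)
    (l r : ℕ) (q : Fin I.n) (k : ℕ) (st : State) : Prop where
  prog : Progress I L lab l r (I.rk q) (I.rk q - 1) k st
  left : st.wreg 4 = l
  right : st.wreg 5 = r
  qry : st.wreg 11 = q
  rank : st.wreg 12 = I.rk q
  part : PartEntry I L lab l r q k (st.warr 13 (allAddr I l r (I.rk q + 1)))
    (st.rarr 3 (allAddr I l r (I.rk q + 1)))

theorem mergeProg_spec (hX : 16 < X) (hs : Bdd X st)
    (hroom : ∀ σ : Cell L.length, σ.Valid I L → σ.addr I + 1 < X) {q : Fin I.n}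
    (hq : I.Within l r q) (hr : r < I.n) {e : Fin L.length} (he : (L.get e).2 = q)
    (h : Setup I L lab st) (h4 : st.wreg 4 = l) (h5 : st.wreg 5 = r) (h7 : st.wreg 7 = e)
    (h12 : st.wreg 12 = I.rk q) (htop : TopOK I L lab st (.top l r e 0))
    (hpart : PartEntry I L lab l r q e (st.warr 13 (allAddr I l r (I.rk q + 1)))
      (st.rarr 3 (allAddr I l r (I.rk q + 1)))) :
    Run X mergeProg 250 st fun st' =>
      PartEntry I L lab l r q (e + 1) (st'.warr 13 (allAddr I l r (I.rk q + 1)))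
        (st'.rarr 3 (allAddr I l r (I.rk q + 1))) ∧
      ∀ l' r' t, l' ≤ r' → r' < I.n → t ≤ I.n + 1 → ¬ (l' = l ∧ r' = r ∧ t = I.rk q + 1) →
        AllOK I L lab st l' r' t → AllOK I L lab st' l' r' t := by
  have hg := h.given
  have hv : Cell.Valid I L (.top l r e 0) := ⟨by rw [he]; exact hq, hr, by omega⟩
  have b1 := hroom _ hv
  have hk := I.rk_le q
  refine Run.flat hX hs rfl ?_ (by decide)
  have e1 : pairExp.val st = Cell.addr I (.top l r e 0) := by
    simp [pairExp, topExp, WExp.val, h4, h5, h7, hg.n, hg.m, Cell.addr]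
  have e2 : ∀ v, nextExp.val (st.putW 13 v (Cell.addr I (.top l r e 0) + 1)) =
      allAddr I l r (I.rk q + 1) := fun v => by
    simp [nextExp, allExp, WExp.val, h4, h5, h12, hg.n, allAddr]
  have e2' : nextExp.val st = allAddr I l r (I.rk q + 1) := by
    simp [nextExp, allExp, WExp.val, h4, h5, h12, hg.n, allAddr]
  have e3 : ∀ v, pairExp.val (st.putW 13 v (Cell.addr I (.top l r e 0) + 1)) =
      Cell.addr I (.top l r e 0) := fun v => by
    simp [pairExp, topExp, WExp.val, h4, h5, h7, hg.n, hg.m, Cell.addr]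
  simp only [mergeProg, Prog.wp, BExp.Holds, WExp.val, RExp.val, e1, e2, e2', e3, State.putR_warr,
    State.putW_warr, State.putR_rarr, State.putW_rarr, if_true, Function.update_self, AllOK]
  refine ⟨fun ⟨c1, c2⟩ => ⟨b1, hpart.replace htop he c1 c2, fun l' r' t a b c d ha => ?_⟩,
    fun c => ⟨hpart.keep htop c, fun l' r' t a b c d ha => ha⟩⟩
  have hne : allAddr I l' r' t ≠ allAddr I l r (I.rk q + 1) := fun h' =>
    d (allAddr_inj b hr c (by omega) h')
  rw [Function.update_of_ne hne, Function.update_of_ne hne]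
  exact ha

theorem PairInv.frame {q : Fin I.n} {P : Prog} {st st' : State} (h : PairInv I L lab l r q k st)
    (hf : Frame P st st') (hP : P.sparesTables = true)
    (hP' : (P.wW 4 || P.wW 5 || P.wW 11 || P.wW 12) = false) : PairInv I L lab l r q k st' := by
  simp only [Bool.or_eq_false_iff] at hP'
  obtain ⟨⟨⟨h1, h2⟩, h3⟩, h4⟩ := hP'
  have h5 := hP
  simp only [Prog.sparesTables, Prog.sparesAll, Bool.and_eq_true, Bool.not_eq_true',
    Bool.or_eq_false_iff] at h5
  refine ⟨h.prog.frame hf hP, (hf.w 4 h1).trans h.left, (hf.w 5 h2).trans h.right,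
    (hf.w 11 h3).trans h.qry, (hf.w 12 h4).trans h.rank, ?_⟩
  rw [hf.a 13 h5.1.2.1, hf.b 3 h5.1.2.2]
  exact h.part

theorem pairProg_spec (hX : 16 < X) (hs : Bdd X st) (hL : ∀ j q, (j, q) ∈ L → q ∈ I.cls j)
    (hroom : ∀ σ : Cell L.length, σ.Valid I L → σ.addr I + 1 < X) {q : Fin I.n}
    (hq : I.Within l r q) (hr : r < I.n) {e : Fin L.length} (he : (L.get e).2 = q)
    (h7 : st.wreg 7 = e) (h : PairInv I L lab l r q e st) :
    Run X pairProg (16000 * I.n) st (PairInv I L lab l r q (e + 1)) := by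
  have hn := I.n_pos
  have h1q := I.one_le_rk q
  have hg := h.prog.setup.given
  refine Run.seq (T := 10) (T' := 15990 * I.n) (Q := fun st => st.wreg 10 = (L.get e).1)
    (Run.flat hX hs rfl ?_ (by decide)) (fun s₁ hs₁ hf₁ h1 => ?_) (by omega)
  · have := hs.warr 1 e
    simp only [Prog.wp, WExp.val, State.setW_wreg, if_true, h7, hg.cls e] at this ⊢
    exact ⟨this, trivial⟩
  have i₁ := h.frame hf₁ rfl rfl
  have F₁ : Focus I l r (L.get e).1 (L.get e).2 s₁ :=
    ⟨i₁.left, i₁.right, h1, by rw [he]; exact i₁.qry, by rw [he]; exact i₁.rank⟩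
  refine Run.seq (thrProg_spec hX hs₁ i₁.prog.setup F₁ i₁.prog.nine) (T' := 13900 * I.n)
    (fun s₂ hs₂ hf₂ h2 => ?_) (by omega)
  have i₂ := i₁.frame hf₂ rfl rfl
  have B₂ : Base I L lab l r e s₂ := by
    refine ⟨i₂.prog.setup, F₁.frame hf₂ rfl, ?_, ?_, fun l' r' a b c d => ?_⟩
    · rw [hf₂.w 7 rfl, hf₁.w 7 rfl, h7]
    · rw [he]
      exact i₂.prog.all l r _ h1q (by have := I.rk_le q; omega) (.inr ⟨rfl, rfl, le_rfl⟩)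
    · have hb : I.Before l r l' r' := ⟨b, by omega, by omega⟩
      exact ⟨fun t ht ht' => i₂.prog.all l' r' t ht ht' (.inl hb),
        fun e s hv => i₂.prog.top l' r' e s hv (.inl hb)⟩
  refine Run.seq (cellLoop_spec hX hs₂ hL hroom (by rw [he]; exact hq) hr B₂ i₂.prog.nine h2)
    (T' := 250) (fun s₃ hs₃ hf₃ ⟨h3, h3'⟩ => ?_) (by omega)
  have S₃ := i₂.prog.setup.frame hf₃ rfl
  have p₃ := i₂.part
  rw [← hf₃.a 13 rfl, ← hf₃.b 3 rfl] at p₃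
  refine (mergeProg_spec hX hs₃ hroom hq hr he S₃ ((hf₃.w 4 rfl).trans i₂.left)
    ((hf₃.w 5 rfl).trans i₂.right) ((hf₃.w 7 rfl).trans B₂.pair) ((hf₃.w 12 rfl).trans i₂.rank)
    (h3 0 (by omega)) p₃).mono le_rfl ?_
  rintro s₄ hs₄ hf₄ ⟨h4, h5⟩
  refine ⟨⟨S₃.frame hf₄ rfl, ?_, fun l' r' t a b c => ?_, fun l' r' e' s a b => ?_⟩, ?_, ?_, ?_, ?_, h4⟩
  · rw [hf₄.w 19 rfl, hf₃.w 19 rfl]; exact i₂.prog.nine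
  -- The merge writes only the entry for rank bound `I.rk q + 1`, which is not yet among those
  -- claimed to be correct.
  · refine h5 l' r' t ?_ ?_ b (by rintro ⟨rfl, rfl, rfl⟩; rcases c with ⟨_, _, c⟩ | c <;> omega)
      ((i₂.prog.all l' r' t a b c).frame hf₃ rfl)
    · have := hq.1; have := hq.2
      rcases c with ⟨c, _⟩ | ⟨rfl, rfl, _⟩ <;> omega
    · rcases c with ⟨_, c, _⟩ | ⟨rfl, rfl, _⟩ <;> omega
  · refine TopOK.frame ?_ hf₄ rfl
    by_cases hc : l' = l ∧ r' = r ∧ e' = e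
    · obtain ⟨rfl, rfl, rfl⟩ := hc
      exact h3 s a.2.2
    · refine h3' _ a (fun s' h' => hc ?_) (i₂.prog.top l' r' e' s a ?_)
      · cases h'
        exact ⟨rfl, rfl, rfl⟩
      · rcases b with b | ⟨rfl, rfl, b | ⟨b, b'⟩⟩
        · exact .inl b
        · exact .inr ⟨rfl, rfl, .inl b⟩
        · refine .inr ⟨rfl, rfl, .inr ⟨b, lt_of_le_of_ne (Nat.lt_succ_iff.1 b') fun h' => hc ?_⟩⟩
          exact ⟨rfl, rfl, Fin.ext h'⟩
  · rw [hf₄.w 4 rfl, hf₃.w 4 rfl]; exact i₂.left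
  · rw [hf₄.w 5 rfl, hf₃.w 5 rfl]; exact i₂.right
  · rw [hf₄.w 11 rfl, hf₃.w 11 rfl]; exact i₂.qry
  · rw [hf₄.w 12 rfl, hf₃.w 12 rfl]; exact i₂.rank

/-- The number of classes that contain the query of rank `t`. -/
noncomputable def rankCount (I : Instance) (L : List (Fin I.p × Fin I.n)) (t : ℕ) : ℕ :=
  ∑ k ∈ Finset.range L.length, if ∃ e : Fin L.length, (e : ℕ) = k ∧ I.rk (L.get e).2 = t then 1 else 0

/-- Each pair has a single query and hence a single rank. This is what keeps the time per interval
at `O(n m)` although all pairs are scanned for each rank. -/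
theorem sum_rankCount_le (I : Instance) (L : List (Fin I.p × Fin I.n)) (N : ℕ) :
    ∑ t ∈ Finset.range N, rankCount I L (t + 1) ≤ L.length := by
  simp only [rankCount]
  rw [Finset.sum_comm]
  calc _ ≤ ∑ k ∈ Finset.range L.length, 1 := Finset.sum_le_sum fun k hk => ?_
    _ = L.length := by simp
  have hk' := Finset.mem_range.1 hk
  have : ∀ t, (∃ e : Fin L.length, (e : ℕ) = k ∧ I.rk (L.get e).2 = t + 1) →
      t = I.rk (L.get ⟨k, hk'⟩).2 - 1 := by
    rintro t ⟨e, rfl, h⟩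
    simp only [Fin.eta]
    omega
  calc _ ≤ ∑ t ∈ Finset.range N, if t = I.rk (L.get ⟨k, hk'⟩).2 - 1 then 1 else 0 := by
        refine Finset.sum_le_sum fun t _ => ?_
        split_ifs with h1 h2
        · exact le_rfl
        · exact absurd (this t h1) h2
        · omega
        · exact le_rfl
    _ ≤ 1 := by
        rw [Finset.sum_ite_eq']
        split_ifs <;> omega

/-- Scanning a pair takes constant time, and the linear work is done only for pairs whose query has
the current rank. The bound keeps these two contributions apart for the later summation. -/
theorem pairLoop_spec (hX : 16 < X) (hs : Bdd X st) (hL : ∀ j q, (j, q) ∈ L → q ∈ I.cls j)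
    (hroom : ∀ σ : Cell L.length, σ.Valid I L → σ.addr I + 1 < X) {q : Fin I.n}
    (hq : I.Within l r q) (hr : r < I.n) (h : PairInv I L lab l r q 0 st) :
    Run X pairLoop (16000 * I.n * rankCount I L (I.rk q) + 40 * L.length + 8) st
      (PairInv I L lab l r q L.length) := by
  have hm := h.prog.setup.given.m
  have key := Run.for hX (i := 7) (N := 2) (P := .cond (.weq (.get 2 (.reg 7)) (.reg 11)) pairProg
    .skip) rfl rfl rfl hs (PairInv I L lab l r q)
    (fun k => 20 + if ∃ e : Fin L.length, (e : ℕ) = k ∧ I.rk (L.get e).2 = I.rk q then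
      16000 * I.n else 0) (T' := 16000 * I.n * rankCount I L (I.rk q) + 40 * L.length + 8)
      (h.frame (Frame.setW _ 7 0) rfl rfl) ?_ ?_
  · rwa [hm] at key
  · intro k hk s₁ hs₁ hf₁ h7 h1
    rw [hm] at hk
    have hq₁ := h1.prog.setup.given.qry ⟨k, hk⟩
    simp only at hq₁
    refine Run.cond hX hs₁ rfl (T := 10 + if ∃ e : Fin L.length, (e : ℕ) = k ∧
      I.rk (L.get e).2 = I.rk q then 16000 * I.n else 0) (fun hc => ?_) (fun hc => ?_) ?_
    · simp only [BExp.Holds, WExp.val, h7, hq₁, h1.qry] at hc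
      have he : (L.get ⟨k, hk⟩).2 = q := Fin.ext hc
      rw [if_pos ⟨⟨k, hk⟩, rfl, by rw [he]⟩]
      exact (pairProg_spec hX hs₁ hL hroom hq hr he h7 h1).mono (by omega)
        fun s₂ _ _ h2 => h2.frame (Frame.setW _ 7 (k + 1)) rfl rfl
    · simp only [BExp.Holds, WExp.val, h7, hq₁, h1.qry] at hc
      have he : (L.get ⟨k, hk⟩).2 ≠ q := fun h' => hc (congrArg Fin.val h')
      refine Run.flat hX hs₁ rfl ?_ (le_trans (by decide : _ ≤ 10) (by omega))
      have h2 : PairInv I L lab l r q (k + 1) s₁ := by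
        refine ⟨⟨h1.prog.setup, h1.prog.nine, h1.prog.all, fun l' r' e s a b =>
          h1.prog.top l' r' e s a ?_⟩, h1.left, h1.right, h1.qry, h1.rank,
          PartEntry.skip (e := ⟨k, hk⟩) h1.part he⟩
        rcases b with b | ⟨b1, b2, b | ⟨b3, b4⟩⟩
        · exact .inl b
        · exact .inr ⟨b1, b2, .inl b⟩
        · refine .inr ⟨b1, b2, .inr ⟨b3, lt_of_le_of_ne (Nat.lt_succ_iff.1 b4) fun h' => he ?_⟩⟩
          have h5 : e = ⟨k, hk⟩ := Fin.ext h'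
          have h6 := I.one_le_rk q
          rw [← h5]
          exact I.rk_injective (by omega)
      exact h2.frame (Frame.setW _ 7 (k + 1)) rfl rfl
    · simp only [BExp.time, WExp.time]
      omega
  · rw [hm]
    simp only [rankCount, Finset.sum_add_distrib, Finset.mul_sum, mul_ite, mul_one, mul_zero,
      Finset.sum_const, Finset.card_range, smul_eq_mul]
    omega

/-- The place written has rank bound above `a`, so no entry claimed so far is touched. -/
theorem Progress.write {a j t : ℕ} {P : Prog} {st' : State} (h : Progress I L lab l r a j k st)
    (hlr : l ≤ r) (hr : r < I.n) (hat : a < t) (ht : t ≤ I.n + 1) (hf : Frame P st st')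
    (hP : (P.keeps && P.sparesTop && !P.wW 19) = true)
    (hw : ∀ i ≠ allAddr I l r t, st'.warr 13 i = st.warr 13 i ∧ st'.rarr 3 i = st.rarr 3 i) :
    Progress I L lab l r a j k st' := by
  simp only [Bool.and_eq_true, Bool.not_eq_true'] at hP
  obtain ⟨⟨h1, h2⟩, h3⟩ := hP
  refine ⟨h.setup.frame hf h1, (hf.w 19 h3).trans h.nine, fun l' r' t' b c d => ?_,
    fun l' r' e s b c => (h.top l' r' e s b c).frame hf h2⟩
  have hr' : r' < I.n := by rcases d with ⟨_, d, _⟩ | ⟨rfl, rfl, _⟩ <;> assumption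
  have h4 := hw (allAddr I l' r' t') fun h' => by
    obtain ⟨rfl, rfl, rfl⟩ := allAddr_inj hr' hr c ht h'
    rcases d with ⟨_, _, d⟩ | d <;> omega
  rw [AllOK, h4.1, h4.2]
  exact h.all l' r' t' b c d

theorem Progress.next {j : ℕ} (h : Progress I L lab l r (j + 1) j L.length st)
    (ha : AllOK I L lab st l r (j + 2)) : Progress I L lab l r (j + 2) (j + 1) 0 st := by
  refine ⟨h.setup, h.nine, fun l' r' t b c d => ?_, fun l' r' e s b c => h.top l' r' e s b ?_⟩
  · by_cases h1 : l' = l ∧ r' = r ∧ t = j + 2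
    · obtain ⟨rfl, rfl, rfl⟩ := h1
      exact ha
    · refine h.all l' r' t b c ?_
      rcases d with d | d
      · exact .inl d
      · omega
  · rcases c with c | ⟨c1, c2, c⟩
    · exact .inl c
    · refine .inr ⟨c1, c2, ?_⟩
      by_cases h1 : I.rk (L.get e).2 ≤ j
      · exact .inl h1
      · exact .inr ⟨by omega, e.2⟩

/-- What is known before the rank `j + 1` is processed. -/
structure RankInv (I : Instance) (L : List (Fin I.p × Fin I.n)) (lab : Fin I.n → Fin I.p)
    (l r j : ℕ) (st : State) : Prop where
  prog : Progress I L lab l r (j + 1) j 0 st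
  left : st.wreg 4 = l
  right : st.wreg 5 = r

theorem RankInv.frame {j : ℕ} {P : Prog} {st st' : State} (h : RankInv I L lab l r j st)
    (hf : Frame P st st') (hP : P.sparesTables = true) (hP' : (P.wW 4 || P.wW 5) = false) :
    RankInv I L lab l r j st' := by
  simp only [Bool.or_eq_false_iff] at hP'
  exact ⟨h.prog.frame hf hP, (hf.w 4 hP'.1).trans h.left, (hf.w 5 hP'.2).trans h.right⟩

theorem queryProg_spec (hX : 16 < X) (hs : Bdd X st) (hL : ∀ j q, (j, q) ∈ L → q ∈ I.cls j)
    (hroom : ∀ σ : Cell L.length, σ.Valid I L → σ.addr I + 1 < X) {j : ℕ} {q : Fin I.n}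
    (hj : I.rk q = j + 1) (hq : I.Within l r q) (hr : r < I.n) (h : RankInv I L lab l r j st)
    (h11 : st.wreg 11 = q) (h12 : st.wreg 12 = j + 1) :
    Run X queryProg (16000 * I.n * rankCount I L (j + 1) + 40 * L.length + 50) st
      (RankInv I L lab l r (j + 1)) := by
  have hlr := hq.1.trans hq.2
  have hk := I.rk_le q
  have hn := h.prog.setup.given.n
  refine Run.seq (T := 40) (T' := 16000 * I.n * rankCount I L (j + 1) + 40 * L.length + 8)
    (Q := PairInv I L lab l r q 0) ?_ (fun s₁ hs₁ hf₁ h1 => ?_) (by omega)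
  · have hw : Run X (.putW 13 nextExp (.const 0)) 40 st fun st' =>
        st'.warr 13 (allAddr I l r (j + 2)) = 0 ∧
        ∀ i ≠ allAddr I l r (j + 2), st'.warr 13 i = st.warr 13 i ∧ st'.rarr 3 i = st.rarr 3 i := by
      refine Run.flat hX hs rfl ?_ (by decide)
      simp only [Prog.wp, WExp.val, nextExp, allExp, h.left, h.right, h12, hn, State.putW_warr,
        State.putW_rarr, if_true]
      exact ⟨by omega, Function.update_self .., fun i hi => ⟨Function.update_of_ne hi _ _, trivial⟩⟩
    refine hw.mono le_rfl fun s₁ _ hf₁ ⟨h1, h2⟩ => ?_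
    have h3 := h.prog.write hlr hr (by omega) (by omega) hf₁ rfl h2
    refine ⟨?_, (hf₁.w 4 rfl).trans h.left, (hf₁.w 5 rfl).trans h.right, (hf₁.w 11 rfl).trans h11,
      ?_, ?_⟩
    · rw [hj]; exact h3
    · rw [hf₁.w 12 rfl, h12, hj]
    · rw [hj, h1]; exact PartEntry.zero
  · rw [← hj]
    refine (pairLoop_spec hX hs₁ hL hroom hq hr h1).mono le_rfl fun s₂ _ _ h2 => ?_
    have h3 := h2.prog
    have h4 := h2.part.allEntry hr hq
    rw [hj] at h3 h4 ⊢
    exact ⟨h3.next h4, h2.left, h2.right⟩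

theorem copyProg_spec (hX : 16 < X) (hs : Bdd X st) {j : ℕ} {q : Fin I.n} (hj : I.rk q = j + 1)
    (hq : ¬ I.Within l r q) (hlr : l ≤ r) (hr : r < I.n) (h : RankInv I L lab l r j st)
    (h12 : st.wreg 12 = j + 1) : Run X copyProg 100 st (RankInv I L lab l r (j + 1)) := by
  have hk := I.rk_le q
  have hn := h.prog.setup.given.n
  have b1 := hs.warr 13 (allAddr I l r (j + 1))
  have hne : allAddr I l r (j + 1) ≠ allAddr I l r (j + 2) := by simp [allAddr]
  have hw : Run X copyProg 100 st fun st' =>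
      (st'.warr 13 (allAddr I l r (j + 2)) = st.warr 13 (allAddr I l r (j + 1)) ∧
        st'.rarr 3 (allAddr I l r (j + 2)) = st.rarr 3 (allAddr I l r (j + 1))) ∧
      ∀ i ≠ allAddr I l r (j + 2), st'.warr 13 i = st.warr 13 i ∧ st'.rarr 3 i = st.rarr 3 i := by
    refine Run.flat hX hs rfl ?_ (by decide)
    simp only [copyProg, Prog.block, Prog.wp, WExp.val, RExp.val, nextExp, allExp, h.left, h.right,
      h12, hn, State.putW_warr, State.putW_rarr, State.putW_wreg, State.putR_warr, State.putR_rarr,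
      if_true]
    exact ⟨b1, ⟨Function.update_self .., Function.update_self ..⟩,
      fun i hi => ⟨Function.update_of_ne hi _ _, Function.update_of_ne hi _ _⟩⟩
  refine hw.mono le_rfl fun s₁ _ hf₁ ⟨h1, h2⟩ => ?_
  have h3 := h.prog.write hlr hr (by omega) (by omega) hf₁ rfl h2
  have hmiss : ∀ y, I.Within l r y → I.rk y ≠ j + 1 := fun y hy hy' =>
    hq (I.rk_injective (hy'.trans hj.symm) ▸ hy)
  have h4 : Progress I L lab l r (j + 1) j L.length s₁ := by
    refine ⟨h3.setup, h3.nine, h3.all, fun l' r' e s a b => h3.top l' r' e s a ?_⟩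
    rcases b with b | ⟨rfl, rfl, b | ⟨b, _⟩⟩
    · exact .inl b
    · exact .inr ⟨rfl, rfl, .inl b⟩
    · exact absurd b (hmiss _ a.1)
  refine ⟨h4.next ?_, (hf₁.w 4 rfl).trans h.left, (hf₁.w 5 rfl).trans h.right⟩
  rw [AllOK, h1.1, h1.2]
  exact AllEntry.succ hmiss (h.prog.all l r (j + 1) (by omega) (by omega) (.inr ⟨rfl, rfl, le_rfl⟩))

theorem rankStep_spec (hX : 16 < X) (hs : Bdd X st) (hL : ∀ j q, (j, q) ∈ L → q ∈ I.cls j)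
    (hroom : ∀ σ : Cell L.length, σ.Valid I L → σ.addr I + 1 < X) {j : ℕ} (hj : j < I.n)
    (hlr : l ≤ r) (hr : r < I.n) (h6 : st.wreg 6 = j) (h : RankInv I L lab l r j st)
    (hn : I.n + 2 < X) :
    Run X rankStep (16000 * I.n * rankCount I L (j + 1) + 40 * L.length + 250) st
      (RankInv I L lab l r (j + 1)) := by
  obtain ⟨q, hq⟩ := I.exists_rk (t := j + 1) (by omega) (by omega)
  have hrk := h.prog.setup.ranked q
  rw [Ranked, hq, Nat.add_sub_cancel] at hrk
  have b1 := hs.warr 7 j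
  rw [hrk.2.2] at b1
  refine Run.seq (T := 20) (T' := 16000 * I.n * rankCount I L (j + 1) + 40 * L.length + 230)
    (Q := fun st => st.wreg 11 = q ∧ st.wreg 12 = j + 1) (Run.flat hX hs rfl ?_ (by decide))
    (fun s₁ hs₁ hf₁ ⟨h11, h12⟩ => ?_) (by omega)
  · simp only [Prog.wp, WExp.val, State.setW_wreg, Nat.reduceEqDiff, if_true, if_false, h6,
      hrk.2.2]
    exact ⟨b1, by omega, trivial, trivial⟩
  have h₁ := h.frame hf₁ rfl rfl
  have hpos := (h₁.prog.setup.ranked q).1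
  refine Run.cond hX hs₁ rfl (T := 16000 * I.n * rankCount I L (j + 1) + 40 * L.length + 150)
    (fun hc => ?_) (fun hc => ?_) (by simp only [BExp.time, WExp.time]; omega)
  · simp only [BExp.Holds, WExp.val, h11, hpos, h₁.left, h₁.right, not_lt] at hc
    exact (queryProg_spec hX hs₁ hL hroom hq hc hr h₁ h11 h12).mono (by omega) fun _ _ _ h => h
  · simp only [BExp.Holds, WExp.val, h11, hpos, h₁.left, h₁.right, not_lt] at hc
    exact (copyProg_spec hX hs₁ hq hc hlr hr h₁ h12).mono (by omega) fun _ _ _ h => h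

theorem intervalProg_spec (hX : 16 < X) (hs : Bdd X st) (hL : ∀ j q, (j, q) ∈ L → q ∈ I.cls j)
    (hroom : ∀ σ : Cell L.length, σ.Valid I L → σ.addr I + 1 < X) (hlr : l ≤ r) (hr : r < I.n)
    (hn : I.n + 2 < X) (h : Progress I L lab l r 0 0 0 st) (h4 : st.wreg 4 = l)
    (h5 : st.wreg 5 = r) : Run X intervalProg (17000 * I.n * L.length + 300 * I.n) st
      (Progress I L lab l (r + 1) 0 0 0) := by
  have hn0 := I.n_pos
  have hg := h.setup.given.n
  refine Run.seq (T := 30) (T' := 16040 * I.n * L.length + 258 * I.n + 8)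
    (Q := RankInv I L lab l r 0) ?_ (fun s₁ hs₁ hf₁ h1 => ?_) (by nlinarith)
  · have hw : Run X (.putW 13 (allExp (.reg 4) (.reg 5) (.const 1)) (.const 0)) 30 st fun st' =>
        st'.warr 13 (allAddr I l r 1) = 0 ∧
        ∀ i ≠ allAddr I l r 1, st'.warr 13 i = st.warr 13 i ∧ st'.rarr 3 i = st.rarr 3 i := by
      refine Run.flat hX hs rfl ?_ (by decide)
      simp only [Prog.wp, WExp.val, allExp, h4, h5, hg, State.putW_warr,
        State.putW_rarr, if_true]
      exact ⟨by omega, Function.update_self .., fun i hi => ⟨Function.update_of_ne hi _ _, trivial⟩⟩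
    refine hw.mono le_rfl fun s₁ _ hf₁ ⟨h1, h2⟩ => ?_
    have h3 := h.write hlr hr (by omega) (by omega) hf₁ rfl h2
    refine ⟨⟨h3.setup, h3.nine, fun l' r' t a b c => ?_, h3.top⟩, (hf₁.w 4 rfl).trans h4,
      (hf₁.w 5 rfl).trans h5⟩
    by_cases hc : l' = l ∧ r' = r ∧ t = 1
    · obtain ⟨rfl, rfl, rfl⟩ := hc
      rw [AllOK, h1]
      exact allEntry_one _ _ _
    · refine h3.all l' r' t a b ?_
      rcases c with c | c
      · exact .inl c
      · omega
  · have hg₁ := h1.prog.setup.given.n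
    have key := Run.for hX (i := 6) (N := 0) (P := rankStep) rfl rfl rfl hs₁ (RankInv I L lab l r)
      (fun j => 16000 * I.n * rankCount I L (j + 1) + 40 * L.length + 250)
      (T' := 16040 * I.n * L.length + 258 * I.n + 8) (h1.frame (Frame.setW _ 6 0) rfl rfl) ?_ ?_
    · rw [hg₁] at key
      exact key.mono le_rfl fun _ _ _ h => h.prog.finish
    · intro j hj s₂ hs₂ hf₂ h6 h2
      rw [hg₁] at hj
      exact (rankStep_spec hX hs₂ hL hroom hj hlr hr h6 h2 hn).mono le_rfl
        fun s₃ _ _ h3 => h3.frame (Frame.setW _ 6 (j + 1)) rfl rfl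
    · rw [hg₁]
      -- Summed over the ranks, the linear work is charged once to each pair, and the scans of the
      -- pairs add another `O(n m)`.
      have := Nat.mul_le_mul_left (16000 * I.n) (sum_rankCount_le I L I.n)
      simp only [Finset.sum_add_distrib, ← Finset.mul_sum, Finset.sum_const, Finset.card_range,
        smul_eq_mul]
      nlinarith

theorem rowProg_spec (hX : 16 < X) (hs : Bdd X st) (hL : ∀ j q, (j, q) ∈ L → q ∈ I.cls j)
    (hroom : ∀ σ : Cell L.length, σ.Valid I L → σ.addr I + 1 < X) (hl : l < I.n)
    (hn : I.n + 2 < X) (h : Progress I L lab l l 0 0 0 st) (h4 : st.wreg 4 = l)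
    (h36 : st.wreg 36 = I.n - l) :
    Run X rowProg (I.n * (17000 * I.n * L.length + 300 * I.n + 40) + 8) st
      (Progress I L lab l I.n 0 0 0) := by
  have key := Run.for_const hX (i := 9) (N := 36) (P := .seq (.setW 5 (.add (.reg 4) (.reg 9)))
    intervalProg) rfl rfl rfl hs (fun d st => Progress I L lab l (l + d) 0 0 0 st ∧ st.wreg 4 = l)
    (17000 * I.n * L.length + 300 * I.n + 10)
    (T' := I.n * (17000 * I.n * L.length + 300 * I.n + 40) + 8)
    ⟨h.frame (Frame.setW _ 9 0) rfl, h4⟩ ?_ ?_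
  · rw [h36, Nat.add_sub_cancel' hl.le] at key
    exact key.mono le_rfl fun _ _ _ h => h.1
  · intro d hd s₁ hs₁ hf₁ h9 ⟨h1, h1'⟩
    rw [h36] at hd
    refine Run.seq (T := 10) (T' := 17000 * I.n * L.length + 300 * I.n)
      (Q := fun st => st.wreg 5 = l + d) (Run.flat hX hs₁ rfl ?_ (by decide))
      (fun s₂ hs₂ hf₂ h2 => ?_) (by omega)
    · simp only [Prog.wp, WExp.val, State.setW_wreg, if_true, h9, h1']
      exact ⟨by omega, trivial⟩
    · refine (intervalProg_spec hX hs₂ hL hroom (Nat.le_add_right l d) (by omega) hn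
        (h1.frame hf₂ rfl) ((hf₂.w 4 rfl).trans h1') h2).mono le_rfl fun s₃ _ hf₃ h3 => ?_
      refine ⟨h3.frame (Frame.setW _ 9 (d + 1)) rfl, ?_⟩
      have : s₃.wreg 4 = l := by rw [hf₃.w 4 rfl, hf₂.w 4 rfl, h1']
      exact this
  · rw [h36]
    refine Nat.add_le_add_right (Nat.mul_le_mul (by omega) (by omega)) 8

/-- Left ends run downwards and right ends upwards, so every proper subinterval is finished before
the interval itself. -/
theorem sweepProg_spec (hX : 16 < X) (hs : Bdd X st) (hL : ∀ j q, (j, q) ∈ L → q ∈ I.cls j)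
    (hroom : ∀ σ : Cell L.length, σ.Valid I L → σ.addr I + 1 < X) (hn : I.n + 2 < X)
    (h : Setup I L lab st) :
    Run X sweepProg (I.n * (I.n * (17000 * I.n * L.length + 300 * I.n + 40) + 60) + 20) st
      (Progress I L lab 0 I.n 0 0 0) := by
  refine Run.seq (T := 5) (T' := I.n * (I.n * (17000 * I.n * L.length + 300 * I.n + 40) + 60) + 8)
    (Q := fun st => st.wreg 19 = 9) (Run.flat hX hs rfl ?_ (by decide))
    (fun s₁ hs₁ hf₁ h19 => ?_) (by omega)
  · simp only [Prog.wp, WExp.val, State.setW_wreg, if_true, and_true]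
    omega
  have h₁ := h.frame hf₁ rfl
  have hg := h₁.given.n
  have key := Run.for_const hX (i := 3) (N := 0) (P := .seq
    (.seq (.setW 4 (.sub (.sub (.reg 0) (.const 1)) (.reg 3))) (.setW 36 (.add (.reg 3) (.const 1))))
    rowProg) rfl rfl rfl hs₁ (fun j st => Progress I L lab (I.n - j) I.n 0 0 0 st)
    (I.n * (17000 * I.n * L.length + 300 * I.n + 40) + 50)
    (T' := I.n * (I.n * (17000 * I.n * L.length + 300 * I.n + 40) + 60) + 8) ?_ ?_ ?_
  · rw [hg, Nat.sub_self] at key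
    exact key
  · have h2 : Progress I L lab I.n I.n 0 0 0 s₁ := by
      refine ⟨h₁, h19, fun l' r' t a b c => ?_, fun l' r' e s a b => ?_⟩
      · rcases c with ⟨c1, c2, c3⟩ | c <;> omega
      · have := I.one_le_rk (L.get e).2
        rcases b with ⟨c1, c2, c3⟩ | c <;> omega
    exact h2.frame (Frame.setW _ 3 0) rfl
  · intro j hj s₂ hs₂ hf₂ h3 h2
    rw [hg] at hj
    have hg₂ := h2.setup.given.n
    refine Run.seq (T := 20) (T' := I.n * (17000 * I.n * L.length + 300 * I.n + 40) + 8)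
      (Q := fun st => st.wreg 4 = I.n - (j + 1) ∧ st.wreg 36 = j + 1)
      (Run.flat hX hs₂ rfl ?_ (by decide)) (fun s₃ hs₃ hf₃ ⟨h4, h36⟩ => ?_) (by omega)
    · simp only [Prog.wp, WExp.val, State.setW_wreg, Nat.reduceEqDiff, if_true, if_false, h3, hg₂]
      exact ⟨by omega, by omega, by omega, trivial⟩
    · have h5 : Progress I L lab (I.n - (j + 1)) (I.n - (j + 1)) 0 0 0 s₃ := by
        refine Progress.left ?_
        rw [show I.n - (j + 1) + 1 = I.n - j by omega]
        exact h2.frame hf₃ rfl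
      exact (rowProg_spec hX hs₃ hL hroom (by omega) hn h5 h4 (by omega)).mono le_rfl
        fun s₄ _ _ h6 => h6.frame (Frame.setW _ 3 (j + 1)) rfl
  · rw [hg]
    exact Nat.add_le_add_right (Nat.mul_le_mul le_rfl (by omega)) 8

end Sweep
end TwoWay

namespace TwoWay

/-! ### The output of a tree -/

section Output

variable {n p : ℕ}

/-- The tables describe the tree. -/
inductive Rep (E : ℕ → Entry) : ℕ → Tree n p → Prop
  | leaf (a : ℕ) (j : Fin p) (h : (E a).kind = 1) (hj : (E a).label = j) : Rep E a (.leaf j)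
  | eq (a : ℕ) (g : Fin n) (j : Fin p) (T : Tree n p) (h : (E a).kind = 2) (hg : (E a).key = g)
      (hj : (E a).label = j) (hT : Rep E (E a).fst T) : Rep E a (.node (.eq g) (.leaf j) T)
  | lt (a : ℕ) (k : Fin n) (T T' : Tree n p) (h : (E a).kind = 3) (hk : (E a).key = k)
      (hT : Rep E (E a).fst T) (hT' : Rep E (E a).snd T') : Rep E a (.node (.lt k) T T')

/-- The first cells of the stack describe the trees, the first tree being on top. -/
def StackRep (E : ℕ → Entry) (f : ℕ → ℕ) : List (Tree n p) → Prop
  | [] => True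
  | T :: Ts => Rep E (f Ts.length) T ∧ StackRep E f Ts

theorem StackRep.congr {E : ℕ → Entry} {f g : ℕ → ℕ} {Ts : List (Tree n p)}
    (h : StackRep E f Ts) (hfg : ∀ i < Ts.length, g i = f i) : StackRep E g Ts := by
  induction Ts with
  | nil => trivial
  | cons T Ts ih =>
    refine ⟨?_, ih h.2 fun i hi => hfg i (hi.trans (Nat.lt_succ_self _))⟩
    rw [hfg _ (Nat.lt_succ_self _)]
    exact h.1

theorem StackRep.push {E : ℕ → Entry} {f : ℕ → ℕ} {Ts : List (Tree n p)} {T : Tree n p} {a k : ℕ}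
    (h : StackRep E f Ts) (hT : Rep E a T) (hk : k = Ts.length) :
    StackRep E (Function.update f k a) (T :: Ts) := by
  subst hk
  refine ⟨by rwa [Function.update_self], h.congr fun i hi => Function.update_of_ne (by omega) _ _⟩

/-- The first cells hold the words of the list. -/
def Written (f : ℕ → ℕ) (w : List ℕ) : Prop := (List.range w.length).map f = w

theorem Written.snoc {f : ℕ → ℕ} {w : List ℕ} (h : Written f w) (x : ℕ) {k : ℕ}
    (hk : k = w.length) : Written (Function.update f k x) (w ++ [x]) := by
  subst hk
  rw [Written, List.length_append, List.length_singleton, List.range_succ, List.map_append]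
  congr 1
  · conv_rhs => rw [← h]
    exact List.map_congr_left fun i hi => Function.update_of_ne (by
      have := List.mem_range.1 hi; omega) _ _
  · simp

/-- Writes a leaf. -/
def emitLeaf : Prog := .block [.putW 0 (.reg 38) (.const 0),
  .putW 0 (.add (.reg 38) (.const 1)) (.get 10 (.reg 39)), .setW 38 (.add (.reg 38) (.const 2))]

/-- Writes an equality test and its yes-subtree. -/
def emitEq : Prog := .block [.putW 0 (.reg 38) (.const 2),
  .putW 0 (.add (.reg 38) (.const 1)) (.get 9 (.reg 39)),
  .putW 0 (.add (.reg 38) (.const 2)) (.const 0),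
  .putW 0 (.add (.reg 38) (.const 3)) (.get 10 (.reg 39)), .setW 38 (.add (.reg 38) (.const 4)),
  .putW 16 (.reg 37) (.get 11 (.reg 39)), .setW 37 (.add (.reg 37) (.const 1))]

/-- Writes a comparison. -/
def emitLt : Prog := .block [.putW 0 (.reg 38) (.const 1),
  .putW 0 (.add (.reg 38) (.const 1)) (.get 9 (.reg 39)), .setW 38 (.add (.reg 38) (.const 2)),
  .putW 16 (.reg 37) (.get 12 (.reg 39)),
  .putW 16 (.add (.reg 37) (.const 1)) (.get 11 (.reg 39)),
  .setW 37 (.add (.reg 37) (.const 2))]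

/-- Handles the subtree on top of the stack. -/
def emitStep : Prog :=
  .seq (.seq (.setW 37 (.sub (.reg 37) (.const 1))) (.setW 39 (.get 16 (.reg 37))))
    (.cond (.weq (.get 8 (.reg 39)) (.const 1)) emitLeaf
      (.cond (.weq (.get 8 (.reg 39)) (.const 2)) emitEq emitLt))

/-- The state of the output of the list `w`: a part has been written, and the rest, which consists of
`k` words, describes the trees on the stack. -/
structure Emit (E : ℕ → Entry) (w out : List ℕ) (Ts : List (Tree n p)) (st : State) : Prop where
  tables : ∀ a, entryAt st a = E a
  height : st.wreg 37 = Ts.length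
  length : st.wreg 38 = out.length
  stack : StackRep E (st.warr 16) Ts
  written : Written (st.warr 0) out
  total : out ++ Ts.flatMap Tree.encode = w

theorem Tree.two_le_length (T : Tree n p) : 2 ≤ T.encode.length := by
  rcases T with j | ⟨k | k, T, T'⟩ <;> simp [Tree.encode]

theorem length_le_flatMap (Ts : List (Tree n p)) :
    Ts.length ≤ (Ts.flatMap Tree.encode).length := by
  induction Ts with
  | nil => simp
  | cons T Ts ih =>
    have := T.two_le_length
    simp only [List.length_cons, List.flatMap_cons, List.length_append]
    omega

variable {X : ℕ} {st : State} {E : ℕ → Entry} {w out : List ℕ} {Ts : List (Tree n p)}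

theorem Emit.kind {a : ℕ} (h : Emit E w out Ts st) : st.warr 8 a = (E a).kind := by
  rw [← h.tables a]; rfl

theorem Emit.key {a : ℕ} (h : Emit E w out Ts st) : st.warr 9 a = (E a).key := by
  rw [← h.tables a]; rfl

theorem Emit.label {a : ℕ} (h : Emit E w out Ts st) : st.warr 10 a = (E a).label := by
  rw [← h.tables a]; rfl

theorem Emit.fst {a : ℕ} (h : Emit E w out Ts st) : st.warr 11 a = (E a).fst := by
  rw [← h.tables a]; rfl

theorem Emit.snd {a : ℕ} (h : Emit E w out Ts st) : st.warr 12 a = (E a).snd := by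
  rw [← h.tables a]; rfl

/-- The yes-subtree of an equality test is always a leaf, so four words are written at once and only
the no-subtree is pushed. For a comparison the no-subtree is pushed first, so that the yes-subtree
is on top and the output is in preorder. -/
theorem emitStep_spec (hX : 16 < X) (hs : Bdd X st) (hw : w.length + 4 < X) {T : Tree n p}
    (h : Emit E w out (T :: Ts) st) :
    Run X emitStep 200 st fun st' => ∃ out', ∃ Ts' : List (Tree n p), Emit E w out' Ts' st' ∧
      (Ts'.flatMap Tree.encode).length < ((T :: Ts).flatMap Tree.encode).length := by
  have hlen := congrArg List.length h.total
  have hle := length_le_flatMap Ts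
  have h2 := T.two_le_length
  rw [List.length_append, List.flatMap_cons, List.length_append] at hlen
  obtain ⟨hT, hTs⟩ := h.stack
  obtain ⟨a, ha⟩ : ∃ a, a = st.warr 16 Ts.length := ⟨_, rfl⟩
  rw [← ha] at hT
  have hh := h.height
  rw [List.length_cons] at hh
  refine Run.seq (T := 20) (T' := 180) (Q := fun s => s.wreg 37 = Ts.length ∧
    s.wreg 39 = a) (Run.flat hX hs rfl ?_ (by decide))
    (fun s₁ hs₁ hf₁ ⟨h37, h39⟩ => ?_) (by omega)
  · have := hs.warr 16 Ts.length
    rw [← ha] at this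
    simp only [Prog.wp, WExp.val, State.setW_wreg, State.setW_warr, Nat.reduceEqDiff, if_true,
      if_false, hh, Nat.add_sub_cancel, ← ha]
    exact ⟨by omega, this, trivial, trivial⟩
  have h38 : s₁.wreg 38 = out.length := (hf₁.w 38 rfl).trans h.length
  have k0 : s₁.warr 8 a = (E a).kind := by rw [hf₁.a 8 rfl, h.kind]
  have k1 : s₁.warr 9 a = (E a).key := by rw [hf₁.a 9 rfl, h.key]
  have k2 : s₁.warr 10 a = (E a).label := by rw [hf₁.a 10 rfl, h.label]
  have k3 : s₁.warr 11 a = (E a).fst := by rw [hf₁.a 11 rfl, h.fst]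
  have k4 : s₁.warr 12 a = (E a).snd := by rw [hf₁.a 12 rfl, h.snd]
  have b1 := hs₁.warr 9 a
  have b2 := hs₁.warr 10 a
  have b3 := hs₁.warr 11 a
  have b4 := hs₁.warr 12 a
  rw [k1] at b1
  rw [k2] at b2
  rw [k3] at b3
  rw [k4] at b4
  have w0 : Written (s₁.warr 0) out := by rw [hf₁.a 0 rfl]; exact h.written
  have r0 : StackRep E (s₁.warr 16) Ts := by rw [hf₁.a 16 rfl]; exact hTs
  have t0 : ∀ P : Prog, ∀ s', Frame P s₁ s' → P.sparesTop = true → ∀ a, entryAt s' a = E a := by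
    intro P s' hf hP a
    simp only [Prog.sparesTop, Bool.not_eq_true', Bool.or_eq_false_iff] at hP
    obtain ⟨⟨⟨⟨⟨p1, p2⟩, p3⟩, p4⟩, p5⟩, p6⟩ := hP
    rw [← h.tables a]
    simp only [entryAt, hf.a 8 p1, hf.a 9 p2, hf.a 10 p3, hf.a 11 p4, hf.a 12 p5, hf.b 2 p6,
      hf₁.a 8 rfl, hf₁.a 9 rfl, hf₁.a 10 rfl, hf₁.a 11 rfl, hf₁.a 12 rfl, hf₁.b 2 rfl]
  have c0 : ∀ c, (BExp.weq (.get 8 (.reg 39)) (.const c)).Holds s₁ ↔ (E a).kind = c := fun c => by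
    simp only [BExp.Holds, WExp.val, h39, k0]
  cases hT with
  | leaf _ j hk hj =>
    refine Run.cond hX hs₁ rfl (T := 170) (fun _ => ?_) (fun hc => absurd ((c0 1).2 hk) hc)
      (by decide)
    have key : Run X emitLeaf 60 s₁ fun s => s.wreg 38 = out.length + 2 ∧
        s.warr 0 = Function.update (Function.update (s₁.warr 0) out.length 0) (out.length + 1) j := by
      refine Run.flat hX hs₁ rfl ?_ (by decide)
      rw [hj] at b2 k2
      simp [emitLeaf, h38, h39, k2]
      omega
    refine key.mono (by omega) fun s' _ hf ⟨e1, e2⟩ => ⟨out ++ [0] ++ [(j : ℕ)], Ts, ⟨t0 _ _ hf rfl,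
      (hf.w 37 rfl).trans h37, by simp [e1], by rw [hf.a 16 rfl]; exact r0, ?_, ?_⟩, ?_⟩
    · rw [e2]
      exact (w0.snoc 0 rfl).snoc _ (by simp)
    · rw [← h.total]
      simp [Tree.encode]
    · simp [Tree.encode]
  | eq _ g j T hk hg hj hT =>
    refine Run.cond hX hs₁ rfl (T := 170) (fun hc => absurd ((c0 1).1 hc) (by omega)) (fun _ => ?_)
      (by decide)
    refine Run.cond hX hs₁ rfl (T := 160) (fun _ => ?_) (fun hc => absurd ((c0 2).2 hk) hc)
      (by decide)
    have key : Run X emitEq 100 s₁ fun s => s.wreg 38 = out.length + 4 ∧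
        s.wreg 37 = Ts.length + 1 ∧
        s.warr 0 = Function.update (Function.update (Function.update (Function.update (s₁.warr 0)
          out.length 2) (out.length + 1) g) (out.length + 2) 0) (out.length + 3) j ∧
        s.warr 16 = Function.update (s₁.warr 16) Ts.length (E a).fst := by
      refine Run.flat hX hs₁ rfl ?_ (by decide)
      rw [hj] at b2 k2
      rw [hg] at b1 k1
      simp [emitEq, h38, h39, h37, k1, k2, k3]
      omega
    refine key.mono (by omega) fun s' _ hf ⟨e1, e2, e3, e4⟩ =>
      ⟨out ++ [2] ++ [(g : ℕ)] ++ [0] ++ [(j : ℕ)], T :: Ts, ⟨t0 _ _ hf rfl, by simp [e2],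
      by simp [e1], ?_, ?_, ?_⟩, ?_⟩
    · rw [e4]
      exact r0.push hT rfl
    · rw [e3]
      exact (((w0.snoc 2 rfl).snoc _ (by simp)).snoc 0 (by simp)).snoc _ (by simp)
    · rw [← h.total]
      simp [Tree.encode]
    · simp [Tree.encode]
      omega
  | lt _ k T T' hk hg hT hT' =>
    refine Run.cond hX hs₁ rfl (T := 170) (fun hc => absurd ((c0 1).1 hc) (by omega)) (fun _ => ?_)
      (by decide)
    refine Run.cond hX hs₁ rfl (T := 160) (fun hc => absurd ((c0 2).1 hc) (by omega)) (fun _ => ?_)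
      (by decide)
    have key : Run X emitLt 100 s₁ fun s => s.wreg 38 = out.length + 2 ∧
        s.wreg 37 = Ts.length + 2 ∧
        s.warr 0 = Function.update (Function.update (s₁.warr 0) out.length 1) (out.length + 1) k ∧
        s.warr 16 = Function.update (Function.update (s₁.warr 16) Ts.length (E a).snd)
          (Ts.length + 1) (E a).fst := by
      refine Run.flat hX hs₁ rfl ?_ (by decide)
      rw [hg] at b1 k1
      simp [emitLt, h38, h39, h37, k1, k3, k4]
      omega
    refine key.mono (by omega) fun s' _ hf ⟨e1, e2, e3, e4⟩ =>
      ⟨out ++ [1] ++ [(k : ℕ)], T :: T' :: Ts, ⟨t0 _ _ hf rfl, by simp [e2],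
      by simp [e1], ?_, ?_, ?_⟩, ?_⟩
    · rw [e4]
      exact (r0.push hT' rfl).push hT (by simp)
    · rw [e3]
      exact (w0.snoc 1 rfl).snoc _ (by simp)
    · rw [← h.total]
      simp [Tree.encode]
    · simp [Tree.encode]

/-- The supply of the loop is the number of words still to be written, which drops with every
subtree handled. -/
theorem emitLoop_spec (hX : 16 < X) (hs : Bdd X st) (hw : w.length + 4 < X)
    (h : Emit E w out Ts st) :
    Run X (.loop (.wlt (.const 0) (.reg 37)) emitStep) ((w.length + 1) * 210) st fun st' =>
      st'.wreg 38 = w.length ∧ Written (st'.warr 0) w := by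
  have key := Run.while hX (b := .wlt (.const 0) (.reg 37)) (P := emitStep) rfl (T := 200)
    (fun k st => ∃ out, ∃ Ts : List (Tree n p), Emit E w out Ts st ∧
      (Ts.flatMap Tree.encode).length = k) ?_ hs ⟨out, Ts, h, rfl⟩ le_rfl
  · refine key.mono ?_ ?_
    · have := congrArg List.length h.total
      rw [List.length_append] at this
      simp only [BExp.time, WExp.time]
      exact Nat.mul_le_mul (by omega) (by omega)
    · rintro s' _ _ ⟨⟨k, out', Ts', h1, _⟩, h3⟩
      simp only [BExp.Holds, WExp.val, h1.height, Nat.pos_iff_ne_zero, not_not] at h3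
      have h4 := h1.total
      rw [List.eq_nil_of_length_eq_zero h3, List.flatMap_nil, List.append_nil] at h4
      subst h4
      exact ⟨h1.length, h1.written⟩
  · rintro k s hs ⟨out', Ts', h1, h2⟩ hb
    simp only [BExp.Holds, WExp.val, h1.height] at hb
    obtain ⟨T, Ts'', rfl⟩ := List.exists_cons_of_length_pos hb
    refine (emitStep_spec hX hs hw h1).mono le_rfl ?_
    rintro s' _ _ ⟨out'', Us, h3, h4⟩
    exact ⟨_, by rw [← h2]; exact h4, out'', Us, h3, rfl⟩

end Output

/-! ### Reconstruction of the tree and the report -/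

section Solve

variable {I : Instance} {L : List (Fin I.p × Fin I.n)} {lab : Fin I.n → Fin I.p}

/-- References in the tables lead to cells of smaller potential, so following them is well founded.
The value stored at a cell is its best value, hence the subtrees found at the referenced cells have
exactly the costs that the entry was computed from. -/
theorem exists_rep {st : State} (h : ∀ σ : Cell L.length, σ.Valid I L → TopOK I L lab st σ)
    {σ : Cell L.length} (hσ : σ.Valid I L) {v : ℝ} (hv : Best I L lab σ v) :
    ∃ T, Der I L lab σ T v ∧ Rep (entryAt st) (σ.addr I) T := by
  induction hN : σ.potential I L using Nat.strong_induction_on generalizing σ v with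
  | _ N ih =>
    obtain ⟨⟨T₀, h0⟩, h1⟩ := hv
    rcases h σ hσ with ⟨_, h3⟩ | ⟨h2, h3, h4⟩
    · exact absurd trivial (h3 _ _ h0)
    have hval : (entryAt st (σ.addr I)).val = v := by
      obtain ⟨T, hT⟩ := h3.exists_der
      exact le_antisymm (h4 _ _ h0 trivial) (h1 _ _ hT)
    rw [← hval]
    clear h4 hval
    generalize hE : entryAt st (σ.addr I) = E at *
    cases h3 with
    | leaf j k a b v h => exact ⟨_, h, .leaf _ j (by rw [hE]) (by rw [hE])⟩
    | eq g j τ b v' v hτ hp hb h' =>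
      obtain ⟨T, hT, hT'⟩ := ih _ (hN ▸ hp) hτ hb rfl
      exact ⟨_, h' T hT, .eq _ g j T (by rw [hE]) (by rw [hE]) (by rw [hE]) (by rw [hE]; exact hT')⟩
    | lt k j τ τ' v' v'' v hτ hτ' hp hp' hb hb' h' =>
      obtain ⟨T, hT, hT'⟩ := ih _ (hN ▸ hp) hτ hb rfl
      obtain ⟨T', hT₂, hT₂'⟩ := ih _ (hN ▸ hp') hτ' hb' rfl
      exact ⟨_, h' T T' hT hT₂, .lt _ k T T' (by rw [hE]) (by rw [hE]) (by rw [hE]; exact hT')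
        (by rw [hE]; exact hT₂')⟩

/-- The place in the tables of the set of all queries. -/
def rootExp : WExp := allExp (.const 0) (.sub (.reg 0) (.const 1)) (.add (.reg 0) (.const 1))

/-- Reports the result. -/
def reportProg : Prog :=
  .cond (.weq (.get 13 rootExp) (.const 0)) (.setW 0 (.const 0))
    (.seq (.block [.setR 0 (.get 3 rootExp), .putW 16 (.const 0) (.sub (.get 13 rootExp) (.const 1)),
      .setW 37 (.const 1), .setW 38 (.const 0)])
    (.seq (.loop (.wlt (.const 0) (.reg 37)) emitStep)
      (.seq (.setW 1 (.reg 38)) (.setW 0 (.const 1)))))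

/-- Computes a tree of minimum cost. -/
def solveProg : Prog := .seq (.seq rankProg memProg) (.seq sweepProg reportProg)

/-- Together with `Der.length_le`, this bounds the output by `200 * n ^ 2` words, which must be
addressable. -/
theorem root_potential_le (I : Instance) (L : List (Fin I.p × Fin I.n)) :
    (I.root L.length).potential I L ≤ 50 * (I.n * I.n) := by
  have hn := I.n_pos
  obtain ⟨k, hk⟩ := Nat.exists_eq_add_of_lt hn
  simp only [Instance.root, Cell.potential, hk]
  have : 2 * (0 + k + 1 - 1 - 0) + 1 = 2 * k + 1 := by omega
  rw [this]
  nlinarith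

theorem reportProg_spec {X : ℕ} (hX : 16 < X) {st : State} (hs : Bdd X st)
    (hw : 200 * (I.n * I.n) + 4 < X) (h : Progress I L lab 0 I.n 0 0 0 st) :
    Run X reportProg (42500 * (I.n * I.n)) st fun st' =>
      ((∀ T v, ¬ Der I L lab (I.root L.length) T v) ∧ st'.ReportsInfeasible) ∨
      ∃ T v, Der I L lab (I.root L.length) T v ∧
        (∀ T' v', Der I L lab (I.root L.length) T' v' → v ≤ v') ∧ st'.ReportsTree T v := by
  have hn := I.n_pos
  have hnn : 1 ≤ I.n * I.n := Nat.mul_pos hn hn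
  have hg := h.setup.given.n
  have hall := h.all 0 (I.n - 1) (I.n + 1) (by omega) le_rfl (.inl ⟨by omega, by omega, by omega⟩)
  have htop : ∀ σ : Cell L.length, σ.Valid I L → TopOK I L lab st σ := by
    -- The sweep ends at left end `0` and right end `I.n`, one past the last position, so every
    -- valid interval counts as finished.
    rintro (_ | ⟨l, r, e, s⟩) hσ
    · exact hσ.elim
    · refine h.top l r e s hσ (.inl ⟨?_, hσ.2.1, ?_⟩)
      · exact hσ.1.1.trans hσ.1.2
      · have := hσ.2.1
        omega
  have e0 : rootExp.val st = allAddr I 0 (I.n - 1) (I.n + 1) := by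
    simp [rootExp, allExp, WExp.val, hg, allAddr]
  refine Run.cond hX hs rfl (T := 42400 * (I.n * I.n)) (fun hc => ?_) (fun hc => ?_)
    (by simp only [BExp.time, WExp.time, rootExp, allExp]; omega)
  · simp only [BExp.Holds, WExp.val, e0] at hc
    refine Run.flat hX hs rfl ?_ (le_trans (by decide : _ ≤ 10) (by omega))
    simp only [Prog.wp, WExp.val]
    refine ⟨by omega, .inl ⟨?_, by simp [State.ReportsInfeasible]⟩⟩
    rcases hall with ⟨_, h1⟩ | ⟨τ, _, h1, _⟩
    · exact h1
    · omega
  · simp only [BExp.Holds, WExp.val, e0] at hc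
    rcases hall with ⟨h1, _⟩ | ⟨τ, h1, h2, h3, h4, h5, h6⟩
    · exact absurd h1 hc
    obtain ⟨T, hT, hR⟩ := exists_rep htop h1 h4
    have hlen := (h5 T hT).length_le
    have hpot := root_potential_le I L
    rw [Instance.root] at hpot
    have b1 := hs.warr 13 (allAddr I 0 (I.n - 1) (I.n + 1))
    refine Run.seq (T := 70) (T' := 42330 * (I.n * I.n))
      (Q := fun st' => st'.rreg 0 = st.rarr 3 (allAddr I 0 (I.n - 1) (I.n + 1)) ∧
        Emit (entryAt st) T.encode [] [T] st') ?_ (fun s₁ hs₁ hf₁ ⟨h7, h8⟩ => ?_) (by omega)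
    · have e1 : ∀ v, rootExp.val (st.setR 0 v) = rootExp.val st := fun v => rfl
      have hflat : Run X (.block [.setR 0 (.get 3 rootExp),
          .putW 16 (.const 0) (.sub (.get 13 rootExp) (.const 1)), .setW 37 (.const 1),
          .setW 38 (.const 0)]) 70 st fun st' =>
          st'.rreg 0 = st.rarr 3 (allAddr I 0 (I.n - 1) (I.n + 1)) ∧ st'.wreg 37 = 1 ∧
          st'.wreg 38 = 0 ∧ st'.warr 16 0 = τ.addr I := by
        refine Run.flat hX hs rfl ?_ (by decide)
        simp [WExp.val, RExp.val, e1, e0, h2]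
        omega
      refine hflat.mono le_rfl fun s₁ _ hf₁ ⟨h7, h8, h9, h10⟩ =>
        ⟨h7, fun a => ?_, h8, h9, ⟨by rw [List.length_nil, h10]; exact hR, trivial⟩, rfl, by simp⟩
      simp only [entryAt, hf₁.a 8 rfl, hf₁.a 9 rfl, hf₁.a 10 rfl, hf₁.a 11 rfl, hf₁.a 12 rfl,
        hf₁.b 2 rfl]
    · refine Run.seq (emitLoop_spec hX hs₁ (by omega) h8) (T' := 10)
        (fun s₂ hs₂ hf₂ ⟨h9, h10⟩ => ?_) (by omega)
      refine Run.flat hX hs₂ rfl ?_ (by decide)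
      simp only [Prog.wp, WExp.val]
      refine ⟨hs₂.wreg _, by omega, .inr ⟨T, _, h5 T hT, h6, ?_⟩⟩
      refine ⟨by simp, by simp [h9], h10, ?_⟩
      exact (hf₂.r 0 rfl).trans h7

end Solve
end TwoWay

namespace TwoWay

/-! ### The whole algorithm -/

section Main

variable {I : Instance} {L : List (Fin I.p × Fin I.n)}

theorem solveProg_spec {X : ℕ} (hX : 16 < X) {st : State} (hs : Bdd X st) (hn : I.n + 2 < X)
    (hw : 200 * (I.n * I.n) + 4 < X)
    (hroom : ∀ σ : Cell L.length, σ.Valid I L → σ.addr I + 1 < X) (h : Given I L st)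
    (hL : ∀ j q, (j, q) ∈ L ↔ q ∈ I.cls j) (h0 : ∀ i, st.warr 5 i = 0) (hm : 1 ≤ L.length) :
    Run X solveProg (70000 * (I.n ^ 3 * L.length)) st fun st' =>
      ((∃ T, I.IsDecisionTree T) → ∃ T, I.IsMinCost T ∧ st'.ReportsTree T (I.cost T)) ∧
      ((¬ ∃ T, I.IsDecisionTree T) → st'.ReportsInfeasible) := by
  have hn0 := I.n_pos
  obtain ⟨N, hN⟩ : ∃ N, N = I.n ^ 3 * L.length := ⟨_, rfl⟩
  have e1 : I.n * I.n ≤ N := by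
    rw [hN, pow_succ, pow_two, mul_assoc]
    exact Nat.le_mul_of_pos_right _ (Nat.mul_pos hn0 hm)
  have e2 : I.n ≤ I.n * I.n := Nat.le_mul_of_pos_left _ hn0
  have e3 : I.n ^ 3 ≤ N := by rw [hN]; exact Nat.le_mul_of_pos_right _ hm
  have e4 : L.length ≤ N := by rw [hN]; exact Nat.le_mul_of_pos_left _ (by positivity)
  have e5 : I.n * (I.n * (17000 * I.n * L.length + 300 * I.n + 40) + 60) + 20 =
      17000 * N + 300 * I.n ^ 3 + 40 * (I.n * I.n) + 60 * I.n + 20 := by rw [hN]; ring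
  rw [← hN]
  refine Run.seq (setup_spec hX hs hn h hL h0) (T' := 60000 * N)
    (fun s₁ hs₁ hf₁ ⟨lab, hlab, h1⟩ => ?_) (by omega)
  refine Run.seq (sweepProg_spec hX hs₁ (fun j q => (hL j q).1) hroom hn h1) (T' := 42500 * N)
    (fun s₂ hs₂ hf₂ h2 => ?_) (by omega)
  refine (reportProg_spec hX hs₂ hw h2).mono (by omega) fun s₃ _ _ h3 => ?_
  rw [exists_der hL hlab]
  rcases h3 with ⟨h4, h5⟩ | ⟨T, v, h4, h5, h6⟩
  · exact ⟨fun ⟨T, v, hT⟩ => absurd hT (h4 T v), fun _ => h5⟩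
  · obtain ⟨h7, h8⟩ := h4.isMinCost hL hlab h5
    exact ⟨fun _ => ⟨T, h7, h8 ▸ h6⟩, fun hc => absurd ⟨T, v, h4⟩ hc⟩

theorem given_input (hL : I.Lists L) : Given I L (I.input L) := by
  classical
  have h1 : ∀ e : Fin L.length, (e : ℕ) < L.length := fun e => e.2
  constructor
  · rfl
  · exact hL.length_eq.symm
  · intro y
    simp [Instance.input]
  · intro e
    simp [Instance.input, List.getD_eq_getElem?_getD]
  · intro e
    simp [Instance.input, List.getD_eq_getElem?_getD]
  · intro y
    simp [Instance.input]
  · intro y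
    simp [Instance.input]

theorem bdd_input {X : ℕ} (hX : I.n + I.m + 2 ≤ X) : Bdd X (I.input L) := by
  classical
  have hp := I.p_le
  have key : ∀ (f : Fin I.p × Fin I.n → ℕ), (∀ c, f c < X) → ∀ i, (L.map f).getD i 0 < X := by
    intro f hf i
    rw [List.getD_eq_getElem?_getD]
    by_cases hi : i < L.length
    · simp [hi, hf]
    · simp [hi]
      omega
  constructor
  · intro x
    simp only [Instance.input]
    split_ifs <;> omega
  · intro a i
    simp only [Instance.input]
    split_ifs
    · omega
    · omega
    · exact key _ (fun c => by have := c.1.2; omega) i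
    · exact key _ (fun c => by have := c.2.2; omega) i
    · omega

theorem Cell.Valid.addr_lt {σ : Cell L.length} (h : σ.Valid I L) :
    σ.addr I + 1 ≤ 9 * (I.n * I.n * L.length) := by
  rcases σ with _ | ⟨l, r, e, s⟩
  · exact h.elim
  obtain ⟨⟨h1, h2⟩, h3, h4⟩ := h
  have e1 : (l + 1) * I.n ≤ I.n * I.n := Nat.mul_le_mul_right _ (by omega)
  have e2 : (l * I.n + r + 1) * L.length ≤ I.n * I.n * L.length :=
    Nat.mul_le_mul_right _ (by rw [Nat.add_mul] at e1; omega)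
  have e3 := e.2
  rw [Nat.add_mul] at e2
  simp only [Cell.addr]
  omega

theorem solveProg_solves (hL : I.Lists L) :
    solveProg.Solves I L ((I.n + I.m + 2) ^ 400) (70000 * (I.n ^ 3 * I.m)) := by
  have hn := I.n_pos
  have hnm := I.n_le_m
  have hlen := hL.length_eq
  obtain ⟨b, hb⟩ : ∃ b, b = I.n + I.m + 2 := ⟨_, rfl⟩
  -- Stored words are kept below `X = b ^ 10`. Since `n` and `m` are positive, `b ≥ 4`, so this
  -- leaves room for the table addresses, which are of order `b ^ 3`, and for the output length.
  -- Expressions then stay below `X ^ 40 = b ^ 400`.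
  have hX : 4 ^ 7 * b ^ 3 ≤ b ^ 10 := by
    rw [show b ^ 10 = b ^ 7 * b ^ 3 by ring]
    exact Nat.mul_le_mul_right _ (Nat.pow_le_pow_left (by omega) 7)
  have h1 : b * b ≤ b ^ 3 := by
    rw [show b ^ 3 = b * b * b by ring]
    exact Nat.le_mul_of_pos_right _ (by omega)
  have h2 : 4 * b ≤ b * b := Nat.mul_le_mul_right _ (by omega)
  have h3 : I.n * I.n ≤ b * b := Nat.mul_le_mul (by omega) (by omega)
  have h4 : I.n * I.n * L.length ≤ b ^ 3 := by
    rw [show b ^ 3 = b * b * b by ring]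
    exact Nat.mul_le_mul h3 (by omega)
  have key := solveProg_spec (L := L) (X := b ^ 10) (st := I.input L) (by omega)
    (bdd_input (by omega)) (by omega) (by omega)
    (fun σ hσ => by have := hσ.addr_lt; omega) (given_input hL) hL.2
    (fun i => rfl) (by omega)
  rw [hlen] at key
  obtain ⟨t, ht, s', h5, _, h6⟩ := key
  refine ⟨t, ht, s', ?_, h6⟩
  rw [← hb, show b ^ 400 = (b ^ 10) ^ 40 by rw [← pow_mul]]
  exact h5

end Main
end TwoWay

theorem mainTheorem2 :
    ∃ (P : TwoWay.Prog) (C d : ℕ), ∀ (I : TwoWay.Instance) (L : List (Fin I.p × Fin I.n)),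
      I.Lists L → P.Solves I L ((I.n + I.m + 2) ^ d) (C * (I.n ^ 3 * I.m)) :=
  ⟨TwoWay.solveProg, 70000, 400, fun _ _ => TwoWay.solveProg_solves⟩
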